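/- **Definitions.** Let $d\ge 3$ and let $\pi:\mathcal X^{d+1}\to\{x\in\mathbb R^d:|x|>R_0\}$ be a principal circle bundle with fibres of length $L$ and vertical field $T$ (whose flow goes around the fibres in time $L$). Let $\eta$ be an $\mathbb S^1$-invariant one-form with $\eta(T)=1$ and $d\eta=\pi^*\Omega$, $\Omega=\mathcal O(r^{1-d})$, $D\Omega=\mathcal O(r^{-d})$, where $r=|x|$, and let $h=\pi^*g_{\mathbb R^d}+\eta^2$. A metric $g$ on $\mathcal X$ is *asymptotic to $h$* if $g=h+\mathcal O(r^{2-d})$, $\nabla^hg=\mathcal O(r^{1-d})$, $\nabla^{h,2}g=\mathcal O(r^{-d})$. With $\mathrm{Div}_hg=-\sum_a(\nabla^h_{e_a}g)(e_a,\cdot)$ for an $h$-orthonormal frame $(e_a)$, $\omega_d=\mathrm{vol}(\mathbb S^{d-1})$ and $\partial B_R=\{r=R\}$, put $$\mu^{D}_{g,h}=-\frac1{\omega_dL}\limsup_{R\to\infty}\int_{\partial B_R}*_h\big(\mathrm{Div}_hg+d\,\mathrm{Tr}_hg\big),$$ $$\mu^{GB}_{g,h}=-\frac1{\omega_dL}\limsup_{R\to\infty}\int_{\partial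 B_R}*_h\big(\mathrm{Div}_hg+d\,\mathrm{Tr}_hg-\tfrac12\,d(g(T,T))\big).$$ On the trivial bundle, $h_0=dx^2+dt^2$ with $t\in\mathbb R/L\mathbb Z$; its *trivial spin structure* is the one for which the frame $(\partial_{x_1},\dots,\partial_{x_d},\partial_t)$ lifts to a section. **(1) Schwarzschild.** Let $n\ge4$, $\gamma>0$, $V(r)=1-(\gamma/r)^{n-3}$, $c=\frac{2\gamma}{n-3}$. There is a strictly increasing $G:[0,\infty)\to\mathbb R$ with $G'=\sqrt{V(G)}$, $G(0)=\gamma$. For any such $G$, let $F=c\sqrt{V(G)}$ and $g_\gamma=d\rho^2+F(\rho)^2d\theta^2+G(\rho)^2d\omega^2$ on $\mathbb R^2\times\mathbb S^{n-2}$, where $(\rho,\theta)$ are polar coordinates on $\mathbb R^2$. The isotropic coordinates $x=u\,\omega\in\mathbb R^{n-1}$, $t=c\theta$, where $G(\rho)=u\big[1+\frac14(\gamma/u)^{n-3}\big]^{2/(n-3)}$, identify the complement of $\{0\}\times\mathbb S^{n-2}$ with $\{|x|>4^{-1/(n-3)}\gamma\}\times\mathbb R/L\mathbb Z$, $L=2\pi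 c$. In them $g_\gamma$ is asymptotic to $h_0$, and $$\mu^{D}_{g_\gamma,h_0}=\gamma^{n-3},\qquad \mu^{GB}_{g_\gamma,h_0}=\tfrac{n-1}2\gamma^{n-3}.$$ For every spin structure on $\mathbb R^2\times\mathbb S^{n-2}$, the spin structure that it induces on the end is not the trivial one. **(2) Reissner–Nordström.** Let $m,q\in\mathbb R$ with $m>0$ or $q\ne0$, $V(r)=1-\frac{2m}r-\frac{q^2}{r^2}$, $G_0=m+\sqrt{m^2+q^2}$, $c=\frac{G_0^2}{G_0-m}$. There is a strictly increasing $G:[0,\infty)\to\mathbb R$ with $G'=\sqrt{V(G)}$, $G(0)=G_0$. For any such $G$, with $F=c\sqrt{V(G)}$, $g=d\rho^2+F(\rho)^2d\theta^2+G(\rho)^2d\omega^2$ is a smooth complete metric on $\mathbb R^2\times\mathbb S^2$, with vanishing scalar curvature on the complement of $\{0\}\times\mathbb S^2$ (a dense subset). The isotropic coordinates $x=u\,\omega\in\mathbb R^3$, $t=c\theta$, where $G(\rho)=u\big[1+\frac mu+\frac{m^2+q^2}{4u^2}\big]$, identify this complement with $\{|x|>\frac12\sqrt{m^2+q^2}\}\times\mathbb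 R/2\pi c\,\mathbb Z$. In them $g$ is asymptotic to $h_0$, and $\mu^D_{g,h_0}=2m$; in particular the mass is negative when $m<0$ (and $q\neq0$). For every spin structure on $\mathbb R^2\times\mathbb S^2$, the spin structure that it induces on the end is not the trivial one. **(3) Taub-NUT.** Let $m,L>0$. Let $\pi:\mathbb C^2\setminus\{0\}\to\mathbb R^3\setminus\{0\}$ be the Hopf map $z\mapsto(2\mathrm{Re}\,z_1\bar z_2,\,2\mathrm{Im}\,z_1\bar z_2,\,|z_1|^2-|z_2|^2)$, and let $\eta_1=\frac L{2\pi}|z|^{-2}\langle iz,\cdot\rangle$ be the standard contact form scaled so that the fibres have length $L$. Then $g=(1+\frac{2m}r)dx^2+(1+\frac{2m}r)^{-1}\eta_1^2$ is asymptotic to $h_1=dx^2+\eta_1^2$, and $\mu^{GB}_{g,h_1}=3m$. **(4) Multi-Taub-NUT.** Let $k\ge1$, $m>0$, $a_1,\dots,a_k\in\mathbb R^3$ with $|a_i|\le R_0$, and $V(x)=1+\sum_{i=1}^k\frac{2m}{|x-a_i|}$. Let $\mathcal X_k\to\{|x|>R_0\}$ be the quotient of $\{z\in\mathbb C^2:|z|^2>R_0\}$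 by the $k$-th roots of unity, with the projection induced by $\pi$, let $L=8\pi m$, and let $\eta_k=\frac{kL}{2\pi}|z|^{-2}\langle iz,\cdot\rangle$, $h_k=dx^2+\eta_k^2$. There is a connection form $\theta$ on $\mathcal X_k$ with $d\theta=\pi^*(*dV)$ such that $g=V\,dx^2+V^{-1}\theta^2$ is asymptotic to $h_k$; and for every such $\theta$, $\mu^{GB}_{g,h_k}=3km$. -/

import Mathlib

open MeasureTheory Filter Topology Set
open scoped ContDiff

noncomputable section

namespace ALF

/-- Euclidean space `ℝ^m`. -/
abbrev Euc (m : ℕ) : Type := EuclideanSpace ℝ (Fin m)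

/-! ### Tensor calculus on open subsets of a real vector space

A covariant `2`-tensor is a function `g z v w` (base point `z`, vectors `v`, `w`); a covariant
`k`-tensor is a function `S z u` with `u : Fin k → E`. -/

section Tensors

variable {E : Type*} [NormedAddCommGroup E] [NormedSpace ℝ E]

/-- `g` is a smooth Riemannian metric on the open set `U`. -/
structure IsMetricOn (U : Set E) (g : E → E → E → ℝ) : Prop where
  linear : ∀ z ∈ U, ∀ v, IsLinearMap ℝ (g z v)
  symm : ∀ z ∈ U, ∀ v w, g z v w = g z w v
  pos : ∀ z ∈ U, ∀ v, v ≠ 0 → 0 < g z v v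
  smooth : ∀ v w, ContDiffOn ℝ ∞ (fun p => g p v w) U

/-- The Christoffel vector `Γ(v, w)` of the Levi-Civita connection of `h`: with respect to the
flat connection of the vector space, `∇_v W = D_v W + Γ(v, W)`. It is the unique solution `c` of
Koszul's formula for constant vector fields. -/
def christoffel (h : E → E → E → ℝ) (z v w : E) : E :=
  Classical.epsilon fun c => ∀ y, h z c y =
    (1 / 2) * (fderiv ℝ (fun p => h p w y) z v + fderiv ℝ (fun p => h p v y) z w
      - fderiv ℝ (fun p => h p v w) z y)

/-- The covariant derivative `(∇^h_{u 0} S)(u 1, …, u k)` of a `k`-tensor `S`. -/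
def covDeriv (h : E → E → E → ℝ) {k : ℕ} (S : E → (Fin k → E) → ℝ) :
    E → (Fin (k + 1) → E) → ℝ := fun z u =>
  fderiv ℝ (fun p => S p (Fin.tail u)) z (u 0)
    - ∑ i, S z (Function.update (Fin.tail u) i (christoffel h z (u 0) (Fin.tail u i)))

/-- A `2`-tensor, as a function of a pair of vectors. -/
def asTensor (g : E → E → E → ℝ) : E → (Fin 2 → E) → ℝ := fun z u => g z (u 0) (u 1)

/-- Exterior derivative of a one-form. -/
def extd (η : E → E →L[ℝ] ℝ) (z v w : E) : ℝ := fderiv ℝ η z v w - fderiv ℝ η z w v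

/-- Riemann curvature `R(v, w) y` of the metric `g`. -/
def riemann (g : E → E → E → ℝ) (z v w y : E) : E :=
  fderiv ℝ (fun p => christoffel g p w y) z v - fderiv ℝ (fun p => christoffel g p v y) z w
    + christoffel g z v (christoffel g z w y) - christoffel g z w (christoffel g z v y)

/-- Ricci curvature `Ric(w, y) = Tr (v ↦ R(v, w) y)`. -/
def ricci [FiniteDimensional ℝ E] (g : E → E → E → ℝ) (z w y : E) : ℝ :=
  ∑ i, (Module.finBasis ℝ E).repr (riemann g z (Module.finBasis ℝ E i) w y) i

/-- Scalar curvature `∑ g^{ij} Ric_{ij}`. -/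
def scal [FiniteDimensional ℝ E] (g : E → E → E → ℝ) (z : E) : ℝ :=
  let b := Module.finBasis ℝ E
  ∑ i, ∑ j, (Matrix.of fun i j => g z (b i) (b j))⁻¹ i j * ricci g z (b i) (b j)

end Tensors

/-! ### Circle fibrations over the exterior of a ball -/

/-- Data presenting a principal circle fibration over `{x ∈ ℝ^m : R₀ < ‖x‖}`. The total space is
`carrier / ⟨flow L⟩`, where `carrier` is open in the vector space `E`; tensors on the total
space are the `flow L`-invariant tensors on `carrier`. The flow is that of the vertical field
`T`, which goes around the fibres in time `L`. -/
structure CircleEnd (m : ℕ) (E : Type*) where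
  R₀ : ℝ
  L : ℝ
  carrier : Set E
  proj : E → Euc m
  flow : ℝ → E → E

section Fibration

variable {m : ℕ} {E : Type*} [NormedAddCommGroup E] [NormedSpace ℝ E]

/-- The data `X` do define a principal circle bundle, of total dimension `m + 1`. -/
structure IsCircleEnd (X : CircleEnd m E) : Prop where
  L_pos : 0 < X.L
  dim : Module.finrank ℝ E = m + 1
  isOpen : IsOpen X.carrier
  proj_smooth : ContDiffOn ℝ ∞ X.proj X.carrier
  proj_image : X.proj '' X.carrier = {x | X.R₀ < ‖x‖}
  proj_submersion : ∀ z ∈ X.carrier, Function.Surjective (fderiv ℝ X.proj z)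
  flow_smooth : ContDiffOn ℝ ∞ (fun p : ℝ × E => X.flow p.1 p.2) (univ ×ˢ X.carrier)
  flow_mem : ∀ t, ∀ z ∈ X.carrier, X.flow t z ∈ X.carrier
  flow_zero : ∀ z ∈ X.carrier, X.flow 0 z = z
  flow_add : ∀ s t, ∀ z ∈ X.carrier, X.flow (s + t) z = X.flow s (X.flow t z)
  fibre : ∀ z ∈ X.carrier, ∀ z' ∈ X.carrier, X.proj z = X.proj z' ↔ ∃ t, z' = X.flow t z
  free : ∀ t, ∀ z ∈ X.carrier, X.flow t z = z → ∃ k : ℤ, t = k * X.L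

/-- The vertical vector field `T`. -/
def vert (X : CircleEnd m E) (z : E) : E := deriv (fun t => X.flow t z) 0

/-- `η` is a connection one-form: smooth, invariant, with `η(T) = 1`. -/
structure IsConnection (X : CircleEnd m E) (η : E → E →L[ℝ] ℝ) : Prop where
  smooth : ContDiffOn ℝ ∞ η X.carrier
  eta_vert : ∀ z ∈ X.carrier, η z (vert X z) = 1
  invariant : ∀ t, ∀ z ∈ X.carrier, ∀ v, η (X.flow t z) (fderiv ℝ (X.flow t) z v) = η z v

/-- The curvature `dη = π^* Ω` decays: `Ω = O(r^{1-m})`, `DΩ = O(r^{-m})`. -/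
def CurvatureDecays (X : CircleEnd m E) (η : E → E →L[ℝ] ℝ) : Prop :=
  ∃ Ω : Euc m → Euc m →L[ℝ] Euc m →L[ℝ] ℝ, ContDiffOn ℝ ∞ Ω {x | X.R₀ < ‖x‖} ∧
    (∀ z ∈ X.carrier, ∀ v w,
      extd η z v w = Ω (X.proj z) (fderiv ℝ X.proj z v) (fderiv ℝ X.proj z w)) ∧
    ∃ C R₁ : ℝ, ∀ x, X.R₀ < ‖x‖ → R₁ < ‖x‖ →
      ‖Ω x‖ ≤ C * ‖x‖ ^ (1 - (m : ℤ)) ∧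
        ∀ v, ‖fderiv ℝ Ω x v‖ ≤ C * ‖x‖ ^ (-(m : ℤ)) * ‖v‖

/-- The model metric `h = π^* g_{ℝ^m} + η²`. -/
def model (X : CircleEnd m E) (η : E → E →L[ℝ] ℝ) (z v w : E) : ℝ :=
  inner ℝ (fderiv ℝ X.proj z v) (fderiv ℝ X.proj z w) + η z v * η z w

/-- The tensor `S` is `O(r^p)` at infinity, its size being measured by `h`. -/
def TensorBound (X : CircleEnd m E) (h : E → E → E → ℝ) {k : ℕ} (S : E → (Fin k → E) → ℝ)
    (p : ℤ) : Prop :=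
  ∃ C R₁ : ℝ, ∀ z ∈ X.carrier, R₁ < ‖X.proj z‖ → ∀ u : Fin k → E,
    (∀ i, h z (u i) (u i) ≤ 1) → |S z u| ≤ C * ‖X.proj z‖ ^ p

/-- `g` is a Riemannian metric on the total space of the circle fibration `X`, asymptotic to the
model metric `h = dx² + η²`:
`g = h + O(r^{2-m})`, `∇^h g = O(r^{1-m})`, `∇^{h,2} g = O(r^{-m})`. -/
structure IsALF (X : CircleEnd m E) (η : E → E →L[ℝ] ℝ) (g : E → E → E → ℝ) : Prop where
  fibration : IsCircleEnd X
  connection : IsConnection X η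
  curvature : CurvatureDecays X η
  metric : IsMetricOn X.carrier g
  periodic : ∀ z ∈ X.carrier, ∀ v w,
    g (X.flow X.L z) (fderiv ℝ (X.flow X.L) z v) (fderiv ℝ (X.flow X.L) z w) = g z v w
  decay₀ : TensorBound X (model X η) (asTensor fun z v w => g z v w - model X η z v w) (2 - (m : ℤ))
  decay₁ : TensorBound X (model X η) (covDeriv (model X η) (asTensor g)) (1 - (m : ℤ))
  decay₂ : TensorBound X (model X η)
    (covDeriv (model X η) (covDeriv (model X η) (asTensor g))) (-(m : ℤ))

/-- The horizontal lifts `X_1, …, X_m` of the coordinate fields; `(X_1, …, X_m, T)` is an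
orthonormal frame of the model metric. -/
def hlift (X : CircleEnd m E) (η : E → E →L[ℝ] ℝ) (z : E) (i : Fin m) : E :=
  Classical.epsilon fun v => fderiv ℝ X.proj z v = EuclideanSpace.single i (1 : ℝ) ∧ η z v = 0

/-- `Tr_h g`. -/
def traceH (X : CircleEnd m E) (η : E → E →L[ℝ] ℝ) (g : E → E → E → ℝ) (z : E) : ℝ :=
  (∑ i, g z (hlift X η z i) (hlift X η z i)) + g z (vert X z) (vert X z)

/-- The one-form `Div_h g = - ∑_a (∇^h_{e_a} g)(e_a, ·)` (the sign is that of the formal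
adjoint). -/
def divH (X : CircleEnd m E) (η : E → E →L[ℝ] ℝ) (g : E → E → E → ℝ) (z y : E) : ℝ :=
  -((∑ i, covDeriv (model X η) (asTensor g) z ![hlift X η z i, hlift X η z i, y])
    + covDeriv (model X η) (asTensor g) z ![vert X z, vert X z, y])

/-- The one-form `Div_h g + d Tr_h g`. -/
def formD (X : CircleEnd m E) (η : E → E →L[ℝ] ℝ) (g : E → E → E → ℝ) (z y : E) : ℝ :=
  divH X η g z y + fderiv ℝ (traceH X η g) z y

/-- The one-form `Div_h g + d Tr_h g - (1/2) d (g(T,T))`. -/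
def formGB (X : CircleEnd m E) (η : E → E →L[ℝ] ℝ) (g : E → E → E → ℝ) (z y : E) : ℝ :=
  divH X η g z y + fderiv ℝ (traceH X η g) z y
    - (1 / 2) * fderiv ℝ (fun p => g p (vert X p) (vert X p)) z y

/-- The outward unit normal of `∂B_R = {‖π‖ = R}` for the model metric. -/
def normal (X : CircleEnd m E) (η : E → E →L[ℝ] ℝ) (z : E) : E :=
  ∑ i, (X.proj z i / ‖X.proj z‖) • hlift X η z i

/-- A point over `x`. -/
def pointOver (X : CircleEnd m E) (x : Euc m) : E :=
  Classical.epsilon fun z => z ∈ X.carrier ∧ X.proj z = x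

/-- `∫_{∂B_R} *_h ξ`. On `∂B_R` one has `*_h ξ = ξ(ν) dvol`, where `ν` is the outward unit normal
and `dvol` is the product of the area of the round sphere of radius `R` and of the length `η` of
the fibres; the fibre through `z` is run through by `flow t z`, `0 ≤ t ≤ L`. -/
def flux (X : CircleEnd m E) (η : E → E →L[ℝ] ℝ) (ξ : E → E → ℝ) (R : ℝ) : ℝ :=
  ∫ e : Metric.sphere (0 : Euc m) 1, R ^ (m - 1) *
    (∫ t in (0 : ℝ)..X.L,
      ξ (X.flow t (pointOver X (R • (e : Euc m))))
        (normal X η (X.flow t (pointOver X (R • (e : Euc m))))))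
    ∂(volume : Measure (Euc m)).toSphere

/-- The volume `ω_m` of the unit sphere of `ℝ^m`. -/
def sphereVol (m : ℕ) : ℝ := (volume : Measure (Euc m)).toSphere.real univ

/-- The mass `μ^D_{g,h}` with respect to the model metric `h = dx² + η²`. -/
def massD (X : CircleEnd m E) (η : E → E →L[ℝ] ℝ) (g : E → E → E → ℝ) : EReal :=
  ((-(1 / (sphereVol m * X.L)) : ℝ) : EReal)
    * limsup (fun R : ℝ => ((flux X η (formD X η g) R : ℝ) : EReal)) atTop

/-- The mass `μ^GB_{g,h}` with respect to the model metric `h = dx² + η²`. -/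
def massGB (X : CircleEnd m E) (η : E → E →L[ℝ] ℝ) (g : E → E → E → ℝ) : EReal :=
  ((-(1 / (sphereVol m * X.L)) : ℝ) : EReal)
    * limsup (fun R : ℝ => ((flux X η (formGB X η g) R : ℝ) : EReal)) atTop

end Fibration

/-! ### The trivial fibration `ℝ^m × 𝕊¹` -/

/-- The universal cover `ℝ^m × ℝ` of `ℝ^m × 𝕊¹`, with coordinates `(x, t)`. -/
abbrev Cyl (m : ℕ) : Type := Euc m × ℝ

/-- The trivial fibration `{‖x‖ > R₀} × ℝ/Lℤ`. -/
def trivialEnd (m : ℕ) (R₀ L : ℝ) : CircleEnd m (Cyl m) where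
  R₀ := R₀
  L := L
  carrier := {z | R₀ < ‖z.1‖}
  proj := fun z => z.1
  flow := fun t z => (z.1, z.2 + t)

/-- The flat connection `η₀ = dt`. -/
def dtForm (m : ℕ) : Cyl m → Cyl m →L[ℝ] ℝ := fun _ => ContinuousLinearMap.snd ℝ (Euc m) ℝ

/-! ### Doubly warped metrics on `ℝ² × 𝕊^{m-1}` -/

/-- The ambient space `ℝ² × ℝ^m` of `ℝ² × 𝕊^{m-1}`. -/
abbrev Amb (m : ℕ) : Type := Euc 2 × Euc m

/-- The manifold `ℝ² × 𝕊^{m-1}`; its tangent space at `(y, w)` is `ℝ² × w^⊥`. -/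
def Mfd (m : ℕ) : Set (Amb m) := {p | ‖p.2‖ = 1}

/-- `dρ² + F(ρ)² dθ²` in polar coordinates of `ℝ²`, completed by `|dy|²` at the origin. -/
def polarMetric (F : ℝ → ℝ) (y a b : Euc 2) : ℝ :=
  open Classical in
  if y = 0 then inner ℝ a b
  else (inner ℝ y a / ‖y‖) * (inner ℝ y b / ‖y‖)
    + F ‖y‖ ^ 2 * ((y 0 * a 1 - y 1 * a 0) / ‖y‖ ^ 2) * ((y 0 * b 1 - y 1 * b 0) / ‖y‖ ^ 2)

/-- `dρ² + F(ρ)² dθ² + G(ρ)² dω²`. -/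
def warped {m : ℕ} (F G : ℝ → ℝ) (p v w : Amb m) : ℝ :=
  polarMetric F p.1 v.1 w.1 + G ‖p.1‖ ^ 2 * inner ℝ v.2 w.2

/-- `G` is the increasing solution on `[0, ∞)` of `G' = √(V(G))`, `G(0) = G₀`. -/
structure IsProfile (V : ℝ → ℝ) (G₀ : ℝ) (G : ℝ → ℝ) : Prop where
  init : G 0 = G₀
  mono : StrictMonoOn G (Ici 0)
  ode : ∀ ρ, 0 ≤ ρ → HasDerivWithinAt G (Real.sqrt (V (G ρ))) (Ici 0) ρ

/-- The function `F = c √(V(G))`. -/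
def fibreProfile (V : ℝ → ℝ) (c : ℝ) (G : ℝ → ℝ) (ρ : ℝ) : ℝ := c * Real.sqrt (V (G ρ))

/-- The parametrization `(x, t) ↦ (ρ e^{iθ}, x/|x|)` of the end, where `t = c θ` and
`G(ρ) = r(|x|)` for a given change of radial coordinate `u ↦ r(u)`. -/
def endChart {m : ℕ} (G r : ℝ → ℝ) (c : ℝ) (z : Cyl m) : Amb m :=
  (Function.invFunOn G (Ici 0) (r ‖z.1‖) • !₂[Real.cos (z.2 / c), Real.sin (z.2 / c)],
    ‖z.1‖⁻¹ • z.1)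

/-- Pull-back of a `2`-tensor of `ℝ² × 𝕊^{m-1}` by a map from `ℝ^m × ℝ`. -/
def pullback {m : ℕ} (Ψ : Cyl m → Amb m) (g : Amb m → Amb m → Amb m → ℝ) (z v w : Cyl m) : ℝ :=
  g (Ψ z) (fderiv ℝ Ψ z v) (fderiv ℝ Ψ z w)

/-- The matrix whose columns are the images `f(∂_1), …, f(∂_m), f(∂_t)` of the standard basis,
followed by the normal vector `(0, w)`. -/
def frameMatrix {m : ℕ} (w : Euc m) (f : Cyl m →L[ℝ] Amb m) :
    Matrix (Fin (m + 2)) (Fin (m + 2)) ℝ :=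
  let col : Fin (m + 2) → Amb m :=
    Fin.snoc (Fin.snoc (fun i : Fin m => f (EuclideanSpace.single i 1, 0)) (f (0, 1))) (0, w)
  Matrix.of fun i j => Fin.append (fun a : Fin m => (col j).2 a) (fun b : Fin 2 => (col j).1 b) i

/-- `f : ℝ^m × ℝ → T_p M` is a positively oriented linear frame of `M = ℝ² × 𝕊^{m-1}` at `p`. -/
def IsFrame {m : ℕ} (p : Amb m) (f : Cyl m →L[ℝ] Amb m) : Prop :=
  p ∈ Mfd m ∧ (∀ v, inner ℝ p.2 (f v).2 = (0 : ℝ)) ∧ 0 < (frameMatrix p.2 f).det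

/-- The bundle of oriented frames of `ℝ² × 𝕊^{m-1}`. -/
abbrev FrameBundle (m : ℕ) : Type := {q : Amb m × (Cyl m →L[ℝ] Amb m) // IsFrame q.1 q.2}

/-- `Ψ` induces an orientation preserving diffeomorphism from `{‖x‖ > R₀} × ℝ/Lℤ` onto the
complement of the compact set `{0} × 𝕊^{m-1}` in `ℝ² × 𝕊^{m-1}`. -/
structure IsEndChart {m : ℕ} (Ψ : Cyl m → Amb m) (R₀ L : ℝ) : Prop where
  smooth : ContDiffOn ℝ ∞ Ψ {z | R₀ < ‖z.1‖}
  image : Ψ '' {z | R₀ < ‖z.1‖} = {p | p ∈ Mfd m ∧ p.1 ≠ 0}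
  frame : ∀ z, R₀ < ‖z.1‖ → IsFrame (Ψ z) (fderiv ℝ Ψ z)
  inj : ∀ z z', R₀ < ‖z.1‖ → R₀ < ‖z'.1‖ →
    (Ψ z = Ψ z' ↔ ∃ k : ℤ, z' = (z.1, z.2 + k * L))

/-! ### Completeness -/

/-- The Riemannian distance of the metric `g` on `ℝ² × 𝕊^{m-1}`: the infimum of the lengths of
`C¹` paths. -/
def riemDist {m : ℕ} (g : Amb m → Amb m → Amb m → ℝ) (p q : Amb m) : ENNReal :=
  ⨅ (γ : ℝ → Amb m) (_ : ContDiff ℝ 1 γ ∧ γ 0 = p ∧ γ 1 = q ∧ ∀ t ∈ Icc (0 : ℝ) 1, γ t ∈ Mfd m),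
    ENNReal.ofReal (∫ t in (0 : ℝ)..1, Real.sqrt (g (γ t) (deriv γ t) (deriv γ t)))

/-- `g` is a smooth complete Riemannian metric on `ℝ² × 𝕊^{m-1}` (for tensors that are defined on
the whole ambient space). -/
structure IsCompleteMetric {m : ℕ} (g : Amb m → Amb m → Amb m → ℝ) : Prop where
  metric : IsMetricOn univ g
  complete : ∀ p : ℕ → Amb m, (∀ j, p j ∈ Mfd m) →
    (∀ ε : ENNReal, 0 < ε → ∃ N, ∀ i j, N ≤ i → N ≤ j → riemDist g (p i) (p j) < ε) →
    ∃ q ∈ Mfd m, Tendsto (fun j => riemDist g (p j) q) atTop (𝓝 0)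

/-! ### Spin structures -/

/-- The quadratic form `-(|x|² + t²)` on `ℝ^m × ℝ`. -/
def cylForm (m : ℕ) : QuadraticForm ℝ (Cyl m) :=
  -(QuadraticMap.prod (LinearMap.BilinMap.toQuadraticMap (innerₗ (Euc m))) QuadraticMap.sq)

/-- The Clifford algebra carries the topology of a finite dimensional real vector space. -/
instance cliffordTopology (m : ℕ) : TopologicalSpace (CliffordAlgebra (cylForm m)) :=
  moduleTopology ℝ (CliffordAlgebra (cylForm m))

/-- The group `Spin(m + 1)`. -/
abbrev SpinGrp (m : ℕ) : Type := spinGroup (cylForm m)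

/-- A spin structure on `M = ℝ² × 𝕊^{m-1}`: a two-sheeted covering of the bundle of oriented
frames, with a free continuous right action of `Spin(m + 1)` that lifts the action of
`SO(m + 1)` on frames through `Ad(s) v = s v s⁻¹`, and whose sheets are exchanged by `-1`. Over
the orthonormal frames of any Riemannian metric on `M` this is a principal `Spin(m + 1)`-bundle
doubly covering the orthonormal frame bundle; conversely such a bundle extends uniquely to all
oriented frames, since these retract onto the orthonormal ones. -/
structure SpinStructure (m : ℕ) where
  P : Type
  [top : TopologicalSpace P]
  cov : P → FrameBundle m
  act : P → SpinGrp m → P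
  isCovering : IsCoveringMap cov
  surjective : Function.Surjective cov
  continuous_act : Continuous fun q : P × SpinGrp m => act q.1 q.2
  act_one : ∀ p, act p 1 = p
  act_mul : ∀ p s t, act p (s * t) = act (act p s) t
  free : ∀ p s, act p s = p → s = 1
  cov_base : ∀ p s, (cov (act p s)).1.1 = (cov p).1.1
  cov_frame : ∀ p (s : SpinGrp m) (v w : Cyl m),
    CliffordAlgebra.ι (cylForm m) w
      = (s : CliffordAlgebra (cylForm m)) * CliffordAlgebra.ι (cylForm m) v
        * star (s : CliffordAlgebra (cylForm m)) →
    (cov (act p s)).1.2 v = (cov p).1.2 w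
  sheets : ∀ p p', cov p = cov p' ↔
    ∃ s : SpinGrp m, ((s : CliffordAlgebra (cylForm m)) = 1 ∨
      (s : CliffordAlgebra (cylForm m)) = -1) ∧ p' = act p s

/-- The spin structure `S` is, through the parametrization `Ψ` of the end by
`{‖x‖ > R₁} × ℝ/Lℤ` and for some large `R₁`, the trivial spin structure of
`{‖x‖ > R₁} × ℝ/Lℤ`, that is, the one for which the frame field `(∂_1, …, ∂_m, ∂_t)` lifts to a
section of `S`. -/
def SpinTrivialAtInfinity {m : ℕ} (S : SpinStructure m) (Ψ : Cyl m → Amb m) (L : ℝ) : Prop :=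
  letI := S.top
  ∃ (R₁ : ℝ) (σ : Cyl m → S.P), ContinuousOn σ {z | R₁ < ‖z.1‖} ∧
    (∀ z, R₁ < ‖z.1‖ → σ (z.1, z.2 + L) = σ z) ∧
    ∀ z, R₁ < ‖z.1‖ → (S.cov (σ z)).1 = (Ψ z, fderiv ℝ Ψ z)

/-! ### Schwarzschild metrics in dimension `n` -/

/-- `V(r) = 1 - (γ/r)^{n-3}`. -/
def schwV (n : ℕ) (γ r : ℝ) : ℝ := 1 - (γ / r) ^ (n - 3)

/-- `t = c θ` with `c = 2γ/(n-3)`; the circles at infinity have length `2πc`. -/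
def schwC (n : ℕ) (γ : ℝ) : ℝ := 2 * γ / ((n : ℝ) - 3)

/-- The isotropic radial coordinate `u`:
`r = u (1 + (1/4)(γ/u)^{n-3})^{2/(n-3)}`. -/
def schwR (n : ℕ) (γ u : ℝ) : ℝ :=
  u * (1 + (1 / 4) * (γ / u) ^ (n - 3)) ^ (2 / ((n : ℝ) - 3))

/-- The value of `u` with `r = γ`. -/
def schwU (n : ℕ) (γ : ℝ) : ℝ := γ * (4 : ℝ) ^ (-(1 / ((n : ℝ) - 3)))

/-! ### Reissner–Nordström metrics -/

/-- `V(r) = 1 - 2m/r - q²/r²`. -/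
def rnV (m q r : ℝ) : ℝ := 1 - 2 * m / r - q ^ 2 / r ^ 2

/-- `G₀ = m + √(m² + q²)`. -/
def rnG₀ (m q : ℝ) : ℝ := m + Real.sqrt (m ^ 2 + q ^ 2)

/-- `t = c θ` with `c = G₀²/(G₀ - m)`. -/
def rnC (m q : ℝ) : ℝ := rnG₀ m q ^ 2 / (rnG₀ m q - m)

/-- The isotropic radial coordinate `u`: `r = u (1 + m/u + (m² + q²)/(4u²))`. -/
def rnR (m q u : ℝ) : ℝ := u * (1 + m / u + (m ^ 2 + q ^ 2) / (4 * u ^ 2))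

/-- The value of `u` with `r = G₀`. -/
def rnU (m q : ℝ) : ℝ := Real.sqrt (m ^ 2 + q ^ 2) / 2

/-! ### Taub-NUT and multi-Taub-NUT metrics -/

/-- The Hopf map `ℂ² → ℝ³`; it satisfies `‖hopf z‖ = |z₁|² + |z₂|²`. -/
def hopf (z : ℂ × ℂ) : Euc 3 :=
  !₂[2 * (z.1 * star z.2).re, 2 * (z.1 * star z.2).im, Complex.normSq z.1 - Complex.normSq z.2]

/-- The degree `k` circle fibration over `{‖x‖ > R₀} ⊆ ℝ³`, with fibres of length `L`: the
quotient of `{|z|² > R₀} ⊆ ℂ²` by the scalar action of the `k`-th roots of unity. -/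
def hopfEnd (k : ℕ) (R₀ L : ℝ) : CircleEnd 3 (ℂ × ℂ) where
  R₀ := R₀
  L := L
  carrier := {z | R₀ < Complex.normSq z.1 + Complex.normSq z.2}
  proj := hopf
  flow := fun t z => Complex.exp ((2 * Real.pi * t / (k * L) : ℝ) * Complex.I) • z

/-- The connection `η_k`: the standard contact form `|z|^{-2} ⟨i z, ·⟩` of the three-spheres,
times the constant `kL/(2π)` that makes `η_k(T) = 1`. -/
def hopfForm (k : ℕ) (L : ℝ) (z : ℂ × ℂ) : (ℂ × ℂ) →L[ℝ] ℝ :=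
  (k * L / (2 * Real.pi) / (Complex.normSq z.1 + Complex.normSq z.2)) •
    (Complex.imCLM.comp ((star z.1) • ContinuousLinearMap.fst ℝ ℂ ℂ)
      + Complex.imCLM.comp ((star z.2) • ContinuousLinearMap.snd ℝ ℂ ℂ))

/-- The metric `V dx² + V⁻¹ θ²`. -/
def ghMetric (X : CircleEnd 3 (ℂ × ℂ)) (V : Euc 3 → ℝ) (θ : ℂ × ℂ → (ℂ × ℂ) →L[ℝ] ℝ)
    (z v w : ℂ × ℂ) : ℝ :=
  V (X.proj z) * inner ℝ (fderiv ℝ X.proj z v) (fderiv ℝ X.proj z w)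
    + (V (X.proj z))⁻¹ * (θ z v * θ z w)

/-- `V = 1 + 2m/|x|`. -/
def tnV (m : ℝ) (x : Euc 3) : ℝ := 1 + 2 * m / ‖x‖

/-- `V = 1 + ∑ 2m/|x - a_i|`. -/
def mtnV {k : ℕ} (m : ℝ) (a : Fin k → Euc 3) (x : Euc 3) : ℝ := 1 + ∑ i, 2 * m / ‖x - a i‖

/-- The two-form `*dV` on `ℝ³`. -/
def starD (V : Euc 3 → ℝ) (x v w : Euc 3) : ℝ :=
  fderiv ℝ V x (WithLp.toLp 2 (crossProduct v.ofLp w.ofLp))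

/-- `θ` is a connection on `X` with curvature `dθ = *dV`. -/
def IsMonopole (X : CircleEnd 3 (ℂ × ℂ)) (V : Euc 3 → ℝ)
    (θ : ℂ × ℂ → (ℂ × ℂ) →L[ℝ] ℝ) : Prop :=
  IsConnection X θ ∧ ∀ z ∈ X.carrier, ∀ v w,
    extd θ z v w = starD V (X.proj z) (fderiv ℝ X.proj z v) (fderiv ℝ X.proj z w)

end ALF

end

open ALF

set_option maxSynthPendingDepth 3

noncomputable section

namespace ALF

open Bornology Asymptotics

/-! ### Symbol classes at infinity -/

section Cobounded

variable {V : Type*} [NormedAddCommGroup V]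

/-! All the metrics have the form `P dx² + N (η + β)²` on a circle bundle, where `P`, `N` are
functions and `β` is a one-form on the base. In the coframe `(dx, η)` such a metric has coefficients
pulled back from ℝ^m, and the Levi-Civita connection of the model metric is algebraic in the
curvature `Ω` (`fderiv_coframe_eq`). Being asymptotic to the model thus becomes a statement about
symbol classes on ℝ^m (`isALF_of_coeff`). On the unit normal ν, the form `Div g + d Tr g` equals
`(m-1) ∂_ν P + ∂_ν N` up to terms that contain `β` together with a second factor `β`, `∂β` or `Ω`
(`abs_fluxD_sub_le`). These are `O(r^{3-2m})`, negligible against the area `r^{m-1}`. If `p` and `n`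
are the limits of `r^{m-1} ∂_ν P` and `r^{m-1} ∂_ν N`, the two masses are therefore `-((m-1)p + n)`
and `-((m-1)p + n/2)` (`mass_bundle`).

For Schwarzschild and Reissner–Nordström metrics, the isotropic coordinate `u` turns `dr²/V + r²
dω²` into `(r/u)² dx²`, and any profile `G` is `r` composed with the inverse of the arc length `∫
(r/u) du` (`profile_eq`). The coefficients are then smooth functions of `|x|^{-k}`, and the masses
are read off from their first derivatives at 0 (`static_radial`).

The spin statement is topological (`frameCircle_not_lift`). On a circle at infinity the product
frame turns once with respect to ℝ². The circle can be shrunk to the origin of ℝ² through circles of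
frames; if the first one lifted to a closed curve, so would the last. The last one is the full turn
of a single frame, whose lift is an orbit of `cos(θ/2) + sin(θ/2) e ∂_t`, and this ends at -1.

Reissner–Nordström metrics extend smoothly over `ρ = 0` because, with `u = u₀ exp τ`, all the data
are explicit functions of `τ²` and `τ²` is a smooth function of `ρ²`; the constant `c` removes the
conical singularity (`rn_isSmoothWarping`). They are complete because `√(1 + ρ²)` is proper on ℝ² ×
𝕊² and 1-Lipschitz (`isCompleteMetric`). Their scalar curvature is computed from a closed formula
for rotation invariant static metrics (`IsStatic.scal_eq`).

For the Gibbons–Hawking metrics, `P = V` and `N = 1/V` with `V = 1 + 2mk/r + O(r^{-2})`, which gives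
`3km`. A monopole connection exists because the difference between the field of a charge at `a` and
that of a charge at 0 has an explicit decaying potential (`extd_magForm`), while `L = 8πm` matches
the total charge with the Hopf curvature. Conversely, any connection differs from the Hopf
connection by a form `β` on the base (`IsConnection.exists_eq_add`), and `β` decays because it is,
up to the factor `V`, the mixed component of the asymptotic metric. -/

theorem eventually_cobounded_iff {P : V → Prop} :
    (∀ᶠ x in cobounded V, P x) ↔ ∃ R : ℝ, ∀ x, R < ‖x‖ → P x := by
  rw [← comap_norm_atTop, eventually_comap]
  constructor
  · intro h
    obtain ⟨R, hR⟩ := eventually_atTop.1 h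
    exact ⟨R, fun x hx => hR _ hx.le x rfl⟩
  · rintro ⟨R, hR⟩
    filter_upwards [eventually_gt_atTop R] with b hb x hx
    exact hR x (hx ▸ hb)

/-- The exteriors `{R < ‖x‖}` are open. This is what allows eventual identities to be
differentiated. -/
theorem eventually_cobounded_nhds {P : V → Prop} (h : ∀ᶠ x in cobounded V, P x) :
    ∀ᶠ x in cobounded V, ∀ᶠ y in 𝓝 x, P y := by
  obtain ⟨R, hR⟩ := eventually_cobounded_iff.1 h
  refine eventually_cobounded_iff.2 ⟨R, fun x hx => ?_⟩
  filter_upwards [(isOpen_lt continuous_const continuous_norm).mem_nhds hx] with y hy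
  exact hR y hy

theorem eventually_norm_gt (R : ℝ) : ∀ᶠ x in cobounded V, R < ‖x‖ :=
  eventually_cobounded_iff.2 ⟨R, fun _ h => h⟩

end Cobounded

section SymbolClass

variable {V : Type} [NormedAddCommGroup V] [NormedSpace ℝ V]
variable {W W₁ W₂ : Type} [NormedAddCommGroup W] [NormedSpace ℝ W]
  [NormedAddCommGroup W₁] [NormedSpace ℝ W₁] [NormedAddCommGroup W₂] [NormedSpace ℝ W₂]

/-- The functions that are `O(|x|^p)` at infinity and whose derivatives of order `j ≤ n` are
`O(|x|^(p-j))`. -/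
def SymbolClass : ℕ → ℤ → ∀ {W : Type} [NormedAddCommGroup W] [NormedSpace ℝ W], (V → W) → Prop
  | 0, p, _, _, _, f => (∀ᶠ x in cobounded V, ContDiffAt ℝ ∞ f x) ∧
      f =O[cobounded V] fun x => ‖x‖ ^ p
  | n + 1, p, _, _, _, f => ((∀ᶠ x in cobounded V, ContDiffAt ℝ ∞ f x) ∧
      f =O[cobounded V] fun x => ‖x‖ ^ p) ∧ SymbolClass n (p - 1) (fderiv ℝ f)

theorem SymbolClass.zero_order {n : ℕ} {p : ℤ} {f : V → W} (h : SymbolClass n p f) :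
    SymbolClass 0 p f := by
  cases n with
  | zero => exact h
  | succ n => exact h.1

theorem SymbolClass.smooth {n : ℕ} {p : ℤ} {f : V → W} (h : SymbolClass n p f) :
    ∀ᶠ x in cobounded V, ContDiffAt ℝ ∞ f x := h.zero_order.1

theorem SymbolClass.isBigO {n : ℕ} {p : ℤ} {f : V → W} (h : SymbolClass n p f) :
    f =O[cobounded V] fun x => ‖x‖ ^ p := h.zero_order.2

theorem SymbolClass.bound {n : ℕ} {p : ℤ} {f : V → W} (h : SymbolClass n p f) :
    ∃ C R : ℝ, 0 ≤ C ∧ ∀ x, R < ‖x‖ → ‖f x‖ ≤ C * ‖x‖ ^ p := by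
  obtain ⟨C, hC, hb⟩ := h.isBigO.exists_nonneg
  obtain ⟨R, hR⟩ := eventually_cobounded_iff.1 hb.bound
  refine ⟨C, R, hC, fun x hx => (hR x hx).trans_eq ?_⟩
  rw [norm_zpow, norm_norm]

theorem SymbolClass.of_bound {p : ℤ} {f : V → W} {C R : ℝ}
    (hs : ∀ᶠ x in cobounded V, ContDiffAt ℝ ∞ f x)
    (h : ∀ x, R < ‖x‖ → ‖f x‖ ≤ C * ‖x‖ ^ p) : SymbolClass 0 p f := by
  refine ⟨hs, IsBigO.of_bound C (eventually_cobounded_iff.2 ⟨R, fun x hx => ?_⟩)⟩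
  rw [norm_zpow, norm_norm]
  exact h x hx

theorem SymbolClass.fderiv_mem {n : ℕ} {p : ℤ} {f : V → W} (h : SymbolClass (n + 1) p f) :
    SymbolClass n (p - 1) (fderiv ℝ f) := h.2

theorem SymbolClass.of_succ {n : ℕ} {p : ℤ} {f : V → W} (h : SymbolClass (n + 1) p f) :
    SymbolClass n p f := by
  induction n generalizing p W with
  | zero => exact h.1
  | succ n ih => exact ⟨h.1, ih h.2⟩

theorem SymbolClass.congr {n : ℕ} {p : ℤ} {f g : V → W} (h : SymbolClass n p f)
    (hfg : ∀ᶠ x in cobounded V, f x = g x) : SymbolClass n p g := by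
  induction n generalizing p W with
  | zero =>
    refine ⟨?_, h.2.congr' hfg EventuallyEq.rfl⟩
    filter_upwards [h.1, eventually_cobounded_nhds hfg] with x hx he
    exact hx.congr_of_eventuallyEq (he.mono fun y hy => hy.symm)
  | succ n ih =>
    refine ⟨⟨?_, h.1.2.congr' hfg EventuallyEq.rfl⟩, ih h.2 ?_⟩
    · filter_upwards [h.1.1, eventually_cobounded_nhds hfg] with x hx he
      exact hx.congr_of_eventuallyEq (he.mono fun y hy => hy.symm)
    · filter_upwards [eventually_cobounded_nhds hfg] with x he
      exact Filter.EventuallyEq.fderiv_eq he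

theorem SymbolClass.mono {n : ℕ} {p q : ℤ} {f : V → W} (h : SymbolClass n p f) (hpq : p ≤ q) :
    SymbolClass n q f := by
  have key : ∀ {p q : ℤ}, p ≤ q →
      (fun x : V => ‖x‖ ^ p) =O[cobounded V] fun x => ‖x‖ ^ q := by
    intro p q hpq
    refine IsBigO.of_bound 1 ((eventually_norm_gt 1).mono fun x hx => ?_)
    rw [one_mul, norm_zpow, norm_zpow, norm_norm]
    exact zpow_le_zpow_right₀ hx.le hpq
  induction n generalizing p q W with
  | zero => exact ⟨h.1, h.2.trans (key hpq)⟩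
  | succ n ih => exact ⟨⟨h.1.1, h.1.2.trans (key hpq)⟩, ih h.2 (by omega)⟩

theorem SymbolClass.add {n : ℕ} {p : ℤ} {f g : V → W} (hf : SymbolClass n p f)
    (hg : SymbolClass n p g) : SymbolClass n p (fun x => f x + g x) := by
  have key : ∀ {p : ℤ} {W : Type} [NormedAddCommGroup W] [NormedSpace ℝ W] {f g : V → W},
      SymbolClass 0 p f → SymbolClass 0 p g → SymbolClass 0 p (fun x => f x + g x) := by
    intro p W _ _ f g hf hg
    exact ⟨by filter_upwards [hf.1, hg.1] with x h1 h2 using h1.add h2, hf.2.add hg.2⟩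
  induction n generalizing p W with
  | zero => exact key hf hg
  | succ n ih =>
    refine ⟨key hf.zero_order hg.zero_order, (ih hf.2 hg.2).congr ?_⟩
    filter_upwards [hf.smooth, hg.smooth] with x h1 h2
    exact (fderiv_fun_add (h1.differentiableAt (by simp)) (h2.differentiableAt (by simp))).symm

/-- Differentiation turns `T` into the operator of composition with `T`, acting on maps `V →L W₁`;
the induction therefore has to let both target spaces vary. -/
theorem SymbolClass.clm_comp {n : ℕ} {p : ℤ} {f : V → W₁} (hf : SymbolClass n p f)
    (T : W₁ →L[ℝ] W) : SymbolClass n p (fun x => T (f x)) := by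
  have key : ∀ {p : ℤ} {W W₁ : Type} [NormedAddCommGroup W] [NormedSpace ℝ W]
      [NormedAddCommGroup W₁] [NormedSpace ℝ W₁] {f : V → W₁} (T : W₁ →L[ℝ] W),
      SymbolClass 0 p f → SymbolClass 0 p (fun x => T (f x)) := by
    intro p W W₁ _ _ _ _ f T hf
    exact ⟨hf.1.mono fun x h => T.contDiff.contDiffAt.comp x h,
      (T.isBigO_comp f _).trans hf.2⟩
  induction n generalizing p W W₁ with
  | zero => exact key T hf
  | succ n ih =>
    refine ⟨key T hf.zero_order,
      (ih hf.2 (ContinuousLinearMap.compL ℝ V W₁ W T)).congr ?_⟩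
    filter_upwards [hf.smooth] with x h1
    exact (T.hasFDerivAt.comp x (h1.differentiableAt (by simp)).hasFDerivAt).fderiv.symm

/-- Leibniz' rule: the derivative is the sum of two bilinear expressions, in `(f, g')` and in `(f',
g)`, each of degree `p + q - 1`. -/
theorem SymbolClass.bilin {n : ℕ} {p q : ℤ} {f : V → W₁} {g : V → W₂}
    (B : W₁ →L[ℝ] W₂ →L[ℝ] W) (hf : SymbolClass n p f) (hg : SymbolClass n q g) :
    SymbolClass n (p + q) (fun x => B (f x) (g x)) := by
  have key : ∀ {p q : ℤ} {W W₁ W₂ : Type} [NormedAddCommGroup W] [NormedSpace ℝ W]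
      [NormedAddCommGroup W₁] [NormedSpace ℝ W₁] [NormedAddCommGroup W₂] [NormedSpace ℝ W₂]
      {f : V → W₁} {g : V → W₂} (B : W₁ →L[ℝ] W₂ →L[ℝ] W),
      SymbolClass 0 p f → SymbolClass 0 q g → SymbolClass 0 (p + q) (fun x => B (f x) (g x)) := by
    intro p q W W₁ W₂ _ _ _ _ _ _ f g B hf hg
    refine ⟨?_, ?_⟩
    · filter_upwards [hf.1, hg.1] with x h1 h2
      exact (B.contDiff.contDiffAt.comp x h1).clm_apply h2
    · have h1 : (fun x => B (f x) (g x)) =O[cobounded V] fun x => ‖f x‖ * ‖g x‖ := by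
        refine IsBigO.of_bound ‖B‖ (Eventually.of_forall fun x => ?_)
        rw [norm_mul, norm_norm, norm_norm, ← mul_assoc]
        exact B.le_opNorm₂ _ _
      refine h1.trans ((hf.2.norm_left.mul hg.2.norm_left).trans_eventuallyEq ?_)
      filter_upwards [eventually_norm_gt 0] with x hx
      rw [zpow_add₀ hx.ne']
  induction n generalizing p q W W₁ W₂ with
  | zero => exact key B hf hg
  | succ n ih =>
    refine ⟨key B hf.zero_order hg.zero_order, ?_⟩
    have h1 := ih (B.precompR V) hf.of_succ hg.2
    have h2 := ih (B.precompL V) hf.2 hg.of_succ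
    rw [show p + (q - 1) = p + q - 1 by ring] at h1
    rw [show p - 1 + q = p + q - 1 by ring] at h2
    refine (h1.add h2).congr ?_
    filter_upwards [hf.smooth, hg.smooth] with x h3 h4
    exact (B.fderiv_of_bilinear (h3.differentiableAt (by simp))
      (h4.differentiableAt (by simp))).symm

theorem SymbolClass.smul {n : ℕ} {p q : ℤ} {f : V → ℝ} {g : V → W} (hf : SymbolClass n p f)
    (hg : SymbolClass n q g) : SymbolClass n (p + q) (fun x => f x • g x) :=
  SymbolClass.bilin (ContinuousLinearMap.lsmul ℝ ℝ) hf hg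

theorem SymbolClass.mul {n : ℕ} {p q : ℤ} {f g : V → ℝ} (hf : SymbolClass n p f)
    (hg : SymbolClass n q g) : SymbolClass n (p + q) (fun x => f x * g x) :=
  SymbolClass.bilin (ContinuousLinearMap.mul ℝ ℝ) hf hg

theorem SymbolClass.const_smul {n : ℕ} {p : ℤ} {f : V → W} (hf : SymbolClass n p f) (c : ℝ) :
    SymbolClass n p (fun x => c • f x) :=
  hf.clm_comp (c • ContinuousLinearMap.id ℝ W)

theorem SymbolClass.neg {n : ℕ} {p : ℤ} {f : V → W} (hf : SymbolClass n p f) :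
    SymbolClass n p (fun x => -f x) :=
  hf.clm_comp (-ContinuousLinearMap.id ℝ W)

theorem SymbolClass.sub {n : ℕ} {p : ℤ} {f g : V → W} (hf : SymbolClass n p f)
    (hg : SymbolClass n p g) : SymbolClass n p (fun x => f x - g x) := by
  simpa only [sub_eq_add_neg] using hf.add hg.neg

theorem SymbolClass.zero (n : ℕ) (p : ℤ) : SymbolClass n p (fun _ : V => (0 : W)) := by
  induction n generalizing p W with
  | zero => exact ⟨Eventually.of_forall fun x => contDiffAt_const, isBigO_zero _ _⟩
  | succ n ih =>
    refine ⟨⟨Eventually.of_forall fun x => contDiffAt_const, isBigO_zero _ _⟩, ?_⟩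
    rw [fderiv_fun_const]
    exact ih _

theorem SymbolClass.const (n : ℕ) (w : W) : SymbolClass n 0 (fun _ : V => w) := by
  have h : (∀ᶠ x in cobounded V, ContDiffAt ℝ ∞ (fun _ : V => w) x) ∧
      (fun _ : V => w) =O[cobounded V] fun x => ‖x‖ ^ (0 : ℤ) :=
    ⟨Eventually.of_forall fun x => contDiffAt_const, by
      simp only [zpow_zero]; exact isBigO_const_const w one_ne_zero _⟩
  cases n with
  | zero => exact h
  | succ n =>
    refine ⟨h, ?_⟩
    rw [fderiv_fun_const]
    exact SymbolClass.zero _ _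

theorem SymbolClass.sum {n : ℕ} {p : ℤ} {ι : Type*} (s : Finset ι) {f : ι → V → W}
    (hf : ∀ i ∈ s, SymbolClass n p (f i)) : SymbolClass n p (fun x => ∑ i ∈ s, f i x) := by
  classical
  induction s using Finset.induction_on with
  | empty => simpa using SymbolClass.zero n p
  | insert a s ha ih =>
    simp only [Finset.sum_insert ha]
    exact (hf a (by simp)).add (ih fun i hi => hf i (by simp [hi]))

theorem SymbolClass.clm (n : ℕ) (T : V →L[ℝ] W) : SymbolClass n 1 (fun x => T x) := by
  have h : (∀ᶠ x in cobounded V, ContDiffAt ℝ ∞ (fun x => T x) x) ∧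
      (fun x => T x) =O[cobounded V] fun x => ‖x‖ ^ (1 : ℤ) :=
    ⟨Eventually.of_forall fun x => T.contDiff.contDiffAt, by
      simp only [zpow_one]; exact (T.isBigO_id _).norm_right⟩
  cases n with
  | zero => exact h
  | succ n =>
    refine ⟨h, ?_⟩
    have : fderiv ℝ (fun x => T x) = fun _ => T := funext fun x => T.fderiv
    rw [this]
    exact SymbolClass.const n T

/-- Smooth homogeneous functions are symbols. -/
theorem SymbolClass.of_homogeneous [FiniteDimensional ℝ V] (n : ℕ) {p : ℤ} {f : V → W}
    (hs : ∀ x, x ≠ 0 → ContDiffAt ℝ ∞ f x)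
    (hom : ∀ (c : ℝ) (x : V), 0 < c → x ≠ 0 → f (c • x) = c ^ p • f x) :
    SymbolClass n p f := by
  have key : ∀ {p : ℤ} {W : Type} [NormedAddCommGroup W] [NormedSpace ℝ W] {f : V → W},
      (∀ x, x ≠ 0 → ContDiffAt ℝ ∞ f x) →
      (∀ (c : ℝ) (x : V), 0 < c → x ≠ 0 → f (c • x) = c ^ p • f x) → SymbolClass 0 p f := by
    intro p W _ _ f hs hom
    -- The bound holds on the unit sphere by compactness, and homogeneity carries it to all other
    -- radii.
    have hcont : ContinuousOn f (Metric.sphere 0 1) := fun x hx =>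
      (hs x (by rintro rfl; simp at hx)).continuousAt.continuousWithinAt
    obtain ⟨C, hC⟩ := (isCompact_sphere (0 : V) 1).exists_bound_of_continuousOn hcont
    refine SymbolClass.of_bound (C := C) (R := 0) ?_ fun x hx => ?_
    · filter_upwards [eventually_norm_gt 0] with x hx using hs x (norm_pos_iff.1 hx)
    · have hx0 : ‖x‖ ≠ 0 := hx.ne'
      have h1 : f x = ‖x‖ ^ p • f (‖x‖⁻¹ • x) := by
        rw [← hom _ _ hx (smul_ne_zero (inv_ne_zero hx0) (norm_pos_iff.1 hx)), smul_smul,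
          mul_inv_cancel₀ hx0, one_smul]
      rw [h1, norm_smul, norm_zpow, norm_norm, mul_comm]
      gcongr
      exact hC _ (by simp [norm_smul, inv_mul_cancel₀ hx0])
  induction n generalizing p W with
  | zero => exact key hs hom
  | succ n ih =>
    refine ⟨key hs hom, ih (fun x hx => (hs x hx).fderiv_right (by simp)) fun c x hc hx => ?_⟩
    have hcx : c • x ≠ 0 := smul_ne_zero hc.ne' hx
    have hd := ((hs _ hcx).differentiableAt (by simp)).hasFDerivAt
    -- Differentiating `f(cx) = c^p f(x)` in `x` shows that `f'` is homogeneous of degree `p - 1`.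
    have h1 : HasFDerivAt (fun y => f (c • y))
        ((fderiv ℝ f (c • x)).comp (c • ContinuousLinearMap.id ℝ V)) x :=
      HasFDerivAt.comp x (f := fun y : V => c • y) hd ((hasFDerivAt_id x).const_smul c)
    have h2 : HasFDerivAt (fun y => c ^ p • f y) (c ^ p • fderiv ℝ f x) x :=
      ((hs _ hx).differentiableAt (by simp)).hasFDerivAt.const_smul _
    have h3 := h1.unique (h2.congr_of_eventuallyEq
      ((isOpen_ne.eventually_mem hx).mono fun y hy => hom c y hc hy))
    ext v
    have h4 := congrArg (fun T : V →L[ℝ] W => T v) h3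
    simp only [ContinuousLinearMap.comp_smul, ContinuousLinearMap.comp_id,
      smul_apply] at h4
    rw [smul_apply, zpow_sub_one₀ hc.ne', mul_comm, mul_smul, ← h4, smul_smul,
      inv_mul_cancel₀ hc.ne', one_smul]

/-- For `‖x‖ > 2‖a‖` the norms of `x` and `x - a` agree up to a factor 2, so their powers agree up
to `2^|p|`; translation commutes with differentiation. -/
theorem SymbolClass.comp_sub_const {n : ℕ} {p : ℤ} {f : V → W} (hf : SymbolClass n p f) (a : V) :
    SymbolClass n p (fun x => f (x - a)) := by
  have ht : Tendsto (fun x : V => x - a) (cobounded V) (cobounded V) := by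
    rw [← comap_norm_atTop (E := V), tendsto_comap_iff]
    refine tendsto_atTop_mono (fun x => norm_sub_norm_le x a) ?_
    exact tendsto_atTop_add_const_right _ _ tendsto_comap
  have hO : ∀ p : ℤ, (fun x : V => ‖x - a‖ ^ p) =O[cobounded V] fun x => ‖x‖ ^ p := by
    intro p
    refine IsBigO.of_bound (2 ^ |p|) ?_
    filter_upwards [eventually_norm_gt (2 * ‖a‖), eventually_norm_gt 0] with x hx hx0
    rw [norm_zpow, norm_zpow, norm_norm, norm_norm]
    have h1 : ‖x - a‖ ≤ 2 * ‖x‖ := by linarith [norm_sub_le x a]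
    have h2 : 2⁻¹ * ‖x‖ ≤ ‖x - a‖ := by linarith [norm_sub_norm_le x a]
    rcases le_total 0 p with hp | hp
    · rw [abs_of_nonneg hp, ← mul_zpow]
      exact zpow_le_zpow_left₀ hp (norm_nonneg _) h1
    · rw [abs_of_nonpos hp]
      have h3 : (2⁻¹ * ‖x‖) ^ (-p) ≤ ‖x - a‖ ^ (-p) :=
        zpow_le_zpow_left₀ (by omega) (by positivity) h2
      have h4 := inv_anti₀ (by positivity) h3
      rw [← zpow_neg, ← zpow_neg, neg_neg, mul_zpow, inv_zpow, ← zpow_neg] at h4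
      exact h4
  have key : ∀ {p : ℤ} {W : Type} [NormedAddCommGroup W] [NormedSpace ℝ W] {f : V → W},
      SymbolClass 0 p f → SymbolClass 0 p (fun x => f (x - a)) := by
    intro p W _ _ f hf
    refine ⟨?_, (hf.2.comp_tendsto ht).trans (hO p)⟩
    filter_upwards [ht.eventually hf.1] with x hx
    exact hx.comp x (contDiffAt_id.sub contDiffAt_const)
  induction n generalizing p W with
  | zero => exact key hf
  | succ n ih =>
    refine ⟨key hf.zero_order, (ih hf.2).congr (Eventually.of_forall fun x => ?_)⟩
    rw [fderiv_comp_sub]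

/-- The derivative is `-(f⁻¹)² f'`, of degree `-2p + (p - 1) = -p - 1`, and the induction hypothesis
applies to both factors `f⁻¹`. The lower bound is used only at order zero. -/
theorem SymbolClass.inv {n : ℕ} {p : ℤ} {f : V → ℝ} (hf : SymbolClass n p f) {c : ℝ}
    (hc : 0 < c) (hb : ∀ᶠ x in cobounded V, c * ‖x‖ ^ p ≤ f x) :
    SymbolClass n (-p) (fun x => (f x)⁻¹) := by
  have hpos : ∀ᶠ x in cobounded V, 0 < f x := by
    filter_upwards [hb, eventually_norm_gt 0] with x h1 h2
    exact lt_of_lt_of_le (by positivity) h1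
  have key : SymbolClass 0 (-p) (fun x => (f x)⁻¹) := by
    refine ⟨?_, ?_⟩
    · filter_upwards [hf.smooth, hpos] with x h1 h2 using h1.inv h2.ne'
    · refine IsBigO.of_bound c⁻¹ ?_
      filter_upwards [hb, hpos, eventually_norm_gt 0] with x h1 h2 h3
      rw [norm_inv, norm_zpow, norm_norm, zpow_neg, ← mul_inv, Real.norm_of_nonneg h2.le]
      exact inv_anti₀ (by positivity) h1
  induction n with
  | zero => exact key
  | succ n ih =>
    refine ⟨key, ?_⟩
    have h1 := ih hf.of_succ
    have h2 := ((h1.mul h1).smul hf.2).neg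
    rw [show -p + -p + (p - 1) = -p - 1 by ring] at h2
    refine h2.congr ?_
    filter_upwards [hf.smooth, hpos] with x h3 h4
    have h5 := ((hasDerivAt_inv h4.ne').comp_hasFDerivAt x
      (h3.differentiableAt (by simp)).hasFDerivAt).fderiv
    refine Eq.trans ?_ h5.symm
    rw [← neg_smul]
    congr 1
    field_simp

theorem eventually_contDiffAt_deriv {P : ℝ → ℝ} {x : ℝ} (hP : ∀ᶠ y in 𝓝 x, ContDiffAt ℝ ∞ P y) :
    ∀ᶠ y in 𝓝 x, ContDiffAt ℝ ∞ (deriv P) y := by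
  filter_upwards [hP] with y hy
  have h := (hy.fderiv_right (m := ∞) (by simp)).clm_apply (contDiffAt_const (c := (1 : ℝ)))
  exact h.congr_of_eventuallyEq (Eventually.of_forall fun z => fderiv_apply_one_eq_deriv.symm)

theorem SymbolClass.tendsto_zero {n : ℕ} {p : ℤ} {w : V → W} (hw : SymbolClass n p w)
    (hp : p < 0) : Tendsto w (cobounded V) (𝓝 0) :=
  hw.isBigO.trans_tendsto
    ((tendsto_zpow_atTop_zero hp (𝕜 := ℝ)).comp (tendsto_norm_cobounded_atTop (E := V)))

/-- Composition of a decaying symbol with a function that is smooth near `0`. -/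
theorem SymbolClass.comp_smooth {n : ℕ} {p : ℤ} {w : V → ℝ} (hw : SymbolClass n p w)
    (hp : p < 0) {P : ℝ → ℝ} (hP : ∀ᶠ y in 𝓝 0, ContDiffAt ℝ ∞ P y) :
    SymbolClass n 0 (fun x => P (w x)) := by
  have hw0 := hw.tendsto_zero hp
  have key : ∀ {P : ℝ → ℝ}, (∀ᶠ y in 𝓝 0, ContDiffAt ℝ ∞ P y) →
      SymbolClass 0 0 (fun x => P (w x)) := by
    intro P hP
    refine ⟨?_, ?_⟩
    · filter_upwards [hw0.eventually hP, hw.smooth] with x h1 h2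
      exact h1.comp x h2
    · simp only [zpow_zero]
      exact (hP.self_of_nhds.continuousAt.tendsto.comp hw0).isBigO_one ℝ
  induction n generalizing P with
  | zero => exact key hP
  | succ n ih =>
    refine ⟨key hP, ?_⟩
    have h1 := (ih hw.of_succ (eventually_contDiffAt_deriv hP)).smul hw.2
    refine (h1.mono (by omega)).congr ?_
    filter_upwards [hw0.eventually hP, hw.smooth] with x h1 h2
    exact ((h1.differentiableAt (by simp)).hasDerivAt.comp_hasFDerivAt x
      (h2.differentiableAt (by simp)).hasFDerivAt).fderiv.symm

/-- The vanishing of `P` at 0 gives `P(w) = O(w)`. In the derivative `P'(w) w'` the decay already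
comes from `w'`, so `P'` need only be bounded. -/
theorem SymbolClass.comp_smooth_of_zero {n : ℕ} {p : ℤ} {w : V → ℝ} (hw : SymbolClass n p w)
    (hp : p < 0) {P : ℝ → ℝ} (hP : ∀ᶠ y in 𝓝 0, ContDiffAt ℝ ∞ P y) (hP0 : P 0 = 0) :
    SymbolClass n p (fun x => P (w x)) := by
  have hw0 := hw.tendsto_zero hp
  have key : SymbolClass 0 p (fun x => P (w x)) := by
    refine ⟨(hw.comp_smooth hp hP).smooth, ?_⟩
    have h1 := (hP.self_of_nhds.differentiableAt (by simp)).isBigO_sub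
    simp only [hP0, sub_zero] at h1
    exact (h1.comp_tendsto hw0).trans hw.isBigO
  cases n with
  | zero => exact key
  | succ n =>
    refine ⟨key, ?_⟩
    have h1 := (hw.of_succ.comp_smooth hp (eventually_contDiffAt_deriv hP)).smul hw.2
    rw [zero_add] at h1
    refine h1.congr ?_
    filter_upwards [hw0.eventually hP, hw.smooth] with x h1 h2
    exact ((h1.differentiableAt (by simp)).hasDerivAt.comp_hasFDerivAt x
      (h2.differentiableAt (by simp)).hasFDerivAt).fderiv.symm

end SymbolClass

open Bornology Asymptotics

/-- Koszul's formula determines the Christoffel vectors of a definite form. -/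
theorem christoffel_eq {E : Type*} [NormedAddCommGroup E] [NormedSpace ℝ E]
    {h : E → E → E → ℝ} {z v w c : E} (hlin : ∀ a b y, h z (a - b) y = h z a y - h z b y)
    (hpos : ∀ v, v ≠ 0 → 0 < h z v v)
    (hc : ∀ y, h z c y = (1 / 2) * (fderiv ℝ (fun p => h p w y) z v
      + fderiv ℝ (fun p => h p v y) z w - fderiv ℝ (fun p => h p v w) z y)) :
    christoffel h z v w = c := by
  have hspec : ∀ y, h z (christoffel h z v w) y = (1 / 2) * (fderiv ℝ (fun p => h p w y) z v
      + fderiv ℝ (fun p => h p v y) z w - fderiv ℝ (fun p => h p v w) z y) :=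
    Classical.epsilon_spec (p := fun c => ∀ y, h z c y = (1 / 2) * (fderiv ℝ (fun p => h p w y) z v
      + fderiv ℝ (fun p => h p v y) z w - fderiv ℝ (fun p => h p v w) z y)) ⟨c, hc⟩
  by_contra hne
  have h1 := hpos _ (sub_ne_zero.2 hne)
  rw [hlin, hc, hspec, sub_self] at h1
  exact h1.false

/-! ### The orthonormal frame of a model metric -/

section Frame

variable {m : ℕ} {E : Type*} [NormedAddCommGroup E] [NormedSpace ℝ E]
  {X : CircleEnd m E} {η : E → E →L[ℝ] ℝ}

theorem IsCircleEnd.finiteDimensional (hX : IsCircleEnd X) : FiniteDimensional ℝ E :=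
  Module.finite_of_finrank_pos (by rw [hX.dim]; omega)

theorem IsCircleEnd.proj_mem (hX : IsCircleEnd X) {z : E} (hz : z ∈ X.carrier) :
    X.R₀ < ‖X.proj z‖ := by
  have : X.proj z ∈ X.proj '' X.carrier := ⟨z, hz, rfl⟩
  rwa [hX.proj_image] at this

theorem IsCircleEnd.contDiffAt_proj (hX : IsCircleEnd X) {z : E} (hz : z ∈ X.carrier) :
    ContDiffAt ℝ ∞ X.proj z := hX.proj_smooth.contDiffAt (hX.isOpen.mem_nhds hz)

theorem IsCircleEnd.hasFDerivAt_proj (hX : IsCircleEnd X) {z : E} (hz : z ∈ X.carrier) :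
    HasFDerivAt X.proj (fderiv ℝ X.proj z) z :=
  ((hX.contDiffAt_proj hz).differentiableAt (by simp)).hasFDerivAt

theorem IsCircleEnd.contDiffAt_flow (hX : IsCircleEnd X) {z : E} (hz : z ∈ X.carrier) (t : ℝ) :
    ContDiffAt ℝ ∞ (fun p : ℝ × E => X.flow p.1 p.2) (t, z) :=
  hX.flow_smooth.contDiffAt ((isOpen_univ.prod hX.isOpen).mem_nhds ⟨mem_univ _, hz⟩)

theorem IsCircleEnd.hasDerivAt_flow (hX : IsCircleEnd X) {z : E} (hz : z ∈ X.carrier) :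
    HasDerivAt (fun t => X.flow t z) (vert X z) 0 := by
  have h : ContDiffAt ℝ ∞ (fun t : ℝ => X.flow t z) 0 :=
    (hX.contDiffAt_flow hz 0).comp (0 : ℝ) (contDiffAt_id.prodMk contDiffAt_const)
  exact (h.differentiableAt (by simp)).hasDerivAt

theorem IsCircleEnd.proj_flow (hX : IsCircleEnd X) {z : E} (hz : z ∈ X.carrier) (t : ℝ) :
    X.proj (X.flow t z) = X.proj z :=
  ((hX.fibre z hz _ (hX.flow_mem t z hz)).2 ⟨t, rfl⟩).symm

theorem IsCircleEnd.fderiv_proj_vert (hX : IsCircleEnd X) {z : E} (hz : z ∈ X.carrier) :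
    fderiv ℝ X.proj z (vert X z) = 0 := by
  have h1 : HasFDerivAt X.proj (fderiv ℝ X.proj z) (X.flow 0 z) := by
    rw [hX.flow_zero z hz]; exact hX.hasFDerivAt_proj hz
  have h2 := h1.comp_hasDerivAt (0 : ℝ) (hX.hasDerivAt_flow hz)
  have h3 : HasDerivAt (X.proj ∘ fun t => X.flow t z) 0 0 :=
    (hasDerivAt_const (0 : ℝ) (X.proj z)).congr_of_eventuallyEq
      (Eventually.of_forall fun t => hX.proj_flow hz t)
  exact h2.unique h3

/-- The coframe `(dx_1, …, dx_m, η)`. -/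
def coframe (X : CircleEnd m E) (η : E → E →L[ℝ] ℝ) (z : E) : E →L[ℝ] Cyl m :=
  (fderiv ℝ X.proj z).prod (η z)

@[simp] theorem coframe_apply (z v : E) : coframe X η z v = (fderiv ℝ X.proj z v, η z v) := rfl

theorem coframe_fst (z v : E) : (coframe X η z v).1 = fderiv ℝ X.proj z v := rfl

/-- The frame dual to `coframe`. -/
def frame (X : CircleEnd m E) (η : E → E →L[ℝ] ℝ) (z : E) : Cyl m →L[ℝ] E :=
  (coframe X η z).inverse

/-- Surjectivity comes from the submersion and a vertical correction; injectivity follows because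
both spaces have dimension `m + 1`. -/
theorem exists_coframe_equiv (hX : IsCircleEnd X) (hη : IsConnection X η) {z : E}
    (hz : z ∈ X.carrier) : ∃ e : E ≃L[ℝ] Cyl m, (e : E →L[ℝ] Cyl m) = coframe X η z := by
  have := hX.finiteDimensional
  have hsurj : Function.Surjective (coframe X η z : E →ₗ[ℝ] Cyl m) := by
    rintro ⟨ξ, s⟩
    obtain ⟨v, hv⟩ := hX.proj_submersion z hz ξ
    -- Adding a multiple of `T` adjusts `η` freely without changing the projection.
    refine ⟨v + (s - η z v) • vert X z, ?_⟩
    simp [hv, hX.fderiv_proj_vert hz, hη.eta_vert z hz]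
  have hinj : Function.Injective (coframe X η z : E →ₗ[ℝ] Cyl m) :=
    (LinearMap.injective_iff_surjective_of_finrank_eq_finrank (by simp [hX.dim])).2 hsurj
  refine ⟨(LinearEquiv.ofBijective _ ⟨hinj, hsurj⟩).toContinuousLinearEquiv, ?_⟩
  ext v <;> rfl

theorem coframe_frame (hX : IsCircleEnd X) (hη : IsConnection X η) {z : E}
    (hz : z ∈ X.carrier) (c : Cyl m) : coframe X η z (frame X η z c) = c := by
  obtain ⟨e, he⟩ := exists_coframe_equiv hX hη hz
  rw [frame, ← he, ContinuousLinearMap.inverse_equiv]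
  exact e.apply_symm_apply c

theorem frame_coframe (hX : IsCircleEnd X) (hη : IsConnection X η) {z : E}
    (hz : z ∈ X.carrier) (v : E) : frame X η z (coframe X η z v) = v := by
  obtain ⟨e, he⟩ := exists_coframe_equiv hX hη hz
  rw [frame, ← he, ContinuousLinearMap.inverse_equiv]
  exact e.symm_apply_apply v

theorem coframe_injective (hX : IsCircleEnd X) (hη : IsConnection X η) {z : E}
    (hz : z ∈ X.carrier) : Function.Injective (coframe X η z) :=
  Function.LeftInverse.injective (frame_coframe hX hη hz)

theorem coframe_vert (hX : IsCircleEnd X) (hη : IsConnection X η) {z : E}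
    (hz : z ∈ X.carrier) : coframe X η z (vert X z) = (0, 1) := by
  simp [hX.fderiv_proj_vert hz, hη.eta_vert z hz]

theorem coframe_hlift (hX : IsCircleEnd X) (hη : IsConnection X η) {z : E}
    (hz : z ∈ X.carrier) (i : Fin m) :
    coframe X η z (hlift X η z i) = (EuclideanSpace.single i 1, 0) := by
  have h : ∃ v, fderiv ℝ X.proj z v = EuclideanSpace.single i (1 : ℝ) ∧ η z v = 0 := by
    refine ⟨frame X η z (EuclideanSpace.single i 1, 0), ?_, ?_⟩
    · exact congrArg Prod.fst (coframe_frame hX hη hz _)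
    · exact congrArg Prod.snd (coframe_frame hX hη hz _)
  have h2 := Classical.epsilon_spec h
  exact Prod.ext h2.1 h2.2

theorem coframe_normal (hX : IsCircleEnd X) (hη : IsConnection X η) {z : E}
    (hz : z ∈ X.carrier) :
    coframe X η z (normal X η z) = (‖X.proj z‖⁻¹ • X.proj z, 0) := by
  unfold normal
  rw [map_sum]
  simp only [map_smul, coframe_hlift hX hη hz]
  refine Prod.ext ?_ ?_
  · rw [Prod.fst_sum]
    ext j
    simp [Finset.sum_apply, Pi.single_apply, div_eq_inv_mul]
  · simp [Prod.snd_sum]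

/-- The inner product of `ℝ^m` as a continuous bilinear form. -/
def innerForm (m : ℕ) : Euc m →L[ℝ] Euc m →L[ℝ] ℝ := innerSL ℝ

@[simp] theorem innerForm_apply (v w : Euc m) : innerForm m v w = inner ℝ v w := rfl

/-- The Euclidean metric of `ℝ^m × ℝ`. -/
def euclForm (m : ℕ) : Cyl m →L[ℝ] Cyl m →L[ℝ] ℝ :=
  (innerForm m).bilinearComp (ContinuousLinearMap.fst ℝ (Euc m) ℝ)
      (ContinuousLinearMap.fst ℝ (Euc m) ℝ)
    + (ContinuousLinearMap.mul ℝ ℝ).bilinearComp (ContinuousLinearMap.snd ℝ (Euc m) ℝ)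
      (ContinuousLinearMap.snd ℝ (Euc m) ℝ)

@[simp] theorem euclForm_apply (c d : Cyl m) :
    euclForm m c d = inner ℝ c.1 d.1 + c.2 * d.2 := rfl

theorem euclForm_pos {c : Cyl m} (hc : c ≠ 0) : 0 < euclForm m c c := by
  rw [euclForm_apply, real_inner_self_eq_norm_sq]
  by_cases h : c.1 = 0
  · have h2 : c.2 ≠ 0 := fun h2 => hc (Prod.ext h h2)
    have := mul_self_pos.2 h2
    positivity
  · have := norm_pos_iff.2 h
    nlinarith [mul_self_nonneg c.2]

theorem model_eq (z v w : E) :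
    model X η z v w = euclForm m (coframe X η z v) (coframe X η z w) := rfl

/-- The vector-valued map dual to a bilinear form. -/
def sharp (B : Euc m →L[ℝ] Euc m →L[ℝ] ℝ) : Euc m →L[ℝ] Euc m :=
  ∑ i, (B.flip (EuclideanSpace.single i 1)).smulRight (EuclideanSpace.single i (1 : ℝ))

theorem inner_sharp (B : Euc m →L[ℝ] Euc m →L[ℝ] ℝ) (v w : Euc m) :
    inner ℝ (sharp B v) w = B v w := by
  conv_rhs => rw [← (EuclideanSpace.basisFun (Fin m) ℝ).sum_repr w]
  simp [sharp, sum_inner, inner_smul_left, EuclideanSpace.inner_single_left, mul_comm]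

theorem sharp_add (B B' : Euc m →L[ℝ] Euc m →L[ℝ] ℝ) (v : Euc m) :
    sharp (B + B') v = sharp B v + sharp B' v :=
  ext_inner_right ℝ fun w => by simp [inner_sharp, inner_add_left]

theorem sharp_smul (r : ℝ) (B : Euc m →L[ℝ] Euc m →L[ℝ] ℝ) (v : Euc m) :
    sharp (r • B) v = r • sharp B v :=
  ext_inner_right ℝ fun w => by simp [inner_sharp, inner_smul_left]

/-- The connection coefficients `∇_{e_a} e_c` of the model metric in the frame `frame`, where
`B = Ω` is the curvature. -/
def connCoeff (B : Euc m →L[ℝ] Euc m →L[ℝ] ℝ) : Cyl m →L[ℝ] Cyl m →L[ℝ] Cyl m :=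
  (LinearMap.mk₂ ℝ (fun a c : Cyl m => (((1 / 2 : ℝ) • (c.2 • sharp B a.1 + a.2 • sharp B c.1),
    -(1 / 2 : ℝ) * B a.1 c.1) : Cyl m))
    (fun a a' c => Prod.ext (by simp; module) (by simp; ring))
    (fun r a c => Prod.ext (by simp; module) (by simp; ring))
    (fun a c c' => Prod.ext (by simp; module) (by simp; ring))
    (fun r a c => Prod.ext (by simp; module) (by simp; ring))).toContinuousBilinearMap

@[simp] theorem connCoeff_apply (B : Euc m →L[ℝ] Euc m →L[ℝ] ℝ) (a c : Cyl m) :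
    connCoeff B a c = ((1 / 2 : ℝ) • (c.2 • sharp B a.1 + a.2 • sharp B c.1),
      -(1 / 2 : ℝ) * B a.1 c.1) := rfl

/-- `connCoeff` as a linear map of the curvature. -/
def connCoeffL (m : ℕ) :
    (Euc m →L[ℝ] Euc m →L[ℝ] ℝ) →L[ℝ] (Cyl m →L[ℝ] Cyl m →L[ℝ] Cyl m) :=
  LinearMap.toContinuousLinearMap
    { toFun := connCoeff
      map_add' := by
        intro B B'
        refine ContinuousLinearMap.ext fun a => ContinuousLinearMap.ext fun c => Prod.ext ?_ ?_
        · simp [sharp_add]; module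
        · simp; ring
      map_smul' := by
        intro r B
        refine ContinuousLinearMap.ext fun a => ContinuousLinearMap.ext fun c => Prod.ext ?_ ?_
        · simp [sharp_smul]; module
        · simp; ring }

@[simp] theorem connCoeffL_apply (B : Euc m →L[ℝ] Euc m →L[ℝ] ℝ) :
    connCoeffL m B = connCoeff B := rfl

/-- This is the compatibility of the connection with the model metric, in an orthonormal frame: the
connection coefficients are skew because `Ω` is. -/
theorem euclForm_connCoeff_right (B : Euc m →L[ℝ] Euc m →L[ℝ] ℝ)
    (hB : ∀ v w, B v w = -B w v) (a c d : Cyl m) :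
    euclForm m (connCoeff B a c) d + euclForm m c (connCoeff B a d) = 0 := by
  simp only [euclForm_apply, connCoeff_apply, inner_smul_left, inner_smul_right, inner_add_left,
    inner_add_right, inner_sharp, real_inner_comm (sharp B _) _]
  simp only [RCLike.conj_to_real]
  rw [hB d.1 c.1]
  ring

theorem fderiv_coframe (hX : IsCircleEnd X) (hη : IsConnection X η) {z : E}
    (hz : z ∈ X.carrier) : HasFDerivAt (coframe X η) (fderiv ℝ (coframe X η) z) z ∧
      ∀ v w, fderiv ℝ (coframe X η) z v w =
        (fderiv ℝ (fderiv ℝ X.proj) z v w, fderiv ℝ η z v w) := by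
  have h1 : HasFDerivAt (fderiv ℝ X.proj) (fderiv ℝ (fderiv ℝ X.proj) z) z :=
    (((hX.contDiffAt_proj hz).fderiv_right (m := ∞) (by simp)).differentiableAt
      (by simp)).hasFDerivAt
  have h2 : HasFDerivAt η (fderiv ℝ η z) z :=
    ((hη.smooth.contDiffAt (hX.isOpen.mem_nhds hz)).differentiableAt (by simp)).hasFDerivAt
  have h3 : DifferentiableAt ℝ (coframe X η) z := by
    have h : coframe X η = fun p => (ContinuousLinearMap.inl ℝ (Euc m) ℝ).comp (fderiv ℝ X.proj p)
        + (ContinuousLinearMap.inr ℝ (Euc m) ℝ).comp (η p) := by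
      funext p
      refine ContinuousLinearMap.ext fun v => ?_
      simp
    rw [h]
    exact ((differentiableAt_const _).clm_comp h1.differentiableAt).add
      ((differentiableAt_const _).clm_comp h2.differentiableAt)
  refine ⟨h3.hasFDerivAt, fun v w => ?_⟩
  have h4 : HasFDerivAt (fun p => coframe X η p w) ((fderiv ℝ (coframe X η) z).flip w) z := by
    simpa using h3.hasFDerivAt.clm_apply (hasFDerivAt_const w z)
  have h5 : HasFDerivAt (fun p => coframe X η p w)
      (((fderiv ℝ (fderiv ℝ X.proj) z).flip w).prod ((fderiv ℝ η z).flip w)) z := by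
    refine HasFDerivAt.prodMk ?_ ?_
    · simpa using h1.clm_apply (hasFDerivAt_const w z)
    · simpa using h2.clm_apply (hasFDerivAt_const w z)
  exact congrArg (fun T : E →L[ℝ] Cyl m => T v) (h4.unique h5)

theorem fderiv_model (hX : IsCircleEnd X) (hη : IsConnection X η) {z : E}
    (hz : z ∈ X.carrier) (v w y : E) :
    fderiv ℝ (fun p => model X η p w y) z v =
      inner ℝ (fderiv ℝ (fderiv ℝ X.proj) z v w) (fderiv ℝ X.proj z y)
      + inner ℝ (fderiv ℝ X.proj z w) (fderiv ℝ (fderiv ℝ X.proj) z v y)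
      + fderiv ℝ η z v w * η z y + η z w * fderiv ℝ η z v y := by
  obtain ⟨h, h'⟩ := fderiv_coframe hX hη hz
  have hw : ∀ w, HasFDerivAt (fun p => coframe X η p w)
      ((fderiv ℝ (coframe X η) z).flip w) z := fun w => by
    simpa using h.clm_apply (hasFDerivAt_const w z)
  have h1 := (euclForm m).hasFDerivAt_of_bilinear (hw w) (hw y)
  have h2 := congrArg (fun T : E →L[ℝ] ℝ => T v) h1.fderiv
  refine h2.trans ?_
  simp [h']
  ring

/-- The curvature form `Ω` of a connection `η`. -/
def IsCurvature (X : CircleEnd m E) (η : E → E →L[ℝ] ℝ)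
    (Ω : Euc m → Euc m →L[ℝ] Euc m →L[ℝ] ℝ) : Prop :=
  ∀ z ∈ X.carrier, ∀ v w,
    extd η z v w = Ω (X.proj z) (fderiv ℝ X.proj z v) (fderiv ℝ X.proj z w)

theorem IsCurvature.antisymm (hX : IsCircleEnd X) {Ω : Euc m → Euc m →L[ℝ] Euc m →L[ℝ] ℝ}
    (hΩ : IsCurvature X η Ω) {x : Euc m} (hx : X.R₀ < ‖x‖) (v w : Euc m) :
    Ω x v w = -Ω x w v := by
  have : x ∈ X.proj '' X.carrier := by rw [hX.proj_image]; exact hx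
  obtain ⟨z, hz, rfl⟩ := this
  obtain ⟨v, rfl⟩ := hX.proj_submersion z hz v
  obtain ⟨w, rfl⟩ := hX.proj_submersion z hz w
  rw [← hΩ z hz, ← hΩ z hz]
  simp [extd]

/-- The Levi-Civita connection of the model metric in the adapted frame. The Christoffel vector is
guessed and then verified in Koszul's formula: the Hessian of the projection is symmetric, and the
remaining derivatives of `η` combine into three values of `dη`, that is, of `Ω`. -/
theorem fderiv_coframe_eq (hX : IsCircleEnd X) (hη : IsConnection X η)
    {Ω : Euc m → Euc m →L[ℝ] Euc m →L[ℝ] ℝ} (hΩ : IsCurvature X η Ω) {z : E}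
    (hz : z ∈ X.carrier) (v w : E) :
    fderiv ℝ (coframe X η) z v w = coframe X η z (christoffel (model X η) z v w)
      - connCoeff (Ω (X.proj z)) (coframe X η z v) (coframe X η z w) := by
  have hsymm : ∀ v w, fderiv ℝ (fderiv ℝ X.proj) z v w = fderiv ℝ (fderiv ℝ X.proj) z w v :=
    fun v w => (hX.contDiffAt_proj hz).isSymmSndFDerivAt (by simp; exact WithTop.coe_le_coe.2 le_top) v w
  have h3 : christoffel (model X η) z v w = frame X η z (fderiv ℝ (coframe X η) z v w
      + connCoeff (Ω (X.proj z)) (coframe X η z v) (coframe X η z w)) := by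
    refine christoffel_eq (fun a b y => ?_) (fun v hv => ?_) fun y => ?_
    · simp only [model_eq, map_sub, sub_apply]
    · have h0 : coframe X η z v ≠ 0 := fun h => hv (coframe_injective hX hη hz (by simpa using h))
      exact euclForm_pos h0
    rw [model_eq, coframe_frame hX hη hz, fderiv_model hX hη hz, fderiv_model hX hη hz,
      fderiv_model hX hη hz, (fderiv_coframe hX hη hz).2]
    have e1 := hΩ z hz v w
    have e2 := hΩ z hz v y
    have e3 := hΩ z hz w y
    simp only [extd] at e1 e2 e3
    simp only [map_add, add_apply, euclForm_apply, connCoeff_apply, coframe_apply,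
      inner_smul_left, inner_add_left, inner_sharp, ← e1, ← e2, ← e3, hsymm y v, hsymm y w,
      hsymm w v, real_inner_comm (fderiv ℝ X.proj z w)]
    simp only [RCLike.conj_to_real]
    ring
  rw [h3, coframe_frame hX hη hz]
  abel

/-- The covariant derivative of a `2`-tensor whose coefficients in the frame are `M ∘ proj`. -/
theorem covDeriv_two (hX : IsCircleEnd X) (hη : IsConnection X η)
    {Ω : Euc m → Euc m →L[ℝ] Euc m →L[ℝ] ℝ} (hΩ : IsCurvature X η Ω)
    {M : Euc m → Cyl m →L[ℝ] Cyl m →L[ℝ] ℝ} {S : E → (Fin 2 → E) → ℝ}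
    (hS : ∀ p ∈ X.carrier, ∀ u,
      S p u = M (X.proj p) (coframe X η p (u 0)) (coframe X η p (u 1)))
    {z : E} (hz : z ∈ X.carrier) (hM : DifferentiableAt ℝ M (X.proj z)) (u : Fin 3 → E) :
    covDeriv (model X η) S z u =
      fderiv ℝ M (X.proj z) (coframe X η z (u 0)).1 (coframe X η z (u 1)) (coframe X η z (u 2))
      - M (X.proj z) (connCoeff (Ω (X.proj z)) (coframe X η z (u 0)) (coframe X η z (u 1)))
          (coframe X η z (u 2))
      - M (X.proj z) (coframe X η z (u 1))
          (connCoeff (Ω (X.proj z)) (coframe X η z (u 0)) (coframe X η z (u 2))) := by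
  have hA : ∀ w, HasFDerivAt (fun p => coframe X η p w)
      ((fderiv ℝ (coframe X η) z).flip w) z := fun w => by
    simpa using (fderiv_coframe hX hη hz).1.clm_apply (hasFDerivAt_const w z)
  have hMz : HasFDerivAt (fun p => M (X.proj p))
      ((fderiv ℝ M (X.proj z)).comp (fderiv ℝ X.proj z)) z :=
    HasFDerivAt.comp z hM.hasFDerivAt (hX.hasFDerivAt_proj hz)
  have h1 := (hMz.clm_apply (hA (u 1))).clm_apply (hA (u 2))
  have h2 : HasFDerivAt (fun p => S p (Fin.tail u)) _ z := h1.congr_of_eventuallyEq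
    ((hX.isOpen.eventually_mem hz).mono fun p hp => hS p hp _)
  rw [covDeriv, h2.fderiv]
  simp only [Fin.sum_univ_two, hS z hz]
  -- The Christoffel terms produced by differentiating the coframe cancel those subtracted in
  -- `covDeriv`; only the curvature terms remain.
  simp [Fin.tail, fderiv_coframe_eq hX hη hΩ hz, coframe_fst, -coframe_apply, -connCoeff_apply]
  ring

/-- The covariant derivative of a `3`-tensor whose coefficients in the frame are `M ∘ proj`. -/
theorem covDeriv_three (hX : IsCircleEnd X) (hη : IsConnection X η)
    {Ω : Euc m → Euc m →L[ℝ] Euc m →L[ℝ] ℝ} (hΩ : IsCurvature X η Ω)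
    {M : Euc m → Cyl m →L[ℝ] Cyl m →L[ℝ] Cyl m →L[ℝ] ℝ} {S : E → (Fin 3 → E) → ℝ}
    (hS : ∀ p ∈ X.carrier, ∀ u, S p u =
      M (X.proj p) (coframe X η p (u 0)) (coframe X η p (u 1)) (coframe X η p (u 2)))
    {z : E} (hz : z ∈ X.carrier) (hM : DifferentiableAt ℝ M (X.proj z)) (u : Fin 4 → E)
    {a b c d : Cyl m} (ha : a = coframe X η z (u 0)) (hb : b = coframe X η z (u 1))
    (hc : c = coframe X η z (u 2)) (hd : d = coframe X η z (u 3)) :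
    covDeriv (model X η) S z u =
      fderiv ℝ M (X.proj z) a.1 b c d - M (X.proj z) (connCoeff (Ω (X.proj z)) a b) c d
      - M (X.proj z) b (connCoeff (Ω (X.proj z)) a c) d
      - M (X.proj z) b c (connCoeff (Ω (X.proj z)) a d) := by
  have hA : ∀ w, HasFDerivAt (fun p => coframe X η p w)
      ((fderiv ℝ (coframe X η) z).flip w) z := fun w => by
    simpa using (fderiv_coframe hX hη hz).1.clm_apply (hasFDerivAt_const w z)
  have hMz : HasFDerivAt (fun p => M (X.proj p))
      ((fderiv ℝ M (X.proj z)).comp (fderiv ℝ X.proj z)) z :=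
    HasFDerivAt.comp z hM.hasFDerivAt (hX.hasFDerivAt_proj hz)
  have h1 := ((hMz.clm_apply (hA (u 1))).clm_apply (hA (u 2))).clm_apply (hA (u 3))
  have h2 : HasFDerivAt (fun p => S p (Fin.tail u)) _ z := h1.congr_of_eventuallyEq
    ((hX.isOpen.eventually_mem hz).mono fun p hp => hS p hp _)
  subst ha hb hc hd
  rw [covDeriv, h2.fderiv]
  simp only [Fin.sum_univ_three, hS z hz]
  simp [Fin.tail, fderiv_coframe_eq hX hη hΩ hz, coframe_fst, -coframe_apply, -connCoeff_apply]
  ring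

end Frame

open Bornology Asymptotics

/-! ### A criterion for the asymptotics of a metric -/

section Trilinear

variable {F : Type*} [NormedAddCommGroup F] [NormedSpace ℝ F]

/-- The derivation action of an endomorphism-valued form on bilinear forms. -/
def bilinAct : (F →L[ℝ] F →L[ℝ] ℝ) →L[ℝ] (F →L[ℝ] F →L[ℝ] F) →L[ℝ] (F →L[ℝ] F →L[ℝ] F →L[ℝ] ℝ) :=
  (ContinuousLinearMap.compL ℝ F (F →L[ℝ] F) (F →L[ℝ] F →L[ℝ] ℝ)).comp
      (ContinuousLinearMap.compL ℝ F F (F →L[ℝ] ℝ))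
    + (ContinuousLinearMap.compL ℝ F (F →L[ℝ] F) (F →L[ℝ] F →L[ℝ] ℝ)).comp
      (((ContinuousLinearMap.compL ℝ (F →L[ℝ] F) ((F →L[ℝ] ℝ) →L[ℝ] (F →L[ℝ] ℝ))
        (F →L[ℝ] F →L[ℝ] ℝ)).flip (ContinuousLinearMap.compL ℝ F F ℝ).flip).comp
        (ContinuousLinearMap.compL ℝ F (F →L[ℝ] ℝ) (F →L[ℝ] ℝ)).flip)

@[simp] theorem bilinAct_apply (M : F →L[ℝ] F →L[ℝ] ℝ) (A : F →L[ℝ] F →L[ℝ] F) (a c d : F) :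
    bilinAct M A a c d = M (A a c) d + M c (A a d) := rfl

theorem abs_trilinear_le (T : F →L[ℝ] F →L[ℝ] F →L[ℝ] ℝ) (b c d : F) :
    |T b c d| ≤ ‖T‖ * ‖b‖ * ‖c‖ * ‖d‖ := by
  rw [← Real.norm_eq_abs]
  refine (ContinuousLinearMap.le_opNorm₂ _ _ _).trans ?_
  gcongr
  exact T.le_opNorm b

theorem abs_trilinear_le_norm (T : F →L[ℝ] F →L[ℝ] F →L[ℝ] ℝ) {b c d : F}
    (hb : ‖b‖ ≤ 1) (hc : ‖c‖ ≤ 1) (hd : ‖d‖ ≤ 1) : |T b c d| ≤ ‖T‖ :=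
  (abs_trilinear_le _ _ _ _).trans (by
    calc _ ≤ ‖T‖ * 1 * 1 * 1 := by gcongr
      _ = _ := by ring)

theorem abs_bilinear_le_norm (T : F →L[ℝ] F →L[ℝ] ℝ) {c d : F}
    (hc : ‖c‖ ≤ 1) (hd : ‖d‖ ≤ 1) : |T c d| ≤ ‖T‖ := by
  rw [← Real.norm_eq_abs]
  refine (ContinuousLinearMap.le_opNorm₂ _ _ _).trans ?_
  calc _ ≤ ‖T‖ * 1 * 1 := by gcongr
    _ = _ := by ring

theorem abs_sub_act_le (D T : F →L[ℝ] F →L[ℝ] F →L[ℝ] ℝ) (A : F →L[ℝ] F →L[ℝ] F) {a b c d : F}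
    (ha : ‖a‖ ≤ 1) (hb : ‖b‖ ≤ 1) (hc : ‖c‖ ≤ 1) (hd : ‖d‖ ≤ 1) :
    |D b c d - T (A a b) c d - T b (A a c) d - T b c (A a d)| ≤ ‖D‖ + 3 * (‖T‖ * ‖A‖) := by
  have hA : ∀ y : F, ‖y‖ ≤ 1 → ‖A a y‖ ≤ ‖A‖ := fun y hy => by
    refine (ContinuousLinearMap.le_opNorm₂ _ _ _).trans ?_
    calc _ ≤ ‖A‖ * 1 * 1 := by gcongr
      _ = _ := by ring
  have f1 : |D b c d| ≤ ‖D‖ := abs_trilinear_le_norm D hb hc hd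
  have f2 : |T (A a b) c d| ≤ ‖T‖ * ‖A‖ := (abs_trilinear_le _ _ _ _).trans (by
    calc _ ≤ ‖T‖ * ‖A‖ * 1 * 1 := by gcongr; exact hA b hb
      _ = _ := by ring)
  have f3 : |T b (A a c) d| ≤ ‖T‖ * ‖A‖ := (abs_trilinear_le _ _ _ _).trans (by
    calc _ ≤ ‖T‖ * 1 * ‖A‖ * 1 := by gcongr; exact hA c hc
      _ = _ := by ring)
  have f4 : |T b c (A a d)| ≤ ‖T‖ * ‖A‖ := (abs_trilinear_le _ _ _ _).trans (by
    calc _ ≤ ‖T‖ * 1 * 1 * ‖A‖ := by gcongr; exact hA d hd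
      _ = _ := by ring)
  rw [abs_le] at *
  constructor <;> linarith

end Trilinear

section Criterion

variable {m : ℕ} {E : Type*} [NormedAddCommGroup E] [NormedSpace ℝ E]
  {X : CircleEnd m E} {η : E → E →L[ℝ] ℝ}

/-- The coefficients in the frame of the covariant derivative of the `2`-tensor with coefficients
`M`. -/
def covCoeff (Ω : Euc m → Euc m →L[ℝ] Euc m →L[ℝ] ℝ) (M : Euc m → Cyl m →L[ℝ] Cyl m →L[ℝ] ℝ)
    (x : Euc m) : Cyl m →L[ℝ] Cyl m →L[ℝ] Cyl m →L[ℝ] ℝ :=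
  (fderiv ℝ M x).comp (ContinuousLinearMap.fst ℝ (Euc m) ℝ) - bilinAct (M x) (connCoeff (Ω x))

theorem covCoeff_apply (Ω : Euc m → Euc m →L[ℝ] Euc m →L[ℝ] ℝ)
    (M : Euc m → Cyl m →L[ℝ] Cyl m →L[ℝ] ℝ) (x : Euc m) (a c d : Cyl m) :
    covCoeff Ω M x a c d = fderiv ℝ M x a.1 c d - M x (connCoeff (Ω x) a c) d
      - M x c (connCoeff (Ω x) a d) := by
  rw [sub_sub]; rfl

theorem covDeriv_eq_covCoeff (hX : IsCircleEnd X) (hη : IsConnection X η)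
    {Ω : Euc m → Euc m →L[ℝ] Euc m →L[ℝ] ℝ} (hΩ : IsCurvature X η Ω)
    {M : Euc m → Cyl m →L[ℝ] Cyl m →L[ℝ] ℝ} {g : E → E → E → ℝ}
    (hg : ∀ z ∈ X.carrier, ∀ v w,
      g z v w = M (X.proj z) (coframe X η z v) (coframe X η z w))
    (hM : ContDiffOn ℝ ∞ M {x | X.R₀ < ‖x‖}) {z : E} (hz : z ∈ X.carrier) (u : Fin 3 → E) :
    covDeriv (model X η) (asTensor g) z u = covCoeff Ω M (X.proj z) (coframe X η z (u 0))
      (coframe X η z (u 1)) (coframe X η z (u 2)) := by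
  rw [covDeriv_two hX hη hΩ (S := asTensor g) (fun p hp u => hg p hp _ _) hz, covCoeff_apply]
  exact (hM.contDiffAt ((isOpen_lt continuous_const continuous_norm).mem_nhds
    (hX.proj_mem hz))).differentiableAt (by simp)

/-- The model metric is parallel, by `euclForm_connCoeff_right`. The connection coefficients thus
act only on the decaying part `g - h`. -/
theorem covCoeff_sub_euclForm {Ω : Euc m → Euc m →L[ℝ] Euc m →L[ℝ] ℝ}
    {M : Euc m → Cyl m →L[ℝ] Cyl m →L[ℝ] ℝ} {x : Euc m} (hΩ : ∀ v w, Ω x v w = -Ω x w v) :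
    covCoeff Ω (fun x => M x - euclForm m) x = covCoeff Ω M x := by
  refine ContinuousLinearMap.ext fun a => ContinuousLinearMap.ext fun c =>
    ContinuousLinearMap.ext fun d => ?_
  rw [covCoeff_apply, covCoeff_apply, fderiv_sub_const]
  have := euclForm_connCoeff_right (Ω x) hΩ a c d
  simp only [sub_apply]
  linarith

/-- The norm of the product `ℝ^m × ℝ` is the supremum norm, which is at most the Euclidean norm that
measures `h`. -/
theorem norm_le_one_of_model_le {z u : E} (h : model X η z u u ≤ 1) : ‖coframe X η z u‖ ≤ 1 := by
  rw [model_eq, euclForm_apply, real_inner_self_eq_norm_sq] at h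
  rw [Prod.norm_def, sup_le_iff]
  constructor
  · nlinarith [mul_self_nonneg (coframe X η z u).2, norm_nonneg (coframe X η z u).1]
  · rw [Real.norm_eq_abs]
    exact abs_le_one_iff_mul_self_le_one.2 (by nlinarith [sq_nonneg ‖(coframe X η z u).1‖])

theorem coframe_flow (hX : IsCircleEnd X) (hη : IsConnection X η) {z : E} (hz : z ∈ X.carrier)
    (t : ℝ) (v : E) :
    coframe X η (X.flow t z) (fderiv ℝ (X.flow t) z v) = coframe X η z v := by
  refine Prod.ext ?_ (hη.invariant t z hz v)
  have h1 : ContDiffAt ℝ ∞ (X.flow t) z :=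
    (hX.contDiffAt_flow hz t).comp z (contDiffAt_const.prodMk contDiffAt_id)
  have h2 := (hX.hasFDerivAt_proj (hX.flow_mem t z hz)).comp z
    (h1.differentiableAt (by simp)).hasFDerivAt
  have h3 : HasFDerivAt (X.proj ∘ X.flow t) (fderiv ℝ X.proj z) z :=
    (hX.hasFDerivAt_proj hz).congr_of_eventuallyEq
      ((hX.isOpen.eventually_mem hz).mono fun p hp => hX.proj_flow hp t)
  exact congrArg (fun T : E →L[ℝ] Euc m => T v) (h2.unique h3)

theorem contDiffOn_coframe_apply (hX : IsCircleEnd X) (hη : IsConnection X η) (v : E) :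
    ContDiffOn ℝ ∞ (fun p => coframe X η p v) X.carrier := by
  refine ContDiffOn.prodMk ?_ (hη.smooth.clm_apply contDiffOn_const)
  exact (hX.proj_smooth.fderiv_of_isOpen hX.isOpen (by simp)).clm_apply contDiffOn_const

/-- The derivative of `g - h` has degree `1 - m`; the connection term has degree `(2 - m) + (1 -
m)`, which is lower. -/
theorem symbolClass_covCoeff (hm : 3 ≤ m) (hX : IsCircleEnd X)
    {Ω : Euc m → Euc m →L[ℝ] Euc m →L[ℝ] ℝ} (hΩ : IsCurvature X η Ω)
    (hΩd : SymbolClass 1 (1 - (m : ℤ)) Ω) {M : Euc m → Cyl m →L[ℝ] Cyl m →L[ℝ] ℝ}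
    (hMd : SymbolClass 2 (2 - (m : ℤ)) fun x => M x - euclForm m) :
    SymbolClass 1 (1 - (m : ℤ)) (covCoeff Ω M) := by
  have hc : SymbolClass 1 (1 - (m : ℤ)) fun x => connCoeff (Ω x) := hΩd.clm_comp (connCoeffL m)
  have h1 := hMd.fderiv_mem.clm_comp
    ((ContinuousLinearMap.compL ℝ (Cyl m) (Euc m) (Cyl m →L[ℝ] Cyl m →L[ℝ] ℝ)).flip
      (ContinuousLinearMap.fst ℝ (Euc m) ℝ))
  have h2 := (SymbolClass.bilin (bilinAct) hMd.of_succ hc).mono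
    (show (2 - (m : ℤ)) + (1 - m) ≤ 1 - m by omega)
  rw [show 2 - (m : ℤ) - 1 = 1 - m by ring] at h1
  refine (h1.sub h2).congr ?_
  filter_upwards [eventually_norm_gt X.R₀] with x hx
  exact covCoeff_sub_euclForm fun v w => hΩ.antisymm hX hx v w

-- Everything is read off in the frame, where vectors of `h`-length at most 1 have coordinates of
-- norm at most 1. The second covariant derivative is the derivative of `covCoeff`, of degree `-m`,
-- corrected by three connection terms of degree `2(1 - m)`.
set_option maxHeartbeats 800000 in
theorem isALF_of_coeff (hm : 3 ≤ m) (hX : IsCircleEnd X) (hη : IsConnection X η)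
    {Ω : Euc m → Euc m →L[ℝ] Euc m →L[ℝ] ℝ} (hΩ : IsCurvature X η Ω)
    (hΩs : ContDiffOn ℝ ∞ Ω {x | X.R₀ < ‖x‖}) (hΩd : SymbolClass 1 (1 - (m : ℤ)) Ω)
    {M : Euc m → Cyl m →L[ℝ] Cyl m →L[ℝ] ℝ} {g : E → E → E → ℝ}
    (hg : ∀ z ∈ X.carrier, ∀ v w,
      g z v w = M (X.proj z) (coframe X η z v) (coframe X η z w))
    (hM : ContDiffOn ℝ ∞ M {x | X.R₀ < ‖x‖})
    (hMsymm : ∀ x, X.R₀ < ‖x‖ → ∀ c d, M x c d = M x d c)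
    (hMpos : ∀ x, X.R₀ < ‖x‖ → ∀ c, c ≠ 0 → 0 < M x c c)
    (hMd : SymbolClass 2 (2 - (m : ℤ)) fun x => M x - euclForm m) : IsALF X η g := by
  have hext : IsOpen {x : Euc m | X.R₀ < ‖x‖} := isOpen_lt continuous_const continuous_norm
  have hc : SymbolClass 1 (1 - (m : ℤ)) fun x => connCoeff (Ω x) := hΩd.clm_comp (connCoeffL m)
  have hN := symbolClass_covCoeff hm hX hΩ hΩd hMd
  have hcov := fun {z : E} => covDeriv_eq_covCoeff hX hη hΩ hg hM (z := z)
  refine ⟨hX, hη, ⟨Ω, hΩs, hΩ, ?_⟩, ⟨?_, ?_, ?_, ?_⟩, ?_, ?_, ?_, ?_⟩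
  · obtain ⟨C, R, hC, h⟩ := hΩd.bound
    obtain ⟨C', R', hC', h'⟩ := hΩd.fderiv_mem.bound
    refine ⟨max C C', max (max R R') 1, fun x hx hx1 => ⟨?_, fun v => ?_⟩⟩
    · refine (h x (by simp_all)).trans ?_
      gcongr
      exact le_max_left _ _
    · refine ((fderiv ℝ Ω x).le_opNorm v).trans ?_
      gcongr
      refine (h' x (by simp_all)).trans ?_
      rw [show (1 - (m : ℤ) - 1) = -m by ring]
      gcongr
      exact le_max_right _ _
  · intro z hz v
    have : g z v = fun w => M (X.proj z) (coframe X η z v) (coframe X η z w) :=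
      funext (hg z hz v)
    rw [this]
    exact ((M (X.proj z) (coframe X η z v)).comp (coframe X η z)).isLinear
  · intro z hz v w
    rw [hg z hz, hg z hz, hMsymm _ (hX.proj_mem hz)]
  · intro z hz v hv
    rw [hg z hz]
    exact hMpos _ (hX.proj_mem hz) _
      fun h => hv (coframe_injective hX hη hz (by rw [h, map_zero]))
  · intro v w
    refine ContDiffOn.congr ?_ fun z hz => hg z hz v w
    exact ((hM.comp hX.proj_smooth fun z hz => hX.proj_mem hz).clm_apply
      (contDiffOn_coframe_apply hX hη v)).clm_apply (contDiffOn_coframe_apply hX hη w)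
  · intro z hz v w
    rw [hg _ (hX.flow_mem _ z hz), hg z hz, coframe_flow hX hη hz, coframe_flow hX hη hz,
      hX.proj_flow hz]
  · obtain ⟨C, R, hC, h⟩ := hMd.bound
    refine ⟨C, R, fun z hz hR u hu => ?_⟩
    have h1 : asTensor (fun z v w => g z v w - model X η z v w) z u =
        (M (X.proj z) - euclForm m) (coframe X η z (u 0)) (coframe X η z (u 1)) := by
      rw [asTensor, hg z hz, model_eq, sub_apply, sub_apply]
    rw [h1]
    exact (abs_bilinear_le_norm _ (norm_le_one_of_model_le (hu 0))
      (norm_le_one_of_model_le (hu 1))).trans (h _ hR)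
  · obtain ⟨C, R, hC, h⟩ := hN.bound
    refine ⟨C, R, fun z hz hR u hu => ?_⟩
    rw [hcov hz]
    exact (abs_trilinear_le_norm _ (norm_le_one_of_model_le (hu 0))
      (norm_le_one_of_model_le (hu 1)) (norm_le_one_of_model_le (hu 2))).trans (h _ hR)
  · obtain ⟨C₁, R₁, hC₁, h₁⟩ := hN.fderiv_mem.bound
    obtain ⟨C₂, R₂, hC₂, h₂⟩ := hN.bound
    obtain ⟨C₃, R₃, hC₃, h₃⟩ := hc.bound
    obtain ⟨R₄, hR₄⟩ := eventually_cobounded_iff.1 hN.smooth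
    refine ⟨C₁ + 3 * (C₂ * C₃), max (max R₁ R₂) (max (max R₃ R₄) 1), fun z hz hR u hu => ?_⟩
    simp only [max_lt_iff] at hR
    obtain ⟨⟨hR1, hR2⟩, ⟨hR3, hR4⟩, hR5⟩ := hR
    rw [covDeriv_three hX hη hΩ (fun p hp u => hcov hp u) hz
      ((hR₄ _ hR4).differentiableAt (by simp)) u rfl rfl rfl rfl]
    have hu0 := norm_le_one_of_model_le (hu 0)
    have hu1 := norm_le_one_of_model_le (hu 1)
    have hu2 := norm_le_one_of_model_le (hu 2)
    have hu3 := norm_le_one_of_model_le (hu 3)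
    set x := X.proj z
    refine (abs_sub_act_le _ _ _ hu0 hu1 hu2 hu3).trans ?_
    -- Here `2 - 2m ≤ -m`, and `‖x‖ > 1` makes the powers monotone in the exponent.
    have hpow : ‖x‖ ^ (1 - (m : ℤ)) * ‖x‖ ^ (1 - (m : ℤ)) ≤ ‖x‖ ^ (-(m : ℤ)) := by
      rw [← zpow_add₀ (by positivity)]
      exact zpow_le_zpow_right₀ hR5.le (by omega)
    have f1 : ‖fderiv ℝ (covCoeff Ω M) x (coframe X η z (u 0)).1‖ ≤ C₁ * ‖x‖ ^ (-(m : ℤ)) := by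
      have h5 := h₁ x hR1
      rw [show (1 - (m : ℤ) - 1) = -m by ring] at h5
      have h6 : ‖(coframe X η z (u 0)).1‖ ≤ 1 := (le_max_left _ _).trans hu0
      refine ((fderiv ℝ (covCoeff Ω M) x).le_opNorm _).trans ?_
      calc _ ≤ C₁ * ‖x‖ ^ (-(m : ℤ)) * 1 := by gcongr
        _ = _ := by ring
    have f2 : ‖covCoeff Ω M x‖ * ‖connCoeff (Ω x)‖ ≤ C₂ * C₃ * ‖x‖ ^ (-(m : ℤ)) := by
      calc _ ≤ C₂ * ‖x‖ ^ (1 - (m : ℤ)) * (C₃ * ‖x‖ ^ (1 - (m : ℤ))) := by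
            gcongr
            exacts [h₂ x hR2, h₃ x hR3]
        _ = C₂ * C₃ * (‖x‖ ^ (1 - (m : ℤ)) * ‖x‖ ^ (1 - (m : ℤ))) := by ring
        _ ≤ _ := by gcongr
    linarith

end Criterion

open Bornology Asymptotics

/-! ### Flux integrals and masses -/

theorem sphereVol_pos {m : ℕ} (hm : 0 < m) : 0 < sphereVol m := by
  have : Nonempty (Fin m) := ⟨⟨0, hm⟩⟩
  have : Nontrivial (Euc m) := inferInstance
  unfold sphereVol
  rw [measureReal_def, Measure.toSphere_apply_univ]
  refine ENNReal.toReal_pos ?_ ?_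
  · refine mul_ne_zero ?_ (Metric.measure_ball_pos _ _ one_pos).ne'
    simp [hm.ne']
  · exact ENNReal.mul_ne_top (by simp) measure_ball_lt_top.ne

/-- In all the examples the flux converges, so the upper limit is a limit. -/
theorem mass_of_tendsto {m : ℕ} (hm : 0 < m) {L : ℝ} (hL : 0 < L) {f : ℝ → ℝ} {c : ℝ}
    (h : Tendsto f atTop (𝓝 (sphereVol m * L * c))) :
    ((-(1 / (sphereVol m * L)) : ℝ) : EReal) * limsup (fun R : ℝ => ((f R : ℝ) : EReal)) atTop
      = ((-c : ℝ) : EReal) := by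
  have h1 : Tendsto (fun R : ℝ => ((f R : ℝ) : EReal)) atTop
      (𝓝 ((sphereVol m * L * c : ℝ) : EReal)) :=
    (continuous_coe_real_ereal.tendsto _).comp h
  rw [h1.limsup_eq, ← EReal.coe_mul]
  have := sphereVol_pos hm
  congr 1
  field_simp

section Mass

variable {m : ℕ} {E : Type*} [NormedAddCommGroup E] [NormedSpace ℝ E]
  {X : CircleEnd m E} {η : E → E →L[ℝ] ℝ}

theorem pointOver_spec (hX : IsCircleEnd X) {x : Euc m} (hx : X.R₀ < ‖x‖) :
    pointOver X x ∈ X.carrier ∧ X.proj (pointOver X x) = x := by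
  have h : x ∈ X.proj '' X.carrier := by rw [hX.proj_image]; exact hx
  exact Classical.epsilon_spec (p := fun z => z ∈ X.carrier ∧ X.proj z = x) h

/-- The integrand is constant along each fibre, so the choice of a point over `x` does not matter
and the fibre integral is multiplication by `L`. -/
theorem flux_eq (hX : IsCircleEnd X) {ξ : E → E → ℝ} {Φ : Euc m → ℝ}
    (hΦ : ∀ z ∈ X.carrier, ξ z (normal X η z) = Φ (X.proj z)) {R : ℝ} (hR : X.R₀ < R)
    (hR0 : 0 ≤ R) :
    flux X η ξ R = ∫ e : Metric.sphere (0 : Euc m) 1, R ^ (m - 1) * (X.L * Φ (R • (e : Euc m)))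
      ∂(volume : Measure (Euc m)).toSphere := by
  unfold flux
  congr 1
  funext e
  have he : ‖R • (e : Euc m)‖ = R := by
    rw [norm_smul, Real.norm_of_nonneg hR0, mem_sphere_zero_iff_norm.1 e.2, mul_one]
  obtain ⟨h1, h2⟩ := pointOver_spec hX (x := R • (e : Euc m)) (by rwa [he])
  have h3 : ∀ t : ℝ, ξ (X.flow t (pointOver X (R • (e : Euc m))))
      (normal X η (X.flow t (pointOver X (R • (e : Euc m))))) = Φ (R • (e : Euc m)) := fun t => by
    rw [hΦ _ (hX.flow_mem t _ h1), hX.proj_flow h1, h2]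
  simp only [h3, intervalIntegral.integral_const, sub_zero, smul_eq_mul]

/-- A limit along `cobounded` is uniform over the spheres, so the integrals converge by a sup bound.
Continuity serves only to make the integrands integrable. -/
theorem tendsto_flux (hX : IsCircleEnd X) {ξ : E → E → ℝ} {Φ : Euc m → ℝ}
    (hΦ : ∀ z ∈ X.carrier, ξ z (normal X η z) = Φ (X.proj z))
    (hc : ContinuousOn Φ {x | X.R₀ < ‖x‖}) {c : ℝ}
    (hlim : Tendsto (fun x => ‖x‖ ^ (m - 1) * Φ x) (cobounded (Euc m)) (𝓝 c)) :
    Tendsto (flux X η ξ) atTop (𝓝 (sphereVol m * X.L * c)) := by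
  rw [Metric.tendsto_atTop]
  intro ε hε
  -- The `+ 1` makes `K` positive and gives a strict inequality at the end, whatever the volume of
  -- the sphere.
  set K := X.L * (sphereVol m + 1) with hK
  have hvol : 0 ≤ sphereVol m := measureReal_nonneg
  have hKpos : 0 < K := mul_pos hX.L_pos (by linarith)
  obtain ⟨R₁, hR₁⟩ := eventually_cobounded_iff.1 (Metric.tendsto_nhds.1 hlim (ε / K) (by positivity))
  refine ⟨max (max R₁ X.R₀) 0 + 1, fun R hR => ?_⟩
  have hR1 : R₁ < R := by linarith [le_max_left R₁ X.R₀, le_max_left (max R₁ X.R₀) 0]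
  have hR2 : X.R₀ < R := by linarith [le_max_right R₁ X.R₀, le_max_left (max R₁ X.R₀) 0]
  have hR3 : 0 ≤ R := by linarith [le_max_right (max R₁ X.R₀) 0]
  have hn : ∀ e : Metric.sphere (0 : Euc m) 1, ‖R • (e : Euc m)‖ = R := fun e => by
    rw [norm_smul, Real.norm_of_nonneg hR3, mem_sphere_zero_iff_norm.1 e.2, mul_one]
  rw [flux_eq hX hΦ hR2 hR3]
  have hcont : Continuous fun e : Metric.sphere (0 : Euc m) 1 =>
      R ^ (m - 1) * (X.L * Φ (R • (e : Euc m))) := by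
    refine continuous_const.mul (continuous_const.mul ?_)
    refine hc.comp_continuous (by fun_prop) fun e => ?_
    rw [mem_ofPred_eq, hn]; exact hR2
  have hint := hcont.integrable_of_hasCompactSupport (HasCompactSupport.of_compactSpace _)
    (μ := (volume : Measure (Euc m)).toSphere)
  have h1 : sphereVol m * X.L * c = ∫ e : Metric.sphere (0 : Euc m) 1, X.L * c
      ∂(volume : Measure (Euc m)).toSphere := by
    rw [integral_const, smul_eq_mul, sphereVol, mul_assoc]
  rw [h1, dist_eq_norm, ← integral_sub hint (integrable_const _)]
  have h2 : ∀ e : Metric.sphere (0 : Euc m) 1,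
      ‖R ^ (m - 1) * (X.L * Φ (R • (e : Euc m))) - X.L * c‖ ≤ X.L * (ε / K) := fun e => by
    have h3 := hR₁ (R • (e : Euc m)) (by rw [hn]; exact hR1)
    rw [hn, dist_eq_norm] at h3
    rw [show R ^ (m - 1) * (X.L * Φ (R • (e : Euc m))) - X.L * c
      = X.L * (R ^ (m - 1) * Φ (R • (e : Euc m)) - c) by ring, norm_mul,
      Real.norm_of_nonneg hX.L_pos.le]
    exact mul_le_mul_of_nonneg_left h3.le hX.L_pos.le
  refine (norm_integral_le_of_norm_le_const (Eventually.of_forall h2)).trans_lt ?_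
  change X.L * (ε / K) * sphereVol m < ε
  have h4 : X.L * (ε / K) * sphereVol m = ε * (X.L * sphereVol m / K) := by ring
  rw [h4]
  refine mul_lt_of_lt_one_right hε ((div_lt_one hKpos).2 ?_)
  rw [hK]
  nlinarith [hX.L_pos]

variable {Ω : Euc m → Euc m →L[ℝ] Euc m →L[ℝ] ℝ} {M : Euc m → Cyl m →L[ℝ] Cyl m →L[ℝ] ℝ}
  {g : E → E → E → ℝ}

/-- The horizontal vectors of the standard basis of `ℝ^m × ℝ`. -/
def hvec (i : Fin m) : Cyl m := (EuclideanSpace.single i 1, 0)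

/-- The vertical vector of the standard basis of `ℝ^m × ℝ`. -/
def vvec (m : ℕ) : Cyl m := (0, 1)

/-- The value on the normal of the one-form `Div_h g + d Tr_h g`, in terms of the coefficients of
`g`. -/
def fluxD (Ω : Euc m → Euc m →L[ℝ] Euc m →L[ℝ] ℝ) (M : Euc m → Cyl m →L[ℝ] Cyl m →L[ℝ] ℝ)
    (x : Euc m) : ℝ :=
  -((∑ i, covCoeff Ω M x (hvec i) (hvec i) (‖x‖⁻¹ • x, 0))
    + covCoeff Ω M x (vvec m) (vvec m) (‖x‖⁻¹ • x, 0))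
  + ((∑ i, fderiv ℝ M x (‖x‖⁻¹ • x) (hvec i) (hvec i))
    + fderiv ℝ M x (‖x‖⁻¹ • x) (vvec m) (vvec m))

theorem hasFDerivAt_coeff (hX : IsCircleEnd X) (hM : ContDiffOn ℝ ∞ M {x | X.R₀ < ‖x‖}) {z : E}
    (hz : z ∈ X.carrier) : HasFDerivAt (fun p => M (X.proj p))
      ((fderiv ℝ M (X.proj z)).comp (fderiv ℝ X.proj z)) z :=
  HasFDerivAt.comp z ((hM.contDiffAt ((isOpen_lt continuous_const continuous_norm).mem_nhds
    (hX.proj_mem hz))).differentiableAt (by simp)).hasFDerivAt (hX.hasFDerivAt_proj hz)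

theorem fderiv_vert_vert (hX : IsCircleEnd X) (hη : IsConnection X η)
    (hg : ∀ z ∈ X.carrier, ∀ v w,
      g z v w = M (X.proj z) (coframe X η z v) (coframe X η z w))
    (hM : ContDiffOn ℝ ∞ M {x | X.R₀ < ‖x‖}) {z : E} (hz : z ∈ X.carrier) :
    fderiv ℝ (fun p => g p (vert X p) (vert X p)) z (normal X η z) =
      fderiv ℝ M (X.proj z) (‖X.proj z‖⁻¹ • X.proj z) (vvec m) (vvec m) := by
  have h1 := ((hasFDerivAt_coeff hX hM hz).clm_apply (hasFDerivAt_const (vvec m) z)).clm_apply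
    (hasFDerivAt_const (vvec m) z)
  have h2 := h1.congr_of_eventuallyEq (f₁ := fun p => g p (vert X p) (vert X p))
    ((hX.isOpen.eventually_mem hz).mono fun p hp => by
      simp only [hg p hp, coframe_vert hX hη hp, vvec])
  have hn := congrArg Prod.fst (coframe_normal hX hη hz)
  rw [coframe_fst] at hn
  rw [h2.fderiv]
  simp [hn]

/-- In the frame, the vectors traced over are constant, so the derivative of the trace is the trace
of the derivative of `M`; the normal is the horizontal vector `x/‖x‖`. -/
theorem formD_normal (hX : IsCircleEnd X) (hη : IsConnection X η) (hΩ : IsCurvature X η Ω)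
    (hg : ∀ z ∈ X.carrier, ∀ v w,
      g z v w = M (X.proj z) (coframe X η z v) (coframe X η z w))
    (hM : ContDiffOn ℝ ∞ M {x | X.R₀ < ‖x‖}) {z : E} (hz : z ∈ X.carrier) :
    formD X η g z (normal X η z) = fluxD Ω M (X.proj z) := by
  have h0 : ∀ c : Cyl m, HasFDerivAt (fun p => M (X.proj p) c c) _ z := fun c =>
    ((hasFDerivAt_coeff hX hM hz).clm_apply (hasFDerivAt_const c z)).clm_apply
      (hasFDerivAt_const c z)
  have h1 := (HasFDerivAt.fun_sum (u := Finset.univ) fun (i : Fin m) _ => h0 (hvec i)).add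
    (h0 (vvec m))
  have h2 := h1.congr_of_eventuallyEq (f₁ := traceH X η g)
    ((hX.isOpen.eventually_mem hz).mono fun p hp => by
      simp only [traceH, hg p hp, coframe_vert hX hη hp, coframe_hlift hX hη hp, vvec, hvec,
        Pi.add_apply])
  have hn := congrArg Prod.fst (coframe_normal hX hη hz)
  rw [coframe_fst] at hn
  rw [formD, h2.fderiv, divH]
  simp only [covDeriv_eq_covCoeff hX hη hΩ hg hM hz]
  simp [coframe_vert hX hη hz, coframe_hlift hX hη hz, coframe_normal hX hη hz, hn,
    fluxD, hvec, vvec, -coframe_apply]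

theorem formGB_normal (hX : IsCircleEnd X) (hη : IsConnection X η) (hΩ : IsCurvature X η Ω)
    (hg : ∀ z ∈ X.carrier, ∀ v w,
      g z v w = M (X.proj z) (coframe X η z v) (coframe X η z w))
    (hM : ContDiffOn ℝ ∞ M {x | X.R₀ < ‖x‖}) {z : E} (hz : z ∈ X.carrier) :
    formGB X η g z (normal X η z) = fluxD Ω M (X.proj z)
      - (1 / 2) * fderiv ℝ M (X.proj z) (‖X.proj z‖⁻¹ • X.proj z) (vvec m) (vvec m) := by
  rw [← formD_normal hX hη hΩ hg hM hz, ← fderiv_vert_vert hX hη hg hM hz]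
  rfl

end Mass

open Bornology Asymptotics

/-! ### Metrics `P dx² + N (η + β)²` -/

section Bundle

variable {m : ℕ} {E : Type*} [NormedAddCommGroup E] [NormedSpace ℝ E]
  {X : CircleEnd m E} {η : E → E →L[ℝ] ℝ}

/-- The one-form `dt + β`. -/
def tiltForm (β : Euc m → Euc m →L[ℝ] ℝ) (x : Euc m) : Cyl m →L[ℝ] ℝ :=
  ContinuousLinearMap.snd ℝ (Euc m) ℝ + (β x).comp (ContinuousLinearMap.fst ℝ (Euc m) ℝ)

/-- The coefficients of `P dx² + N (dt + β)²`. -/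
def bundleCoeff (P N : Euc m → ℝ) (β : Euc m → Euc m →L[ℝ] ℝ) (x : Euc m) :
    Cyl m →L[ℝ] Cyl m →L[ℝ] ℝ :=
  P x • (innerForm m).bilinearComp (ContinuousLinearMap.fst ℝ (Euc m) ℝ)
      (ContinuousLinearMap.fst ℝ (Euc m) ℝ)
    + N x • ContinuousLinearMap.smulRightL ℝ (Cyl m) (Cyl m →L[ℝ] ℝ) (tiltForm β x) (tiltForm β x)

theorem bundleCoeff_apply (P N : Euc m → ℝ) (β : Euc m → Euc m →L[ℝ] ℝ) (x : Euc m)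
    (c d : Cyl m) : bundleCoeff P N β x c d =
      P x * inner ℝ c.1 d.1 + N x * ((c.2 + β x c.1) * (d.2 + β x d.1)) := rfl

variable {P N : Euc m → ℝ} {β : Euc m → Euc m →L[ℝ] ℝ}

theorem contDiffOn_bundleCoeff {s : Set (Euc m)} (hP : ContDiffOn ℝ ∞ P s)
    (hN : ContDiffOn ℝ ∞ N s) (hβ : ContDiffOn ℝ ∞ β s) :
    ContDiffOn ℝ ∞ (bundleCoeff P N β) s := by
  have h1 : ContDiffOn ℝ ∞ (tiltForm β) s :=
    contDiffOn_const.add (hβ.clm_comp contDiffOn_const)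
  exact (hP.smul contDiffOn_const).add (hN.smul
    (((ContinuousLinearMap.smulRightL ℝ (Cyl m) (Cyl m →L[ℝ] ℝ)).contDiff.comp_contDiffOn
      h1).clm_apply h1))

theorem bundleCoeff_pos {x : Euc m} (hP : 0 < P x) (hN : 0 < N x) {c : Cyl m} (hc : c ≠ 0) :
    0 < bundleCoeff P N β x c c := by
  rw [bundleCoeff_apply, real_inner_self_eq_norm_sq]
  by_cases h : c.1 = 0
  · have h2 : c.2 ≠ 0 := fun h2 => hc (Prod.ext h h2)
    have := mul_self_pos.2 h2
    simp only [h, norm_zero, map_zero, add_zero]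
    positivity
  · have := norm_pos_iff.2 h
    have h3 := mul_self_nonneg (c.2 + β x c.1)
    positivity

/-- With `t = dt + β`, the difference is `(P - 1) dx² + (N - 1) t ⊗ t + β ⊗ t + dt ⊗ β`, and each of
the four terms has a factor of degree `p`. -/
theorem symbolClass_bundleCoeff {n : ℕ} {p : ℤ} (hp : p ≤ 0)
    (hP : SymbolClass n p fun x => P x - 1) (hN : SymbolClass n p fun x => N x - 1)
    (hβ : SymbolClass n p β) :
    SymbolClass n p fun x => bundleCoeff P N β x - euclForm m := by
  have hb : SymbolClass n p fun x => (β x).comp (ContinuousLinearMap.fst ℝ (Euc m) ℝ) :=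
    hβ.clm_comp ((ContinuousLinearMap.compL ℝ (Cyl m) (Euc m) ℝ).flip
      (ContinuousLinearMap.fst ℝ (Euc m) ℝ))
  have ht : SymbolClass n 0 (tiltForm β) := (SymbolClass.const n _).add (hb.mono hp)
  have h1 := hP.smul (SymbolClass.const (V := Euc m) n ((innerForm m).bilinearComp
    (ContinuousLinearMap.fst ℝ (Euc m) ℝ) (ContinuousLinearMap.fst ℝ (Euc m) ℝ)))
  have h2 := hN.smul (SymbolClass.bilin
    (ContinuousLinearMap.smulRightL ℝ (Cyl m) (Cyl m →L[ℝ] ℝ)) ht ht)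
  have h3 := SymbolClass.bilin (ContinuousLinearMap.smulRightL ℝ (Cyl m) (Cyl m →L[ℝ] ℝ)) hb ht
  have h4 := SymbolClass.bilin (ContinuousLinearMap.smulRightL ℝ (Cyl m) (Cyl m →L[ℝ] ℝ))
    (SymbolClass.const (V := Euc m) n (ContinuousLinearMap.snd ℝ (Euc m) ℝ)) hb
  simp only [add_zero, zero_add] at h1 h2 h3 h4
  refine ((h1.add h2).add (h3.add h4)).congr (Eventually.of_forall fun x => ?_)
  refine ContinuousLinearMap.ext fun c => ContinuousLinearMap.ext fun d => ?_
  rw [sub_apply, sub_apply, bundleCoeff_apply]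
  simp [tiltForm]
  ring

theorem isALF_bundle (hm : 3 ≤ m) (hX : IsCircleEnd X) (hη : IsConnection X η)
    {Ω : Euc m → Euc m →L[ℝ] Euc m →L[ℝ] ℝ} (hΩ : IsCurvature X η Ω)
    (hΩs : ContDiffOn ℝ ∞ Ω {x | X.R₀ < ‖x‖}) (hΩd : SymbolClass 1 (1 - (m : ℤ)) Ω)
    {g : E → E → E → ℝ}
    (hg : ∀ z ∈ X.carrier, ∀ v w,
      g z v w = bundleCoeff P N β (X.proj z) (coframe X η z v) (coframe X η z w))
    (hPs : ContDiffOn ℝ ∞ P {x | X.R₀ < ‖x‖}) (hNs : ContDiffOn ℝ ∞ N {x | X.R₀ < ‖x‖})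
    (hβs : ContDiffOn ℝ ∞ β {x | X.R₀ < ‖x‖})
    (hP0 : ∀ x, X.R₀ < ‖x‖ → 0 < P x) (hN0 : ∀ x, X.R₀ < ‖x‖ → 0 < N x)
    (hP : SymbolClass 2 (2 - (m : ℤ)) fun x => P x - 1)
    (hN : SymbolClass 2 (2 - (m : ℤ)) fun x => N x - 1)
    (hβ : SymbolClass 2 (2 - (m : ℤ)) β) : IsALF X η g := by
  refine isALF_of_coeff hm hX hη hΩ hΩs hΩd hg (contDiffOn_bundleCoeff hPs hNs hβs)
    (fun x _ c d => ?_) (fun x hx c hc => bundleCoeff_pos (hP0 x hx) (hN0 x hx) hc)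
    (symbolClass_bundleCoeff (by omega) hP hN hβ)
  rw [bundleCoeff_apply, bundleCoeff_apply, real_inner_comm]
  ring

theorem fderiv_bundleCoeff {x : Euc m} (hP : DifferentiableAt ℝ P x)
    (hN : DifferentiableAt ℝ N x) (hβ : DifferentiableAt ℝ β x) (v : Euc m) (c d : Cyl m) :
    fderiv ℝ (bundleCoeff P N β) x v c d =
      fderiv ℝ P x v * inner ℝ c.1 d.1 + fderiv ℝ N x v * ((c.2 + β x c.1) * (d.2 + β x d.1))
      + N x * (fderiv ℝ β x v c.1 * (d.2 + β x d.1) + (c.2 + β x c.1) * fderiv ℝ β x v d.1) := by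
  have h0 : DifferentiableAt ℝ (bundleCoeff P N β) x := by
    have h1 : DifferentiableAt ℝ (tiltForm β) x :=
      (differentiableAt_const _).add (hβ.clm_comp (differentiableAt_const _))
    exact (hP.smul (differentiableAt_const _)).add (hN.smul
      (((ContinuousLinearMap.smulRightL ℝ (Cyl m) (Cyl m →L[ℝ] ℝ)).differentiableAt.comp x
        h1).clm_apply h1))
  have h1 := (h0.hasFDerivAt.clm_apply (hasFDerivAt_const c x)).clm_apply (hasFDerivAt_const d x)
  have hb : ∀ c : Cyl m, HasFDerivAt (fun y => c.2 + β y c.1) ((fderiv ℝ β x).flip c.1) x :=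
    fun c => by simpa using (hβ.hasFDerivAt.clm_apply (hasFDerivAt_const c.1 x)).const_add c.2
  have h2 := (hP.hasFDerivAt.mul_const (inner ℝ c.1 d.1)).add
    (hN.hasFDerivAt.mul ((hb c).mul (hb d)))
  have h3 := congrArg (fun T : Euc m →L[ℝ] ℝ => T v) (h1.unique h2)
  simp at h3
  rw [h3]
  ring

theorem norm_sharp_le (B : Euc m →L[ℝ] Euc m →L[ℝ] ℝ) (v : Euc m) :
    ‖sharp B v‖ ≤ ‖B‖ * ‖v‖ := by
  have h1 : ‖sharp B v‖ * ‖sharp B v‖ ≤ ‖B‖ * ‖v‖ * ‖sharp B v‖ := by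
    rw [← real_inner_self_eq_norm_mul_norm, inner_sharp]
    exact (le_abs_self _).trans (B.le_opNorm₂ _ _)
  rcases eq_or_lt_of_le (norm_nonneg (sharp B v)) with h | h
  · rw [← h]; positivity
  · exact le_of_mul_le_mul_right h1 h

/-- The divergence contributes `-∂_ν P` and the trace `m ∂_ν P + ∂_ν N`. Every other term contains
`β` with a second factor `β`, `∂β` or `Ω`: the vertical part of the metric enters the divergence
along `ν` only through `β`. -/
theorem abs_fluxD_sub_le {Ω : Euc m → Euc m →L[ℝ] Euc m →L[ℝ] ℝ} {x : Euc m} (hx : x ≠ 0)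
    (hΩ : ∀ v w, Ω x v w = -Ω x w v) (hP : DifferentiableAt ℝ P x)
    (hN : DifferentiableAt ℝ N x) (hβ : DifferentiableAt ℝ β x) :
    |fluxD Ω (bundleCoeff P N β) x
      - (((m : ℝ) - 1) * fderiv ℝ P x (‖x‖⁻¹ • x) + fderiv ℝ N x (‖x‖⁻¹ • x))| ≤
      (4 * m + 1) * (‖fderiv ℝ N x‖ * (‖β x‖ * ‖β x‖) + ‖N x‖ * (‖β x‖ * ‖fderiv ℝ β x‖)
        + ‖N x‖ * (‖β x‖ * ‖Ω x‖)) := by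
  set ν : Euc m := ‖x‖⁻¹ • x with hν
  have hν1 : ‖ν‖ = 1 := by
    rw [hν, norm_smul, norm_inv, norm_norm, inv_mul_cancel₀ (norm_ne_zero_iff.2 hx)]
  have he1 : ∀ i : Fin m, ‖(EuclideanSpace.single i 1 : Euc m)‖ = 1 := fun i => by simp
  have hee : ∀ i : Fin m, inner ℝ (EuclideanSpace.single i 1 : Euc m)
      (EuclideanSpace.single i 1) = (1 : ℝ) := fun i => by simp
  have hΩ0 : ∀ v, Ω x v v = 0 := fun v => by linarith [hΩ v v]
  have hsum : ∑ i, fderiv ℝ P x (EuclideanSpace.single i 1) *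
      inner ℝ (EuclideanSpace.single i 1 : Euc m) ν = fderiv ℝ P x ν := by
    conv_rhs => rw [← (EuclideanSpace.basisFun (Fin m) ℝ).sum_repr ν]
    simp [EuclideanSpace.inner_single_left, mul_comm]
  set b := ‖β x‖
  set b' := ‖fderiv ℝ β x‖
  have hb : ∀ v : Euc m, ‖v‖ = 1 → |β x v| ≤ b := fun v hv => by
    simpa [hv] using (β x).le_opNorm v
  have hb' : ∀ v w : Euc m, ‖v‖ = 1 → ‖w‖ = 1 → |fderiv ℝ β x v w| ≤ b' := fun v w hv hw => by
    simpa [hv, hw] using (fderiv ℝ β x).le_opNorm₂ v w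
  have hn' : ∀ v : Euc m, ‖v‖ = 1 → |fderiv ℝ N x v| ≤ ‖fderiv ℝ N x‖ := fun v hv => by
    simpa [hv] using (fderiv ℝ N x).le_opNorm v
  have ho : ∀ v w : Euc m, ‖v‖ = 1 → ‖w‖ = 1 → |Ω x v w| ≤ ‖Ω x‖ := fun v w hv hw => by
    simpa [hv, hw] using (Ω x).le_opNorm₂ v w
  have hs : |β x (sharp (Ω x) ν)| ≤ b * ‖Ω x‖ := by
    refine ((β x).le_opNorm _).trans ?_
    have := norm_sharp_le (Ω x) ν
    rw [hν1, mul_one] at this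
    gcongr
  have key : fluxD Ω (bundleCoeff P N β) x
      - (((m : ℝ) - 1) * fderiv ℝ P x ν + fderiv ℝ N x ν) =
      (∑ i : Fin m, (-(fderiv ℝ N x (EuclideanSpace.single i 1) *
          (β x (EuclideanSpace.single i 1) * β x ν)
        + N x * (fderiv ℝ β x (EuclideanSpace.single i 1) (EuclideanSpace.single i 1) * β x ν
          + β x (EuclideanSpace.single i 1) * fderiv ℝ β x (EuclideanSpace.single i 1) ν))
        - N x * (β x (EuclideanSpace.single i 1) * (1 / 2 * Ω x (EuclideanSpace.single i 1) ν))
        + (fderiv ℝ N x ν * (β x (EuclideanSpace.single i 1) * β x (EuclideanSpace.single i 1))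
          + N x * (fderiv ℝ β x ν (EuclideanSpace.single i 1) * β x (EuclideanSpace.single i 1)
          + β x (EuclideanSpace.single i 1) * fderiv ℝ β x ν (EuclideanSpace.single i 1)))))
      + N x * (1 / 2 * β x (sharp (Ω x) ν)) := by
    have hcard : ∑ i : Fin m, fderiv ℝ P x ν = m * fderiv ℝ P x ν := by simp
    simp only [fluxD, covCoeff_apply, fderiv_bundleCoeff hP hN hβ, bundleCoeff_apply,
      connCoeff_apply, hvec, vvec, ← hν]
    simp only [hΩ0, map_zero, mul_zero, smul_zero, add_zero, zero_smul, zero_add, inner_zero_left,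
      zero_apply, mul_one, inner_zero_right, zero_mul, one_mul, map_smul, one_smul, smul_eq_mul,
      sub_zero, hee]
    simp only [Finset.sum_add_distrib, Finset.sum_sub_distrib, Finset.sum_neg_distrib, neg_mul,
      mul_neg, neg_add, hcard, hsum]
    ring
  rw [key]
  have hmul : ∀ {p q A B : ℝ}, |p| ≤ A → |q| ≤ B → |p * q| ≤ A * B := fun hp hq => by
    rw [abs_mul]
    exact mul_le_mul hp hq (abs_nonneg _) ((abs_nonneg _).trans hp)
  have hNN : |N x| ≤ ‖N x‖ := le_rfl
  have hb0 : 0 ≤ b := norm_nonneg _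
  have hb0' : 0 ≤ b' := norm_nonneg _
  set K := ‖fderiv ℝ N x‖ * (b * b) + ‖N x‖ * (b * b') + ‖N x‖ * (b * ‖Ω x‖) with hK
  have k1 : 0 ≤ ‖fderiv ℝ N x‖ * (b * b) := by positivity
  have k2 : 0 ≤ ‖N x‖ * (b * b') := by positivity
  have k3 : 0 ≤ ‖N x‖ * (b * ‖Ω x‖) := by positivity
  have hlast : |N x * (1 / 2 * β x (sharp (Ω x) ν))| ≤ K := by
    have h1 := hmul hNN (hmul (p := 1 / 2) (A := 1) (by rw [abs_le]; constructor <;> norm_num) hs)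
    linarith
  refine (abs_add_le _ _).trans ?_
  -- Each of the `m` summands contains `‖β‖ ‖∂β‖` four times and the other products less often,
  -- whence `4 K`; the last term, from the vertical direction, is at most `K`.
  have hle : ∀ {f : Fin m → ℝ}, (∀ i, |f i| ≤ 4 * K) →
      |∑ i, f i| + |N x * (1 / 2 * β x (sharp (Ω x) ν))| ≤ (4 * m + 1) * K := fun {f} hf => by
    have h1 := (Finset.abs_sum_le_sum_abs f Finset.univ).trans
      (Finset.sum_le_sum (g := fun _ => 4 * K) fun i _ => hf i)
    simp only [Finset.sum_const, Finset.card_univ, Fintype.card_fin, nsmul_eq_mul] at h1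
    linarith
  refine hle fun i => ?_
  have e := he1 i
  have t1 := hmul (hn' _ e) (hmul (hb _ e) (hb ν hν1))
  have t2 := hmul hNN (hmul (hb' _ _ e e) (hb ν hν1))
  have t3 := hmul hNN (hmul (hb _ e) (hb' _ _ e hν1))
  have t4 := hmul hNN (hmul (hb _ e) (ho _ _ e hν1))
  have t5 := hmul (hn' ν hν1) (hmul (hb _ e) (hb _ e))
  have t6 := hmul hNN (hmul (hb _ e) (hb' _ _ hν1 e))
  rw [mul_comm b' b] at t2
  rw [abs_le] at t1 t2 t3 t4 t5 t6 ⊢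
  constructor <;> linarith

theorem continuousOn_fluxD {Ω : Euc m → Euc m →L[ℝ] Euc m →L[ℝ] ℝ}
    {M : Euc m → Cyl m →L[ℝ] Cyl m →L[ℝ] ℝ} {R : ℝ} (hR : 0 ≤ R)
    (hΩ : ContDiffOn ℝ ∞ Ω {x | R < ‖x‖}) (hM : ContDiffOn ℝ ∞ M {x | R < ‖x‖}) :
    ContinuousOn (fluxD Ω M) {x | R < ‖x‖} ∧
      ContinuousOn (fun x => fderiv ℝ M x (‖x‖⁻¹ • x) (vvec m) (vvec m)) {x | R < ‖x‖} := by
  have hopen : IsOpen {x : Euc m | R < ‖x‖} := isOpen_lt continuous_const continuous_norm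
  have h1 : ContinuousOn (fderiv ℝ M) {x | R < ‖x‖} :=
    hM.continuousOn_fderiv_of_isOpen hopen (by simp)
  have h2 : ContinuousOn (covCoeff Ω M) {x | R < ‖x‖} :=
    (h1.clm_comp continuousOn_const).sub
      (((bilinAct (F := Cyl m)).continuous.comp_continuousOn hM.continuousOn).clm_apply
        ((connCoeffL m).continuous.comp_continuousOn hΩ.continuousOn))
  have h3 : ContinuousOn (fun x : Euc m => ‖x‖⁻¹ • x) {x | R < ‖x‖} :=
    (continuous_norm.continuousOn.inv₀ fun x hx => (hR.trans_lt hx).ne').smul continuousOn_id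
  have h4 : ContinuousOn (fun x : Euc m => ((‖x‖⁻¹ • x, 0) : Cyl m)) {x | R < ‖x‖} :=
    h3.prodMk continuousOn_const
  have h5 : ∀ c d : Cyl m, ContinuousOn (fun x => fderiv ℝ M x (‖x‖⁻¹ • x) c d) {x | R < ‖x‖} :=
    fun c d => ((h1.clm_apply h3).clm_apply continuousOn_const).clm_apply continuousOn_const
  have h6 : ∀ c d : Cyl m,
      ContinuousOn (fun x => covCoeff Ω M x c d (‖x‖⁻¹ • x, 0)) {x | R < ‖x‖} :=
    fun c d => ((h2.clm_apply continuousOn_const).clm_apply continuousOn_const).clm_apply h4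
  refine ⟨?_, h5 _ _⟩
  exact ((continuousOn_finsetSum _ fun i _ => h6 _ _).add (h6 _ _)).neg.add
    ((continuousOn_finsetSum _ fun i _ => h5 _ _).add (h5 _ _))

/-- The masses of a metric `P dx² + N (η + β)²`. -/
theorem mass_bundle (hm : 3 ≤ m) (hR : 0 ≤ X.R₀) (hX : IsCircleEnd X) (hη : IsConnection X η)
    {Ω : Euc m → Euc m →L[ℝ] Euc m →L[ℝ] ℝ} (hΩ : IsCurvature X η Ω)
    (hΩs : ContDiffOn ℝ ∞ Ω {x | X.R₀ < ‖x‖}) (hΩd : SymbolClass 1 (1 - (m : ℤ)) Ω)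
    {g : E → E → E → ℝ}
    (hg : ∀ z ∈ X.carrier, ∀ v w,
      g z v w = bundleCoeff P N β (X.proj z) (coframe X η z v) (coframe X η z w))
    (hPs : ContDiffOn ℝ ∞ P {x | X.R₀ < ‖x‖}) (hNs : ContDiffOn ℝ ∞ N {x | X.R₀ < ‖x‖})
    (hβs : ContDiffOn ℝ ∞ β {x | X.R₀ < ‖x‖})
    (hN : SymbolClass 1 (2 - (m : ℤ)) fun x => N x - 1)
    (hβ : SymbolClass 1 (2 - (m : ℤ)) β) {p n : ℝ}
    (hp : Tendsto (fun x => ‖x‖ ^ (m - 1) * fderiv ℝ P x (‖x‖⁻¹ • x)) (cobounded (Euc m)) (𝓝 p))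
    (hn : Tendsto (fun x => ‖x‖ ^ (m - 1) * fderiv ℝ N x (‖x‖⁻¹ • x)) (cobounded (Euc m)) (𝓝 n)) :
    massD X η g = ((-(((m : ℝ) - 1) * p + n) : ℝ) : EReal) ∧
      massGB X η g = ((-(((m : ℝ) - 1) * p + n / 2) : ℝ) : EReal) := by
  have hopen : IsOpen {x : Euc m | X.R₀ < ‖x‖} := isOpen_lt continuous_const continuous_norm
  have hMs := contDiffOn_bundleCoeff hPs hNs hβs
  have hdiff : ∀ {W : Type} [NormedAddCommGroup W] [NormedSpace ℝ W] {f : Euc m → W},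
      ContDiffOn ℝ ∞ f {x | X.R₀ < ‖x‖} → ∀ x, X.R₀ < ‖x‖ → DifferentiableAt ℝ f x :=
    fun hf x hx => (hf.contDiffAt (hopen.mem_nhds hx)).differentiableAt (by simp)
  have hN0 : SymbolClass 1 0 N := by
    refine ((hN.mono (by omega)).add (SymbolClass.const 1 (1 : ℝ))).congr
      (Eventually.of_forall fun x => by simp)
  have hN1 : fderiv ℝ N =O[cobounded (Euc m)] fun x => ‖x‖ ^ (1 - (m : ℤ)) := by
    have h := hN.fderiv_mem.isBigO
    rw [show 2 - (m : ℤ) - 1 = 1 - m by ring] at h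
    refine h.congr' (Eventually.of_forall fun x => ?_) EventuallyEq.rfl
    exact fderiv_sub_const _
  have hβ1 : fderiv ℝ β =O[cobounded (Euc m)] fun x => ‖x‖ ^ (1 - (m : ℤ)) := by
    have h := hβ.fderiv_mem.isBigO
    rwa [show 2 - (m : ℤ) - 1 = 1 - m by ring] at h
  have hpow : ∀ {p q : ℤ}, p ≤ q →
      (fun x : Euc m => ‖x‖ ^ p) =O[cobounded (Euc m)] fun x => ‖x‖ ^ q := by
    intro p q hpq
    refine IsBigO.of_bound 1 ((eventually_norm_gt 1).mono fun x hx => ?_)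
    rw [one_mul, norm_zpow, norm_zpow, norm_norm]
    exact zpow_le_zpow_right₀ hx.le hpq
  have hmulpow : ∀ p q : ℤ, (fun x : Euc m => ‖x‖ ^ p * ‖x‖ ^ q) =ᶠ[cobounded (Euc m)]
      fun x => ‖x‖ ^ (p + q) := fun p q =>
    (eventually_norm_gt 0).mono fun x hx => (zpow_add₀ hx.ne' p q).symm
  -- The error is `O(r^{3-2m})`; multiplied by `r^{m-1}` it is `O(r^{2-m})`, which tends to 0 since
  -- `m ≥ 3`.
  have herr : Tendsto (fun x => ‖x‖ ^ (m - 1) * (fluxD Ω (bundleCoeff P N β) x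
      - (((m : ℝ) - 1) * fderiv ℝ P x (‖x‖⁻¹ • x) + fderiv ℝ N x (‖x‖⁻¹ • x))))
      (cobounded (Euc m)) (𝓝 0) := by
    have e1 : (fun x => ‖fderiv ℝ N x‖ * (‖β x‖ * ‖β x‖)) =O[cobounded (Euc m)]
        fun x => ‖x‖ ^ (3 - 2 * (m : ℤ)) :=
      ((hN1.norm_left.mul ((hβ.isBigO.norm_left.mul hβ.isBigO.norm_left).trans_eventuallyEq
        (hmulpow _ _))).trans_eventuallyEq (hmulpow _ _)).trans (hpow (by omega))
    have e2 : (fun x => ‖N x‖ * (‖β x‖ * ‖fderiv ℝ β x‖)) =O[cobounded (Euc m)]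
        fun x => ‖x‖ ^ (3 - 2 * (m : ℤ)) :=
      ((hN0.isBigO.norm_left.mul ((hβ.isBigO.norm_left.mul hβ1.norm_left).trans_eventuallyEq
        (hmulpow _ _))).trans_eventuallyEq (hmulpow _ _)).trans (hpow (by omega))
    have e3 : (fun x => ‖N x‖ * (‖β x‖ * ‖Ω x‖)) =O[cobounded (Euc m)]
        fun x => ‖x‖ ^ (3 - 2 * (m : ℤ)) :=
      ((hN0.isBigO.norm_left.mul ((hβ.isBigO.norm_left.mul
        hΩd.isBigO.norm_left).trans_eventuallyEq
        (hmulpow _ _))).trans_eventuallyEq (hmulpow _ _)).trans (hpow (by omega))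
    have e4 : (fun x => fluxD Ω (bundleCoeff P N β) x
        - (((m : ℝ) - 1) * fderiv ℝ P x (‖x‖⁻¹ • x) + fderiv ℝ N x (‖x‖⁻¹ • x)))
        =O[cobounded (Euc m)] fun x => ‖x‖ ^ (3 - 2 * (m : ℤ)) := by
      refine IsBigO.trans ?_ (((e1.add e2).add e3).const_mul_left (4 * (m : ℝ) + 1))
      refine IsBigO.of_bound 1 ((eventually_norm_gt X.R₀).mono fun x hx => ?_)
      rw [one_mul]
      refine (abs_fluxD_sub_le (norm_pos_iff.1 (hR.trans_lt hx)) (hΩ.antisymm hX hx)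
        (hdiff hPs x hx) (hdiff hNs x hx) (hdiff hβs x hx)).trans (le_abs_self _)
    have e5 : (fun x : Euc m => ‖x‖ ^ (m - 1)) =O[cobounded (Euc m)]
        fun x => ‖x‖ ^ ((m : ℤ) - 1) := by
      refine IsBigO.of_bound 1 (Eventually.of_forall fun x => ?_)
      rw [one_mul, ← zpow_natCast, Nat.cast_sub (by omega), Nat.cast_one]
    refine ((e5.mul e4).trans_eventuallyEq (hmulpow _ _)).trans_tendsto ?_
    exact (tendsto_zpow_atTop_zero (by omega) (𝕜 := ℝ)).comp tendsto_norm_cobounded_atTop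
  have hlimD : Tendsto (fun x => ‖x‖ ^ (m - 1) * fluxD Ω (bundleCoeff P N β) x)
      (cobounded (Euc m)) (𝓝 (((m : ℝ) - 1) * p + n)) := by
    have h := herr.add ((hp.const_mul ((m : ℝ) - 1)).add hn)
    rw [zero_add] at h
    exact h.congr fun x => by ring
  obtain ⟨hc1, hc2⟩ := continuousOn_fluxD hR hΩs hMs
  have hD := tendsto_flux hX (fun z hz => formD_normal hX hη hΩ hg hMs hz) hc1 hlimD
  -- Since `g(T, T) = N`, the correction term subtracts exactly half of `∂_ν N`.
  have hlimGB : Tendsto (fun x => ‖x‖ ^ (m - 1) * (fluxD Ω (bundleCoeff P N β) x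
      - (1 / 2) * fderiv ℝ (bundleCoeff P N β) x (‖x‖⁻¹ • x) (vvec m) (vvec m)))
      (cobounded (Euc m)) (𝓝 (((m : ℝ) - 1) * p + n / 2)) := by
    have h := hlimD.sub (hn.const_mul (1 / 2))
    rw [show ((m : ℝ) - 1) * p + n - 1 / 2 * n = ((m : ℝ) - 1) * p + n / 2 by ring] at h
    refine h.congr' ((eventually_norm_gt X.R₀).mono fun x hx => ?_)
    beta_reduce
    rw [fderiv_bundleCoeff (hdiff hPs x hx) (hdiff hNs x hx) (hdiff hβs x hx)]
    simp [vvec]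
    ring
  have hGB := tendsto_flux hX (fun z hz => formGB_normal hX hη hΩ hg hMs hz)
    (hc1.sub (continuousOn_const.mul hc2)) hlimGB
  exact ⟨mass_of_tendsto (by omega) hX.L_pos hD, mass_of_tendsto (by omega) hX.L_pos hGB⟩

end Bundle

open Bornology Asymptotics

/-! ### Static radial metrics on the trivial fibration -/

section Trivial

variable {m : ℕ} {R₀ L : ℝ}

theorem hasFDerivAt_norm {F : Type*} [NormedAddCommGroup F] [InnerProductSpace ℝ F] {x : F}
    (hx : x ≠ 0) : HasFDerivAt (fun y : F => ‖y‖) (‖x‖⁻¹ • innerSL ℝ x) x := by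
  have h1 : HasFDerivAt (fun y : F => Real.sqrt (‖y‖ ^ 2)) _ x :=
    (hasStrictFDerivAt_norm_sq x).hasFDerivAt.sqrt (by simpa using hx)
  have h2 : (fun y : F => Real.sqrt (‖y‖ ^ 2)) = fun y => ‖y‖ :=
    funext fun y => Real.sqrt_sq (norm_nonneg y)
  rw [h2] at h1
  convert h1 using 1
  ext v
  rw [Real.sqrt_sq (norm_nonneg x)]
  simp
  field_simp

theorem hasFDerivAt_radial {F : Type*} [NormedAddCommGroup F] [InnerProductSpace ℝ F] {x : F}
    (hx : x ≠ 0) {q : ℝ → ℝ} {q' : ℝ} (hq : HasDerivAt q q' ‖x‖) :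
    HasFDerivAt (fun y : F => q ‖y‖) (q' • (‖x‖⁻¹ • innerSL ℝ x)) x :=
  hq.comp_hasFDerivAt x (hasFDerivAt_norm hx)

theorem fderiv_radial_normal {F : Type*} [NormedAddCommGroup F] [InnerProductSpace ℝ F] {x : F}
    (hx : x ≠ 0) {q : ℝ → ℝ} {q' : ℝ} (hq : HasDerivAt q q' ‖x‖) :
    fderiv ℝ (fun y : F => q ‖y‖) x (‖x‖⁻¹ • x) = q' := by
  rw [(hasFDerivAt_radial hx hq).fderiv]
  have : ‖x‖ ≠ 0 := norm_ne_zero_iff.2 hx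
  simp
  field_simp

theorem fderiv_trivialEnd_proj (z : Cyl m) :
    fderiv ℝ (trivialEnd m R₀ L).proj z = ContinuousLinearMap.fst ℝ (Euc m) ℝ :=
  (ContinuousLinearMap.fst ℝ (Euc m) ℝ).fderiv

theorem isCircleEnd_trivialEnd (hL : 0 < L) : IsCircleEnd (trivialEnd m R₀ L) where
  L_pos := hL
  dim := by simp
  isOpen := isOpen_lt continuous_const (continuous_norm.comp continuous_fst)
  proj_smooth := contDiff_fst.contDiffOn
  proj_image := by
    ext x
    constructor
    · rintro ⟨z, hz, rfl⟩; exact hz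
    · intro hx; exact ⟨(x, 0), hx, rfl⟩
  proj_submersion z _ := by
    rw [fderiv_trivialEnd_proj]
    exact fun x => ⟨(x, 0), rfl⟩
  flow_smooth := by
    refine ContDiff.contDiffOn ?_
    change ContDiff ℝ ∞ fun p : ℝ × Cyl m => ((p.2.1, p.2.2 + p.1) : Cyl m)
    fun_prop
  flow_mem _ _ hz := hz
  flow_zero z _ := by simp [trivialEnd]
  flow_add s t z _ := by
    simp only [trivialEnd]
    rw [add_assoc, add_comm s t]
  fibre z _ z' _ := by
    constructor
    · intro h
      exact ⟨z'.2 - z.2, Prod.ext h.symm (by simp [trivialEnd])⟩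
    · rintro ⟨t, rfl⟩; rfl
  free t z _ h := by
    refine ⟨0, ?_⟩
    have := congrArg Prod.snd h
    simpa [trivialEnd] using this

theorem vert_trivialEnd (z : Cyl m) : vert (trivialEnd m R₀ L) z = (0, 1) := by
  have h : HasDerivAt (fun t : ℝ => ((z.1, z.2 + t) : Cyl m)) (0, 1) 0 :=
    (hasDerivAt_const _ _).prodMk ((hasDerivAt_id _).const_add _)
  exact h.deriv

theorem isConnection_dtForm : IsConnection (trivialEnd m R₀ L) (dtForm m) where
  smooth := contDiff_const.contDiffOn
  eta_vert z _ := by rw [vert_trivialEnd]; rfl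
  invariant t z _ v := by
    have h : HasFDerivAt (fun z : Cyl m => ((z.1, z.2 + t) : Cyl m))
        (ContinuousLinearMap.id ℝ (Cyl m)) z := by
      have := (hasFDerivAt_id (𝕜 := ℝ) z).add_const ((0, t) : Cyl m)
      refine this.congr_of_eventuallyEq (Eventually.of_forall fun y => ?_)
      exact Prod.ext (by simp) rfl
    have h' : fderiv ℝ ((trivialEnd m R₀ L).flow t) z = ContinuousLinearMap.id ℝ (Cyl m) :=
      h.fderiv
    rw [h']
    rfl

theorem coframe_trivialEnd (z v : Cyl m) : coframe (trivialEnd m R₀ L) (dtForm m) z v = v := by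
  rw [coframe_apply, fderiv_trivialEnd_proj]
  rfl

theorem isCurvature_dtForm : IsCurvature (trivialEnd m R₀ L) (dtForm m) 0 := by
  intro z _ v w
  have h : fderiv ℝ (dtForm m) z = 0 := fderiv_const_apply _
  simp [extd, h]

end Trivial

/-! ### Metrics whose coefficients are smooth functions of `|x|^{-k}`. -/

section Radial

variable {k : ℕ}

theorem symbolClass_inv_norm_pow (n k m : ℕ) :
    SymbolClass n (-(k : ℤ)) fun x : Euc m => (‖x‖ ^ k)⁻¹ := by
  refine SymbolClass.of_homogeneous n (fun x hx => ?_) fun c x hc hx => ?_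
  · exact ((contDiffAt_norm ℝ hx).pow k).inv (by simpa using fun h => absurd h hx)
  · rw [norm_smul, Real.norm_of_nonneg hc.le, mul_pow, mul_inv, zpow_neg, zpow_natCast,
      smul_eq_mul]

theorem tendsto_inv_norm_pow (hk : 1 ≤ k) (m : ℕ) :
    Tendsto (fun x : Euc m => (‖x‖ ^ k)⁻¹) (cobounded (Euc m)) (𝓝 0) :=
  (symbolClass_inv_norm_pow 0 k m).tendsto_zero (by omega)

theorem symbolClass_radial (n : ℕ) {m : ℕ} (hk : 1 ≤ k) {p : ℝ → ℝ}
    (hp : ∀ᶠ y in 𝓝 0, ContDiffAt ℝ ∞ p y) (hp0 : p 0 = 1) :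
    SymbolClass n (-(k : ℤ)) fun x : Euc m => p ((‖x‖ ^ k)⁻¹) - 1 :=
  (symbolClass_inv_norm_pow n k m).comp_smooth_of_zero (by omega)
    (P := fun y => p y - 1) (hp.mono fun y hy => hy.sub contDiffAt_const) (by simp [hp0])

/-- The radial derivative of `‖x‖^{-k}` is `-k ‖x‖^{-k-1}`, so the weight `‖x‖^{k+1}` cancels
exactly and `-k p'(‖x‖^{-k})` remains. In ℝ^{k+2} this weight is the growth of the area of spheres.
-/
theorem tendsto_fderiv_radial {m : ℕ} (hk : 1 ≤ k) {p : ℝ → ℝ}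
    (hp : ∀ᶠ y in 𝓝 0, ContDiffAt ℝ ∞ p y) :
    Tendsto (fun x : Euc m => ‖x‖ ^ (k + 1) *
      fderiv ℝ (fun x : Euc m => p ((‖x‖ ^ k)⁻¹)) x (‖x‖⁻¹ • x)) (cobounded (Euc m))
      (𝓝 (-k * deriv p 0)) := by
  have hw := tendsto_inv_norm_pow hk m
  have h1 : Tendsto (fun x : Euc m => -k * deriv p ((‖x‖ ^ k)⁻¹)) (cobounded (Euc m))
      (𝓝 (-k * deriv p 0)) :=
    (((eventually_contDiffAt_deriv hp).self_of_nhds.continuousAt.tendsto).comp hw).const_mul _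
  refine h1.congr' ?_
  filter_upwards [hw.eventually hp, eventually_norm_gt 0] with x h2 h3
  have h4 : HasDerivAt (fun u : ℝ => p ((u ^ k)⁻¹))
      (deriv p ((‖x‖ ^ k)⁻¹) * (-(k * ‖x‖ ^ (k - 1)) / (‖x‖ ^ k) ^ 2)) ‖x‖ :=
    (h2.differentiableAt (by simp)).hasDerivAt.comp (h := fun u : ℝ => (u ^ k)⁻¹) _
      ((hasDerivAt_pow k ‖x‖).inv (pow_pos h3 k).ne')
  rw [fderiv_radial_normal (norm_pos_iff.1 h3) h4]
  obtain ⟨j, rfl⟩ : ∃ j, k = j + 1 := ⟨k - 1, by omega⟩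
  simp only [Nat.add_sub_cancel]
  generalize deriv p (‖x‖ ^ (j + 1))⁻¹ = a
  field_simp
  ring

/-- Asymptotics and masses of the metric `p(|x|^{-k}) dx² + n(|x|^{-k}) dt²` in dimension
`k + 3`. -/
theorem static_radial (hk : 1 ≤ k) {R₀ L : ℝ} (hR : 0 < R₀) (hL : 0 < L) {p n : ℝ → ℝ}
    (hp : ∀ᶠ y in 𝓝 0, ContDiffAt ℝ ∞ p y) (hn : ∀ᶠ y in 𝓝 0, ContDiffAt ℝ ∞ n y)
    (hp0 : p 0 = 1) (hn0 : n 0 = 1)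
    (hps : ∀ u, R₀ < u → ContDiffAt ℝ ∞ p ((u ^ k)⁻¹))
    (hns : ∀ u, R₀ < u → ContDiffAt ℝ ∞ n ((u ^ k)⁻¹))
    (hpp : ∀ u, R₀ < u → 0 < p ((u ^ k)⁻¹)) (hnp : ∀ u, R₀ < u → 0 < n ((u ^ k)⁻¹))
    {g : Cyl (k + 2) → Cyl (k + 2) → Cyl (k + 2) → ℝ}
    (hg : ∀ z : Cyl (k + 2), R₀ < ‖z.1‖ → ∀ v w, g z v w =
      p ((‖z.1‖ ^ k)⁻¹) * inner ℝ v.1 w.1 + n ((‖z.1‖ ^ k)⁻¹) * (v.2 * w.2)) :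
    IsALF (trivialEnd (k + 2) R₀ L) (dtForm (k + 2)) g ∧
    massD (trivialEnd (k + 2) R₀ L) (dtForm (k + 2)) g
      = ((k * ((k + 1) * deriv p 0 + deriv n 0) : ℝ) : EReal) ∧
    massGB (trivialEnd (k + 2) R₀ L) (dtForm (k + 2)) g
      = ((k * ((k + 1) * deriv p 0 + deriv n 0 / 2) : ℝ) : EReal) := by
  have hX := isCircleEnd_trivialEnd (m := k + 2) (R₀ := R₀) hL
  have hη := isConnection_dtForm (m := k + 2) (R₀ := R₀) (L := L)
  have hΩ := isCurvature_dtForm (m := k + 2) (R₀ := R₀) (L := L)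
  have hsm : ∀ {f : ℝ → ℝ}, (∀ u, R₀ < u → ContDiffAt ℝ ∞ f ((u ^ k)⁻¹)) →
      ContDiffOn ℝ ∞ (fun x : Euc (k + 2) => f ((‖x‖ ^ k)⁻¹)) {x | R₀ < ‖x‖} := by
    intro f hf x hx
    have hx0 : x ≠ 0 := norm_pos_iff.1 (hR.trans hx)
    refine ContDiffAt.contDiffWithinAt ?_
    exact (hf _ hx).comp x (((contDiffAt_norm ℝ hx0).pow k).inv
      (by simpa using fun h => absurd h hx0))
  have hg' : ∀ z ∈ (trivialEnd (k + 2) R₀ L).carrier, ∀ v w, g z v w =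
      bundleCoeff (fun x => p ((‖x‖ ^ k)⁻¹)) (fun x => n ((‖x‖ ^ k)⁻¹)) 0
        ((trivialEnd (k + 2) R₀ L).proj z) (coframe (trivialEnd (k + 2) R₀ L) (dtForm (k + 2)) z v)
        (coframe (trivialEnd (k + 2) R₀ L) (dtForm (k + 2)) z w) := by
    intro z hz v w
    rw [hg z hz, bundleCoeff_apply, coframe_trivialEnd, coframe_trivialEnd]
    simp [trivialEnd]
  have he : (2 - ((k + 2 : ℕ) : ℤ)) = -(k : ℤ) := by push_cast; ring
  have hz : ∀ n q, SymbolClass n q (0 : Euc (k + 2) → Euc (k + 2) →L[ℝ] ℝ) :=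
    fun n q => SymbolClass.zero n q
  have hzΩ : ∀ n q, SymbolClass n q (0 : Euc (k + 2) → Euc (k + 2) →L[ℝ] Euc (k + 2) →L[ℝ] ℝ) :=
    fun n q => SymbolClass.zero n q
  refine ⟨?_, ?_⟩
  · refine isALF_bundle (by omega) hX hη hΩ contDiff_const.contDiffOn (hzΩ _ _) hg'
      (hsm hps) (hsm hns) contDiff_const.contDiffOn (fun x hx => hpp _ hx) (fun x hx => hnp _ hx)
      ?_ ?_ (hz _ _)
    · rw [he]; exact symbolClass_radial 2 hk hp hp0
    · rw [he]; exact symbolClass_radial 2 hk hn hn0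
  · obtain ⟨h1, h2⟩ := mass_bundle (by omega) hR.le hX hη hΩ contDiff_const.contDiffOn (hzΩ _ _) hg'
      (hsm hps) (hsm hns) contDiff_const.contDiffOn
      (by rw [he]; exact symbolClass_radial 1 hk hn hn0) (hz _ _)
      (tendsto_fderiv_radial hk hp) (tendsto_fderiv_radial hk hn)
    rw [h1, h2]
    constructor <;> refine congrArg Real.toEReal ?_ <;> push_cast <;> ring

end Radial

/-! ### Isotropic coordinates -/

/-- `r` is an isotropic radial coordinate for the profile equation `G' = √(V(G))`,
`G(0) = G₀`: the metric `dr²/V + r² dω²` is `(r/u)² (du² + u² dω²)`. -/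
structure IsIsotropic (V : ℝ → ℝ) (G₀ u₀ : ℝ) (r : ℝ → ℝ) : Prop where
  u₀_pos : 0 < u₀
  init : r u₀ = G₀
  smooth : ∀ u, u₀ ≤ u → ContDiffAt ℝ ∞ r u
  pos : ∀ u, u₀ ≤ u → 0 < r u
  V_pos : ∀ u, u₀ < u → 0 < V (r u)
  hasDerivAt : ∀ u, u₀ ≤ u → HasDerivAt r (r u / u * Real.sqrt (V (r u))) u
  tendsto : Tendsto r atTop atTop

/-- A continuous strictly increasing function from `[a, ∞)` onto `[b, ∞)`, extended by a
translation to an order isomorphism of the line. -/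
theorem exists_orderIso_extension {f : ℝ → ℝ} {a : ℝ} (hc : ContinuousOn f (Ici a))
    (hm : StrictMonoOn f (Ici a)) (ht : Tendsto f atTop atTop) :
    ∃ e : ℝ ≃o ℝ, ∀ x, a ≤ x → e x = f x := by
  set h : ℝ → ℝ := fun x => f (max x a) + min (x - a) 0 with hh
  have hcont : Continuous h := by
    refine Continuous.add ?_ (by fun_prop)
    exact hc.comp_continuous (by fun_prop) fun x => le_max_right x a
  have hmono : StrictMono h := by
    intro x y hxy
    simp only [hh]
    rcases lt_or_ge x a with hx | hx
    · have h1 : f (max x a) ≤ f (max y a) :=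
        hm.monotoneOn (le_max_right x a) (le_max_right y a) (max_le_max_right a hxy.le)
      have h2 : min (x - a) 0 < min (y - a) 0 := by
        rw [min_eq_left (by linarith)]
        exact lt_min (by linarith) (by linarith)
      linarith
    · have h1 : f (max x a) < f (max y a) := by
        rw [max_eq_left hx, max_eq_left (hx.trans hxy.le)]
        exact hm hx (hx.trans hxy.le) hxy
      rw [min_eq_right (by linarith), min_eq_right (by linarith)]
      linarith
  have htop : Tendsto h atTop atTop := by
    refine ht.congr' ((eventually_ge_atTop a).mono fun x hx => ?_)
    simp only [hh]
    rw [max_eq_left hx, min_eq_right (by linarith), add_zero]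
  have hbot : Tendsto h atBot atBot := by
    have : Tendsto (fun x : ℝ => f a + (x - a)) atBot atBot :=
      tendsto_atBot_add_const_left _ _ (tendsto_atBot_add_const_right _ (-a) tendsto_id)
    refine this.congr' ((eventually_le_atBot a).mono fun x hx => ?_)
    simp only [hh]
    rw [max_eq_right hx, min_eq_left (by linarith)]
  refine ⟨hmono.orderIsoOfSurjective h (hcont.surjective htop hbot), fun x hx => ?_⟩
  change h x = f x
  simp only [hh]
  rw [max_eq_left hx, min_eq_right (by linarith), add_zero]

theorem hasDerivAt_orderIso_symm {e : ℝ ≃o ℝ} {x f' : ℝ} (h : HasDerivAt e f' x) (h0 : f' ≠ 0) :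
    HasDerivAt e.symm f'⁻¹ (e x) := by
  refine HasDerivAt.of_local_left_inverse (f := e) e.symm.continuous.continuousAt ?_ h0
    (Eventually.of_forall fun y => e.apply_symm_apply y)
  rwa [e.symm_apply_apply]

namespace IsIsotropic

variable {V : ℝ → ℝ} {G₀ u₀ : ℝ} {r : ℝ → ℝ}

theorem strictMonoOn (h : IsIsotropic V G₀ u₀ r) : StrictMonoOn r (Ici u₀) := by
  refine strictMonoOn_of_deriv_pos (convex_Ici _)
    (fun u hu => (h.hasDerivAt u hu).continuousAt.continuousWithinAt) fun u hu => ?_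
  rw [interior_Ici] at hu
  have hu' : u₀ < u := hu
  rw [(h.hasDerivAt u hu'.le).deriv]
  exact mul_pos (div_pos (h.pos u hu'.le) (h.u₀_pos.trans hu')) (Real.sqrt_pos.2 (h.V_pos u hu'))

/-- The distance `ρ = ∫ (r/u) du` to the locus `u = u₀`, as a function of `u`, extended to an
order isomorphism of the line. -/
theorem exists_radial (h : IsIsotropic V G₀ u₀ r) : ∃ e : ℝ ≃o ℝ, e u₀ = 0 ∧
    (∀ u, u₀ ≤ u → HasDerivAt e (r u / u) u) := by
  have hcont : ContinuousOn (fun u => r u / u) (Ici u₀) := fun u hu =>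
    ((h.hasDerivAt u hu).continuousAt.div continuousAt_id
      (h.u₀_pos.trans_le hu).ne').continuousWithinAt
  -- Freezing the integrand at its value at `u₀` keeps it continuous and positive on the whole line,
  -- so that its primitive is a bijection of ℝ.
  set φ : ℝ → ℝ := fun u => r (max u u₀) / max u u₀ with hφ
  have hφc : Continuous φ :=
    hcont.comp_continuous (f := fun u => max u u₀) (by fun_prop) fun x => le_max_right x u₀
  have hφpos : ∀ u, 0 < φ u := fun u =>
    div_pos (h.pos _ (le_max_right _ _)) (h.u₀_pos.trans_le (le_max_right _ _))
  have hder : ∀ u, HasDerivAt (fun u => ∫ s in u₀..u, φ s) (φ u) u := fun u =>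
    intervalIntegral.integral_hasDerivAt_right (hφc.intervalIntegrable _ _)
      (hφc.stronglyMeasurableAtFilter _ _) hφc.continuousAt
  have hmono : StrictMono fun u => ∫ s in u₀..u, φ s :=
    strictMono_of_deriv_pos fun u => by rw [(hder u).deriv]; exact hφpos u
  have htop : Tendsto (fun u => ∫ s in u₀..u, φ s) atTop atTop := by
    -- Since `r ≥ G₀`, the arc length dominates `G₀ log(u/u₀)` and is therefore unbounded.
    have hlog : Tendsto (fun u => G₀ * (Real.log u - Real.log u₀)) atTop atTop :=
      (tendsto_atTop_add_const_right _ (-Real.log u₀) Real.tendsto_log_atTop).const_mul_atTop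
        (by rw [← h.init]; exact h.pos _ le_rfl)
    refine tendsto_atTop_mono' _ ((eventually_ge_atTop u₀).mono fun u hu => ?_) hlog
    have hd : ∀ s, u₀ ≤ s → HasDerivAt (fun u => (∫ s in u₀..u, φ s)
        - G₀ * (Real.log u - Real.log u₀)) (φ s - G₀ * s⁻¹) s := fun s hs =>
      (hder s).sub (((Real.hasDerivAt_log (h.u₀_pos.trans_le hs).ne').sub_const _).const_mul _)
    have hmon : MonotoneOn (fun u => (∫ s in u₀..u, φ s)
        - G₀ * (Real.log u - Real.log u₀)) (Ici u₀) := by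
      refine monotoneOn_of_deriv_nonneg (convex_Ici _)
        (fun s hs => (hd s hs).continuousAt.continuousWithinAt)
        (fun s hs => ?_) fun s hs => ?_
      · exact (hd s (interior_subset hs)).differentiableAt.differentiableWithinAt
      · have hs' : u₀ ≤ s := interior_subset hs
        rw [(hd s hs').deriv, hφ]
        simp only
        rw [max_eq_left hs', ← h.init, div_eq_mul_inv, ← sub_mul]
        refine mul_nonneg (sub_nonneg.2 (h.strictMonoOn.monotoneOn self_mem_Ici hs' hs'))
          (inv_nonneg.2 (h.u₀_pos.le.trans hs'))
    have := hmon self_mem_Ici hu hu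
    simp only [intervalIntegral.integral_same, sub_self, mul_zero] at this
    linarith
  have hbot : Tendsto (fun u => ∫ s in u₀..u, φ s) atBot atBot := by
    have h1 : Tendsto (fun u : ℝ => φ u₀ * (u - u₀)) atBot atBot :=
      (tendsto_atBot_add_const_right _ (-u₀) tendsto_id).const_mul_atBot (hφpos u₀)
    refine h1.congr' ((eventually_le_atBot u₀).mono fun u hu => ?_)
    have h2 : ∫ s in u₀..u, φ s = ∫ _ in u₀..u, φ u₀ := by
      refine intervalIntegral.integral_congr fun s hs => ?_
      rw [uIcc_of_ge hu] at hs
      simp only [hφ, max_eq_right hs.2, max_self]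
    beta_reduce
    rw [h2, intervalIntegral.integral_const, smul_eq_mul, mul_comm]
  refine ⟨hmono.orderIsoOfSurjective _ ((continuous_iff_continuousAt.2 fun u =>
    (hder u).continuousAt).surjective htop hbot), intervalIntegral.integral_same, fun u hu => ?_⟩
  have h1 := hder u
  simp only [hφ, max_eq_left hu] at h1
  exact h1

theorem contDiffAt_radial (h : IsIsotropic V G₀ u₀ r) {e : ℝ ≃o ℝ}
    (he : ∀ u, u₀ ≤ u → HasDerivAt e (r u / u) u) {u : ℝ} (hu : u₀ < u) :
    ContDiffAt ℝ ∞ e u := by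
  have h1 : ContDiffOn ℝ ∞ e (Ioi u₀) := by
    rw [contDiffOn_infty_iff_deriv_of_isOpen isOpen_Ioi]
    refine ⟨fun s hs => (he s (le_of_lt hs)).differentiableAt.differentiableWithinAt, ?_⟩
    refine ContDiffOn.congr (f := fun s => r s / s) (fun s hs => ?_) fun s hs => (he s (le_of_lt hs)).deriv
    exact ((h.smooth s (le_of_lt hs)).div contDiffAt_id
      (h.u₀_pos.trans hs).ne').contDiffWithinAt
  exact h1.contDiffAt (Ioi_mem_nhds hu)

theorem le_symm {u₀ ρ : ℝ} {e : ℝ ≃o ℝ} (he0 : e u₀ = 0) (hρ : 0 ≤ ρ) : u₀ ≤ e.symm ρ := by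
  rw [← he0] at hρ
  exact e.le_symm_apply.2 hρ

/-- With `dr/du = (r/u) √V` and `du/dρ = u/r`, the chain rule gives `dr/dρ = √V`. -/
theorem isProfile (h : IsIsotropic V G₀ u₀ r) {e : ℝ ≃o ℝ} (he0 : e u₀ = 0)
    (he : ∀ u, u₀ ≤ u → HasDerivAt e (r u / u) u) :
    IsProfile V G₀ (fun ρ => r (e.symm ρ)) where
  init := by rw [← he0, e.symm_apply_apply, h.init]
  mono := fun x hx y hy hxy => h.strictMonoOn (le_symm he0 hx) (le_symm he0 hy)
    (e.symm.strictMono hxy)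
  ode := fun ρ hρ => by
    have hu := le_symm he0 hρ
    have hu0 := h.u₀_pos.trans_le hu
    have hr := h.pos _ hu
    have h1 := hasDerivAt_orderIso_symm (he _ hu) (div_pos hr hu0).ne'
    rw [e.apply_symm_apply] at h1
    have h2 := (h.hasDerivAt _ hu).comp ρ h1
    refine HasDerivAt.hasDerivWithinAt ?_
    refine h2.congr_deriv ?_
    field_simp

/-- The profile equation determines `G`. -/
theorem profile_eq (h : IsIsotropic V G₀ u₀ r) {e : ℝ ≃o ℝ} (he0 : e u₀ = 0)
    (he : ∀ u, u₀ ≤ u → HasDerivAt e (r u / u) u) {G : ℝ → ℝ} (hG : IsProfile V G₀ G)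
    {ρ : ℝ} (hρ : 0 ≤ ρ) : G ρ = r (e.symm ρ) := by
  obtain ⟨q, hq⟩ := exists_orderIso_extension
    (fun u hu => (h.hasDerivAt u hu).continuousAt.continuousWithinAt) h.strictMonoOn h.tendsto
  have hq0 : q.symm G₀ = u₀ := by rw [← h.init, ← hq _ le_rfl, q.symm_apply_apply]
  have hGc : ContinuousOn G (Ici 0) := fun ρ hρ => (hG.ode ρ hρ).continuousWithinAt
  -- The right-hand side `√V` need not be Lipschitz at `G₀`, so the usual uniqueness theorem does
  -- not apply at the initial point. Strict monotonicity of `G` gives `G > G₀` for `ρ > 0`; there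
  -- the arc length corresponding to `G ρ` has derivative 1, and continuity at 0 fixes the constant.
  have key : ∀ ρ, 0 ≤ ρ → e (q.symm (G ρ)) = ρ := by
    have hd : ∀ s, 0 < s → HasDerivAt (fun ρ => e (q.symm (G ρ)) - ρ) 0 s := by
      intro s hs
      have hGs : G₀ < G s := by
        rw [← hG.init]; exact hG.mono self_mem_Ici hs.le hs
      have hu : u₀ < q.symm (G s) := by rw [← hq0]; exact q.symm.strictMono hGs
      set u := q.symm (G s) with hudef
      have hqu : q u = G s := q.apply_symm_apply _
      have hru : r u = G s := by rw [← hq u hu.le, hqu]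
      have hpos := h.pos u hu.le
      have hu0 := h.u₀_pos.trans hu
      have hVp := Real.sqrt_pos.2 (h.V_pos u hu)
      have h1 : HasDerivAt q (r u / u * Real.sqrt (V (r u))) u :=
        (h.hasDerivAt u hu.le).congr_of_eventuallyEq
          ((eventually_gt_nhds hu).mono fun s hs => hq s hs.le)
      have h2 := hasDerivAt_orderIso_symm h1 (mul_pos (div_pos hpos hu0) hVp).ne'
      rw [hqu] at h2
      have h3 : HasDerivAt G (Real.sqrt (V (G s))) s :=
        (hG.ode s hs.le).hasDerivAt (Ici_mem_nhds hs)
      have h4 := ((he u hu.le).comp s (h2.comp s h3)).sub (hasDerivAt_id s)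
      refine h4.congr_deriv ?_
      rw [hru] at hpos hVp ⊢
      field_simp
      simp
    have hc : ContinuousOn (fun ρ => e (q.symm (G ρ)) - ρ) (Ici 0) :=
      ((e.continuous.comp q.symm.continuous).comp_continuousOn hGc).sub continuousOn_id
    intro ρ hρ
    have h6 : (fun ρ => e (q.symm (G ρ)) - ρ) ρ = (fun ρ => e (q.symm (G ρ)) - ρ) 0 := by
      rcases eq_or_lt_of_le hρ with h0 | h0
      · rw [← h0]
      · obtain ⟨s, hs, hs'⟩ := exists_hasDerivAt_eq_slope (fun ρ => e (q.symm (G ρ)) - ρ)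
          (fun _ => 0) h0 (hc.mono Icc_subset_Ici_self) fun s hs => hd s hs.1
        have := (eq_div_iff (by linarith)).1 hs'
        linarith
    simp only [hG.init, hq0, he0, sub_zero] at h6
    linarith
  have hu : u₀ ≤ q.symm (G ρ) := by
    rw [← hq0, q.symm.le_iff_le, ← hG.init]
    exact hG.mono.monotoneOn self_mem_Ici hρ hρ
  conv_rhs => rw [← key ρ hρ]
  rw [e.symm_apply_apply, ← hq _ hu, q.apply_symm_apply]

theorem invFunOn_profile (h : IsIsotropic V G₀ u₀ r) {e : ℝ ≃o ℝ} (he0 : e u₀ = 0)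
    (he : ∀ u, u₀ ≤ u → HasDerivAt e (r u / u) u) {G : ℝ → ℝ} (hG : IsProfile V G₀ G)
    {u : ℝ} (hu : u₀ ≤ u) : Function.invFunOn G (Ici 0) (r u) = e u := by
  have h0 : 0 ≤ e u := by rw [← he0]; exact e.monotone hu
  have h1 : G (e u) = r u := by rw [h.profile_eq he0 he hG h0, e.symm_apply_apply]
  have h2 : ∃ a ∈ Ici (0 : ℝ), G a = r u := ⟨e u, h0, h1⟩
  exact hG.mono.injOn (Function.invFunOn_mem h2) h0 ((Function.invFunOn_eq h2).trans h1.symm)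

end IsIsotropic

/-! ### Oriented frames of `ℝ² × 𝕊^{m-1}` -/

section Frames

variable {m : ℕ}

/-- The frame at `(y, e)` that maps `e` to `a`, `∂_t` to `b` and is `μ` times the identity on the
orthogonal complement of `e`. -/
def frameMap (e : Euc m) (a b : Euc 2) (μ : ℝ) : Cyl m →L[ℝ] Amb m :=
  ((((innerSL ℝ e).comp (ContinuousLinearMap.fst ℝ (Euc m) ℝ)).smulRight a
    + (ContinuousLinearMap.snd ℝ (Euc m) ℝ).smulRight b).prod
  (μ • (ContinuousLinearMap.fst ℝ (Euc m) ℝ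
    - ((innerSL ℝ e).comp (ContinuousLinearMap.fst ℝ (Euc m) ℝ)).smulRight e)))

theorem frameMap_apply (e : Euc m) (a b : Euc 2) (μ : ℝ) (v : Cyl m) :
    frameMap e a b μ v =
      ((inner ℝ e v.1 : ℝ) • a + v.2 • b, μ • (v.1 - (inner ℝ e v.1 : ℝ) • e)) := rfl

theorem frameMatrix_frameMap_submatrix (e : Euc m) (a b : Euc 2) (μ : ℝ) :
    (frameMatrix e (frameMap e a b μ)).submatrix finSumFinEquiv finSumFinEquiv =
      Matrix.fromBlocks (Matrix.of fun i j => μ * ((if i = j then 1 else 0) - e j * e i))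
        (Matrix.of fun i (j : Fin 2) => if j = 0 then 0 else e i)
        (Matrix.of fun (i : Fin 2) j => e j * a i)
        (Matrix.of fun (i j : Fin 2) => if j = 0 then b i else 0) := by
  have hcol0 : ∀ (f : Fin m → Amb m) (p q : Amb m) (j : Fin m),
      (Fin.snoc (Fin.snoc f p) q : Fin (m + 2) → Amb m) (Fin.castAdd 2 j) = f j := by
    intro f p q j
    have : Fin.castAdd 2 j = Fin.castSucc (Fin.castSucc j) := rfl
    rw [this, Fin.snoc_castSucc (α := fun _ => Amb m), Fin.snoc_castSucc (α := fun _ => Amb m)]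
  have hcol1 : ∀ (f : Fin m → Amb m) (p q : Amb m),
      (Fin.snoc (Fin.snoc f p) q : Fin (m + 2) → Amb m) (Fin.natAdd m (0 : Fin 2)) = p := by
    intro f p q
    have : Fin.natAdd m (0 : Fin 2) = Fin.castSucc (Fin.last m) := rfl
    rw [this, Fin.snoc_castSucc (α := fun _ => Amb m), Fin.snoc_last (α := fun _ => Amb m)]
  have hcol2 : ∀ (f : Fin m → Amb m) (p q : Amb m),
      (Fin.snoc (Fin.snoc f p) q : Fin (m + 2) → Amb m) (Fin.natAdd m (1 : Fin 2)) = q := by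
    intro f p q
    have : Fin.natAdd m (1 : Fin 2) = Fin.last (m + 1) := rfl
    rw [this, Fin.snoc_last (α := fun _ => Amb m)]
  have hs : ∀ j : Fin m, inner ℝ e (EuclideanSpace.single j (1 : ℝ)) = e j := fun j => by
    simp [EuclideanSpace.inner_single_right]
  ext i j
  rcases i with i | i <;> rcases j with j | j
  · simp [frameMatrix, hcol0, frameMap_apply, hs]
  · fin_cases j
    · simp [frameMatrix, hcol1, frameMap_apply]
    · simp [frameMatrix, hcol2]
  · simp [frameMatrix, hcol0, frameMap_apply, hs]
  · fin_cases j
    · simp [frameMatrix, hcol1, frameMap_apply]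
    · simp [frameMatrix, hcol2]

/-- A column operation with the normal vector completes the projection `μ(1 - e eᵀ)` to `μ · 1`. The
Schur complement of this block is a 2 × 2 matrix built from `a` and `b`. -/
theorem det_frameMap {e : Euc m} (he : ‖e‖ = 1) (a b : Euc 2) {μ : ℝ} (hμ : μ ≠ 0) :
    (frameMatrix e (frameMap e a b μ)).det = μ ^ m * (μ⁻¹ * (a 0 * b 1 - a 1 * b 0)) := by
  have hsum : ∑ j, e j * e j = 1 := by
    have := EuclideanSpace.real_norm_sq_eq e
    rw [he, one_pow] at this
    rw [this]
    exact Finset.sum_congr rfl fun j _ => by ring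
  rw [← Matrix.det_submatrix_equiv_self finSumFinEquiv, frameMatrix_frameMap_submatrix]
  set B : Matrix (Fin m) (Fin m) ℝ := Matrix.of fun i j => μ * ((if i = j then 1 else 0) - e j * e i)
  set C : Matrix (Fin m) (Fin 2) ℝ := Matrix.of fun i (j : Fin 2) => if j = 0 then 0 else e i
    with hC
  set D : Matrix (Fin 2) (Fin m) ℝ := Matrix.of fun (i : Fin 2) j => e j * a i with hD
  set A : Matrix (Fin 2) (Fin 2) ℝ := Matrix.of fun (i j : Fin 2) => if j = 0 then b i else 0
    with hA
  -- Adds `μ e_j` times the last column to the `j`-th one. The last column has no component in ℝ²,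
  -- so the lower left block is unchanged.
  set Q : Matrix (Fin 2) (Fin m) ℝ := Matrix.of fun i j => if i = 0 then 0 else μ * e j with hQ
  have h1 : Matrix.fromBlocks B C D A * Matrix.fromBlocks 1 0 Q 1 =
      Matrix.fromBlocks (μ • (1 : Matrix (Fin m) (Fin m) ℝ)) C D A := by
    rw [Matrix.fromBlocks_multiply]
    simp only [Matrix.mul_one, Matrix.mul_zero, zero_add]
    congr 1
    · ext i j
      simp only [B, hC, hQ, Matrix.add_apply, Matrix.mul_apply, Fin.sum_univ_two, Matrix.of_apply,
        Matrix.smul_apply, Matrix.one_apply, smul_eq_mul, Fin.isValue, one_ne_zero, if_false,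
        if_true]
      split_ifs <;> ring
    · ext i j
      simp [hA, hQ, Matrix.mul_apply, Fin.sum_univ_two]
  have h2 := congrArg Matrix.det h1
  rw [Matrix.det_mul, Matrix.det_fromBlocks_zero₁₂, Matrix.det_one, Matrix.det_one, mul_one,
    mul_one] at h2
  rw [h2]
  let _ : Invertible (μ • (1 : Matrix (Fin m) (Fin m) ℝ)) :=
    ⟨μ⁻¹ • 1, by simp [smul_smul, hμ], by simp [smul_smul, hμ]⟩
  have hinv : ⅟(μ • (1 : Matrix (Fin m) (Fin m) ℝ)) = μ⁻¹ • 1 := rfl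
  rw [Matrix.det_fromBlocks₁₁, hinv, Matrix.det_smul, Matrix.det_one, Fintype.card_fin, mul_one]
  congr 1
  have hDC : D * (μ⁻¹ • (1 : Matrix (Fin m) (Fin m) ℝ)) * C =
      Matrix.of fun (i j : Fin 2) => if j = 0 then 0 else μ⁻¹ * a i := by
    ext i j
    simp only [Matrix.mul_smul, Matrix.mul_one, Matrix.smul_apply,
      Matrix.mul_apply, hD, hC, Matrix.of_apply, smul_eq_mul]
    split_ifs
    · simp
    · calc _ = ∑ x, μ⁻¹ * a i * (e x * e x) := Finset.sum_congr rfl fun x _ => by ring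
        _ = _ := by rw [← Finset.mul_sum, hsum, mul_one]
  rw [hDC, Matrix.det_fin_two]
  simp [hA]
  ring

theorem isFrame_frameMap {e : Euc m} (he : ‖e‖ = 1) (y : Euc 2) {a b : Euc 2}
    (hab : 0 < a 0 * b 1 - a 1 * b 0) {μ : ℝ} (hμ : 0 < μ) :
    IsFrame (y, e) (frameMap e a b μ) := by
  refine ⟨he, fun v => ?_, ?_⟩
  · rw [frameMap_apply]
    simp only [inner_smul_right, inner_sub_right, real_inner_self_eq_norm_sq, he]
    ring
  · rw [det_frameMap he a b hμ.ne']
    positivity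

end Frames

/-! ### The chart of the end -/

/-- The point `e^{iθ}` of the unit circle. -/
def circ (θ : ℝ) : Euc 2 := !₂[Real.cos θ, Real.sin θ]

/-- The tangent vector `i e^{iθ}` of the unit circle. -/
def circ' (θ : ℝ) : Euc 2 := !₂[-Real.sin θ, Real.cos θ]

theorem circ_eq (θ : ℝ) : circ θ = Real.cos θ • EuclideanSpace.single 0 1
    + Real.sin θ • EuclideanSpace.single 1 1 := by
  ext i; fin_cases i <;> simp [circ]

theorem circ'_eq (θ : ℝ) : circ' θ = (-Real.sin θ) • EuclideanSpace.single 0 1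
    + Real.cos θ • EuclideanSpace.single 1 1 := by
  ext i; fin_cases i <;> simp [circ']

theorem hasDerivAt_circ (θ : ℝ) : HasDerivAt circ (circ' θ) θ := by
  rw [circ'_eq, funext circ_eq]
  exact ((Real.hasDerivAt_cos θ).smul_const _).add ((Real.hasDerivAt_sin θ).smul_const _)

theorem contDiff_circ : ContDiff ℝ ∞ circ := by
  rw [funext circ_eq]
  exact (Real.contDiff_cos.smul contDiff_const).add (Real.contDiff_sin.smul contDiff_const)

theorem norm_circ (θ : ℝ) : ‖circ θ‖ = 1 := by
  rw [EuclideanSpace.norm_eq, Fin.sum_univ_two]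
  simp [circ]

theorem circ_eq_iff {θ θ' : ℝ} : circ θ = circ θ' ↔ ∃ k : ℤ, θ' = θ + k * (2 * Real.pi) := by
  constructor
  · intro h
    have h0 := congrArg (fun v : Euc 2 => v 0) h
    have h1 := congrArg (fun v : Euc 2 => v 1) h
    simp only [circ, PiLp.toLp_apply, Matrix.cons_val_zero, Matrix.cons_val_one] at h0 h1
    obtain ⟨k, hk⟩ := Real.Angle.angle_eq_iff_two_pi_dvd_sub.1
      (Real.Angle.cos_sin_inj (θ := θ') (ψ := θ) h0.symm h1.symm)
    exact ⟨k, by linarith⟩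
  · rintro ⟨k, rfl⟩
    simp [circ, Real.cos_add_int_mul_two_pi, Real.sin_add_int_mul_two_pi]

theorem exists_circ {y : Euc 2} (hy : y ≠ 0) : ∃ θ, y = ‖y‖ • circ θ := by
  set z : ℂ := ⟨y 0, y 1⟩ with hz
  have hn : ‖z‖ = ‖y‖ := by
    rw [EuclideanSpace.norm_eq, Fin.sum_univ_two, Complex.norm_eq_sqrt_sq_add_sq]
    simp [hz]
  have hz0 : z ≠ 0 := by
    rw [← norm_ne_zero_iff, hn]
    exact norm_ne_zero_iff.2 hy
  refine ⟨z.arg, ?_⟩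
  ext i
  fin_cases i
  · change y 0 = ‖y‖ * Real.cos z.arg
    rw [Complex.cos_arg hz0, hn, mul_div_cancel₀ _ (norm_ne_zero_iff.2 hy)]
  · change y 1 = ‖y‖ * Real.sin z.arg
    rw [Complex.sin_arg, hn, mul_div_cancel₀ _ (norm_ne_zero_iff.2 hy)]

/-- Polar coordinates `(x, t) ↦ (e(|x|) exp(it/c), x/|x|)` of `ℝ² × 𝕊^{m-1}`. -/
def polarChart {m : ℕ} (e : ℝ → ℝ) (c : ℝ) (z : Cyl m) : Amb m :=
  (e ‖z.1‖ • circ (z.2 / c), ‖z.1‖⁻¹ • z.1)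

/-- The derivative is a `frameMap`: the radial vector goes to `e' circ`, `∂_t` goes to `(e/c)
circ'`, and the orthogonal complement of `x` is scaled by `1/‖x‖`, the derivative of `x/‖x‖`. -/
theorem hasFDerivAt_polarChart {m : ℕ} {e : ℝ → ℝ} {e' : ℝ} (c : ℝ) {z : Cyl m} (hz : z.1 ≠ 0)
    (he : HasDerivAt e e' ‖z.1‖) :
    HasFDerivAt (polarChart e c) (frameMap (‖z.1‖⁻¹ • z.1) (e' • circ (z.2 / c))
      ((e ‖z.1‖ / c) • circ' (z.2 / c)) ‖z.1‖⁻¹) z := by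
  have hf : HasFDerivAt (fun z : Cyl m => z.1) (ContinuousLinearMap.fst ℝ (Euc m) ℝ) z :=
    hasFDerivAt_fst
  have hs : HasFDerivAt (fun z : Cyl m => z.2 / c)
      (c⁻¹ • ContinuousLinearMap.snd ℝ (Euc m) ℝ) z := by
    simp_rw [div_eq_inv_mul]
    exact (hasFDerivAt_snd (𝕜 := ℝ) (p := z)).const_smul c⁻¹
  have hn : ‖z.1‖ ≠ 0 := norm_ne_zero_iff.2 hz
  have h1 := ((hasFDerivAt_radial hz he).comp z hf).smul
    ((hasDerivAt_circ (z.2 / c)).hasFDerivAt.comp z hs)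
  have h2 := ((hasFDerivAt_radial hz (hasDerivAt_inv hn)).comp z hf).smul hf
  refine (h1.prodMk h2).congr_fderiv ?_
  refine ContinuousLinearMap.ext fun v => Prod.ext ?_ ?_
  · simp only [frameMap_apply, ContinuousLinearMap.prod_apply, add_apply, smul_apply,
      ContinuousLinearMap.smulRight_apply, ContinuousLinearMap.comp_apply,
      ContinuousLinearMap.coe_fst', ContinuousLinearMap.coe_snd', innerSL_apply_apply,
      Function.comp_apply, inner_smul_left, smul_eq_mul]
    rw [add_comm]
    simp only [ContinuousLinearMap.toSpanSingleton_apply, smul_smul]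
    congr 2
    · simp; ring
    · ring
  · simp only [frameMap_apply, ContinuousLinearMap.prod_apply, add_apply, smul_apply,
      ContinuousLinearMap.smulRight_apply, ContinuousLinearMap.comp_apply,
      ContinuousLinearMap.coe_fst', innerSL_apply_apply,
      Function.comp_apply, inner_smul_left, smul_eq_mul, smul_sub, smul_smul]
    rw [sub_eq_add_neg, ← neg_smul]
    congr 2
    simp
    field_simp

theorem polarMetric_of_ne {F : ℝ → ℝ} {y : Euc 2} (hy : y ≠ 0) (a b : Euc 2) :
    polarMetric F y a b = (inner ℝ y a / ‖y‖) * (inner ℝ y b / ‖y‖)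
      + F ‖y‖ ^ 2 * ((y 0 * a 1 - y 1 * a 0) / ‖y‖ ^ 2) * ((y 0 * b 1 - y 1 * b 0) / ‖y‖ ^ 2) := by
  unfold polarMetric
  exact if_neg hy

namespace IsIsotropic

variable {V r G e : ℝ → ℝ} {G₀ u₀ : ℝ} {m : ℕ}

/-- The chart of the end, in terms of the geodesic radial coordinate `e`. -/
theorem endChart_eq (h : IsIsotropic V G₀ u₀ r) {e : ℝ ≃o ℝ} (he0 : e u₀ = 0)
    (he : ∀ u, u₀ ≤ u → HasDerivAt e (r u / u) u) (hG : IsProfile V G₀ G) (c : ℝ) {z : Cyl m}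
    (hz : u₀ ≤ ‖z.1‖) : endChart G r c z = polarChart e c z := by
  rw [endChart, h.invFunOn_profile he0 he hG hz]
  rfl

theorem hasFDerivAt_endChart (h : IsIsotropic V G₀ u₀ r) {e : ℝ ≃o ℝ} (he0 : e u₀ = 0)
    (he : ∀ u, u₀ ≤ u → HasDerivAt e (r u / u) u) (hG : IsProfile V G₀ G) (c : ℝ) {z : Cyl m}
    (hz : u₀ < ‖z.1‖) :
    HasFDerivAt (endChart G r c) (frameMap (‖z.1‖⁻¹ • z.1) ((r ‖z.1‖ / ‖z.1‖) • circ (z.2 / c))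
      ((e ‖z.1‖ / c) • circ' (z.2 / c)) ‖z.1‖⁻¹) z := by
  have h0 : z.1 ≠ 0 := norm_ne_zero_iff.1 (h.u₀_pos.trans hz).ne'
  refine (hasFDerivAt_polarChart c h0 (he _ hz.le)).congr_of_eventuallyEq ?_
  have : ∀ᶠ y : Cyl m in 𝓝 z, u₀ < ‖y.1‖ :=
    (isOpen_lt continuous_const (continuous_norm.comp continuous_fst)).mem_nhds hz
  exact this.mono fun y hy => h.endChart_eq he0 he hG c hy.le

theorem norm_inv_smul_self {F : Type*} [NormedAddCommGroup F] [NormedSpace ℝ F] {x : F}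
    (hx : x ≠ 0) : ‖‖x‖⁻¹ • x‖ = 1 := by
  rw [norm_smul, norm_inv, norm_norm, inv_mul_cancel₀ (norm_ne_zero_iff.2 hx)]

theorem inner_smul_sub_smul {F : Type*} [NormedAddCommGroup F] [InnerProductSpace ℝ F] {n : F}
    (hn : (inner ℝ n n : ℝ) = 1) (μ : ℝ) (a b : F) :
    (inner ℝ (μ • (a - (inner ℝ n a : ℝ) • n)) (μ • (b - (inner ℝ n b : ℝ) • n)) : ℝ)
      = μ ^ 2 * (inner ℝ a b - inner ℝ n a * inner ℝ n b) := by
  rw [inner_smul_left, inner_smul_right, inner_sub_left, inner_sub_right, inner_sub_right,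
    inner_smul_left, inner_smul_left, inner_smul_right, inner_smul_right, hn,
    real_inner_comm n a]
  simp
  ring

theorem isEndChart (h : IsIsotropic V G₀ u₀ r) (hG : IsProfile V G₀ G) {c : ℝ} (hc : 0 < c) :
    IsEndChart (endChart (m := m) G r c) u₀ (2 * Real.pi * c) := by
  obtain ⟨e, he0, he⟩ := h.exists_radial
  have hpos : ∀ z : Cyl m, u₀ < ‖z.1‖ → 0 < e ‖z.1‖ := fun z hz => by
    rw [← he0]; exact e.strictMono hz
  have hne : ∀ z : Cyl m, u₀ < ‖z.1‖ → z.1 ≠ 0 := fun z hz =>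
    norm_ne_zero_iff.1 (h.u₀_pos.trans hz).ne'
  refine ⟨?_, ?_, ?_, ?_⟩
  · refine ContDiffOn.congr (f := polarChart e c) (fun z hz => ?_)
      fun z hz => h.endChart_eq he0 he hG c (le_of_lt hz)
    have hn : ContDiffAt ℝ ∞ (fun z : Cyl m => ‖z.1‖) z := contDiffAt_fst.norm ℝ (hne z hz)
    have h1 : ContDiffAt ℝ ∞ (fun z : Cyl m => e ‖z.1‖) z :=
      (h.contDiffAt_radial he hz).comp z hn
    have h2 : ContDiffAt ℝ ∞ (fun z : Cyl m => circ (z.2 / c)) z :=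
      contDiff_circ.contDiffAt.comp z (contDiffAt_snd.div_const c)
    exact ((h1.smul h2).prodMk ((hn.inv (norm_ne_zero_iff.2 (hne z hz))).smul
      contDiffAt_fst)).contDiffWithinAt
  · ext p
    constructor
    · rintro ⟨z, hz, rfl⟩
      rw [h.endChart_eq he0 he hG c (le_of_lt hz)]
      refine ⟨norm_inv_smul_self (hne z hz), ?_⟩
      simp only [polarChart]
      rw [← norm_ne_zero_iff, norm_smul, norm_circ, mul_one]
      exact norm_ne_zero_iff.2 (hpos z hz).ne'
    · rintro ⟨hp, hp0⟩
      obtain ⟨θ, hθ⟩ := exists_circ hp0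
      set u := e.symm ‖p.1‖ with hu
      have hu0 : u₀ < u := by
        rw [hu, e.lt_symm_apply, he0]
        exact norm_pos_iff.2 hp0
      have hup := h.u₀_pos.trans hu0
      have hnorm : ‖u • p.2‖ = u := by
        have : ‖p.2‖ = 1 := hp
        rw [norm_smul, this, mul_one, Real.norm_of_nonneg hup.le]
      have hmem : u₀ < ‖((u • p.2, c * θ) : Cyl m).1‖ := by simpa [hnorm] using hu0
      refine ⟨(u • p.2, c * θ), hmem, ?_⟩
      rw [h.endChart_eq he0 he hG c hmem.le]
      refine Prod.ext ?_ ?_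
      · simp only [polarChart, hnorm]
        rw [mul_div_cancel_left₀ _ hc.ne', hu, e.apply_symm_apply]
        exact hθ.symm
      · simp only [polarChart, hnorm]
        rw [inv_smul_smul₀ hup.ne']
  · intro z hz
    rw [(h.hasFDerivAt_endChart he0 he hG c hz).fderiv, h.endChart_eq he0 he hG c hz.le]
    refine isFrame_frameMap (norm_inv_smul_self (hne z hz)) _ ?_
      (inv_pos.2 (h.u₀_pos.trans hz))
    -- This product is the determinant of the pair `(e' circ, (e/c) circ')`, so the chart preserves
    -- the orientation.
    have h1 : 0 < (r ‖z.1‖ / ‖z.1‖) * (e ‖z.1‖ / c) :=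
      mul_pos (div_pos (h.pos _ hz.le) (h.u₀_pos.trans hz)) (div_pos (hpos z hz) hc)
    refine h1.trans_eq ?_
    have := Real.sin_sq_add_cos_sq (z.2 / c)
    simp [circ, circ']
    linear_combination -(r ‖z.1‖ / ‖z.1‖) * (e ‖z.1‖ / c) * this
  · intro z z' hz hz'
    rw [h.endChart_eq he0 he hG c hz.le, h.endChart_eq he0 he hG c hz'.le]
    constructor
    · intro heq
      have h1 : e ‖z.1‖ • circ (z.2 / c) = e ‖z'.1‖ • circ (z'.2 / c) := congrArg Prod.fst heq
      have h2 : ‖z.1‖⁻¹ • z.1 = ‖z'.1‖⁻¹ • z'.1 := congrArg Prod.snd heq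
      have h3 := congrArg norm h1
      rw [norm_smul, norm_smul, norm_circ, norm_circ, mul_one, mul_one,
        Real.norm_of_nonneg (hpos z hz).le, Real.norm_of_nonneg (hpos z' hz').le] at h3
      have h4 := e.injective h3
      rw [h3] at h1
      obtain ⟨k, hk⟩ := circ_eq_iff.1 (smul_right_injective _ (hpos z' hz').ne' h1)
      refine ⟨k, Prod.ext ?_ ?_⟩
      · rw [h4] at h2
        exact (smul_right_injective _ (inv_ne_zero (norm_ne_zero_iff.2 (hne z' hz'))) h2).symm
      · field_simp at hk
        simp only
        linarith
    · rintro ⟨k, rfl⟩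
      simp only [polarChart]
      congr 2
      rw [circ_eq_iff]
      exact ⟨k, by field_simp⟩

/-- Radially the metric is `(e')² = (r/u)²`, and tangentially it is `G²/u² = (r/u)²`; these agree,
so the `dx` part is conformal to the Euclidean metric. In the fibre direction `F²/c² = V`, the
radius in the plane cancelling out. -/
theorem pullback_endChart (h : IsIsotropic V G₀ u₀ r) (hG : IsProfile V G₀ G) {c : ℝ}
    (hc : 0 < c) {z : Cyl m} (hz : u₀ < ‖z.1‖) (v w : Cyl m) :
    pullback (endChart G r c) (warped (fibreProfile V c G) G) z v w =
      (r ‖z.1‖ / ‖z.1‖) ^ 2 * inner ℝ v.1 w.1 + V (r ‖z.1‖) * (v.2 * w.2) := by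
  obtain ⟨e, he0, he⟩ := h.exists_radial
  have hpos : 0 < e ‖z.1‖ := by rw [← he0]; exact e.strictMono hz
  have hne : z.1 ≠ 0 := norm_ne_zero_iff.1 (h.u₀_pos.trans hz).ne'
  have hu : ‖z.1‖ ≠ 0 := norm_ne_zero_iff.2 hne
  have hG' : G (e ‖z.1‖) = r ‖z.1‖ := by
    rw [h.profile_eq he0 he hG hpos.le, e.symm_apply_apply]
  rw [pullback, (h.hasFDerivAt_endChart he0 he hG c hz).fderiv, h.endChart_eq he0 he hG c hz.le]
  have hy : e ‖z.1‖ • circ (z.2 / c) ≠ 0 := by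
    rw [← norm_ne_zero_iff, norm_smul, norm_circ, mul_one]
    exact norm_ne_zero_iff.2 hpos.ne'
  have hyn : ‖e ‖z.1‖ • circ (z.2 / c)‖ = e ‖z.1‖ := by
    rw [norm_smul, norm_circ, mul_one, Real.norm_of_nonneg hpos.le]
  have hsq : Real.sqrt (V (r ‖z.1‖)) ^ 2 = V (r ‖z.1‖) := Real.sq_sqrt (h.V_pos _ hz).le
  have hcs := Real.sin_sq_add_cos_sq (z.2 / c)
  set C := Real.cos (z.2 / c)
  set S := Real.sin (z.2 / c)
  set n := ‖z.1‖⁻¹ • z.1 with hn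
  have hn1 : (inner ℝ n n : ℝ) = 1 := by
    rw [real_inner_self_eq_norm_sq, norm_inv_smul_self hne, one_pow]
  have hi : ∀ (s t : ℝ), (inner ℝ (e ‖z.1‖ • circ (z.2 / c))
      (s • (r ‖z.1‖ / ‖z.1‖) • circ (z.2 / c) + t • (e ‖z.1‖ / c) • circ' (z.2 / c)) : ℝ)
      = e ‖z.1‖ * (s * (r ‖z.1‖ / ‖z.1‖)) := by
    intro s t
    simp only [EuclideanSpace.inner_eq_star_dotProduct, dotProduct, Fin.sum_univ_two]
    simp [circ, circ']
    linear_combination (e ‖z.1‖ * s * (r ‖z.1‖ / ‖z.1‖)) * hcs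
  have hx : ∀ (s t : ℝ), (e ‖z.1‖ • circ (z.2 / c)) 0 *
      (s • (r ‖z.1‖ / ‖z.1‖) • circ (z.2 / c) + t • (e ‖z.1‖ / c) • circ' (z.2 / c)) 1
      - (e ‖z.1‖ • circ (z.2 / c)) 1 *
      (s • (r ‖z.1‖ / ‖z.1‖) • circ (z.2 / c) + t • (e ‖z.1‖ / c) • circ' (z.2 / c)) 0
      = e ‖z.1‖ ^ 2 * (t / c) := by
    intro s t
    simp [circ, circ']
    linear_combination (e ‖z.1‖ ^ 2 * (t / c)) * hcs
  clear_value n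
  rw [warped]
  simp only [frameMap_apply, polarChart] at hy hyn ⊢
  rw [polarMetric_of_ne hy, hyn, hi, hi, hx, hx, inner_smul_sub_smul hn1, fibreProfile, hG', mul_pow, hsq]
  field_simp
  ring

end IsIsotropic

/-! ### The spin structure at infinity -/

section Rotor

variable {m : ℕ}

theorem cylForm_apply (v : Cyl m) : cylForm m v = -((inner ℝ v.1 v.1 : ℝ) + v.2 * v.2) := by
  simp [cylForm]

theorem polar_cylForm (v w : Cyl m) :
    QuadraticMap.polar (cylForm m) v w = -2 * ((inner ℝ v.1 w.1 : ℝ) + v.2 * w.2) := by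
  simp only [QuadraticMap.polar, cylForm_apply, Prod.fst_add, Prod.snd_add, inner_add_left,
    inner_add_right, real_inner_comm w.1 v.1]
  ring

theorem mul_ι_cylForm {v w : Cyl m} (h : (inner ℝ v.1 w.1 : ℝ) + v.2 * w.2 = 0) :
    CliffordAlgebra.ι (cylForm m) v * CliffordAlgebra.ι (cylForm m) w =
      -(CliffordAlgebra.ι (cylForm m) w * CliffordAlgebra.ι (cylForm m) v) := by
  have h1 := CliffordAlgebra.ι_mul_ι_add_swap (Q := cylForm m) v w
  rw [polar_cylForm, h, mul_zero, map_zero] at h1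
  exact eq_neg_of_add_eq_zero_left h1

theorem ι_mul_self_cylForm {v : Cyl m} (h : (inner ℝ v.1 v.1 : ℝ) + v.2 * v.2 = 1) :
    CliffordAlgebra.ι (cylForm m) v * CliffordAlgebra.ι (cylForm m) v = -1 := by
  rw [CliffordAlgebra.ι_sq_scalar, cylForm_apply, h, map_neg, map_one]

theorem ι_mem_pinGroup {v : Cyl m} (h : (inner ℝ v.1 v.1 : ℝ) + v.2 * v.2 = 1) :
    CliffordAlgebra.ι (cylForm m) v ∈ pinGroup (cylForm m) := by
  have h1 := ι_mul_self_cylForm h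
  let u : (CliffordAlgebra (cylForm m))ˣ :=
    ⟨CliffordAlgebra.ι (cylForm m) v, -CliffordAlgebra.ι (cylForm m) v,
      by rw [mul_neg, h1, neg_neg], by rw [neg_mul, h1, neg_neg]⟩
  refine pinGroup.mem_iff.2 ⟨⟨u, Subgroup.subset_closure ⟨v, rfl⟩, rfl⟩, ?_⟩
  rw [Unitary.mem_iff, CliffordAlgebra.star_ι, neg_mul, mul_neg, h1, neg_neg]
  exact ⟨rfl, rfl⟩

theorem ι_mul_ι_mem_spinGroup {v w : Cyl m} (hv : (inner ℝ v.1 v.1 : ℝ) + v.2 * v.2 = 1)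
    (hw : (inner ℝ w.1 w.1 : ℝ) + w.2 * w.2 = 1) :
    CliffordAlgebra.ι (cylForm m) v * CliffordAlgebra.ι (cylForm m) w ∈ spinGroup (cylForm m) :=
  spinGroup.mem_iff.2 ⟨mul_mem (ι_mem_pinGroup hv) (ι_mem_pinGroup hw),
    CliffordAlgebra.ι_mul_ι_mem_evenOdd_zero _ _ _⟩

/-- The element `cos(θ/2) + sin(θ/2) e ∂_t` of the Clifford algebra. -/
def rotorElt (e : Euc m) (θ : ℝ) : CliffordAlgebra (cylForm m) :=
  Real.cos (θ / 2) • 1 + Real.sin (θ / 2) •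
    (CliffordAlgebra.ι (cylForm m) (e, 0) * CliffordAlgebra.ι (cylForm m) (0, 1))

/-- The rotor is the product of the two unit vectors `-e` and `cos(θ/2) e - sin(θ/2) ∂_t`. -/
theorem rotorElt_mem {e : Euc m} (he : ‖e‖ = 1) (θ : ℝ) : rotorElt e θ ∈ spinGroup (cylForm m) := by
  have hE : (inner ℝ e e : ℝ) = 1 := by rw [real_inner_self_eq_norm_sq, he, one_pow]
  have h1 : (inner ℝ ((-e, 0) : Cyl m).1 ((-e, 0) : Cyl m).1 : ℝ) + (0 : ℝ) * 0 = 1 := by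
    simp [he]
  have h2 : (inner ℝ ((Real.cos (θ / 2) • e, -Real.sin (θ / 2)) : Cyl m).1
      ((Real.cos (θ / 2) • e, -Real.sin (θ / 2)) : Cyl m).1 : ℝ)
      + -Real.sin (θ / 2) * -Real.sin (θ / 2) = 1 := by
    rw [inner_smul_left, inner_smul_right, hE]
    simp
    nlinarith [Real.sin_sq_add_cos_sq (θ / 2)]
  have h3 := ι_mul_ι_mem_spinGroup h1 h2
  have h4 : ((-e, 0) : Cyl m) = (-1 : ℝ) • (e, 0) := by ext <;> simp
  have h5 : ((Real.cos (θ / 2) • e, -Real.sin (θ / 2)) : Cyl m)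
      = Real.cos (θ / 2) • (e, 0) + (-Real.sin (θ / 2)) • (0, 1) := by ext <;> simp
  have h6 := ι_mul_self_cylForm (v := ((e, 0) : Cyl m)) (by simp [he])
  convert h3 using 1
  rw [h4, h5, map_add, map_smul, map_smul, map_smul, mul_add]
  simp only [smul_mul_assoc, mul_smul_comm, h6, rotorElt]
  module

theorem star_rotorElt (e : Euc m) (θ : ℝ) : star (rotorElt e θ) =
    Real.cos (θ / 2) • 1 + Real.sin (θ / 2) •
      (CliffordAlgebra.ι (cylForm m) (0, 1) * CliffordAlgebra.ι (cylForm m) (e, 0)) := by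
  simp [rotorElt, CliffordAlgebra.star_smul]

/-- Conjugation by the rotor is the rotation by the angle `θ`, twice the half angle, in the plane of
`e` and `∂_t`; vectors orthogonal to that plane are fixed. -/
theorem rotorElt_mul_ι {e : Euc m} (he : ‖e‖ = 1) (θ : ℝ) (v : Cyl m) :
    CliffordAlgebra.ι (cylForm m)
      (v.1 + ((inner ℝ e v.1 : ℝ) * (Real.cos θ - 1) - v.2 * Real.sin θ) • e,
        (inner ℝ e v.1 : ℝ) * Real.sin θ + v.2 * Real.cos θ) =
    rotorElt e θ * CliffordAlgebra.ι (cylForm m) v * star (rotorElt e θ) := by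
  rw [star_rotorElt, rotorElt]
  have hE : (inner ℝ e e : ℝ) = 1 := by rw [real_inner_self_eq_norm_sq, he, one_pow]
  set a : ℝ := inner ℝ e v.1 with ha
  set n : Cyl m := (v.1 - a • e, 0) with hn
  have hv : v = a • ((e, 0) : Cyl m) + v.2 • ((0, 1) : Cyl m) + n := by
    ext <;> simp [hn]
  have hw : ((v.1 + (a * (Real.cos θ - 1) - v.2 * Real.sin θ) • e,
        a * Real.sin θ + v.2 * Real.cos θ) : Cyl m) =
      (a * Real.cos θ - v.2 * Real.sin θ) • ((e, 0) : Cyl m)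
        + (a * Real.sin θ + v.2 * Real.cos θ) • ((0, 1) : Cyl m) + n := by
    refine Prod.ext ?_ ?_
    · simp [hn]; module
    · simp [hn]
  rw [hw]
  generalize v.2 = b at *
  rw [hv]
  have hEE := ι_mul_self_cylForm (v := ((e, 0) : Cyl m)) (by simp [he])
  have hTT := ι_mul_self_cylForm (v := ((0, 1) : Cyl m)) (by simp)
  have hTE := mul_ι_cylForm (v := ((0, 1) : Cyl m)) (w := (e, 0)) (by simp)
  have hNE := mul_ι_cylForm (v := n) (w := (e, 0))
    (by simp [hn, inner_sub_left, inner_smul_left, he, ha, real_inner_comm])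
  have hNT := mul_ι_cylForm (v := n) (w := (0, 1)) (by simp [hn])
  simp only [map_add, map_smul]
  generalize CliffordAlgebra.ι (cylForm m) (e, 0) = E at *
  generalize CliffordAlgebra.ι (cylForm m) (0, 1) = T at *
  generalize CliffordAlgebra.ι (cylForm m) n = N at *
  have hEE' : ∀ x, E * (E * x) = -x := fun x => by rw [← mul_assoc, hEE, neg_one_mul]
  have hTT' : ∀ x, T * (T * x) = -x := fun x => by rw [← mul_assoc, hTT, neg_one_mul]
  have hTE' : ∀ x, T * (E * x) = -(E * (T * x)) := fun x => by
    rw [← mul_assoc, hTE, neg_mul, mul_assoc]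
  have hNE' : ∀ x, N * (E * x) = -(E * (N * x)) := fun x => by
    rw [← mul_assoc, hNE, neg_mul, mul_assoc]
  have hNT' : ∀ x, N * (T * x) = -(T * (N * x)) := fun x => by
    rw [← mul_assoc, hNT, neg_mul, mul_assoc]
  have hθ : θ = 2 * (θ / 2) := by ring
  have hc : Real.cos θ = Real.cos (θ / 2) ^ 2 - Real.sin (θ / 2) ^ 2 := by
    conv_lhs => rw [hθ, Real.cos_two_mul']
  have hs : Real.sin θ = 2 * Real.sin (θ / 2) * Real.cos (θ / 2) := by
    conv_lhs => rw [hθ, Real.sin_two_mul]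
  have h1 : Real.cos (θ / 2) ^ 2 + Real.sin (θ / 2) ^ 2 = 1 := Real.cos_sq_add_sin_sq _
  rw [hc, hs]
  generalize Real.cos (θ / 2) = c at *
  generalize Real.sin (θ / 2) = s at *
  -- On the orthogonal component the conjugation produces the factor `c² + s²`; it is inserted on
  -- the other side so that both sides are polynomial in `c` and `s`.
  have hN : N = (c ^ 2 + s ^ 2) • N := by rw [h1, one_smul]
  conv_lhs => rw [hN]
  simp only [mul_add, add_mul, smul_mul_assoc, mul_smul_comm, mul_assoc, hEE', hTT, hTT',
    hTE, hTE', hNE', hNT, one_mul, mul_one, mul_neg, neg_mul, neg_neg, smul_neg]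
  module

theorem continuous_rotorElt (e : Euc m) : Continuous (rotorElt e) := by
  have : IsModuleTopology ℝ (CliffordAlgebra (cylForm m)) := ⟨rfl⟩
  have := IsModuleTopology.toContinuousAdd ℝ (CliffordAlgebra (cylForm m))
  unfold rotorElt
  fun_prop

end Rotor

/-- Rotating the frame vectors in ℝ² amounts to rotating the source in the plane of `e` and `∂_t`.
This identifies the circle of frames over a single point with an orbit of the rotors. -/
theorem frameMap_circ_rotate {m : ℕ} {e : Euc m} (he : ‖e‖ = 1) (μ θ : ℝ) (v : Cyl m) :
    frameMap e (circ θ) (circ' θ) μ v = frameMap e (circ 0) (circ' 0) μ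
      (v.1 + ((inner ℝ e v.1 : ℝ) * (Real.cos θ - 1) - v.2 * Real.sin θ) • e,
        (inner ℝ e v.1 : ℝ) * Real.sin θ + v.2 * Real.cos θ) := by
  have hE : (inner ℝ e e : ℝ) = 1 := by rw [real_inner_self_eq_norm_sq, he, one_pow]
  simp only [frameMap_apply, inner_add_right, inner_smul_right, hE, circ_eq, circ'_eq,
    Real.cos_zero, Real.sin_zero]
  refine Prod.ext ?_ ?_
  · simp only
    module
  · simp only
    module

theorem continuous_frameMap {m : ℕ} (e : Euc m) (μ : ℝ) :
    Continuous fun p : Euc 2 × Euc 2 => frameMap e p.1 p.2 μ := by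
  unfold frameMap
  have h1 : Continuous fun p : Euc 2 × Euc 2 =>
      ((innerSL ℝ e).comp (ContinuousLinearMap.fst ℝ (Euc m) ℝ)).smulRight p.1 :=
    (ContinuousLinearMap.smulRightL ℝ (Cyl m) (Euc 2) _).continuous.comp continuous_fst
  have h2 : Continuous fun p : Euc 2 × Euc 2 =>
      (ContinuousLinearMap.snd ℝ (Euc m) ℝ).smulRight p.2 :=
    (ContinuousLinearMap.smulRightL ℝ (Cyl m) (Euc 2) _).continuous.comp continuous_snd
  let P : (Cyl m →L[ℝ] Euc 2) × (Cyl m →L[ℝ] Euc m) ≃ₗᵢ[ℝ] Cyl m →L[ℝ] Amb m :=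
    ContinuousLinearMap.prodₗᵢ ℝ
  exact P.continuous.comp ((h1.add h2).prodMk continuous_const)

/-- The homotopy, in the first parameter, from a circle of frames of radius `ρ` to one over the
origin of ℝ²; at the same time the lengths `A`, `B` are brought to 1. -/
theorem continuous_frameCircle_aux {m : ℕ} (e : Euc m) (μ A B ρ : ℝ) :
    Continuous fun p : ℝ × ℝ => ((((1 - p.1) * ρ) • circ p.2, e),
      frameMap e (((1 - p.1) * A + p.1) • circ p.2) (((1 - p.1) * B + p.1) • circ' p.2) μ) := by
  have hc : Continuous fun p : ℝ × ℝ => circ p.2 := contDiff_circ.continuous.comp continuous_snd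
  have hc' : Continuous fun p : ℝ × ℝ => circ' p.2 := by
    simp_rw [circ'_eq]
    fun_prop
  have h1 : ∀ C : ℝ, Continuous fun p : ℝ × ℝ => (1 - p.1) * C + p.1 := fun C => by fun_prop
  have h2 : Continuous fun p : ℝ × ℝ => (1 - p.1) * ρ := by fun_prop
  have h3 : Continuous fun p : ℝ × ℝ =>
      (((1 - p.1) * A + p.1) • circ p.2, ((1 - p.1) * B + p.1) • circ' p.2) :=
    ((h1 A).smul hc).prodMk ((h1 B).smul hc')
  have h4 := (continuous_frameMap e μ).comp h3
  exact ((h2.smul hc).prodMk continuous_const).prodMk h4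

/-- The circle of frames `(A e^{iθ}, B i e^{iθ})` over the circle of radius `ρ` in `ℝ² × {e}`. -/
def frameCircle {m : ℕ} {e : Euc m} (he : ‖e‖ = 1) {μ A B : ℝ} (hμ : 0 < μ) (hA : 0 < A)
    (hB : 0 < B) (ρ θ : ℝ) : FrameBundle m :=
  ⟨((ρ • circ θ, e), frameMap e (A • circ θ) (B • circ' θ) μ), isFrame_frameMap he _ (by
    have h := Real.sin_sq_add_cos_sq θ
    have : 0 < A * B := mul_pos hA hB
    refine this.trans_eq ?_
    simp [circ, circ']
    linear_combination -A * B * h) hμ⟩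

/-- On `ℝ² × 𝕊^{m-1}` the rotating frames of the circles around the origin of `ℝ²` do not lift to
a closed curve in any spin structure. -/
theorem SpinStructure.frameCircle_not_lift {m : ℕ} (S : SpinStructure m) {e : Euc m}
    (he : ‖e‖ = 1) {μ A B : ℝ} (hμ : 0 < μ) (hA : 0 < A) (hB : 0 < B) (ρ : ℝ) (f : ℝ → S.P)
    (hf : @Continuous _ _ _ S.top f) (hper : f (2 * Real.pi) = f 0)
    (hcov : ∀ θ, S.cov (f θ) = frameCircle he hμ hA hB ρ θ) : False := by
  let _ := S.top
  have hl : ∀ (C : ℝ), 0 < C → ∀ l : unitInterval, 0 < (1 - (l : ℝ)) * C + l := fun C hC l => by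
    rcases l.2.2.eq_or_lt with h | h
    · rw [h]; norm_num
    · have h1 := mul_pos (sub_pos.2 h) hC
      have h2 := l.2.1
      linarith
  -- The circle is shrunk to the origin while the frames keep rotating; convex combinations with 1
  -- keep the frame vectors independent.
  let H : C(unitInterval × ℝ, FrameBundle m) :=
    ⟨fun p => frameCircle he hμ (hl A hA p.1) (hl B hB p.1) ((1 - (p.1 : ℝ)) * ρ) p.2,
      (((continuous_frameCircle_aux e μ A B ρ).comp
        (continuous_subtype_val.prodMap continuous_id)).subtype_mk _)⟩
  have hH0 : ∀ θ, H (0, θ) = S.cov (f θ) := fun θ => by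
    rw [hcov]
    refine Subtype.ext ?_
    simp [H, frameCircle]
  let Ht := S.isCovering.liftHomotopy H ⟨f, hf⟩ hH0
  have hlift : ∀ p, S.cov (Ht p) = H p := fun p =>
    congrFun (S.isCovering.liftHomotopy_lifts H ⟨f, hf⟩ hH0) p
  have hzero : ∀ θ, Ht (0, θ) = f θ := fun θ => S.isCovering.liftHomotopy_zero H ⟨f, hf⟩ hH0 θ
  -- The paths traced by the two endpoints lift the same path of frames and start at the same point,
  -- by hypothesis, so they agree: all the lifted circles are closed.
  have hclosed : (fun l : unitInterval => Ht (l, 2 * Real.pi)) = fun l => Ht (l, 0) := by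
    refine S.isCovering.eq_of_comp_eq (by fun_prop) (by fun_prop) ?_ 0 ?_
    · funext l
      simp only [Function.comp_apply, hlift]
      refine Subtype.ext ?_
      simp [H, frameCircle, circ, circ']
    · simp only [hzero, hper]
  -- At the end of the homotopy the base point is fixed, and the lift is the orbit of the rotors, by
  -- uniqueness of lifts from `θ = 0`.
  have hrot : (fun θ => Ht (1, θ)) = fun θ => S.act (Ht (1, 0)) ⟨rotorElt e θ, rotorElt_mem he θ⟩ := by
    refine S.isCovering.eq_of_comp_eq (by fun_prop) ?_ ?_ 0 ?_
    · exact S.continuous_act.comp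
        (continuous_const.prodMk ((continuous_rotorElt e).subtype_mk _))
    · funext θ
      refine Subtype.ext (Prod.ext ?_ (ContinuousLinearMap.ext fun v => ?_))
      · simp only [Function.comp_apply]
        rw [S.cov_base, hlift, hlift]
        simp [H, frameCircle]
      · simp only [Function.comp_apply]
        rw [S.cov_frame _ _ _ _ (rotorElt_mul_ι he θ v), hlift, hlift]
        have := frameMap_circ_rotate he μ θ v
        simpa [H, frameCircle] using this
    · have : (⟨rotorElt e 0, rotorElt_mem he 0⟩ : SpinGrp m) = 1 := Subtype.ext (by simp [rotorElt])
      simp only [this, S.act_one]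
  have h1 := congrFun hrot (2 * Real.pi)
  have h2 : Ht (1, 2 * Real.pi) = Ht (1, 0) := congrFun hclosed 1
  rw [show Ht (1, 2 * Real.pi) = _ from h1] at h2
  -- A closed orbit of the free action forces the rotor of angle `2π` to be 1, whereas its half
  -- angle `π` makes it -1.
  have h3 : rotorElt e (2 * Real.pi) = 1 := congrArg Subtype.val (S.free _ _ h2)
  have h4 : rotorElt e (2 * Real.pi) = -1 := by
    simp [rotorElt]
  rw [h4] at h3
  have h5 : (2 : ℝ) • (1 : CliffordAlgebra (cylForm m)) = 0 := by
    rw [two_smul]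
    nth_rewrite 1 [← h3]
    exact neg_add_cancel 1
  exact (smul_ne_zero two_ne_zero one_ne_zero) h5

/-- Restricting a section to the circle `x = R e`, `t = cθ` would lift the product frame there to a
closed curve. In polar coordinates this frame is a rotating frame, which is excluded by
`frameCircle_not_lift`. -/
theorem IsIsotropic.not_spinTrivialAtInfinity {V r G : ℝ → ℝ} {G₀ u₀ : ℝ} {m : ℕ} (hm : 0 < m)
    (h : IsIsotropic V G₀ u₀ r) (hG : IsProfile V G₀ G) {c : ℝ} (hc : 0 < c)
    (S : SpinStructure m) :
    ¬ SpinTrivialAtInfinity S (endChart G r c) (2 * Real.pi * c) := by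
  rintro ⟨R₁, σ, hσ, hper, hcov⟩
  obtain ⟨ρ, hρ0, hρ⟩ := h.exists_radial
  let _ := S.top
  set R := max R₁ u₀ + 1 with hR
  have hR1 : R₁ < R := (le_max_left R₁ u₀).trans_lt (lt_add_one _)
  have hRu : u₀ < R := (le_max_right R₁ u₀).trans_lt (lt_add_one _)
  have hR0 : 0 < R := h.u₀_pos.trans hRu
  set e : Euc m := EuclideanSpace.single ⟨0, hm⟩ 1 with he'
  have he : ‖e‖ = 1 := by simp [he']
  have hn : ‖R • e‖ = R := by rw [norm_smul, he, mul_one, Real.norm_of_nonneg hR0.le]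
  have hpos : 0 < ρ R := by rw [← hρ0]; exact ρ.strictMono hRu
  refine S.frameCircle_not_lift he (inv_pos.2 hR0) (div_pos (h.pos R hRu.le) hR0)
    (div_pos hpos hc) (ρ R) (fun θ => σ (R • e, c * θ)) ?_ ?_ fun θ => ?_
  · refine hσ.comp_continuous (by fun_prop) fun θ => ?_
    simpa [hn] using hR1
  · have := hper (R • e, 0) (by simpa [hn] using hR1)
    simp only [mul_zero, zero_add] at this ⊢
    rw [← this, mul_comm]
  · have hu : u₀ < ‖((R • e, c * θ) : Cyl m).1‖ := by simpa [hn] using hRu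
    refine Subtype.ext ?_
    rw [hcov _ (by simpa [hn] using hR1), (h.hasFDerivAt_endChart hρ0 hρ hG c hu).fderiv,
      h.endChart_eq hρ0 hρ hG c hu.le]
    simp only [polarChart, hn, frameCircle, mul_div_cancel_left₀ θ hc.ne', inv_smul_smul₀ hR0.ne']

/-! ### Schwarzschild metrics -/

section Schwarzschild

variable {k : ℕ} {γ : ℝ}

theorem schwC_pos (hk : 1 ≤ k) (hγ : 0 < γ) : 0 < schwC (k + 3) γ := by
  have : (0 : ℝ) < k := by exact_mod_cast hk
  simp only [schwC]
  push_cast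
  rw [add_sub_cancel_right]
  positivity

theorem schwR_eq (u : ℝ) : schwR (k + 3) γ u
    = u * (1 + γ ^ k / 4 * (u ^ k)⁻¹) ^ (2 / (k : ℝ)) := by
  simp only [schwR, Nat.add_sub_cancel]
  push_cast
  rw [add_sub_cancel_right, div_pow]
  congr 3
  ring

theorem schwU_pos (hγ : 0 < γ) : 0 < schwU (k + 3) γ := by
  unfold schwU
  positivity

theorem schwU_pow (hk : 1 ≤ k) : schwU (k + 3) γ ^ k = γ ^ k / 4 := by
  have hk' : (k : ℝ) ≠ 0 := by exact_mod_cast (by omega : k ≠ 0)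
  simp only [schwU]
  push_cast
  rw [add_sub_cancel_right, mul_pow, ← Real.rpow_mul_natCast (by norm_num), neg_mul, one_div,
    inv_mul_cancel₀ hk', Real.rpow_neg_one]
  ring

theorem schwR_pow (hk : 1 ≤ k) (hγ : 0 < γ) {u : ℝ} (hu : 0 < u) :
    schwR (k + 3) γ u ^ k = u ^ k * (1 + γ ^ k / 4 * (u ^ k)⁻¹) ^ 2 := by
  have hk' : (k : ℝ) ≠ 0 := by exact_mod_cast (by omega : k ≠ 0)
  rw [schwR_eq, mul_pow, ← Real.rpow_mul_natCast (by positivity), div_mul_cancel₀ _ hk']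
  norm_num

/-- With `w = γ^k / (4 u^k)` one has `(γ/r)^k = 4w/(1 + w)²`, and `(1 + w)² - 4w = (1 - w)²`. -/
theorem schwV_schwR (hk : 1 ≤ k) (hγ : 0 < γ) {u : ℝ} (hu : 0 < u) :
    schwV (k + 3) γ (schwR (k + 3) γ u) =
      ((1 - γ ^ k / 4 * (u ^ k)⁻¹) / (1 + γ ^ k / 4 * (u ^ k)⁻¹)) ^ 2 := by
  simp only [schwV, Nat.add_sub_cancel]
  rw [div_pow, schwR_pow hk hγ hu]
  have : 0 < 1 + γ ^ k / 4 * (u ^ k)⁻¹ := by positivity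
  field_simp
  ring

theorem schw_mul_inv_le (hk : 1 ≤ k) (hγ : 0 < γ) {u : ℝ} (hu : schwU (k + 3) γ ≤ u) :
    γ ^ k / 4 * (u ^ k)⁻¹ ≤ 1 := by
  have h0 := schwU_pos (k := k) hγ
  rw [← schwU_pow hk, ← div_eq_mul_inv]
  exact div_le_one_of_le₀ (pow_le_pow_left₀ h0.le hu k)
    (pow_nonneg (h0.le.trans hu) k)

/-- With `w = γ^k / (4 u^k)`, the logarithmic derivative of `u (1 + w)^{2/k}` is `(1/u)(1 - 2w/(1 +
w))`, that is, `√V/u`. The square root is the positive one exactly when `w ≤ 1`, that is, beyond the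
horizon `u = schwU`. -/
theorem isIsotropic_schw (hk : 1 ≤ k) (hγ : 0 < γ) :
    IsIsotropic (schwV (k + 3) γ) γ (schwU (k + 3) γ) (schwR (k + 3) γ) := by
  have hk' : (k : ℝ) ≠ 0 := by exact_mod_cast (by omega : k ≠ 0)
  have h0 := schwU_pos (k := k) hγ
  have hb : ∀ u : ℝ, schwU (k + 3) γ ≤ u → 0 < 1 + γ ^ k / 4 * (u ^ k)⁻¹ := fun u hu => by
    have := h0.trans_le hu
    positivity
  have hder : ∀ u : ℝ, schwU (k + 3) γ ≤ u → HasDerivAt (schwR (k + 3) γ)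
      (schwR (k + 3) γ u / u * Real.sqrt (schwV (k + 3) γ (schwR (k + 3) γ u))) u := by
    intro u hu
    have hu0 := h0.trans_le hu
    have hb' := hb u hu
    have h1 : HasDerivAt (fun u : ℝ => 1 + γ ^ k / 4 * (u ^ k)⁻¹)
        (γ ^ k / 4 * (-(k * u ^ (k - 1)) / (u ^ k) ^ 2)) u :=
      (((hasDerivAt_pow k u).inv (by positivity)).const_mul _).const_add 1
    have h2 := (hasDerivAt_id u).mul (h1.rpow_const (p := 2 / (k : ℝ)) (Or.inl hb'.ne'))
    have h3 : schwR (k + 3) γ = fun u => u * (1 + γ ^ k / 4 * (u ^ k)⁻¹) ^ (2 / (k : ℝ)) :=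
      funext schwR_eq
    rw [schwV_schwR hk hγ hu0, Real.sqrt_sq (div_nonneg
      (sub_nonneg.2 (schw_mul_inv_le hk hγ hu)) hb'.le), h3]
    refine h2.congr_deriv ?_
    obtain ⟨j, rfl⟩ : ∃ j, k = j + 1 := ⟨k - 1, by omega⟩
    rw [Real.rpow_sub_one hb'.ne']
    simp only [id, Nat.add_sub_cancel]
    generalize hB : (1 + γ ^ (j + 1) / 4 * (u ^ (j + 1))⁻¹) ^ (2 / ((j + 1 : ℕ) : ℝ)) = B
    field_simp
    ring
  refine ⟨h0, ?_, fun u hu => ?_, fun u hu => ?_, fun u hu => ?_, hder, ?_⟩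
  · rw [schwR_eq, schwU_pow hk, mul_inv_cancel₀ (by positivity)]
    simp only [schwU]
    push_cast
    rw [add_sub_cancel_right, mul_assoc]
    have : (4 : ℝ) = 2 ^ (2 : ℝ) := by norm_num
    rw [this, ← Real.rpow_mul (by norm_num)]
    norm_num
    rw [← Real.rpow_add (by norm_num)]
    have : -(2 * (k : ℝ)⁻¹) + 2 / k = 0 := by ring
    rw [this, Real.rpow_zero, mul_one]
  · have hu0 := h0.trans_le hu
    rw [funext schwR_eq]
    refine contDiffAt_id.mul (ContDiffAt.rpow_const_of_ne ?_ (hb u hu).ne')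
    exact contDiffAt_const.add (contDiffAt_const.mul
      ((contDiffAt_id.pow k).inv (by simp only [id]; positivity)))
  · have hu0 := h0.trans_le hu
    rw [schwR_eq]
    exact mul_pos hu0 (Real.rpow_pos_of_pos (hb u hu) _)
  · have hu0 := h0.trans hu
    rw [schwV_schwR hk hγ hu0]
    refine pow_pos (div_pos (sub_pos.2 ?_) (hb u hu.le)) 2
    rw [← schwU_pow hk, ← div_eq_mul_inv]
    exact (div_lt_one (by positivity)).2 (pow_lt_pow_left₀ hu h0.le (by omega))
  · refine tendsto_atTop_mono' _ ?_ tendsto_id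
    filter_upwards [eventually_ge_atTop (schwU (k + 3) γ)] with u hu
    have hu0 := h0.trans_le hu
    rw [schwR_eq]
    refine le_mul_of_one_le_right hu0.le (Real.one_le_rpow ?_ (by positivity))
    have : 0 ≤ γ ^ k / 4 * (u ^ k)⁻¹ := by positivity
    linarith

/-- With `A = γ^k/4` and `n = k + 3`, the coefficients are `p(y) = (1 + Ay)^{4/k}` and `((1 - Ay)/(1
+ Ay))²`, of derivatives `4A/k` and `-4A` at 0. The masses are `4(k + 1)A - 4kA = γ^k` and `4(k +
1)A - 2kA = ((k + 2)/2) γ^k`. -/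
theorem schwarzschild (n : ℕ) (γ : ℝ) (hn : 4 ≤ n) (hγ : 0 < γ) :
    (∃ G, IsProfile (schwV n γ) γ G) ∧
      ∀ G, IsProfile (schwV n γ) γ G →
      ∀ (Ψ : Cyl (n - 1) → Amb (n - 1)) (L : ℝ) (X : CircleEnd (n - 1) (Cyl (n - 1)))
        (g : Cyl (n - 1) → Cyl (n - 1) → Cyl (n - 1) → ℝ),
        Ψ = endChart G (schwR n γ) (schwC n γ) →
        L = 2 * Real.pi * schwC n γ →
        X = trivialEnd (n - 1) (schwU n γ) L →
        g = pullback Ψ (warped (fibreProfile (schwV n γ) (schwC n γ) G) G) →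
        IsEndChart Ψ (schwU n γ) L ∧
        IsALF X (dtForm (n - 1)) g ∧
        massD X (dtForm (n - 1)) g = ((γ ^ (n - 3) : ℝ) : EReal) ∧
        massGB X (dtForm (n - 1)) g = ((((n : ℝ) - 1) / 2 * γ ^ (n - 3) : ℝ) : EReal) ∧
        ∀ S : SpinStructure (n - 1), ¬ SpinTrivialAtInfinity S Ψ L := by
  obtain ⟨k, rfl⟩ : ∃ k, n = k + 3 := ⟨n - 3, by omega⟩
  have hk : 1 ≤ k := by omega
  have hk' : (k : ℝ) ≠ 0 := by exact_mod_cast (by omega : k ≠ 0)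
  have hiso := isIsotropic_schw hk hγ
  have hc := schwC_pos hk hγ
  obtain ⟨e, he0, he⟩ := hiso.exists_radial
  refine ⟨⟨_, hiso.isProfile he0 he⟩, ?_⟩
  rintro G hG _ _ _ _ rfl rfl rfl rfl
  set A : ℝ := γ ^ k / 4 with hA
  have hA0 : 0 < A := by positivity
  have hb0 : ∀ᶠ y : ℝ in 𝓝 0, 0 < 1 + A * y := by
    have : ContinuousAt (fun y : ℝ => 1 + A * y) 0 := by fun_prop
    exact this.eventually_const_lt (by simp)
  have hbu : ∀ u : ℝ, schwU (k + 3) γ < u → 0 < 1 + A * (u ^ k)⁻¹ := fun u hu => by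
    have := hiso.u₀_pos.trans hu
    positivity
  have hp : ∀ y : ℝ, 0 < 1 + A * y → ContDiffAt ℝ ∞ (fun w : ℝ => (1 + A * w) ^ (4 / (k : ℝ))) y :=
    fun y hy => ContDiffAt.rpow_const_of_ne (by fun_prop) hy.ne'
  have hN : ∀ y : ℝ, 0 < 1 + A * y →
      ContDiffAt ℝ ∞ (fun w : ℝ => ((1 - A * w) / (1 + A * w)) ^ 2) y :=
    fun y hy => by
      have h1 : ContDiffAt ℝ ∞ (fun w : ℝ => 1 - A * w) y := by fun_prop
      have h2 : ContDiffAt ℝ ∞ (fun w : ℝ => 1 + A * w) y := by fun_prop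
      exact (h1.div h2 hy.ne').pow 2
  have hd : HasDerivAt (fun w : ℝ => 1 + A * w) A 0 := by
    simpa using ((hasDerivAt_id (0 : ℝ)).const_mul A).const_add 1
  have hd' : HasDerivAt (fun w : ℝ => 1 - A * w) (-A) 0 := by
    simpa using ((hasDerivAt_id (0 : ℝ)).const_mul A).const_sub 1
  have hdp : deriv (fun w : ℝ => (1 + A * w) ^ (4 / (k : ℝ))) 0 = 4 / k * A := by
    have := (hd.rpow_const (p := 4 / (k : ℝ)) (Or.inl (by simp))).deriv
    simp only [mul_zero, add_zero, Real.one_rpow, mul_one] at this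
    rw [this]; ring
  have hdn : deriv (fun w : ℝ => ((1 - A * w) / (1 + A * w)) ^ 2) 0 = -(4 * A) := by
    have := ((hd'.div hd (by simp)).pow 2).deriv
    simp only [Pi.pow_def, Pi.div_apply] at this
    rw [this]; simp; ring
  obtain ⟨h1, h2, h3⟩ := static_radial hk (L := 2 * Real.pi * schwC (k + 3) γ)
    hiso.u₀_pos (by positivity)
    (hb0.mono fun y hy => hp y hy) (hb0.mono fun y hy => hN y hy) (by simp) (by simp)
    (fun u hu => hp _ (hbu u hu)) (fun u hu => hN _ (hbu u hu))
    (fun u hu => Real.rpow_pos_of_pos (hbu u hu) _)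
    (fun u hu => by
      rw [← schwV_schwR hk hγ (hiso.u₀_pos.trans hu)]
      exact hiso.V_pos u hu)
    (g := pullback (endChart G (schwR (k + 3) γ) (schwC (k + 3) γ))
      (warped (fibreProfile (schwV (k + 3) γ) (schwC (k + 3) γ) G) G))
    (fun z hz v w => by
      have hz0 := hiso.u₀_pos.trans hz
      rw [hiso.pullback_endChart hG hc hz, schwV_schwR hk hγ hz0, schwR_eq,
        mul_div_cancel_left₀ _ hz0.ne', ← Real.rpow_mul_natCast (hbu _ hz).le]
      congr 3
      push_cast
      ring)
  refine ⟨hiso.isEndChart hG hc, h1, ?_, ?_, hiso.not_spinTrivialAtInfinity (by omega) hG hc⟩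
  · refine h2.trans ?_
    rw [hdp, hdn]
    congr 1
    simp only [Nat.add_sub_cancel, hA]
    field_simp
    ring
  · refine h3.trans ?_
    rw [hdp, hdn]
    congr 1
    simp only [Nat.add_sub_cancel, hA]
    push_cast
    field_simp
    ring

end Schwarzschild

/-! ### Isotropic coordinates of Reissner–Nordström metrics -/

section ReissnerNordstrom

variable {m q : ℝ}

theorem rn_sqrt_pos (h : 0 < m ∨ q ≠ 0) : 0 < Real.sqrt (m ^ 2 + q ^ 2) := by
  refine Real.sqrt_pos.2 ?_
  rcases h with h | h <;> positivity

theorem rnG₀_pos (h : 0 < m ∨ q ≠ 0) : 0 < rnG₀ m q := by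
  rcases h with h | h
  · unfold rnG₀
    positivity
  · have : |m| < Real.sqrt (m ^ 2 + q ^ 2) := by
      rw [← Real.sqrt_sq_eq_abs]
      exact Real.sqrt_lt_sqrt (by positivity) (by have : 0 < q ^ 2 := by positivity
                                                  linarith)
    have := neg_abs_le m
    unfold rnG₀
    linarith

theorem rnC_eq : rnC m q = rnG₀ m q ^ 2 / Real.sqrt (m ^ 2 + q ^ 2) := by
  rw [rnC, rnG₀, add_sub_cancel_left]

theorem rnC_pos (h : 0 < m ∨ q ≠ 0) : 0 < rnC m q := by
  rw [rnC_eq]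
  exact div_pos (pow_pos (rnG₀_pos h) 2) (rn_sqrt_pos h)

theorem rnR_eq {u : ℝ} (hu : u ≠ 0) : rnR m q u = u + m + (m ^ 2 + q ^ 2) / 4 * u⁻¹ := by
  unfold rnR
  field_simp

/-- With `s = √(m² + q²)`, the inequality `u + s²/(4u) ≥ s` gives `r ≥ m + s = G₀ > 0`, also for
negative `m`. -/
theorem rnR_pos (h : 0 < m ∨ q ≠ 0) {u : ℝ} (hu : 0 < u) : 0 < rnR m q u := by
  have h1 := rnG₀_pos h
  have hs := rn_sqrt_pos h
  have hs2 : Real.sqrt (m ^ 2 + q ^ 2) ^ 2 = m ^ 2 + q ^ 2 := Real.sq_sqrt (by positivity)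
  rw [rnR_eq hu.ne', ← hs2]
  rw [rnG₀] at h1
  generalize Real.sqrt (m ^ 2 + q ^ 2) = s at *
  have h2 : s ≤ u + s ^ 2 / 4 * u⁻¹ := by
    have h3 : u + s ^ 2 / 4 * u⁻¹ - s = (u - s / 2) ^ 2 / u := by
      field_simp
      ring
    have : 0 ≤ (u - s / 2) ^ 2 / u := by positivity
    linarith
  linarith

/-- `V r² = (r - m)² - s²` with `s² = m² + q²` and `r - m = u + s²/(4u)`, so `V r²` is the square of
`u - s²/(4u)`. -/
theorem rnV_rnR (h : 0 < m ∨ q ≠ 0) {u : ℝ} (hu : 0 < u) : rnV m q (rnR m q u) =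
    ((u - (m ^ 2 + q ^ 2) / 4 * u⁻¹) / rnR m q u) ^ 2 := by
  have h1 := rnR_pos h hu
  have h2 : rnV m q (rnR m q u)
      = ((rnR m q u - m) ^ 2 - (m ^ 2 + q ^ 2)) / rnR m q u ^ 2 := by
    unfold rnV
    field_simp
    ring
  rw [h2, div_pow]
  congr 1
  rw [rnR_eq hu.ne']
  field_simp
  ring

theorem isIsotropic_rn (h : 0 < m ∨ q ≠ 0) :
    IsIsotropic (rnV m q) (rnG₀ m q) (rnU m q) (rnR m q) := by
  have hs := rn_sqrt_pos h
  have h0 : 0 < rnU m q := by unfold rnU; positivity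
  have hs2 : m ^ 2 + q ^ 2 = 4 * rnU m q ^ 2 := by
    rw [rnU, div_pow, Real.sq_sqrt (by positivity)]
    ring
  have hev : ∀ u : ℝ, 0 < u →
      rnR m q =ᶠ[𝓝 u] fun u => u + m + (m ^ 2 + q ^ 2) / 4 * u⁻¹ := fun u hu =>
    (eventually_gt_nhds hu).mono fun v hv => rnR_eq (ne_of_gt hv)
  have hle : ∀ u : ℝ, rnU m q ≤ u → 0 ≤ u - (m ^ 2 + q ^ 2) / 4 * u⁻¹ := fun u hu => by
    have hu0 := h0.trans_le hu
    have h2 : u - (m ^ 2 + q ^ 2) / 4 * u⁻¹ = (u ^ 2 - rnU m q ^ 2) / u := by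
      rw [hs2]; field_simp
    rw [h2]
    exact div_nonneg (sub_nonneg.2 (pow_le_pow_left₀ h0.le hu 2)) hu0.le
  refine ⟨h0, ?_, fun u hu => ?_, fun u hu => rnR_pos h (h0.trans_le hu), fun u hu => ?_,
    fun u hu => ?_, ?_⟩
  · rw [rnR_eq h0.ne', hs2, rnG₀]
    have : Real.sqrt (m ^ 2 + q ^ 2) = 2 * rnU m q := by unfold rnU; ring
    rw [this]
    field_simp
    ring
  · have hu0 := h0.trans_le hu
    exact (ContDiffAt.add (by fun_prop) (contDiffAt_const.mul
      (contDiffAt_id.inv hu0.ne'))).congr_of_eventuallyEq (hev u hu0)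
  · have hu0 := h0.trans hu
    rw [rnV_rnR h hu0]
    refine pow_pos (div_pos ?_ (rnR_pos h hu0)) 2
    have h2 : u - (m ^ 2 + q ^ 2) / 4 * u⁻¹ = (u ^ 2 - rnU m q ^ 2) / u := by
      rw [hs2]; field_simp
    rw [h2]
    exact div_pos (sub_pos.2 (pow_lt_pow_left₀ hu h0.le (by norm_num))) hu0
  · have hu0 := h0.trans_le hu
    have hr := rnR_pos h hu0
    rw [rnV_rnR h hu0, Real.sqrt_sq (div_nonneg (hle u hu) hr.le)]
    refine (HasDerivAt.congr_of_eventuallyEq ?_ (hev u hu0))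
    refine (((hasDerivAt_id u).add_const m).add
      ((hasDerivAt_inv hu0.ne').const_mul ((m ^ 2 + q ^ 2) / 4))).congr_deriv ?_
    field_simp
    ring
  · refine tendsto_atTop_mono' (f₁ := fun u => u + m) _ ?_
      (tendsto_atTop_add_const_right _ m tendsto_id)
    filter_upwards [eventually_gt_atTop (0 : ℝ)] with u hu
    rw [rnR_eq hu.ne']
    have : 0 ≤ (m ^ 2 + q ^ 2) / 4 * u⁻¹ := by positivity
    linarith

/-- Here `k = 1`, and the charge enters the coefficients only through `A y²`, at second order. The
first derivatives at 0 are `2m` and `-2m`, so the mass is `2 · 2m - 2m`. -/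
theorem rn_asymptotics (h : 0 < m ∨ q ≠ 0) {G : ℝ → ℝ} (hG : IsProfile (rnV m q) (rnG₀ m q) G) :
    IsALF (trivialEnd 3 (rnU m q) (2 * Real.pi * rnC m q)) (dtForm 3)
      (pullback (endChart G (rnR m q) (rnC m q))
        (warped (fibreProfile (rnV m q) (rnC m q) G) G)) ∧
    massD (trivialEnd 3 (rnU m q) (2 * Real.pi * rnC m q)) (dtForm 3)
      (pullback (endChart G (rnR m q) (rnC m q))
        (warped (fibreProfile (rnV m q) (rnC m q) G) G)) = ((2 * m : ℝ) : EReal) := by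
  have hiso := isIsotropic_rn h
  have hc := rnC_pos h
  set A : ℝ := (m ^ 2 + q ^ 2) / 4 with hA
  have hb0 : ∀ᶠ y : ℝ in 𝓝 0, 0 < 1 + m * y + A * y ^ 2 := by
    have : ContinuousAt (fun y : ℝ => 1 + m * y + A * y ^ 2) 0 := by fun_prop
    exact this.eventually_const_lt (by simp)
  have hru : ∀ u : ℝ, 0 < u → rnR m q u = u * (1 + m * (u ^ 1)⁻¹ + A * (u ^ 1)⁻¹ ^ 2) := by
    intro u hu
    rw [rnR_eq hu.ne', ← hA]
    field_simp
  have hbu : ∀ u : ℝ, rnU m q < u → 0 < 1 + m * (u ^ 1)⁻¹ + A * (u ^ 1)⁻¹ ^ 2 := fun u hu => by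
    have hu0 := hiso.u₀_pos.trans hu
    have := rnR_pos h hu0
    rw [hru u hu0] at this
    exact pos_of_mul_pos_right this hu0.le
  have hp : ∀ y : ℝ, ContDiffAt ℝ ∞ (fun w : ℝ => (1 + m * w + A * w ^ 2) ^ 2) y :=
    fun y => by fun_prop
  have hN : ∀ y : ℝ, 0 < 1 + m * y + A * y ^ 2 →
      ContDiffAt ℝ ∞ (fun w : ℝ => ((1 - A * w ^ 2) / (1 + m * w + A * w ^ 2)) ^ 2) y :=
    fun y hy => by
      have h1 : ContDiffAt ℝ ∞ (fun w : ℝ => 1 - A * w ^ 2) y := by fun_prop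
      have h2 : ContDiffAt ℝ ∞ (fun w : ℝ => 1 + m * w + A * w ^ 2) y := by fun_prop
      exact (h1.div h2 hy.ne').pow 2
  have hsq : HasDerivAt (fun w : ℝ => A * w ^ 2) 0 0 := by
    simpa using (hasDerivAt_pow 2 (0 : ℝ)).const_mul A
  have hd : HasDerivAt (fun w : ℝ => 1 + m * w + A * w ^ 2) m 0 := by
    refine ((((hasDerivAt_id (0 : ℝ)).const_mul m).const_add 1).add hsq).congr_deriv ?_
    simp
  have hd' : HasDerivAt (fun w : ℝ => 1 - A * w ^ 2) 0 0 := by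
    simpa using hsq.const_sub 1
  have hdp : deriv (fun w : ℝ => (1 + m * w + A * w ^ 2) ^ 2) 0 = 2 * m := by
    have := (hd.pow 2).deriv
    simp only [Pi.pow_def] at this
    rw [this]; simp
  have hdn : deriv (fun w : ℝ => ((1 - A * w ^ 2) / (1 + m * w + A * w ^ 2)) ^ 2) 0
      = -(2 * m) := by
    have := ((hd'.div hd (by simp)).pow 2).deriv
    simp only [Pi.pow_def, Pi.div_apply] at this
    rw [this]; simp
  have hnu : ∀ u : ℝ, 0 < u → rnV m q (rnR m q u) =
      ((1 - A * (u ^ 1)⁻¹ ^ 2) / (1 + m * (u ^ 1)⁻¹ + A * (u ^ 1)⁻¹ ^ 2)) ^ 2 := by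
    intro u hu
    rw [rnV_rnR h hu, hru u hu]
    have : u - (m ^ 2 + q ^ 2) / 4 * u⁻¹ = u * (1 - A * (u ^ 1)⁻¹ ^ 2) := by
      rw [← hA]
      field_simp
    rw [this, mul_div_mul_left _ _ hu.ne']
  obtain ⟨h1, h2, -⟩ := static_radial le_rfl (L := 2 * Real.pi * rnC m q)
    hiso.u₀_pos (by positivity)
    (Eventually.of_forall hp) (hb0.mono fun y hy => hN y hy) (by simp) (by simp)
    (fun u hu => hp _) (fun u hu => hN _ (hbu u hu))
    (fun u hu => pow_pos (hbu u hu) 2)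
    (fun u hu => by
      rw [← hnu u (hiso.u₀_pos.trans hu)]
      exact hiso.V_pos u hu)
    (g := pullback (endChart G (rnR m q) (rnC m q))
      (warped (fibreProfile (rnV m q) (rnC m q) G) G))
    (fun z hz v w => by
      have hz0 := hiso.u₀_pos.trans hz
      rw [hiso.pullback_endChart hG hc hz, hnu _ hz0, hru _ hz0, mul_div_cancel_left₀ _ hz0.ne'])
  refine ⟨h1, h2.trans ?_⟩
  rw [hdp, hdn]
  congr 1
  push_cast
  ring

end ReissnerNordstrom

/-! ### Completeness of doubly warped metrics -/

section Complete

variable {m : ℕ} {F G : ℝ → ℝ} {K H : Euc 2 → ℝ}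

/-- The oriented area of the parallelogram spanned by two vectors of the plane. -/
def area (y a : Euc 2) : ℝ := y 0 * a 1 - y 1 * a 0

theorem sq_area (y a : Euc 2) : area y a ^ 2 = ‖y‖ ^ 2 * ‖a‖ ^ 2 - (inner ℝ y a : ℝ) ^ 2 := by
  rw [EuclideanSpace.real_norm_sq_eq, EuclideanSpace.real_norm_sq_eq]
  simp only [PiLp.inner_apply, Fin.sum_univ_two, area, RCLike.inner_apply, conj_trivial]
  ring

/-- The metric `dρ² + F² dθ² + G² dω²` extends smoothly and positively over `ρ = 0`:
`F² dθ² = ρ² dθ² + K ρ⁴ dθ²` and `G = H` for smooth functions `K`, `H` on the plane. -/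
structure IsSmoothWarping (F G : ℝ → ℝ) (K H : Euc 2 → ℝ) : Prop where
  smooth_K : ContDiff ℝ ∞ K
  smooth_H : ContDiff ℝ ∞ H
  polar : ∀ y a b, polarMetric F y a b = inner ℝ a b + K y * (area y a * area y b)
  eq_H : ∀ y, G ‖y‖ = H y
  pos_K : ∀ y, 0 < 1 + ‖y‖ ^ 2 * K y
  pos_H : ∀ y, 0 < H y

namespace IsSmoothWarping

/-- The eigenvalues of the planar part are 1 in the radial direction and `1 + ‖y‖² K` in the angular
one. The sign of `K` decides which is the smaller. -/
theorem polar_ge (h : IsSmoothWarping F G K H) (y a : Euc 2) :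
    min 1 (1 + ‖y‖ ^ 2 * K y) * ‖a‖ ^ 2 ≤ polarMetric F y a a := by
  rw [h.polar, real_inner_self_eq_norm_sq, ← sq, sq_area]
  rcases le_total 0 (K y) with hK | hK
  · have h1 : 0 ≤ ‖y‖ ^ 2 * ‖a‖ ^ 2 - (inner ℝ y a : ℝ) ^ 2 := by
      rw [← sq_area]; positivity
    have h2 : min 1 (1 + ‖y‖ ^ 2 * K y) * ‖a‖ ^ 2 ≤ 1 * ‖a‖ ^ 2 :=
      mul_le_mul_of_nonneg_right (min_le_left _ _) (by positivity)
    nlinarith [mul_nonneg hK h1]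
  · have h2 : min 1 (1 + ‖y‖ ^ 2 * K y) * ‖a‖ ^ 2 ≤ (1 + ‖y‖ ^ 2 * K y) * ‖a‖ ^ 2 :=
      mul_le_mul_of_nonneg_right (min_le_right _ _) (by positivity)
    nlinarith [mul_nonneg (neg_nonneg.2 hK) (sq_nonneg (inner ℝ y a : ℝ))]

theorem polar_le (h : IsSmoothWarping F G K H) (y a : Euc 2) :
    polarMetric F y a a ≤ max 1 (1 + ‖y‖ ^ 2 * K y) * ‖a‖ ^ 2 := by
  rw [h.polar, real_inner_self_eq_norm_sq, ← sq, sq_area]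
  rcases le_total 0 (K y) with hK | hK
  · have h2 : (1 + ‖y‖ ^ 2 * K y) * ‖a‖ ^ 2 ≤ max 1 (1 + ‖y‖ ^ 2 * K y) * ‖a‖ ^ 2 :=
      mul_le_mul_of_nonneg_right (le_max_right _ _) (by positivity)
    nlinarith [mul_nonneg hK (sq_nonneg (inner ℝ y a : ℝ))]
  · have h1 : 0 ≤ ‖y‖ ^ 2 * ‖a‖ ^ 2 - (inner ℝ y a : ℝ) ^ 2 := by
      rw [← sq_area]; positivity
    have h2 : 1 * ‖a‖ ^ 2 ≤ max 1 (1 + ‖y‖ ^ 2 * K y) * ‖a‖ ^ 2 :=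
      mul_le_mul_of_nonneg_right (le_max_left _ _) (by positivity)
    nlinarith [mul_nonneg (neg_nonneg.2 hK) h1]

/-- The radial component is not longer than the vector: `⟨y, a⟩² ≤ ‖y‖² g(a, a)`. With the factor `1
+ ‖y‖²` this bounds the derivative of `√(1 + ‖y‖²)`, which is smooth also at the origin. -/
theorem sq_inner_le (h : IsSmoothWarping F G K H) (y a : Euc 2) :
    (inner ℝ y a : ℝ) ^ 2 ≤ (1 + ‖y‖ ^ 2) * polarMetric F y a a := by
  have h1 : 0 ≤ polarMetric F y a a :=
    (mul_nonneg (le_min zero_le_one (h.pos_K y).le) (sq_nonneg ‖a‖)).trans (h.polar_ge y a)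
  have h2 : ‖y‖ ^ 2 * polarMetric F y a a =
      (inner ℝ y a : ℝ) ^ 2 + (1 + ‖y‖ ^ 2 * K y) * area y a ^ 2 := by
    rw [h.polar, real_inner_self_eq_norm_sq, ← sq, sq_area]
    ring
  have h3 := mul_nonneg (h.pos_K y).le (sq_nonneg (area y a))
  linarith

theorem warped_eq (h : IsSmoothWarping F G K H) (p v w : Amb m) :
    warped F G p v w = inner ℝ v.1 w.1 + K p.1 * (area p.1 v.1 * area p.1 w.1)
      + H p.1 ^ 2 * inner ℝ v.2 w.2 := by
  rw [warped, h.polar, h.eq_H]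

theorem isMetricOn (h : IsSmoothWarping F G K H) : IsMetricOn univ (warped (m := m) F G) where
  linear := fun z _ v => by
    constructor
    · intro a b
      simp only [h.warped_eq, Prod.fst_add, Prod.snd_add, inner_add_right, area, PiLp.add_apply]
      ring
    · intro c a
      simp only [h.warped_eq, Prod.smul_fst, Prod.smul_snd, inner_smul_right, area,
        PiLp.smul_apply, smul_eq_mul]
      ring
  symm := fun z _ v w => by
    rw [h.warped_eq, h.warped_eq, real_inner_comm w.1, real_inner_comm w.2,
      mul_comm (area z.1 v.1)]
  pos := fun z _ v hv => by
    rw [warped, real_inner_self_eq_norm_sq, h.eq_H]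
    have h1 := h.polar_ge z.1 v.1
    have h2 : 0 < min 1 (1 + ‖z.1‖ ^ 2 * K z.1) := lt_min one_pos (h.pos_K z.1)
    have h3 := h.pos_H z.1
    by_cases hv1 : v.1 = 0
    · have hv2 : v.2 ≠ 0 := fun h0 => hv (Prod.ext hv1 h0)
      have h4 : 0 < ‖v.2‖ := norm_pos_iff.2 hv2
      have : 0 < H z.1 ^ 2 * ‖v.2‖ ^ 2 := by positivity
      have : 0 ≤ min 1 (1 + ‖z.1‖ ^ 2 * K z.1) * ‖v.1‖ ^ 2 := by positivity
      linarith
    · have h4 : 0 < ‖v.1‖ := norm_pos_iff.2 hv1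
      have : 0 ≤ H z.1 ^ 2 * ‖v.2‖ ^ 2 := by positivity
      have : 0 < min 1 (1 + ‖z.1‖ ^ 2 * K z.1) * ‖v.1‖ ^ 2 := by positivity
      linarith
  smooth := fun v w => by
    simp_rw [h.warped_eq]
    have h1 : ContDiff ℝ ∞ fun p : Amb m => K p.1 := h.smooth_K.comp contDiff_fst
    have h2 : ContDiff ℝ ∞ fun p : Amb m => H p.1 := h.smooth_H.comp contDiff_fst
    have h3 : ∀ a, ContDiff ℝ ∞ fun p : Amb m => area p.1 a := fun a => by
      unfold area
      fun_prop
    exact ((contDiff_const.add (h1.mul ((h3 _).mul (h3 _)))).add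
      ((h2.pow 2).mul contDiff_const)).contDiffOn

/-- Two-sided bounds of the metric on a ball. -/
theorem exists_bounds (h : IsSmoothWarping F G K H) (M : ℝ) :
    ∃ l B : ℝ, 0 < l ∧ 0 < B ∧ ∀ p v : Amb m, ‖p.1‖ ≤ M →
      l ^ 2 * ‖v‖ ^ 2 ≤ warped F G p v v ∧ warped F G p v v ≤ B ^ 2 * ‖v‖ ^ 2 := by
  have hc : IsCompact (Metric.closedBall (0 : Euc 2) M) := isCompact_closedBall 0 M
  have hcK : Continuous fun y : Euc 2 => 1 + ‖y‖ ^ 2 * K y := by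
    have := h.smooth_K.continuous
    fun_prop
  have hcH := h.smooth_H.continuous
  have key : ∀ f : Euc 2 → ℝ, Continuous f → (∀ y, 0 < f y) →
      ∃ l B : ℝ, 0 < l ∧ 0 < B ∧ ∀ y : Euc 2, ‖y‖ ≤ M → l ≤ f y ∧ f y ≤ B := by
    intro f hf hpos
    rcases (Metric.closedBall (0 : Euc 2) M).eq_empty_or_nonempty with he | hne
    · refine ⟨1, 1, one_pos, one_pos, fun y hy => ?_⟩
      have : y ∈ Metric.closedBall (0 : Euc 2) M := by simpa using hy
      rw [he] at this
      exact this.elim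
    · obtain ⟨y₁, -, h1⟩ := hc.exists_isMinOn hne hf.continuousOn
      obtain ⟨y₂, -, h2⟩ := hc.exists_isMaxOn hne hf.continuousOn
      refine ⟨f y₁, f y₂, hpos _, hpos _, fun y hy => ?_⟩
      have : y ∈ Metric.closedBall (0 : Euc 2) M := by simpa using hy
      exact ⟨h1 this, h2 this⟩
  obtain ⟨l₁, B₁, hl₁, hB₁, hK⟩ := key _ hcK h.pos_K
  obtain ⟨l₂, B₂, hl₂, hB₂, hH⟩ := key _ hcH h.pos_H
  refine ⟨Real.sqrt (min (min 1 l₁) (l₂ ^ 2)), Real.sqrt (max 1 B₁ + B₂ ^ 2),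
    Real.sqrt_pos.2 (by positivity), Real.sqrt_pos.2 (by positivity), fun p v hp => ?_⟩
  rw [Real.sq_sqrt (by positivity), Real.sq_sqrt (by positivity), warped,
    real_inner_self_eq_norm_sq, h.eq_H]
  obtain ⟨hK1, hK2⟩ := hK p.1 hp
  obtain ⟨hH1, hH2⟩ := hH p.1 hp
  have h1 := h.polar_ge p.1 v.1
  have h2 := h.polar_le p.1 v.1
  have e1 : ‖v.1‖ ≤ ‖v‖ := norm_fst_le v
  have e2 : ‖v.2‖ ≤ ‖v‖ := norm_snd_le v
  have s1 : ‖v.1‖ ^ 2 ≤ ‖v‖ ^ 2 := pow_le_pow_left₀ (norm_nonneg _) e1 2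
  have s2 : ‖v.2‖ ^ 2 ≤ ‖v‖ ^ 2 := pow_le_pow_left₀ (norm_nonneg _) e2 2
  have hm : 0 ≤ min (min 1 l₁) (l₂ ^ 2) := by positivity
  have hH0 := h.pos_H p.1
  have k1 : min (min 1 l₁) (l₂ ^ 2) * ‖v.1‖ ^ 2 ≤ polarMetric F p.1 v.1 v.1 := by
    refine le_trans (mul_le_mul_of_nonneg_right ?_ (sq_nonneg _)) h1
    exact (min_le_left _ _).trans (min_le_min_left _ hK1)
  have k2 : min (min 1 l₁) (l₂ ^ 2) * ‖v.2‖ ^ 2 ≤ H p.1 ^ 2 * ‖v.2‖ ^ 2 :=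
    mul_le_mul_of_nonneg_right ((min_le_right _ _).trans (pow_le_pow_left₀ hl₂.le hH1 2))
      (sq_nonneg _)
  constructor
  · have k0 : ‖v‖ ^ 2 ≤ ‖v.1‖ ^ 2 + ‖v.2‖ ^ 2 := by
      rcases max_choice ‖v.1‖ ‖v.2‖ with hh | hh <;> rw [Prod.norm_def, hh] <;> nlinarith
    nlinarith [mul_le_mul_of_nonneg_left k0 hm]
  · have k3 : max 1 (1 + ‖p.1‖ ^ 2 * K p.1) * ‖v.1‖ ^ 2 ≤ max 1 B₁ * ‖v‖ ^ 2 :=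
      mul_le_mul (max_le_max_left _ hK2) s1 (sq_nonneg _) (by positivity)
    have k4 : H p.1 ^ 2 * ‖v.2‖ ^ 2 ≤ B₂ ^ 2 * ‖v‖ ^ 2 :=
      mul_le_mul (pow_le_pow_left₀ hH0.le hH2 2) s2 (sq_nonneg _) (by positivity)
    linarith

theorem continuous_speed (h : IsSmoothWarping F G K H) {γ : ℝ → Amb m} (hγ : ContDiff ℝ 1 γ) :
    Continuous fun t => Real.sqrt (warped F G (γ t) (deriv γ t) (deriv γ t)) := by
  have h0 := hγ.continuous
  have h1 : Continuous (deriv γ) := hγ.continuous_deriv le_rfl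
  have hK := h.smooth_K.continuous
  have hH := h.smooth_H.continuous
  simp_rw [h.warped_eq, area]
  fun_prop

end IsSmoothWarping

/-- A function is controlled by the integral of a bound of its derivative. -/
theorem norm_sub_le_integral {E : Type*} [NormedAddCommGroup E] [NormedSpace ℝ E]
    [CompleteSpace E] {f f' : ℝ → E} {s : ℝ → ℝ} (hf : ∀ t, HasDerivAt f (f' t) t)
    (hf' : Continuous f') (hs : Continuous s) {b : ℝ} (hb : 0 ≤ b)
    (hle : ∀ t ∈ Icc 0 b, ‖f' t‖ ≤ s t) : ‖f b - f 0‖ ≤ ∫ t in (0 : ℝ)..b, s t := by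
  rw [← intervalIntegral.integral_eq_sub_of_hasDerivAt (fun t _ => hf t)
    (hf'.intervalIntegrable 0 b)]
  refine (intervalIntegral.norm_integral_le_integral_norm hb).trans ?_
  exact intervalIntegral.integral_mono_on hb (hf'.norm.intervalIntegrable 0 b)
    (hs.intervalIntegrable 0 b) hle

/-- A function controlled by the length of curves: its derivative is bounded by the metric. -/
theorem IsSmoothWarping.radial_le (h : IsSmoothWarping F G K H) {γ : ℝ → Amb m}
    (hγ : ContDiff ℝ 1 γ) {b : ℝ} (hb : 0 ≤ b) :
    |Real.sqrt (1 + ‖(γ b).1‖ ^ 2) - Real.sqrt (1 + ‖(γ 0).1‖ ^ 2)| ≤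
      ∫ t in (0 : ℝ)..b, Real.sqrt (warped F G (γ t) (deriv γ t) (deriv γ t)) := by
  have h1 : Continuous (deriv γ) := hγ.continuous_deriv le_rfl
  have h0 := hγ.continuous
  have hd : ∀ t, HasDerivAt γ (deriv γ t) t := fun t =>
    (hγ.differentiable one_ne_zero t).hasDerivAt
  have hpos : ∀ t, 0 < 1 + ‖(γ t).1‖ ^ 2 := fun t => by positivity
  have hd1 : ∀ t, HasDerivAt (fun t => (γ t).1) (deriv γ t).1 t := fun t =>
    (ContinuousLinearMap.fst ℝ (Euc 2) (Euc m)).hasFDerivAt.comp_hasDerivAt t (hd t)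
  have hder : ∀ t, HasDerivAt (fun t => Real.sqrt (1 + ‖(γ t).1‖ ^ 2))
      (2 * (inner ℝ (γ t).1 (deriv γ t).1 : ℝ) / (2 * Real.sqrt (1 + ‖(γ t).1‖ ^ 2))) t :=
    fun t => ((hd1 t).norm_sq.const_add 1).sqrt (hpos t).ne'
  refine norm_sub_le_integral hder ?_ (h.continuous_speed hγ) hb fun t _ => ?_
  · refine Continuous.div (by fun_prop) (by fun_prop) fun t => ?_
    have := Real.sqrt_pos.2 (hpos t)
    positivity
  · have hs := Real.sqrt_pos.2 (hpos t)
    rw [mul_div_mul_left _ _ two_ne_zero, Real.norm_eq_abs, abs_div, abs_of_pos hs,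
      div_le_iff₀ hs, ← Real.sqrt_mul' _ (hpos t).le]
    refine Real.abs_le_sqrt ?_
    have h2 := h.sq_inner_le (γ t).1 (deriv γ t).1
    have h3 : polarMetric F (γ t).1 (deriv γ t).1 (deriv γ t).1 ≤
        warped F G (γ t) (deriv γ t) (deriv γ t) := by
      rw [warped, real_inner_self_eq_norm_sq]
      have : 0 ≤ G ‖(γ t).1‖ ^ 2 * ‖(deriv γ t).2‖ ^ 2 := by positivity
      linarith
    calc _ ≤ _ := h2
      _ ≤ _ := mul_le_mul_of_nonneg_left h3 (hpos t).le
      _ = _ := mul_comm _ _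

/-- Short curves that start in a given ball are long in the Euclidean sense only if they are long
for the metric. -/
theorem IsSmoothWarping.exists_norm_sub_le (h : IsSmoothWarping F G K H) (M : ℝ) :
    ∃ C : ℝ, 0 < C ∧ ∀ p q : Amb m, ‖p.1‖ ≤ M → ∀ ε : ℝ, ε ≤ 1 →
      riemDist (warped F G) p q < ENNReal.ofReal ε → ‖q - p‖ ≤ C * ε := by
  -- A curve of length at most 1 that starts in the ball of radius `M` stays in the ball of radius
  -- `√(1 + M²) + 1`, because `√(1 + ‖y‖²)` is 1-Lipschitz. The uniform lower bound of the metric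
  -- holds there.
  obtain ⟨l, B, hl, -, hlB⟩ := h.exists_bounds (m := m) (Real.sqrt (1 + M ^ 2) + 1)
  refine ⟨l⁻¹, inv_pos.2 hl, fun p q hp ε hε hd => ?_⟩
  simp only [riemDist, iInf_lt_iff] at hd
  obtain ⟨γ, ⟨hγ, hγ0, hγ1, -⟩, hlen⟩ := hd
  have hlen' : ∫ t in (0 : ℝ)..1, Real.sqrt (warped F G (γ t) (deriv γ t) (deriv γ t)) ≤ ε :=
    (ENNReal.ofReal_lt_ofReal_iff'.1 hlen).1.le
  have hcs := h.continuous_speed hγ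
  have hstay : ∀ t ∈ Icc (0 : ℝ) 1, ‖(γ t).1‖ ≤ Real.sqrt (1 + M ^ 2) + 1 := by
    intro t ht
    have h1 := h.radial_le hγ ht.1
    have h2 : ∫ t in (0 : ℝ)..t, Real.sqrt (warped F G (γ t) (deriv γ t) (deriv γ t)) ≤
        ∫ t in (0 : ℝ)..1, Real.sqrt (warped F G (γ t) (deriv γ t) (deriv γ t)) :=
      intervalIntegral.integral_mono_interval le_rfl ht.1 ht.2
        (ae_of_all _ fun _ => Real.sqrt_nonneg _) (hcs.intervalIntegrable 0 1)
    have h3 : Real.sqrt (1 + ‖(γ 0).1‖ ^ 2) ≤ Real.sqrt (1 + M ^ 2) := by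
      rw [hγ0]
      refine Real.sqrt_le_sqrt ?_
      have := pow_le_pow_left₀ (norm_nonneg _) hp 2
      linarith
    have h4 : ‖(γ t).1‖ ≤ Real.sqrt (1 + ‖(γ t).1‖ ^ 2) := Real.le_sqrt_of_sq_le (by linarith)
    have h5 := (le_abs_self _).trans h1
    linarith
  have h6 := norm_sub_le_integral (f := γ) (f' := deriv γ)
    (s := fun t => l⁻¹ * Real.sqrt (warped F G (γ t) (deriv γ t) (deriv γ t)))
    (fun t => (hγ.differentiable one_ne_zero t).hasDerivAt) (hγ.continuous_deriv le_rfl)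
    (continuous_const.mul hcs) zero_le_one fun t ht => by
      rw [← div_eq_inv_mul, le_div_iff₀ hl]
      refine Real.le_sqrt_of_sq_le ?_
      have := (hlB (γ t) (deriv γ t) (hstay t ht)).1
      rw [mul_pow]
      linarith
  rw [intervalIntegral.integral_const_mul, hγ0, hγ1] at h6
  exact h6.trans (mul_le_mul_of_nonneg_left hlen' (inv_pos.2 hl).le)

/-- The line through two points of the unit sphere at distance at most 1 stays away from the origin,
so it can be projected radially to the sphere. -/
theorem norm_sq_segment {E : Type*} [NormedAddCommGroup E] [InnerProductSpace ℝ E] {w w' : E}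
    (hw : ‖w‖ = 1) (hw' : ‖w'‖ = 1) (t : ℝ) :
    ‖w + t • (w' - w)‖ ^ 2 = 1 - t * (1 - t) * ‖w' - w‖ ^ 2 := by
  have h1 : ‖w' - w‖ ^ 2 = 2 - 2 * (inner ℝ w w' : ℝ) := by
    rw [norm_sub_sq_real, hw, hw', real_inner_comm]
    ring
  rw [norm_add_sq_real, inner_smul_right, inner_sub_right, real_inner_self_eq_norm_sq, norm_smul,
    mul_pow, h1, hw, Real.norm_eq_abs, sq_abs]
  ring

theorem hasDerivAt_segment {E : Type*} [NormedAddCommGroup E] [NormedSpace ℝ E] (w d : E)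
    (t : ℝ) : HasDerivAt (fun t : ℝ => w + t • d) d t := by
  refine (((hasDerivAt_id t).smul_const d).const_add w).congr_deriv ?_
  simp

/-- Nearby points of `ℝ² × 𝕊^{m-1}` are joined by short curves. -/
theorem IsSmoothWarping.exists_riemDist_le (h : IsSmoothWarping F G K H) (M : ℝ) :
    ∃ C : ℝ, 0 < C ∧ ∀ p q : Amb m, p ∈ Mfd m → q ∈ Mfd m → ‖p.1‖ ≤ M → ‖q.1‖ ≤ M →
      ‖q - p‖ ≤ 1 → riemDist (warped F G) p q ≤ ENNReal.ofReal (C * ‖q - p‖) := by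
  obtain ⟨l, B, -, hB, hlB⟩ := h.exists_bounds (m := m) M
  refine ⟨B * 2, by positivity, fun p q hp hq hpM hqM hpq => ?_⟩
  have hp' : ‖p.2‖ = 1 := hp
  have hq' : ‖q.2‖ = 1 := hq
  have e1 : ‖q.1 - p.1‖ ≤ ‖q - p‖ := norm_fst_le (q - p)
  have e2 : ‖q.2 - p.2‖ ≤ ‖q - p‖ := norm_snd_le (q - p)
  set x : ℝ → Euc m := fun t => p.2 + t • (q.2 - p.2) with hx
  have hxn : ∀ t, (1 / 2 : ℝ) ^ 2 ≤ ‖x t‖ ^ 2 := fun t => by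
    rw [hx, norm_sq_segment hp' hq']
    have h1 : ‖q.2 - p.2‖ ^ 2 ≤ 1 := pow_le_one₀ (norm_nonneg _) (e2.trans hpq)
    nlinarith [sq_nonneg (t - 1 / 2), sq_nonneg ‖q.2 - p.2‖]
  have hxn' : ∀ t, 1 / 2 ≤ ‖x t‖ := fun t =>
    (pow_le_pow_iff_left₀ (by norm_num) (norm_nonneg _) two_ne_zero).1 (hxn t)
  have hx0 : ∀ t, x t ≠ 0 := fun t => norm_pos_iff.1 (lt_of_lt_of_le (by norm_num) (hxn' t))
  have hxc : ContDiff ℝ 1 x := by fun_prop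
  have hxd : ∀ t, HasDerivAt x (q.2 - p.2) t := fun t =>
    hasDerivAt_segment _ _ t
  -- A straight segment in ℝ² together with the radial projection of the chord to the sphere.
  set γ : ℝ → Amb m := fun t => (p.1 + t • (q.1 - p.1), ‖x t‖⁻¹ • x t) with hγ
  have hγc : ContDiff ℝ 1 γ := by
    refine ContDiff.prodMk (by fun_prop) (ContDiff.smul (ContDiff.inv (hxc.norm ℝ hx0) ?_) hxc)
    exact fun t => norm_ne_zero_iff.2 (hx0 t)
  have hd1 : ∀ t : ℝ, HasDerivAt (fun t : ℝ => p.1 + t • (q.1 - p.1)) (q.1 - p.1) t := fun t =>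
    hasDerivAt_segment _ _ t
  have hd2 : ∀ t, HasDerivAt (fun t => ‖x t‖⁻¹ • x t) (‖x t‖⁻¹ • ((q.2 - p.2)
      - (inner ℝ (‖x t‖⁻¹ • x t) (q.2 - p.2) : ℝ) • (‖x t‖⁻¹ • x t))) t := by
    intro t
    have hn := norm_ne_zero_iff.2 (hx0 t)
    have h1 := ((hasFDerivAt_radial (hx0 t) (hasDerivAt_inv hn)).comp_hasDerivAt t (hxd t)).smul
      (hxd t)
    refine h1.congr_deriv ?_
    generalize q.2 - p.2 = d
    simp only [Function.comp_apply, smul_apply, innerSL_apply_apply, smul_eq_mul, inner_smul_left,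
      smul_sub, smul_smul]
    rw [sub_eq_add_neg, ← neg_smul]
    congr 2
    simp
    field_simp
  have hder : ∀ t, deriv γ t = (q.1 - p.1, ‖x t‖⁻¹ • ((q.2 - p.2)
      - (inner ℝ (‖x t‖⁻¹ • x t) (q.2 - p.2) : ℝ) • (‖x t‖⁻¹ • x t))) := fun t =>
    ((hd1 t).prodMk (hd2 t)).deriv
  -- The radial projection drops the normal component and scales by `1/‖x‖ ≤ 2`.
  have hnd : ∀ t, ‖deriv γ t‖ ≤ 2 * ‖q - p‖ := by
    intro t
    rw [hder, Prod.norm_def]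
    refine max_le (e1.trans (by linarith [norm_nonneg (q - p)])) ?_
    have h1 : (inner ℝ (‖x t‖⁻¹ • x t) (‖x t‖⁻¹ • x t) : ℝ) = 1 := by
      rw [real_inner_self_eq_norm_sq, IsIsotropic.norm_inv_smul_self (hx0 t), one_pow]
    refine (pow_le_pow_iff_left₀ (norm_nonneg _) (by positivity) two_ne_zero).1 ?_
    rw [← real_inner_self_eq_norm_sq, IsIsotropic.inner_smul_sub_smul h1,
      real_inner_self_eq_norm_sq]
    have h2 : (‖x t‖⁻¹) ^ 2 ≤ 2 ^ 2 := by
      refine pow_le_pow_left₀ (by positivity) ?_ 2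
      rw [inv_le_comm₀ (lt_of_lt_of_le (by norm_num) (hxn' t)) two_pos, ← one_div]
      exact hxn' t
    have h3 : ‖q.2 - p.2‖ ^ 2 - (inner ℝ (‖x t‖⁻¹ • x t) (q.2 - p.2) : ℝ)
        * inner ℝ (‖x t‖⁻¹ • x t) (q.2 - p.2) ≤ ‖q - p‖ ^ 2 := by
      have := pow_le_pow_left₀ (norm_nonneg _) e2 2
      nlinarith [mul_self_nonneg (inner ℝ (‖x t‖⁻¹ • x t) (q.2 - p.2) : ℝ)]
    calc _ ≤ (‖x t‖⁻¹) ^ 2 * ‖q - p‖ ^ 2 := mul_le_mul_of_nonneg_left h3 (by positivity)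
      _ ≤ 2 ^ 2 * ‖q - p‖ ^ 2 := mul_le_mul_of_nonneg_right h2 (by positivity)
      _ = _ := by ring
  have hstay : ∀ t ∈ Icc (0 : ℝ) 1, ‖(γ t).1‖ ≤ M := by
    intro t ht
    have h1 : (γ t).1 = (1 - t) • p.1 + t • q.1 := by simp only [hγ]; module
    rw [h1]
    refine (norm_add_le _ _).trans ?_
    rw [norm_smul, norm_smul, Real.norm_of_nonneg ht.1, Real.norm_of_nonneg (sub_nonneg.2 ht.2)]
    nlinarith [mul_le_mul_of_nonneg_left hpM (sub_nonneg.2 ht.2),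
      mul_le_mul_of_nonneg_left hqM ht.1]
  have hx00 : x 0 = p.2 := by simp [hx]
  have hx11 : x 1 = q.2 := by simp [hx]
  have hends : ContDiff ℝ 1 γ ∧ γ 0 = p ∧ γ 1 = q ∧ ∀ t ∈ Icc (0 : ℝ) 1, γ t ∈ Mfd m := by
    refine ⟨hγc, Prod.ext ?_ ?_, Prod.ext ?_ ?_,
      fun t _ => IsIsotropic.norm_inv_smul_self (hx0 t)⟩
    · simp [hγ]
    · simp only [hγ, hx00, hp', inv_one, one_smul]
    · simp [hγ]
    · simp only [hγ, hx11, hq', inv_one, one_smul]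
  refine (iInf₂_le γ hends).trans (ENNReal.ofReal_le_ofReal ?_)
  have : ∀ t ∈ Icc (0 : ℝ) 1, Real.sqrt (warped F G (γ t) (deriv γ t) (deriv γ t)) ≤
      B * 2 * ‖q - p‖ := by
    intro t ht
    refine Real.sqrt_le_iff.2 ⟨by positivity, ((hlB _ _ (hstay t ht)).2).trans ?_⟩
    rw [mul_assoc, mul_pow]
    exact mul_le_mul_of_nonneg_left (pow_le_pow_left₀ (norm_nonneg _) (hnd t) 2) (by positivity)
  have h2 := intervalIntegral.integral_mono_on (μ := volume) zero_le_one
    ((h.continuous_speed hγc).intervalIntegrable 0 1)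
    (continuous_const.intervalIntegrable 0 1) this
  simpa using h2

/-- A Cauchy sequence for the metric has bounded planar part. On that bounded region the metric is
comparable with the Euclidean one, so the sequence is Cauchy in the ambient space; its limit lies on
the closed set `Mfd m`, and short curves give convergence for the metric. -/
theorem IsSmoothWarping.isCompleteMetric (h : IsSmoothWarping F G K H) :
    IsCompleteMetric (warped (m := m) F G) := by
  refine ⟨h.isMetricOn, fun p hp hcauchy => ?_⟩
  obtain ⟨N, hN⟩ := hcauchy (ENNReal.ofReal 1) (by simp)
  set M := ‖(p N).1‖ with hM
  obtain ⟨C₀, hC₀, h0⟩ := h.exists_norm_sub_le (m := m) M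
  have hbd : ∀ j, N ≤ j → ‖(p j).1‖ ≤ M + C₀ := by
    intro j hj
    have h1 := h0 (p N) (p j) le_rfl 1 le_rfl (hN N j le_rfl hj)
    have h2 : ‖(p j).1 - (p N).1‖ ≤ ‖p j - p N‖ := norm_fst_le (p j - p N)
    have h3 := norm_le_insert' (p j).1 (p N).1
    linarith
  obtain ⟨C₁, hC₁, h1⟩ := h.exists_norm_sub_le (m := m) (M + C₀)
  have hC : CauchySeq p := by
    refine Metric.cauchySeq_iff.2 fun ε hε => ?_
    set δ := min 1 (ε / (2 * C₁)) with hδ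
    have hδ0 : 0 < δ := by positivity
    obtain ⟨N', hN'⟩ := hcauchy (ENNReal.ofReal δ) (by simpa using hδ0)
    refine ⟨max N N', fun i hi j hj => ?_⟩
    have h2 := h1 (p j) (p i) (hbd j ((le_max_left _ _).trans hj)) δ (min_le_left _ _)
      (hN' j i ((le_max_right _ _).trans hj) ((le_max_right _ _).trans hi))
    rw [dist_eq_norm]
    have h3 : C₁ * δ ≤ C₁ * (ε / (2 * C₁)) :=
      mul_le_mul_of_nonneg_left (min_le_right _ _) hC₁.le
    have h4 : C₁ * (ε / (2 * C₁)) = ε / 2 := by field_simp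
    linarith
  obtain ⟨x, hx⟩ := cauchySeq_tendsto_of_complete hC
  have hclosed : IsClosed (Mfd m) :=
    isClosed_eq (continuous_norm.comp continuous_snd) continuous_const
  have hxM : x ∈ Mfd m := hclosed.mem_of_tendsto hx (Eventually.of_forall hp)
  refine ⟨x, hxM, ?_⟩
  have hxb : ‖x.1‖ ≤ M + C₀ :=
    le_of_tendsto ((continuous_norm.comp continuous_fst).continuousAt.tendsto.comp hx)
      ((eventually_ge_atTop N).mono hbd)
  obtain ⟨C₂, hC₂, h2⟩ := h.exists_riemDist_le (m := m) (M + C₀)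
  have hlim : Tendsto (fun j => ‖x - p j‖) atTop (𝓝 0) := by
    have := (tendsto_const_nhds (x := x)).sub hx
    rw [sub_self] at this
    simpa using this.norm
  have hlim2 : Tendsto (fun j => ENNReal.ofReal (C₂ * ‖x - p j‖)) atTop (𝓝 0) := by
    have := ENNReal.tendsto_ofReal (hlim.const_mul C₂)
    simpa using this
  refine tendsto_of_tendsto_of_tendsto_of_le_of_le' tendsto_const_nhds hlim2
    (Eventually.of_forall fun _ => zero_le) ?_
  filter_upwards [eventually_ge_atTop N, hlim.eventually (eventually_le_nhds one_pos)] with j hj hj1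
  exact h2 (p j) x (hp j) hxM (hbd j hj) hxb hj1

end Complete

/-! ### Smoothness of Reissner–Nordström metrics at the horizon -/

/-- `sinh τ = τ S(τ²)` for an analytic function `S`. -/
theorem exists_analytic_sinh : ∃ S : ℝ → ℝ, AnalyticAt ℝ S 0 ∧ S 0 = 1 ∧
    ∀ τ, Real.sinh τ = τ * S (τ ^ 2) := by
  set c : ℕ → ℝ := fun n => (((2 * n + 1).factorial : ℕ) : ℝ)⁻¹ with hc
  set p := FormalMultilinearSeries.ofScalars ℝ c with hp
  have hr : 0 < p.radius := by
    refine lt_of_lt_of_le (b := ((1 : NNReal) : ENNReal)) (by simp) ?_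
    -- The coefficients `1/(2n + 1)!` are at most 1, so the radius of convergence is at least 1;
    -- only its positivity matters.
    refine p.le_radius_of_bound 1 fun n => ?_
    rw [hp, FormalMultilinearSeries.ofScalars_norm]
    simp only [NNReal.coe_one, one_pow, mul_one, hc, norm_inv, Real.norm_natCast]
    exact inv_le_one_of_one_le₀ (by exact_mod_cast Nat.one_le_iff_ne_zero.2 (Nat.factorial_ne_zero _))
  refine ⟨FormalMultilinearSeries.ofScalarsSum c, (p.hasFPowerSeriesOnBall hr).analyticAt, ?_,
    fun τ => ?_⟩
  · simp [hc]
  · rw [FormalMultilinearSeries.ofScalars_sum_eq, ← tsum_mul_left]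
    rw [(Real.hasSum_sinh τ).tsum_eq.symm]
    refine tsum_congr fun n => ?_
    simp only [hc, smul_eq_mul]
    rw [pow_succ, pow_mul]
    field_simp

/-- A doubly warped metric is smooth if `F` and `G` are smooth away from `ρ = 0`, and if, near
`ρ = 0`, `G` and `(F²/ρ² - 1)/ρ²` are smooth functions of `ρ²`. -/
theorem exists_isSmoothWarping {F G Kg Hg : ℝ → ℝ} (hF : ∀ ρ, 0 < ρ → ContDiffAt ℝ ∞ F ρ)
    (hG : ∀ ρ, 0 < ρ → ContDiffAt ℝ ∞ G ρ) (hF0 : ∀ ρ, 0 < ρ → 0 < F ρ)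
    (hG0 : ∀ ρ, 0 ≤ ρ → 0 < G ρ) (hKg : ContDiffAt ℝ ∞ Kg 0) (hHg : ContDiffAt ℝ ∞ Hg 0)
    (hK : ∀ᶠ ρ in 𝓝[>] 0, F ρ ^ 2 = ρ ^ 2 * (1 + ρ ^ 2 * Kg (ρ ^ 2)))
    (hH : ∀ᶠ ρ in 𝓝[>] 0, G ρ = Hg (ρ ^ 2)) (hH0 : G 0 = Hg 0) :
    ∃ K H : Euc 2 → ℝ, IsSmoothWarping F G K H := by
  classical
  set K : Euc 2 → ℝ := fun y => if y = 0 then Kg 0 else (F ‖y‖ ^ 2 / ‖y‖ ^ 2 - 1) / ‖y‖ ^ 2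
    with hKdef
  have hnorm : ∀ {P : ℝ → Prop}, (∀ᶠ ρ in 𝓝[>] 0, P ρ) →
      ∀ᶠ y : Euc 2 in 𝓝 0, y ≠ 0 → P ‖y‖ := by
    intro P hP
    rw [eventually_nhdsWithin_iff] at hP
    have : Tendsto (fun y : Euc 2 => ‖y‖) (𝓝 0) (𝓝 0) := by
      simpa using (continuous_norm (E := Euc 2)).tendsto 0
    exact (this.eventually hP).mono fun y hy h0 => hy (norm_pos_iff.2 h0)
  have hKne : ∀ y : Euc 2, y ≠ 0 → K y = (F ‖y‖ ^ 2 / ‖y‖ ^ 2 - 1) / ‖y‖ ^ 2 := fun y hy =>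
    if_neg hy
  have hsq : ContDiffAt ℝ ∞ (fun y : Euc 2 => ‖y‖ ^ 2) 0 := (contDiff_norm_sq ℝ).contDiffAt
  have h00 : ‖(0 : Euc 2)‖ ^ 2 = 0 := by simp
  have hnc : ∀ y : Euc 2, y ≠ 0 → ContDiffAt ℝ ∞ (fun y : Euc 2 => ‖y‖) y := fun y hy =>
    contDiffAt_norm ℝ hy
  refine ⟨K, fun y => G ‖y‖, ?_, ?_, ?_, fun _ => rfl, ?_, fun y => hG0 _ (norm_nonneg _)⟩
  · rw [contDiff_iff_contDiffAt]
    intro y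
    by_cases hy : y = 0
    · subst hy
      have h1 : ContDiffAt ℝ ∞ (fun y : Euc 2 => Kg (‖y‖ ^ 2)) 0 :=
        ContDiffAt.comp (0 : Euc 2) (by rw [h00]; exact hKg) hsq
      refine h1.congr_of_eventuallyEq ?_
      filter_upwards [hnorm hK] with y hy
      by_cases hy0 : y = 0
      · simp [hKdef, hy0]
      · have hn := norm_ne_zero_iff.2 hy0
        rw [hKne y hy0, hy hy0]
        field_simp
        ring
    · have hn := norm_ne_zero_iff.2 hy
      have h1 : ContDiffAt ℝ ∞ (fun y : Euc 2 => F ‖y‖) y :=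
        (hF ‖y‖ (norm_pos_iff.2 hy)).comp y (hnc y hy)
      have h2 : ContDiffAt ℝ ∞ (fun y : Euc 2 => ‖y‖ ^ 2) y := (contDiff_norm_sq ℝ).contDiffAt
      refine ((((h1.pow 2).div h2 (pow_ne_zero 2 hn)).sub (contDiffAt_const (c := (1 : ℝ)))).div h2
        (pow_ne_zero 2 hn)).congr_of_eventuallyEq ?_
      filter_upwards [isOpen_ne.mem_nhds hy] with z hz
      exact hKne z hz
  · rw [contDiff_iff_contDiffAt]
    intro y
    by_cases hy : y = 0
    · subst hy
      have h1 : ContDiffAt ℝ ∞ (fun y : Euc 2 => Hg (‖y‖ ^ 2)) 0 :=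
        ContDiffAt.comp (0 : Euc 2) (by rw [h00]; exact hHg) hsq
      refine h1.congr_of_eventuallyEq ?_
      filter_upwards [hnorm hH] with y hy
      by_cases hy0 : y = 0
      · simp [hy0, hH0]
      · exact hy hy0
    · exact (hG ‖y‖ (norm_pos_iff.2 hy)).comp y (hnc y hy)
  · intro y a b
    by_cases hy : y = 0
    · subst hy
      unfold polarMetric
      simp [area]
    · have hn := norm_ne_zero_iff.2 hy
      rw [polarMetric_of_ne hy, hKne y hy]
      -- The plane identity that splits the Euclidean metric into a radial and an angular part.
      have h1 : ‖y‖ ^ 2 * (inner ℝ a b : ℝ)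
          = inner ℝ y a * inner ℝ y b + area y a * area y b := by
        rw [EuclideanSpace.real_norm_sq_eq]
        simp only [PiLp.inner_apply, Fin.sum_univ_two, area, RCLike.inner_apply, conj_trivial]
        ring
      have h2 : (inner ℝ a b : ℝ)
          = (inner ℝ y a * inner ℝ y b + area y a * area y b) / ‖y‖ ^ 2 := by
        rw [← h1]
        field_simp
      rw [h2]
      unfold area
      field_simp
      ring
  · intro y
    by_cases hy : y = 0
    · simp [hy]
    · have hn := norm_pos_iff.2 hy
      have h1 : 1 + ‖y‖ ^ 2 * K y = F ‖y‖ ^ 2 / ‖y‖ ^ 2 := by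
        rw [hKne y hy]
        field_simp
        ring
      rw [h1]
      have := hF0 _ hn
      positivity

/-- The geodesic radial coordinate of the Reissner–Nordström metric. -/
theorem rn_radial {m q : ℝ} (h : 0 < m ∨ q ≠ 0) {e : ℝ ≃o ℝ} (he0 : e (rnU m q) = 0)
    (he : ∀ u, rnU m q ≤ u → HasDerivAt e (rnR m q u / u) u) {τ : ℝ} (hτ : 0 ≤ τ) :
    e (rnU m q * Real.exp τ) = m * τ + Real.sqrt (m ^ 2 + q ^ 2) * Real.sinh τ := by
  have hu0 := (isIsotropic_rn h).u₀_pos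
  set s := Real.sqrt (m ^ 2 + q ^ 2) with hs
  have hs2 : s ^ 2 = m ^ 2 + q ^ 2 := Real.sq_sqrt (by positivity)
  -- With `u = (s/2) exp τ` one has `du/u = dτ`, hence `dρ/dτ = r = m + s cosh τ`, whose primitive
  -- is the claimed expression.
  have hder : ∀ x : ℝ, 0 ≤ x →
      HasDerivAt (fun x => e (rnU m q * Real.exp x) - (m * x + s * Real.sinh x)) 0 x := by
    intro x hx
    have hle : rnU m q ≤ rnU m q * Real.exp x :=
      le_mul_of_one_le_right hu0.le (Real.one_le_exp hx)
    have h1 := (he _ hle).comp x ((Real.hasDerivAt_exp x).const_mul (rnU m q))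
    refine (h1.sub (((hasDerivAt_id x).const_mul m).add
      ((Real.hasDerivAt_sinh x).const_mul s))).congr_deriv ?_
    have hp : 0 < rnU m q * Real.exp x := by positivity
    rw [div_mul_cancel₀ _ hp.ne', rnR_eq hp.ne', ← hs2, Real.cosh_eq, Real.exp_neg]
    have : rnU m q = s / 2 := rfl
    rw [this] at hu0 ⊢
    have hs0 : s ≠ 0 := by
      intro h0
      rw [h0] at hu0
      simp at hu0
    field_simp
    ring
  have := constant_of_has_deriv_right_zero (a := 0) (b := τ)
    (fun x hx => (hder x hx.1).continuousAt.continuousWithinAt)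
    (fun x hx => (hder x hx.1).hasDerivWithinAt) τ ⟨hτ, le_rfl⟩
  simp only [Real.exp_zero, mul_one, he0, Real.sinh_zero, mul_zero, add_zero, sub_zero] at this
  linarith

/-- In the parameter `τ`, with `u = u₀ exp τ` and `s = √(m² + q²)`, one has `ρ = mτ + s sinh τ`, `G
= m + s cosh τ` and `F = c s sinh τ / G`. Hence `G`, `F²/ρ²` and `ρ²` are analytic functions of `σ =
τ²` near 0. Since `dρ²/dσ = (m + s)²` at 0, the inverse function theorem expresses `σ`, and so the
other two, through `ρ²`. -/
theorem rn_isSmoothWarping {m q : ℝ} (h : 0 < m ∨ q ≠ 0) {G : ℝ → ℝ}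
    (hG : IsProfile (rnV m q) (rnG₀ m q) G) :
    ∃ K H : Euc 2 → ℝ, IsSmoothWarping (fibreProfile (rnV m q) (rnC m q) G) G K H := by
  have hiso := isIsotropic_rn h
  have hc := rnC_pos h
  obtain ⟨e, he0, he⟩ := hiso.exists_radial
  have hu0 := hiso.u₀_pos
  set s := Real.sqrt (m ^ 2 + q ^ 2) with hs
  have hs2 : s ^ 2 = m ^ 2 + q ^ 2 := Real.sq_sqrt (by positivity)
  have hs0 : 0 < s := rn_sqrt_pos h
  have hms : 0 < m + s := rnG₀_pos h
  have hU : rnU m q = s / 2 := rfl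
  have hsymm : ∀ ρ, 0 < ρ → rnU m q < e.symm ρ := fun ρ hρ => by
    rw [e.lt_symm_apply, he0]; exact hρ
  have hGe : ∀ ρ, 0 ≤ ρ → G ρ = rnR m q (e.symm ρ) := fun ρ hρ => hiso.profile_eq he0 he hG hρ
  have hsm : ∀ ρ, 0 < ρ → ContDiffAt ℝ ∞ e.symm ρ := fun ρ hρ => by
    have h1 := hsymm ρ hρ
    have h2 : e.symm ρ ∈ e.toHomeomorph.toOpenPartialHomeomorph.source := by simp
    refine OpenPartialHomeomorph.contDiffAt_symm_deriv e.toHomeomorph.toOpenPartialHomeomorph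
      (f₀' := rnR m q (e.symm ρ) / e.symm ρ) ?_ (by simp) ?_ ?_
    · exact (div_pos (hiso.pos _ h1.le) (hu0.trans h1)).ne'
    · exact he _ h1.le
    · exact hiso.contDiffAt_radial he h1
  have hGs : ∀ ρ, 0 < ρ → ContDiffAt ℝ ∞ G ρ := fun ρ hρ => by
    refine ((hiso.smooth _ (hsymm ρ hρ).le).comp ρ (hsm ρ hρ)).congr_of_eventuallyEq ?_
    exact (eventually_gt_nhds hρ).mono fun x hx => hGe x (le_of_lt hx)
  have hVs : ∀ r : ℝ, 0 < r → ContDiffAt ℝ ∞ (rnV m q) r := fun r hr => by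
    unfold rnV
    exact (contDiffAt_const.sub (contDiffAt_const.div contDiffAt_id hr.ne')).sub
      (contDiffAt_const.div (contDiffAt_id.pow 2) (pow_ne_zero 2 hr.ne'))
  have hGp : ∀ ρ, 0 ≤ ρ → 0 < G ρ := fun ρ hρ => by
    rw [hGe ρ hρ]; exact hiso.pos _ (IsIsotropic.le_symm he0 hρ)
  have hVp : ∀ ρ, 0 < ρ → 0 < rnV m q (G ρ) := fun ρ hρ => by
    rw [hGe ρ hρ.le]; exact hiso.V_pos _ (hsymm ρ hρ)
  obtain ⟨S, hS, hS0, hSs⟩ := exists_analytic_sinh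
  -- the functions of `σ = τ²`, where `u = u₀ exp τ`
  set Gσ : ℝ → ℝ := fun σ => m + s * (1 + σ * S (σ / 4) ^ 2 / 2) with hGσ
  set D : ℝ → ℝ := fun σ => m + s * S σ with hD
  set Q : ℝ → ℝ := fun σ => σ * D σ ^ 2 with hQ
  set J : ℝ → ℝ := fun σ => (rnC m q * s) ^ 2 * S σ ^ 2 / (Gσ σ ^ 2 * D σ ^ 2) with hJ
  have hS4 : AnalyticAt ℝ (fun σ : ℝ => S (σ / 4)) 0 := by
    have h1 : AnalyticAt ℝ S ((0 : ℝ) / 4) := by simpa using hS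
    have h2 : AnalyticAt ℝ (fun σ : ℝ => σ / 4) 0 := by fun_prop (disch := norm_num)
    exact AnalyticAt.comp (g := S) (f := fun σ : ℝ => σ / 4) h1 h2
  have hGσa : AnalyticAt ℝ Gσ 0 :=
    analyticAt_const.add (analyticAt_const.mul (analyticAt_const.add
      ((analyticAt_id.mul (hS4.pow 2)).div analyticAt_const two_ne_zero)))
  have hDa : AnalyticAt ℝ D 0 := by fun_prop
  have hQa : AnalyticAt ℝ Q 0 := by fun_prop
  have hGσ0 : Gσ 0 = m + s := by simp [hGσ]
  have hD0 : D 0 = m + s := by simp [hD, hS0]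
  have hJa : AnalyticAt ℝ J 0 := by
    refine AnalyticAt.div (by fun_prop) (by fun_prop) ?_
    rw [hGσ0, hD0]
    positivity
  -- The value of `c` makes `F²/ρ²` equal to 1 at the horizon, so that there is no conical
  -- singularity.
  have hcs : rnC m q * s = (m + s) ^ 2 := by
    rw [rnC_eq, rnG₀, ← hs]
    field_simp
  have hJ0 : J 0 = 1 := by
    simp only [hJ]
    rw [hGσ0, hD0, hcs, hS0]
    field_simp
  -- Here `J(τ²) = F²/ρ²`. The divided difference of `J` at 0 is analytic, so `J - 1` is divisible
  -- by `σ`.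
  obtain ⟨pJ, hpJ⟩ := hJa
  have hJ1 : AnalyticAt ℝ (dslope J 0) 0 := ⟨_, hpJ.has_fpower_series_dslope_fslope⟩
  have hJ1e : ∀ σ, J σ = 1 + σ * dslope J 0 σ := fun σ => by
    have := sub_smul_dslope J 0 σ
    rw [hJ0, sub_zero, smul_eq_mul] at this
    linarith
  have hQ0 : Q 0 = 0 := by simp [hQ]
  have hQd : HasDerivAt Q ((m + s) ^ 2) 0 := by
    have h1 := (hasDerivAt_id (0 : ℝ)).mul ((hDa.differentiableAt.hasDerivAt).pow 2)
    refine h1.congr_deriv ?_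
    simp [hD0]
  have hQc : ContDiffAt ℝ ∞ Q 0 := hQa.contDiffAt
  have hms2 : (m + s) ^ 2 ≠ 0 := by positivity
  have hQs : HasStrictDerivAt Q ((m + s) ^ 2) 0 := hQc.hasStrictDerivAt' hQd (by simp)
  -- `R` expresses `τ²` as a smooth function of `ρ²`.
  set R := hQs.localInverse Q _ 0 hms2 with hR
  have hRl : ∀ᶠ σ in 𝓝 0, R (Q σ) = σ := hQs.eventually_left_inverse hms2
  have hRc : ContDiffAt ℝ ∞ R 0 := by
    have := hQc.to_localInverse (f' := ContinuousLinearEquiv.unitsEquivAut ℝ (Units.mk0 _ hms2))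
      hQd.hasFDerivAt (by simp)
    rw [hQ0] at this
    exact this
  have hR0 : R 0 = 0 := by
    have := hRl.self_of_nhds
    rwa [hQ0] at this
  -- the parameter `τ` as a function of `ρ`
  set T : ℝ → ℝ := fun ρ => Real.log (e.symm ρ / rnU m q) with hT
  have hTe : ∀ ρ, 0 < ρ → 0 < T ρ ∧ e.symm ρ = rnU m q * Real.exp (T ρ) := by
    intro ρ hρ
    have h1 := hsymm ρ hρ
    refine ⟨Real.log_pos ((one_lt_div hu0).2 h1), ?_⟩
    rw [Real.exp_log (div_pos (hu0.trans h1) hu0)]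
    field_simp
  have hTρ : ∀ ρ, 0 < ρ → ρ ^ 2 = Q (T ρ ^ 2) := by
    intro ρ hρ
    obtain ⟨h1, h2⟩ := hTe ρ hρ
    have h3 := rn_radial h he0 he h1.le
    rw [← h2, e.apply_symm_apply, ← hs, hSs] at h3
    generalize T ρ = τ at *
    simp only [hQ, hD]
    rw [h3]
    ring
  have hTlim : Tendsto (fun ρ => T ρ ^ 2) (𝓝[>] 0) (𝓝 0) := by
    have h1 : e.symm 0 = rnU m q := by rw [← he0, e.symm_apply_apply]
    have h2 : ContinuousAt T 0 := by
      refine ContinuousAt.log (e.symm.continuous.continuousAt.div_const _) ?_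
      rw [h1, div_self hu0.ne']
      exact one_ne_zero
    have h3 : T 0 = 0 := by simp [hT, h1, div_self hu0.ne']
    have h4 : Tendsto (fun ρ => T ρ ^ 2) (𝓝 0) (𝓝 (T 0 ^ 2)) := (h2.pow 2).tendsto
    rw [h3, zero_pow two_ne_zero] at h4
    exact h4.mono_left nhdsWithin_le_nhds
  have hTR : ∀ᶠ ρ in 𝓝[>] (0 : ℝ), R (ρ ^ 2) = T ρ ^ 2 := by
    filter_upwards [hTlim.eventually hRl, self_mem_nhdsWithin] with ρ h1 h2
    rw [hTρ ρ h2, h1]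
  have hGT : ∀ ρ, 0 < ρ → G ρ = Gσ (T ρ ^ 2) := by
    intro ρ hρ
    obtain ⟨h1, h2⟩ := hTe ρ hρ
    have hp : 0 < rnU m q * Real.exp (T ρ) := by positivity
    have h3 : G ρ = m + s * Real.cosh (T ρ) := by
      rw [hGe ρ hρ.le, h2, rnR_eq hp.ne', ← hs2, Real.cosh_eq, Real.exp_neg, hU]
      field_simp
      ring
    -- The half-angle formula makes `cosh` a function of `τ²` through the same series `S`; this is
    -- the source of the argument `σ/4`.
    have h4 : Real.cosh (T ρ) = 1 + 2 * Real.sinh (T ρ / 2) ^ 2 := by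
      have h5 := Real.cosh_two_mul (T ρ / 2)
      have h6 := Real.cosh_sq (T ρ / 2)
      rw [mul_div_cancel₀ _ two_ne_zero] at h5
      rw [h5, h6]
      ring
    rw [h3, h4, hSs]
    simp only [hGσ]
    rw [div_pow, show (2 : ℝ) ^ 2 = 4 by norm_num]
    ring
  have hFT : ∀ ρ, 0 < ρ → fibreProfile (rnV m q) (rnC m q) G ρ ^ 2 * (Gσ (T ρ ^ 2)) ^ 2 =
      (rnC m q * s) ^ 2 * (T ρ ^ 2 * S (T ρ ^ 2) ^ 2) := by
    intro ρ hρ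
    obtain ⟨h1, h2⟩ := hTe ρ hρ
    have hp : 0 < rnU m q * Real.exp (T ρ) := by positivity
    have h3 : rnV m q (G ρ) * G ρ ^ 2 = (s * Real.sinh (T ρ)) ^ 2 := by
      have hr := rnR_pos h hp
      rw [hGe ρ hρ.le, h2, rnV_rnR h hp, div_pow, div_mul_cancel₀ _ (pow_ne_zero 2 hr.ne'), ← hs2,
        Real.sinh_eq, Real.exp_neg, hU]
      congr 1
      field_simp
      ring
    rw [fibreProfile, mul_pow, Real.sq_sqrt (hVp ρ hρ).le, ← hGT ρ hρ, mul_assoc, h3, hSs]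
    ring
  -- From `F²/ρ² - 1 = σ · dslope J 0 σ` and `ρ² = σ D(σ)²`, the factor `σ` cancels in `(F²/ρ² -
  -- 1)/ρ²`.
  refine exists_isSmoothWarping (Kg := fun x => dslope J 0 (R x) / D (R x) ^ 2)
    (Hg := fun x => Gσ (R x)) (fun ρ hρ => ?_) hGs (fun ρ hρ => ?_) hGp ?_ ?_ ?_ ?_ ?_
  · exact contDiffAt_const.mul (((hVs _ (hGp ρ hρ.le)).comp ρ (hGs ρ hρ)).sqrt (hVp ρ hρ).ne')
  · exact mul_pos hc (Real.sqrt_pos.2 (hVp ρ hρ))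
  · have h1 : ContDiffAt ℝ ∞ (dslope J 0) (R 0) := by rw [hR0]; exact hJ1.contDiffAt
    have h2 : ContDiffAt ℝ ∞ D (R 0) := by rw [hR0]; exact hDa.contDiffAt
    refine (h1.comp 0 hRc).div ((h2.comp 0 hRc).pow 2) ?_
    simp only [hR0, hD0]
    positivity
  · have h1 : ContDiffAt ℝ ∞ Gσ (R 0) := by rw [hR0]; exact hGσa.contDiffAt
    exact h1.comp 0 hRc
  · have hDne : ∀ᶠ σ in 𝓝 (0 : ℝ), D σ ≠ 0 :=
      hDa.continuousAt.eventually_ne (by rw [hD0]; exact hms.ne')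
    filter_upwards [hTR, hTlim.eventually hDne, self_mem_nhdsWithin] with ρ h1 h2 hρ
    have hρ' : 0 < ρ := hρ
    have hne : Gσ (T ρ ^ 2) ≠ 0 := by rw [← hGT ρ hρ']; exact (hGp ρ hρ'.le).ne'
    have h3 : 1 + ρ ^ 2 * (dslope J 0 (R (ρ ^ 2)) / D (R (ρ ^ 2)) ^ 2) = J (T ρ ^ 2) := by
      rw [h1, hJ1e, hTρ ρ hρ']
      simp only [hQ]
      field_simp
    rw [h3]
    have h4 := hFT ρ hρ'
    have h5 : fibreProfile (rnV m q) (rnC m q) G ρ ^ 2 =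
        (rnC m q * s) ^ 2 * (T ρ ^ 2 * S (T ρ ^ 2) ^ 2) / (Gσ (T ρ ^ 2)) ^ 2 := by
      rw [← h4, mul_div_cancel_right₀ _ (pow_ne_zero 2 hne)]
    rw [h5, hTρ ρ hρ']
    simp only [hJ, hQ]
    field_simp
  · filter_upwards [hTR, self_mem_nhdsWithin] with ρ h1 hρ
    rw [h1, hGT ρ hρ]
  · rw [hR0, hGσ0, hG.init, rnG₀]

/-! ### Scalar curvature of static metrics `P dx² + W dt²` -/

section Trace

variable {E : Type*} [NormedAddCommGroup E] [NormedSpace ℝ E]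

theorem sum_repr_eq_trace {ι : Type*} [Fintype ι] [DecidableEq ι] (b : Module.Basis ι ℝ E)
    (f : E →ₗ[ℝ] E) : ∑ i, b.repr (f (b i)) i = LinearMap.trace ℝ E f := by
  rw [LinearMap.trace_eq_matrix_trace ℝ b, Matrix.trace]
  exact Finset.sum_congr rfl fun i _ => by rw [Matrix.diag_apply, LinearMap.toMatrix_apply]

/-- The contraction of the bilinear form `g(A ·, ·)` with the inverse of `g` is the trace of
`A`. -/
theorem sum_inv_gram_mul {ι : Type*} [Fintype ι] [DecidableEq ι] (b : Module.Basis ι ℝ E)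
    {g : E → E → ℝ} (hlin : ∀ v, IsLinearMap ℝ (g v)) (hsymm : ∀ v w, g v w = g w v)
    (hpos : ∀ v, v ≠ 0 → 0 < g v v) (A : E →ₗ[ℝ] E) :
    ∑ i, ∑ j, (Matrix.of fun i j => g (b i) (b j))⁻¹ i j * g (A (b i)) (b j)
      = LinearMap.trace ℝ E A := by
  set M : Matrix ι ι ℝ := Matrix.of fun i j => g (b i) (b j) with hM
  have hsum : ∀ (c : ι → ℝ) (w : E), g (∑ k, c k • b k) w = ∑ k, c k * g (b k) w := by
    intro c w
    rw [hsymm]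
    have := map_sum (hlin w).mk' (fun k => c k • b k) Finset.univ
    simp only [IsLinearMap.mk'_apply] at this
    rw [this]
    refine Finset.sum_congr rfl fun k _ => ?_
    rw [(hlin w).map_smul, smul_eq_mul, hsymm]
  -- A vector in the kernel of the Gram matrix would give a nonzero vector of zero length.
  have hdet : IsUnit M.det := by
    rw [isUnit_iff_ne_zero]
    intro h0
    obtain ⟨v, hv, hMv⟩ := Matrix.exists_mulVec_eq_zero_iff.2 h0
    have hne : ∑ k, v k • b k ≠ 0 := by
      intro h1
      refine hv (funext fun i => ?_)
      exact (Fintype.linearIndependent_iff.1 b.linearIndependent) v h1 i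
    refine (hpos _ hne).ne' ?_
    rw [hsum]
    refine Finset.sum_eq_zero fun k _ => ?_
    rw [hsymm, hsum]
    have := congrFun hMv k
    simp only [Matrix.mulVec, dotProduct, Pi.zero_apply, hM, Matrix.of_apply] at this
    have h2 : ∑ j, v j * g (b j) (b k) = 0 := by
      rw [← this]
      exact Finset.sum_congr rfl fun j _ => by rw [hsymm, mul_comm]
    rw [h2, mul_zero]
  have hMt : ∀ j k, M k j = M j k := fun j k => hsymm _ _
  rw [← sum_repr_eq_trace b]
  refine Finset.sum_congr rfl fun i _ => ?_
  have h1 : ∀ j, g (A (b i)) (b j) = ∑ k, b.repr (A (b i)) k * M k j := by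
    intro j
    conv_lhs => rw [← b.sum_repr (A (b i))]
    rw [hsum]
    rfl
  have h2 : ∀ k, ∑ j, M⁻¹ i j * M k j = if i = k then 1 else 0 := by
    intro k
    have := congrFun (congrFun (Matrix.nonsing_inv_mul M hdet) i) k
    rw [Matrix.mul_apply, Matrix.one_apply] at this
    rw [← this]
    exact Finset.sum_congr rfl fun j _ => by rw [hMt]
  calc _ = ∑ j, ∑ k, b.repr (A (b i)) k * (M⁻¹ i j * M k j) := by
        refine Finset.sum_congr rfl fun j _ => ?_
        rw [h1, Finset.mul_sum]
        exact Finset.sum_congr rfl fun k _ => by ring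
    _ = ∑ k, b.repr (A (b i)) k * ∑ j, M⁻¹ i j * M k j := by
        rw [Finset.sum_comm]
        exact Finset.sum_congr rfl fun k _ => by rw [Finset.mul_sum]
    _ = _ := by simp [h2]

end Trace

/-- The standard basis of `ℝ³ × ℝ`. -/
def cylBasis : Module.Basis (Fin 3 ⊕ Unit) ℝ (Cyl 3) :=
  (EuclideanSpace.basisFun (Fin 3) ℝ).toBasis.prod (Module.Basis.singleton Unit ℝ)

theorem trace_cyl (f : Cyl 3 →ₗ[ℝ] Cyl 3) : LinearMap.trace ℝ (Cyl 3) f =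
    (f (EuclideanSpace.single 0 1, 0)).1 0 + (f (EuclideanSpace.single 1 1, 0)).1 1
      + (f (EuclideanSpace.single 2 1, 0)).1 2 + (f (0, 1)).2 := by
  rw [← sum_repr_eq_trace cylBasis, Fintype.sum_sum_type, Fin.sum_univ_three]
  simp [cylBasis]

/-- The Christoffel symbols of a rotation invariant static metric. -/
def staticGamma (a b d : ℝ) (x : Euc 3) (v w : Cyl 3) : Cyl 3 :=
  (a • ((inner ℝ x v.1 : ℝ) • w.1 + (inner ℝ x w.1 : ℝ) • v.1 - (inner ℝ v.1 w.1 : ℝ) • x)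
      - (b * (v.2 * w.2)) • x,
    d * ((inner ℝ x v.1 : ℝ) * w.2 + (inner ℝ x w.1 : ℝ) * v.2))

/-- The directional derivative of the Christoffel symbols of a rotation invariant static
metric. -/
def staticGammaDeriv (a b d a₁ b₁ d₁ : ℝ) (x : Euc 3) (u v w : Cyl 3) : Cyl 3 :=
  (inner ℝ x u.1 : ℝ) • staticGamma a₁ b₁ d₁ x v w + staticGamma a b d u.1 v w

section StaticGamma

variable (a b d : ℝ) (x : Euc 3)

theorem staticGamma_comm (v w : Cyl 3) : staticGamma a b d x v w = staticGamma a b d x w v := by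
  refine Prod.ext ?_ ?_ <;> simp only [staticGamma]
  · rw [real_inner_comm w.1 v.1]
    module
  · ring

theorem staticGamma_add (v v' w : Cyl 3) :
    staticGamma a b d x (v + v') w = staticGamma a b d x v w + staticGamma a b d x v' w := by
  refine Prod.ext ?_ ?_ <;>
    simp only [staticGamma, Prod.fst_add, Prod.snd_add, inner_add_left, inner_add_right]
  · module
  · ring

theorem staticGamma_smul (c : ℝ) (v w : Cyl 3) :
    staticGamma a b d x (c • v) w = c • staticGamma a b d x v w := by
  refine Prod.ext ?_ ?_ <;>
    simp only [staticGamma, Prod.smul_fst, Prod.smul_snd, real_inner_smul_left,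
      real_inner_smul_right, smul_eq_mul]
  · module
  · ring

theorem staticGamma_add_right (v w w' : Cyl 3) :
    staticGamma a b d x v (w + w') = staticGamma a b d x v w + staticGamma a b d x v w' := by
  rw [staticGamma_comm, staticGamma_add, staticGamma_comm _ _ _ _ w, staticGamma_comm _ _ _ _ w']

theorem staticGamma_smul_right (c : ℝ) (v w : Cyl 3) :
    staticGamma a b d x v (c • w) = c • staticGamma a b d x v w := by
  rw [staticGamma_comm, staticGamma_smul, staticGamma_comm _ _ _ _ w]

theorem staticGamma_add_base (x' : Euc 3) (v w : Cyl 3) :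
    staticGamma a b d (x + x') v w = staticGamma a b d x v w + staticGamma a b d x' v w := by
  refine Prod.ext ?_ ?_ <;>
    simp only [staticGamma, Prod.fst_add, Prod.snd_add, inner_add_left]
  · module
  · ring

theorem staticGamma_smul_base (c : ℝ) (v w : Cyl 3) :
    staticGamma a b d (c • x) v w = c • staticGamma a b d x v w := by
  refine Prod.ext ?_ ?_ <;>
    simp only [staticGamma, Prod.smul_fst, Prod.smul_snd, real_inner_smul_left, smul_eq_mul]
  · module
  · ring

/-- The curvature `v ↦ R(v, w) y` of a rotation invariant static metric. -/
def staticCurv (a₁ b₁ d₁ : ℝ) (w y : Cyl 3) : Cyl 3 →ₗ[ℝ] Cyl 3 where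
  toFun v := staticGammaDeriv a b d a₁ b₁ d₁ x v w y - staticGammaDeriv a b d a₁ b₁ d₁ x w v y
    + staticGamma a b d x v (staticGamma a b d x w y)
    - staticGamma a b d x w (staticGamma a b d x v y)
  map_add' v v' := by
    simp only [staticGammaDeriv, Prod.fst_add, inner_add_right, staticGamma_add,
      staticGamma_add_base, staticGamma_add_right]
    module
  map_smul' c v := by
    simp only [staticGammaDeriv, Prod.smul_fst, real_inner_smul_right, staticGamma_smul,
      staticGamma_smul_base, staticGamma_smul_right, RingHom.id_apply]
    module

/-- The Ricci form: by rotation invariance only three kinds of terms can occur, and their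
coefficients come from a polynomial identity in coordinates. -/
theorem trace_staticCurv (a₁ b₁ d₁ : ℝ) (w y : Cyl 3) :
    LinearMap.trace ℝ (Cyl 3) (staticCurv a b d x a₁ b₁ d₁ w y) =
      (-a₁ * ‖x‖ ^ 2 - 4 * a - d - a ^ 2 * ‖x‖ ^ 2 - a * d * ‖x‖ ^ 2) * inner ℝ w.1 y.1
      + (-a₁ - d₁ + a ^ 2 + 2 * a * d - d ^ 2) * (inner ℝ x w.1 * inner ℝ x y.1)
      - (b₁ * ‖x‖ ^ 2 + 3 * b + 3 * a * b * ‖x‖ ^ 2 - b * d * ‖x‖ ^ 2) * (w.2 * y.2) := by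
  rw [trace_cyl, EuclideanSpace.real_norm_sq_eq, Fin.sum_univ_three]
  simp only [staticCurv, LinearMap.coe_mk, AddHom.coe_mk, staticGammaDeriv, staticGamma,
    PiLp.inner_apply, Fin.sum_univ_three, RCLike.inner_apply, conj_trivial, Prod.fst_add,
    Prod.snd_add, Prod.fst_sub, Prod.snd_sub, Prod.smul_fst, Prod.smul_snd, PiLp.add_apply,
    PiLp.sub_apply, PiLp.smul_apply, smul_eq_mul, PiLp.single_apply, PiLp.zero_apply]
  simp
  ring

end StaticGamma

/-- Rotation invariant static data: a metric `P dx² + W dt²` with `P' = 2 a P x`,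
`W' = 2 b P x = 2 d W x`, on an open subset of `ℝ³`. -/
structure IsStatic (U : Set (Euc 3)) (P W a b d a₁ b₁ d₁ : Euc 3 → ℝ) : Prop where
  isOpen : IsOpen U
  P_pos : ∀ x ∈ U, 0 < P x
  W_pos : ∀ x ∈ U, 0 < W x
  P_deriv : ∀ x ∈ U, HasFDerivAt P ((2 * a x * P x) • innerSL ℝ x) x
  W_deriv : ∀ x ∈ U, HasFDerivAt W ((2 * b x * P x) • innerSL ℝ x) x
  a_deriv : ∀ x ∈ U, HasFDerivAt a (a₁ x • innerSL ℝ x) x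
  b_deriv : ∀ x ∈ U, HasFDerivAt b (b₁ x • innerSL ℝ x) x
  d_deriv : ∀ x ∈ U, HasFDerivAt d (d₁ x • innerSL ℝ x) x
  b_eq : ∀ x ∈ U, b x * P x = d x * W x

namespace IsStatic

variable {U : Set (Euc 3)} {P W a b d a₁ b₁ d₁ : Euc 3 → ℝ} {g : Cyl 3 → Cyl 3 → Cyl 3 → ℝ}

/-- In Koszul's formula the derivative of `W` occurs twice: raised with `P` it gives the coefficient
`b`, raised with `W` it gives `d`. The relation `b P = d W` says that these come from the same
derivative. -/
theorem christoffel (h : IsStatic U P W a b d a₁ b₁ d₁)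
    (hg : ∀ z : Cyl 3, z.1 ∈ U → ∀ v w, g z v w = P z.1 * inner ℝ v.1 w.1 + W z.1 * (v.2 * w.2))
    {z : Cyl 3} (hz : z.1 ∈ U) (v w : Cyl 3) :
    christoffel g z v w = staticGamma (a z.1) (b z.1) (d z.1) z.1 v w := by
  have hnhds : ∀ᶠ p : Cyl 3 in 𝓝 z, p.1 ∈ U := continuous_fst.continuousAt (h.isOpen.mem_nhds hz)
  have hP : HasFDerivAt (fun p : Cyl 3 => P p.1) _ z := (h.P_deriv z.1 hz).comp z hasFDerivAt_fst
  have hW : HasFDerivAt (fun p : Cyl 3 => W p.1) _ z := (h.W_deriv z.1 hz).comp z hasFDerivAt_fst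
  have hder : ∀ v w y : Cyl 3, fderiv ℝ (fun p => g p v w) z y =
      2 * P z.1 * inner ℝ z.1 y.1 * (a z.1 * inner ℝ v.1 w.1 + b z.1 * (v.2 * w.2)) := by
    intro v w y
    have h1 : (fun p => g p v w) =ᶠ[𝓝 z]
        fun p => P p.1 * inner ℝ v.1 w.1 + W p.1 * (v.2 * w.2) := hnhds.mono fun p hp => hg p hp v w
    have h2 := ((hP.mul_const (inner ℝ v.1 w.1 : ℝ)).add (hW.mul_const (v.2 * w.2))).fderiv
    rw [h1.fderiv_eq, show fderiv ℝ (fun p : Cyl 3 => P p.1 * inner ℝ v.1 w.1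
      + W p.1 * (v.2 * w.2)) z = _ from h2]
    simp
    ring
  have hPp := h.P_pos _ hz
  have hWp := h.W_pos _ hz
  refine christoffel_eq (fun p q y => ?_) (fun v hv => ?_) fun y => ?_
  · simp only [hg z hz, Prod.fst_sub, Prod.snd_sub, inner_sub_left]
    ring
  · rw [hg z hz, real_inner_self_eq_norm_sq]
    by_cases hv1 : v.1 = 0
    · have hv2 : v.2 ≠ 0 := fun h0 => hv (Prod.ext hv1 h0)
      have : 0 < v.2 * v.2 := mul_self_pos.2 hv2
      positivity
    · have : 0 < ‖v.1‖ := norm_pos_iff.2 hv1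
      have : 0 ≤ v.2 * v.2 := mul_self_nonneg _
      positivity
  · rw [hder, hder, hder, hg z hz]
    simp only [staticGamma, inner_sub_left, inner_add_left, real_inner_smul_left]
    have := h.b_eq _ hz
    linear_combination -(inner ℝ z.1 v.1 * w.2 + inner ℝ z.1 w.1 * v.2) * y.2 * this

/-- Only the values of the derivative matter, so the linear map produced by the differentiation
rules is left implicit. -/
theorem hasFDerivAt_staticGamma (h : IsStatic U P W a b d a₁ b₁ d₁) {z : Cyl 3} (hz : z.1 ∈ U)
    (w y : Cyl 3) : ∃ D : Cyl 3 →L[ℝ] Cyl 3,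
    HasFDerivAt (fun p : Cyl 3 => staticGamma (a p.1) (b p.1) (d p.1) p.1 w y) D z ∧
    ∀ v, D v = staticGammaDeriv (a z.1) (b z.1) (d z.1) (a₁ z.1) (b₁ z.1) (d₁ z.1) z.1 v w y := by
  have hf : HasFDerivAt (fun p : Cyl 3 => p.1) (ContinuousLinearMap.fst ℝ (Euc 3) ℝ) z :=
    hasFDerivAt_fst
  have ha : HasFDerivAt (fun p : Cyl 3 => a p.1) _ z := (h.a_deriv z.1 hz).comp z hf
  have hb : HasFDerivAt (fun p : Cyl 3 => b p.1) _ z := (h.b_deriv z.1 hz).comp z hf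
  have hd : HasFDerivAt (fun p : Cyl 3 => d p.1) _ z := (h.d_deriv z.1 hz).comp z hf
  have hi : ∀ c : Euc 3, HasFDerivAt (fun p : Cyl 3 => (inner ℝ p.1 c : ℝ))
      ((innerSL ℝ c).comp (ContinuousLinearMap.fst ℝ (Euc 3) ℝ)) z := fun c => by
    have := ((innerSL ℝ c).comp (ContinuousLinearMap.fst ℝ (Euc 3) ℝ)).hasFDerivAt (x := z)
    refine this.congr_of_eventuallyEq (Eventually.of_forall fun p => ?_)
    simp [real_inner_comm]
  have h1 := ((ha.smul ((((hi w.1).smul_const y.1).add ((hi y.1).smul_const w.1)).sub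
    (hf.const_smul (inner ℝ w.1 y.1 : ℝ)))).sub ((hb.mul_const (w.2 * y.2)).smul hf)).prodMk
    (hd.mul (((hi w.1).mul_const y.2).add ((hi y.1).mul_const w.2)))
  refine ⟨_, h1, fun v => ?_⟩
  refine Prod.ext ?_ ?_
  · simp only [staticGammaDeriv, staticGamma, ContinuousLinearMap.prod_apply, add_apply,
      sub_apply, smul_apply, ContinuousLinearMap.smulRight_apply,
      ContinuousLinearMap.comp_apply, ContinuousLinearMap.coe_fst', innerSL_apply_apply,
      Prod.fst_add, Prod.smul_fst, smul_eq_mul, Pi.add_apply, Pi.sub_apply, Pi.smul_apply,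
      real_inner_comm v.1]
    module
  · simp only [staticGammaDeriv, staticGamma, ContinuousLinearMap.prod_apply, add_apply,
      sub_apply, smul_apply, ContinuousLinearMap.smulRight_apply,
      ContinuousLinearMap.comp_apply, ContinuousLinearMap.coe_fst', innerSL_apply_apply,
      Prod.snd_add, Prod.smul_snd, smul_eq_mul, Pi.add_apply, real_inner_comm v.1]
    ring

theorem riemann (h : IsStatic U P W a b d a₁ b₁ d₁)
    (hg : ∀ z : Cyl 3, z.1 ∈ U → ∀ v w, g z v w = P z.1 * inner ℝ v.1 w.1 + W z.1 * (v.2 * w.2))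
    {z : Cyl 3} (hz : z.1 ∈ U) (v w y : Cyl 3) : riemann g z v w y =
      staticCurv (a z.1) (b z.1) (d z.1) z.1 (a₁ z.1) (b₁ z.1) (d₁ z.1) w y v := by
  have hnhds : ∀ᶠ p : Cyl 3 in 𝓝 z, p.1 ∈ U := continuous_fst.continuousAt (h.isOpen.mem_nhds hz)
  have hder : ∀ v w y, fderiv ℝ (fun p => ALF.christoffel g p w y) z v =
      staticGammaDeriv (a z.1) (b z.1) (d z.1) (a₁ z.1) (b₁ z.1) (d₁ z.1) z.1 v w y := by
    intro v w y
    have h1 : (fun p => ALF.christoffel g p w y) =ᶠ[𝓝 z]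
        fun p => staticGamma (a p.1) (b p.1) (d p.1) p.1 w y :=
      hnhds.mono fun p hp => h.christoffel hg hp w y
    obtain ⟨D, hD, hDv⟩ := h.hasFDerivAt_staticGamma hz w y
    rw [h1.fderiv_eq, hD.fderiv, hDv]
  simp only [ALF.riemann, hder, h.christoffel hg hz]
  rfl

/-- The Ricci form is `g(A ·, ·)` for an explicit endomorphism `A`; contracting with the inverse
metric gives the trace of `A`, which needs no inversion of a Gram matrix. -/
theorem scal_eq (h : IsStatic U P W a b d a₁ b₁ d₁)
    (hg : ∀ z : Cyl 3, z.1 ∈ U → ∀ v w, g z v w = P z.1 * inner ℝ v.1 w.1 + W z.1 * (v.2 * w.2))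
    {z : Cyl 3} (hz : z.1 ∈ U) : scal g z =
      (3 * (-a₁ z.1 * ‖z.1‖ ^ 2 - 4 * a z.1 - d z.1 - a z.1 ^ 2 * ‖z.1‖ ^ 2
          - a z.1 * d z.1 * ‖z.1‖ ^ 2)
        + (-a₁ z.1 - d₁ z.1 + a z.1 ^ 2 + 2 * a z.1 * d z.1 - d z.1 ^ 2) * ‖z.1‖ ^ 2) / P z.1
      - (b₁ z.1 * ‖z.1‖ ^ 2 + 3 * b z.1 + 3 * a z.1 * b z.1 * ‖z.1‖ ^ 2
          - b z.1 * d z.1 * ‖z.1‖ ^ 2) / W z.1 := by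
  set x := z.1
  set r₁ := -a₁ x * ‖x‖ ^ 2 - 4 * a x - d x - a x ^ 2 * ‖x‖ ^ 2 - a x * d x * ‖x‖ ^ 2
  set r₂ := -a₁ x - d₁ x + a x ^ 2 + 2 * a x * d x - d x ^ 2
  set r₃ := b₁ x * ‖x‖ ^ 2 + 3 * b x + 3 * a x * b x * ‖x‖ ^ 2 - b x * d x * ‖x‖ ^ 2
  have hPp := h.P_pos _ hz
  have hWp := h.W_pos _ hz
  have hric : ∀ w y, ricci g z w y =
      r₁ * inner ℝ w.1 y.1 + r₂ * (inner ℝ x w.1 * inner ℝ x y.1) - r₃ * (w.2 * y.2) := by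
    intro w y
    have h1 := trace_staticCurv (a x) (b x) (d x) x (a₁ x) (b₁ x) (d₁ x) w y
    rw [← sum_repr_eq_trace (Module.finBasis ℝ (Cyl 3))] at h1
    rw [← h1, ricci]
    exact Finset.sum_congr rfl fun i _ => by rw [h.riemann hg hz]
  let A : Cyl 3 →ₗ[ℝ] Cyl 3 :=
    { toFun := fun v => ((r₁ / P x) • v.1 + (r₂ / P x * inner ℝ x v.1) • x, -(r₃ / W x) * v.2)
      map_add' := fun v w => by
        refine Prod.ext ?_ ?_
        · simp only [Prod.fst_add, inner_add_right]
          module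
        · simp only [Prod.snd_add]
          ring
      map_smul' := fun c v => by
        refine Prod.ext ?_ ?_
        · simp only [Prod.smul_fst, real_inner_smul_right, RingHom.id_apply]
          module
        · simp only [Prod.smul_snd, smul_eq_mul, RingHom.id_apply]
          ring }
  have hA : ∀ v w, ricci g z v w = g z (A v) w := by
    intro v w
    rw [hric, hg z hz]
    simp only [A, LinearMap.coe_mk, AddHom.coe_mk, inner_add_left, real_inner_smul_left]
    field_simp
    ring
  have h2 := sum_inv_gram_mul (Module.finBasis ℝ (Cyl 3)) (g := g z)
    (fun v => by
      constructor
      · intro w w'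
        simp only [hg z hz, Prod.fst_add, Prod.snd_add, inner_add_right]
        ring
      · intro c w
        simp only [hg z hz, Prod.smul_fst, Prod.smul_snd, real_inner_smul_right, smul_eq_mul]
        ring)
    (fun v w => by rw [hg z hz, hg z hz, real_inner_comm, mul_comm v.2])
    (fun v hv => by
      rw [hg z hz, real_inner_self_eq_norm_sq]
      by_cases hv1 : v.1 = 0
      · have hv2 : v.2 ≠ 0 := fun h0 => hv (Prod.ext hv1 h0)
        have : 0 < v.2 * v.2 := mul_self_pos.2 hv2
        positivity
      · have : 0 < ‖v.1‖ := norm_pos_iff.2 hv1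
        have : 0 ≤ v.2 * v.2 := mul_self_nonneg _
        positivity) A
  have h3 : scal g z = LinearMap.trace ℝ (Cyl 3) A := by
    rw [← h2, scal]
    refine Finset.sum_congr rfl fun i _ => Finset.sum_congr rfl fun j _ => ?_
    rw [hA]
  rw [h3, trace_cyl]
  simp only [A, LinearMap.coe_mk, AddHom.coe_mk]
  have hn : ‖x‖ ^ 2 = x 0 * x 0 + x 1 * x 1 + x 2 * x 2 := by
    rw [EuclideanSpace.real_norm_sq_eq, Fin.sum_univ_three]
    ring
  have hi : ∀ i : Fin 3, (inner ℝ x (EuclideanSpace.single i (1 : ℝ)) : ℝ) = x i := fun i => by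
    simp [EuclideanSpace.inner_single_right]
  simp only [hi, PiLp.add_apply, PiLp.smul_apply, smul_eq_mul, PiLp.single_apply]
  rw [hn]
  simp
  ring

end IsStatic

/-- Taking `b = d W / P` satisfies the compatibility between `b` and `d` by construction, and `b₁`
follows from the product rule. -/
theorem IsStatic.of_conformal {U : Set (Euc 3)} {P W a d a₁ d₁ : Euc 3 → ℝ} (hU : IsOpen U)
    (hP : ∀ x ∈ U, 0 < P x) (hW : ∀ x ∈ U, 0 < W x)
    (hP' : ∀ x ∈ U, HasFDerivAt P ((2 * a x * P x) • innerSL ℝ x) x)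
    (hW' : ∀ x ∈ U, HasFDerivAt W ((2 * d x * W x) • innerSL ℝ x) x)
    (ha : ∀ x ∈ U, HasFDerivAt a (a₁ x • innerSL ℝ x) x)
    (hd : ∀ x ∈ U, HasFDerivAt d (d₁ x • innerSL ℝ x) x) :
    IsStatic U P W a (fun x => d x * W x * (P x)⁻¹) d a₁
      (fun x => (d₁ x + 2 * d x ^ 2 - 2 * a x * d x) * (W x * (P x)⁻¹)) d₁ where
  isOpen := hU
  P_pos := hP
  W_pos := hW
  P_deriv := hP'
  W_deriv := fun x hx => by
    refine (hW' x hx).congr_fderiv ?_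
    have := (hP x hx).ne'
    congr 1
    field_simp
  a_deriv := ha
  b_deriv := fun x hx => by
    have hne := (hP x hx).ne'
    have h1 := ((hasDerivAt_inv hne).comp_hasFDerivAt x (hP' x hx))
    refine ((((hd x hx).mul (hW' x hx)).mul h1)).congr_fderiv ?_
    ext v
    simp
    field_simp
    ring
  d_deriv := hd
  b_eq := fun x hx => by
    have := (hP x hx).ne'
    field_simp

/-- The scalar curvature of the Reissner–Nordström metrics vanishes. -/
theorem rn_scal {m q : ℝ} (h : 0 < m ∨ q ≠ 0) {G : ℝ → ℝ}
    (hG : IsProfile (rnV m q) (rnG₀ m q) G) {z : Cyl 3} (hz : rnU m q < ‖z.1‖) :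
    scal (pullback (endChart G (rnR m q) (rnC m q))
      (warped (fibreProfile (rnV m q) (rnC m q) G) G)) z = 0 := by
  have hiso := isIsotropic_rn h
  have hc := rnC_pos h
  set A : ℝ := (m ^ 2 + q ^ 2) / 4 with hA
  set U : Set (Euc 3) := {x | rnU m q < ‖x‖} with hU
  have hUo : IsOpen U := isOpen_lt continuous_const continuous_norm
  have hu : ∀ x ∈ U, 0 < ‖x‖ := fun x hx => hiso.u₀_pos.trans hx
  set D : ℝ → ℝ := fun u => u ^ 2 + m * u + A with hD
  have hDr : ∀ u, 0 < u → D u = u * rnR m q u := fun u hu => by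
    rw [rnR_eq hu.ne', ← hA]
    simp only [hD]
    field_simp
  have hDp : ∀ x ∈ U, 0 < D ‖x‖ := fun x hx => by
    rw [hDr _ (hu x hx)]
    exact mul_pos (hu x hx) (rnR_pos h (hu x hx))
  have hNp : ∀ x ∈ U, 0 < ‖x‖ ^ 2 - A := fun x hx => by
    have h1 : rnU m q ^ 2 = A := by
      rw [rnU, div_pow, Real.sq_sqrt (by positivity), hA]
      norm_num
    rw [← h1]
    exact sub_pos.2 (pow_lt_pow_left₀ hx hiso.u₀_pos.le two_ne_zero)
  have hDd : ∀ u, HasDerivAt D (2 * u + m) u := fun u => by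
    refine (((hasDerivAt_pow 2 u).add ((hasDerivAt_id u).const_mul m)).add_const A).congr_deriv ?_
    simp
  have hNd : ∀ u, HasDerivAt (fun u : ℝ => u ^ 2 - A) (2 * u) u := fun u => by
    refine ((hasDerivAt_pow 2 u).sub_const A).congr_deriv ?_
    simp
  -- With `D = u² + mu + A = u r`, the metric has `P = (D/u²)²` and `W = ((u² - A)/D)²`. Then `a =
  -- P'/(2uP)` and `d = W'/(2uW)`, while `a₁ = a'/u` and `d₁ = d'/u`, written as unsimplified
  -- quotients.
  have hst := IsStatic.of_conformal (U := U)
    (P := fun x => (D ‖x‖ / ‖x‖ ^ 2) ^ 2) (W := fun x => ((‖x‖ ^ 2 - A) / D ‖x‖) ^ 2)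
    (a := fun x => -(m * ‖x‖ + 2 * A) / (‖x‖ ^ 2 * D ‖x‖))
    (d := fun x => (m * ‖x‖ ^ 2 + 4 * A * ‖x‖ + A * m) / (‖x‖ * D ‖x‖ * (‖x‖ ^ 2 - A)))
    (a₁ := fun x => (-m * (‖x‖ ^ 2 * D ‖x‖) - -(m * ‖x‖ + 2 * A) *
      (2 * ‖x‖ * D ‖x‖ + ‖x‖ ^ 2 * (2 * ‖x‖ + m))) / (‖x‖ ^ 2 * D ‖x‖) ^ 2 * ‖x‖⁻¹)
    (d₁ := fun x => ((2 * m * ‖x‖ + 4 * A) * (‖x‖ * D ‖x‖ * (‖x‖ ^ 2 - A))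
      - (m * ‖x‖ ^ 2 + 4 * A * ‖x‖ + A * m) * ((D ‖x‖ + ‖x‖ * (2 * ‖x‖ + m)) * (‖x‖ ^ 2 - A)
        + ‖x‖ * D ‖x‖ * (2 * ‖x‖))) / (‖x‖ * D ‖x‖ * (‖x‖ ^ 2 - A)) ^ 2 * ‖x‖⁻¹)
    hUo (fun x hx => ?_) (fun x hx => ?_) (fun x hx => ?_) (fun x hx => ?_) (fun x hx => ?_)
    (fun x hx => ?_)
  · have hg : ∀ z : Cyl 3, z.1 ∈ U → ∀ v w, pullback (endChart G (rnR m q) (rnC m q))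
        (warped (fibreProfile (rnV m q) (rnC m q) G) G) z v w =
        (D ‖z.1‖ / ‖z.1‖ ^ 2) ^ 2 * inner ℝ v.1 w.1
          + ((‖z.1‖ ^ 2 - A) / D ‖z.1‖) ^ 2 * (v.2 * w.2) := by
      intro z hz v w
      have h1 := hu _ hz
      have h2 := rnR_pos h h1
      rw [hiso.pullback_endChart hG hc hz, rnV_rnR h h1, hDr _ h1, ← hA]
      congr 3
      · field_simp
      · field_simp
    have h1 := hu _ hz
    have h2 := hDp _ hz
    have h3 := hNp _ hz
    rw [hst.scal_eq hg hz]
    have hDe : D ‖z.1‖ = ‖z.1‖ ^ 2 + m * ‖z.1‖ + A := rfl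
    rw [hDe] at h2 ⊢
    generalize ‖z.1‖ = u at *
    field_simp
    ring
  · have h1 := hu x hx
    have h2 := hDp x hx
    positivity
  · have h2 := hDp x hx
    have h3 := hNp x hx
    positivity
  · have h1 := hu x hx
    have h2 := hDp x hx
    have h4 := hasFDerivAt_radial (norm_pos_iff.1 h1)
      (((hDd ‖x‖).div (hasDerivAt_pow 2 ‖x‖) (by positivity)).pow 2)
    refine h4.congr_fderiv ?_
    ext v
    simp
    field_simp
    simp only [hD]
    ring
  · have h1 := hu x hx
    have h2 := hDp x hx
    have h3 := hNp x hx
    have h4 := hasFDerivAt_radial (norm_pos_iff.1 h1)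
      (((hNd ‖x‖).div (hDd ‖x‖) h2.ne').pow 2)
    refine h4.congr_fderiv ?_
    ext v
    simp
    field_simp
    simp only [hD]
    ring
  · have h1 := hu x hx
    have h2 := hDp x hx
    have h4 := hasFDerivAt_radial (norm_pos_iff.1 h1)
      ((((((hasDerivAt_id ‖x‖).const_mul m).add_const (2 * A)).neg).div
        ((hasDerivAt_pow 2 ‖x‖).mul (hDd ‖x‖)) (by simp only [Pi.mul_apply]; positivity)))
    refine h4.congr_fderiv ?_
    ext v
    simp
    ring
  · have h1 := hu x hx
    have h2 := hDp x hx
    have h3 := hNp x hx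
    have h4 := hasFDerivAt_radial (norm_pos_iff.1 h1)
      (((((hasDerivAt_pow 2 ‖x‖).const_mul m).add ((hasDerivAt_id ‖x‖).const_mul (4 * A))).add_const
        (A * m)).div
        (((hasDerivAt_id ‖x‖).mul (hDd ‖x‖)).mul (hNd ‖x‖))
        (by simp only [Pi.mul_apply, id]; positivity))
    refine h4.congr_fderiv ?_
    ext v
    simp
    ring

theorem reissnerNordstrom (m q : ℝ) (h : 0 < m ∨ q ≠ 0) :
    (∃ G, IsProfile (rnV m q) (rnG₀ m q) G) ∧
      ∀ G, IsProfile (rnV m q) (rnG₀ m q) G →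
      ∀ (Ψ : Cyl 3 → Amb 3) (L : ℝ) (X : CircleEnd 3 (Cyl 3))
        (gM : Amb 3 → Amb 3 → Amb 3 → ℝ) (g : Cyl 3 → Cyl 3 → Cyl 3 → ℝ),
        Ψ = endChart G (rnR m q) (rnC m q) →
        L = 2 * Real.pi * rnC m q →
        X = trivialEnd 3 (rnU m q) L →
        gM = warped (fibreProfile (rnV m q) (rnC m q) G) G →
        g = pullback Ψ gM →
        IsCompleteMetric gM ∧
        IsEndChart Ψ (rnU m q) L ∧
        (∀ z ∈ X.carrier, scal g z = 0) ∧
        IsALF X (dtForm 3) g ∧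
        massD X (dtForm 3) g = ((2 * m : ℝ) : EReal) ∧
        (m < 0 → massD X (dtForm 3) g < 0) ∧
        ∀ S : SpinStructure 3, ¬ SpinTrivialAtInfinity S Ψ L := by
  have hiso := isIsotropic_rn h
  have hc := rnC_pos h
  obtain ⟨e, he0, he⟩ := hiso.exists_radial
  refine ⟨⟨_, hiso.isProfile he0 he⟩, ?_⟩
  rintro G hG _ _ _ _ _ rfl rfl rfl rfl rfl
  obtain ⟨K, H, hKH⟩ := rn_isSmoothWarping h hG
  obtain ⟨h1, h2⟩ := rn_asymptotics h hG
  refine ⟨hKH.isCompleteMetric, hiso.isEndChart hG hc, fun z hz => rn_scal h hG hz, h1, h2,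
    fun hm => ?_, hiso.not_spinTrivialAtInfinity (by norm_num) hG hc⟩
  rw [h2]
  exact_mod_cast (by linarith : 2 * m < 0)

open Bornology Asymptotics

/-! ### The Hopf fibration -/

theorem norm_hopf (z : ℂ × ℂ) : ‖hopf z‖ = Complex.normSq z.1 + Complex.normSq z.2 := by
  rw [EuclideanSpace.norm_eq, Real.sqrt_eq_iff_mul_self_eq (by positivity)
    (add_nonneg (Complex.normSq_nonneg _) (Complex.normSq_nonneg _))]
  simp [hopf, Fin.sum_univ_three, Complex.normSq_apply]
  ring

theorem contDiff_re_im : (ContDiff ℝ ∞ fun z : ℂ × ℂ => z.1.re) ∧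
    (ContDiff ℝ ∞ fun z : ℂ × ℂ => z.1.im) ∧ (ContDiff ℝ ∞ fun z : ℂ × ℂ => z.2.re) ∧
    (ContDiff ℝ ∞ fun z : ℂ × ℂ => z.2.im) :=
  ⟨Complex.reCLM.contDiff.comp contDiff_fst, Complex.imCLM.contDiff.comp contDiff_fst,
    Complex.reCLM.contDiff.comp contDiff_snd, Complex.imCLM.contDiff.comp contDiff_snd⟩

theorem contDiff_hopf : ContDiff ℝ ∞ hopf := by
  obtain ⟨h1, h2, h3, h4⟩ := contDiff_re_im
  rw [contDiff_euclidean]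
  intro i
  fin_cases i
  · simp [hopf]
    fun_prop
  · simp [hopf]
    fun_prop
  · simp [hopf, Complex.normSq_apply]
    fun_prop

/-- The Hopf map is quadratic, so along a line it is a polynomial of degree 2 whose linear
coefficient is the derivative. -/
theorem fderiv_hopf (z w : ℂ × ℂ) : fderiv ℝ hopf z w =
    !₂[2 * (w.1 * star z.2 + z.1 * star w.2).re, 2 * (w.1 * star z.2 + z.1 * star w.2).im,
      2 * (star z.1 * w.1).re - 2 * (star z.2 * w.2).re] := by
  set D : Euc 3 := !₂[2 * (w.1 * star z.2 + z.1 * star w.2).re,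
    2 * (w.1 * star z.2 + z.1 * star w.2).im, 2 * (star z.1 * w.1).re - 2 * (star z.2 * w.2).re]
    with hD
  have h1 : ∀ t : ℝ, hopf (z + t • w) = hopf z + t • D + t ^ 2 • hopf w := by
    intro t
    ext i
    fin_cases i <;> simp [hopf, hD, Complex.normSq_apply] <;> ring
  have h2 : HasDerivAt (fun t : ℝ => hopf (z + t • w)) D 0 := by
    simp_rw [h1]
    have h3 := (((hasDerivAt_id (0 : ℝ)).smul_const D).const_add (hopf z)).add
      ((hasDerivAt_pow 2 (0 : ℝ)).smul_const (hopf w))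
    refine h3.congr_deriv ?_
    simp
  have h3 : HasFDerivAt hopf (fderiv ℝ hopf z) (z + (0 : ℝ) • w) := by
    simpa using ((contDiff_hopf.differentiable (by simp)) z).hasFDerivAt
  have h4 : HasDerivAt (fun t : ℝ => z + t • w) w 0 := by
    simpa using ((hasDerivAt_id (0 : ℝ)).smul_const w).const_add z
  have h5 : HasDerivAt (fun t : ℝ => hopf (z + t • w)) (fderiv ℝ hopf z w) 0 :=
    HasFDerivAt.comp_hasDerivAt (f := fun t : ℝ => z + t • w) (0 : ℝ) h3 h4
  exact h5.unique h2

/-- The Clifford action of `v` on the spinor `z`. -/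
def pauli (v : Euc 3) (z : ℂ × ℂ) : ℂ × ℂ :=
  (v 2 * z.1 + (v 0 + v 1 * Complex.I) * z.2, (v 0 - v 1 * Complex.I) * z.1 - v 2 * z.2)

/-- Up to the factor `2‖hopf z‖`, the Clifford action is a right inverse of the derivative. It gives
the submersion property here, and later the horizontal lift. -/
theorem fderiv_hopf_pauli (v : Euc 3) (z : ℂ × ℂ) :
    fderiv ℝ hopf z (pauli v z) = (2 * ‖hopf z‖) • v := by
  rw [fderiv_hopf, norm_hopf]
  ext i
  fin_cases i <;> simp [pauli, Complex.normSq_apply] <;> ring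

/-- A preimage with first coordinate real and positive exists unless `x` lies on the ray `x₂ =
-‖x‖`, where the first coordinate of `z` vanishes. -/
theorem exists_hopf_eq (x : Euc 3) : ∃ z, hopf z = x := by
  have hx : ‖x‖ ^ 2 = x 0 ^ 2 + x 1 ^ 2 + x 2 ^ 2 := by
    rw [EuclideanSpace.norm_sq_eq, Fin.sum_univ_three]; simp
  have hn := norm_nonneg x
  rcases (show 0 ≤ ‖x‖ + x 2 by nlinarith [sq_nonneg (x 0), sq_nonneg (x 1)]).eq_or_lt with h | h
  · refine ⟨(0, (Real.sqrt ‖x‖ : ℝ)), ?_⟩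
    have h0 : x 0 = 0 := by nlinarith [sq_nonneg (x 0), sq_nonneg (x 1)]
    have h1 : x 1 = 0 := by nlinarith [sq_nonneg (x 0), sq_nonneg (x 1)]
    ext i
    fin_cases i
    · simp [hopf, h0]
    · simp [hopf, h1]
    · simp [hopf, Complex.normSq_apply, Real.mul_self_sqrt hn]
      linarith
  · set s := Real.sqrt ((‖x‖ + x 2) / 2) with hs
    have hs0 : 0 < s := Real.sqrt_pos.2 (by linarith)
    have hss : s * s = (‖x‖ + x 2) / 2 := Real.mul_self_sqrt (by linarith)
    refine ⟨((s : ℂ), ⟨x 0 / (2 * s), -(x 1 / (2 * s))⟩), ?_⟩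
    ext i
    fin_cases i
    · simp [hopf]
      field_simp
    · simp [hopf]
      field_simp
    · simp [hopf, Complex.normSq_apply]
      field_simp
      linear_combination (4 * (s * s) + 2 * (‖x‖ + x 2) - 4 * x 2) * hss + hx

theorem hopf_unit_smul {c : ℂ} (hc : ‖c‖ = 1) (z : ℂ × ℂ) : hopf (c • z) = hopf z := by
  have h : c.re * c.re + c.im * c.im = 1 := by
    rw [← Complex.normSq_apply, Complex.normSq_eq_norm_sq, hc, one_pow]
  ext i
  fin_cases i
  · simp [hopf]
    linear_combination (z.1.re * z.2.re + z.1.im * z.2.im) * h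
  · simp [hopf]
    linear_combination (z.1.im * z.2.re - z.1.re * z.2.im) * h
  · simp [hopf, Complex.normSq_eq_norm_sq, hc]

/-- The Hopf map and its norm determine `|z₁|`, `|z₂|` and `z₁ z̄₂`, hence `z` up to a phase; the
phase is a quotient of coordinates that do not vanish. -/
theorem exists_smul_of_hopf_eq {z w : ℂ × ℂ} (h : hopf z = hopf w) (hz : z ≠ 0) :
    ∃ c : ℂ, ‖c‖ = 1 ∧ w = c • z := by
  have hn := congrArg norm h
  rw [norm_hopf, norm_hopf] at hn
  have h2 : Complex.normSq z.1 - Complex.normSq z.2 = Complex.normSq w.1 - Complex.normSq w.2 :=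
    congrArg (fun x : Euc 3 => x 2) h
  have h0 : 2 * (z.1 * star z.2).re = 2 * (w.1 * star w.2).re := congrArg (fun x : Euc 3 => x 0) h
  have h1 : 2 * (z.1 * star z.2).im = 2 * (w.1 * star w.2).im := congrArg (fun x : Euc 3 => x 1) h
  have hp : z.1 * star z.2 = w.1 * star w.2 := Complex.ext (by linarith) (by linarith)
  have ha : Complex.normSq z.1 = Complex.normSq w.1 := by linarith
  have hb : Complex.normSq z.2 = Complex.normSq w.2 := by linarith
  have ha' : ‖z.1‖ = ‖w.1‖ := by
    rw [Complex.normSq_eq_norm_sq, Complex.normSq_eq_norm_sq] at ha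
    exact (pow_left_inj₀ (norm_nonneg _) (norm_nonneg _) two_ne_zero).1 ha
  have hb' : ‖z.2‖ = ‖w.2‖ := by
    rw [Complex.normSq_eq_norm_sq, Complex.normSq_eq_norm_sq] at hb
    exact (pow_left_inj₀ (norm_nonneg _) (norm_nonneg _) two_ne_zero).1 hb
  have hca : z.1 * star z.1 = w.1 * star w.1 := by
    have := congrArg (fun r : ℝ => (r : ℂ)) ha
    simpa [Complex.mul_conj] using this
  have hcb : z.2 * star z.2 = w.2 * star w.2 := by
    have := congrArg (fun r : ℝ => (r : ℂ)) hb
    simpa [Complex.mul_conj] using this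
  by_cases h1 : z.1 = 0
  · have hz2 : z.2 ≠ 0 := fun h2 => hz (Prod.ext h1 h2)
    have hw1 : w.1 = 0 := by rw [← norm_eq_zero, ← ha', h1, norm_zero]
    refine ⟨w.2 / z.2, by rw [norm_div, hb', div_self (by rw [← hb']; simpa using hz2)], ?_⟩
    ext1
    · simp [h1, hw1]
    · simp [hz2]
  · have hw1 : w.1 ≠ 0 := by rw [← norm_ne_zero_iff, ← ha', norm_ne_zero_iff]; exact h1
    refine ⟨w.1 / z.1, by rw [norm_div, ha', div_self (by simpa using hw1)], ?_⟩
    ext1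
    · simp [h1]
    · have hp' : star z.1 * z.2 = star w.1 * w.2 := by
        have := congrArg star hp
        simpa [mul_comm] using this
      have hsz : star w.1 ≠ 0 := by simpa using hw1
      show w.2 = w.1 / z.1 * z.2
      rw [div_mul_eq_mul_div, eq_div_iff h1]
      refine mul_left_cancel₀ hsz ?_
      linear_combination -z.1 * hp' + z.2 * hca

/-! ### The Hopf circle bundle, its connection and its curvature. -/

section HopfEnd

variable {k : ℕ} {R₀ L : ℝ}

theorem ne_zero_of_mem_hopfEnd (hR : 0 ≤ R₀) {z : ℂ × ℂ} (hz : z ∈ (hopfEnd k R₀ L).carrier) :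
    z ≠ 0 := by
  rintro rfl
  have : R₀ < Complex.normSq (0 : ℂ) + Complex.normSq (0 : ℂ) := hz
  simp at this
  linarith

theorem hopfEnd_carrier : (hopfEnd k R₀ L).carrier = {z | R₀ < ‖hopf z‖} := by
  simp_rw [norm_hopf]; rfl

theorem hopfEnd_flow (t : ℝ) (z : ℂ × ℂ) : (hopfEnd k R₀ L).flow t z =
    Complex.exp ((2 * Real.pi * t / (k * L) : ℝ) * Complex.I) • z := rfl

theorem fderiv_hopfEnd_flow (t : ℝ) (z v : ℂ × ℂ) : fderiv ℝ ((hopfEnd k R₀ L).flow t) z v =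
    Complex.exp ((2 * Real.pi * t / (k * L) : ℝ) * Complex.I) • v := by
  have h : HasFDerivAt ((hopfEnd k R₀ L).flow t)
      (Complex.exp ((2 * Real.pi * t / (k * L) : ℝ) * Complex.I) •
        ContinuousLinearMap.id ℝ (ℂ × ℂ)) z :=
    (hasFDerivAt_id (𝕜 := ℝ) z).const_smul
      (Complex.exp ((2 * Real.pi * t / (k * L) : ℝ) * Complex.I))
  rw [h.fderiv]; rfl

theorem isCircleEnd_hopfEnd (hk : 1 ≤ k) (hR : 0 ≤ R₀) (hL : 0 < L) :
    IsCircleEnd (hopfEnd k R₀ L) where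
  L_pos := hL
  dim := by simp
  isOpen := by
    rw [hopfEnd_carrier]
    exact isOpen_lt continuous_const contDiff_hopf.continuous.norm
  proj_smooth := contDiff_hopf.contDiffOn
  proj_image := by
    rw [hopfEnd_carrier]
    ext x
    constructor
    · rintro ⟨z, hz, rfl⟩
      exact hz
    · intro hx
      obtain ⟨z, rfl⟩ := exists_hopf_eq x
      exact ⟨z, hx, rfl⟩
  proj_submersion := by
    rw [hopfEnd_carrier]
    intro z hz v
    have hz0 : 2 * ‖hopf z‖ ≠ 0 := by
      have : R₀ < ‖hopf z‖ := hz
      have : 0 < ‖hopf z‖ := hR.trans_lt this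
      positivity
    refine ⟨(2 * ‖hopf z‖)⁻¹ • pauli v z, ?_⟩
    rw [map_smul]
    show _ • fderiv ℝ hopf z _ = v
    rw [fderiv_hopf_pauli, inv_smul_smul₀ hz0]
  flow_smooth := by
    refine ContDiff.contDiffOn (ContDiff.smul (𝕜' := ℂ) ?_ contDiff_snd)
    refine Complex.contDiff_exp.comp ((Complex.ofRealCLM.contDiff.comp ?_).mul contDiff_const)
    exact (contDiff_const.mul contDiff_fst).div_const _
  flow_mem := by
    rw [hopfEnd_carrier]
    intro t z hz
    rw [mem_ofPred_eq, hopfEnd_flow, hopf_unit_smul (Complex.norm_exp_ofReal_mul_I _)]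
    exact hz
  flow_zero := fun z _ => by simp [hopfEnd_flow]
  flow_add := fun s t z _ => by
    rw [hopfEnd_flow, hopfEnd_flow, hopfEnd_flow, smul_smul, ← Complex.exp_add]
    congr 2
    push_cast
    ring
  fibre := by
    intro z hz w _
    constructor
    · intro h
      obtain ⟨c, hc, rfl⟩ := exists_smul_of_hopf_eq h (ne_zero_of_mem_hopfEnd hR hz)
      -- The flow multiplies by a phase of angle `2πt/(kL)`, so this is the time at which the angle
      -- equals `arg c`.
      refine ⟨k * L * c.arg / (2 * Real.pi), ?_⟩
      rw [hopfEnd_flow]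
      have hk' : (k : ℝ) ≠ 0 := by positivity
      have : 2 * Real.pi * (k * L * c.arg / (2 * Real.pi)) / (k * L) = c.arg := by
        field_simp
      rw [this]
      congr 1
      have := Complex.norm_mul_exp_arg_mul_I c
      rw [hc] at this
      simpa using this.symm
    · rintro ⟨t, rfl⟩
      exact (hopf_unit_smul (Complex.norm_exp_ofReal_mul_I _) z).symm
  free := by
    intro t z hz h
    rw [hopfEnd_flow] at h
    have h1 : Complex.exp ((2 * Real.pi * t / (k * L) : ℝ) * Complex.I) = 1 := by
      have h2 : (Complex.exp ((2 * Real.pi * t / (k * L) : ℝ) * Complex.I) - 1) • z = 0 := by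
        rw [sub_smul, h, one_smul, sub_self]
      exact sub_eq_zero.1 ((smul_eq_zero.1 h2).resolve_right (ne_zero_of_mem_hopfEnd hR hz))
    obtain ⟨n, hn⟩ := Complex.exp_eq_one_iff.1 h1
    -- Upstairs in ℂ² the flow closes up only at multiples of `kL`; these are in particular
    -- multiples of `L`.
    refine ⟨n * k, ?_⟩
    have h3 := congrArg Complex.im hn
    simp only [Complex.im_ofReal_mul, Complex.I_im, mul_one] at h3
    have h4 : (n * (2 * Real.pi * Complex.I)).im = n * (2 * Real.pi) := by simp
    rw [h4] at h3
    have hk' : (k : ℝ) ≠ 0 := by positivity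
    have hp := Real.pi_pos
    field_simp at h3
    show t = ((n * k : ℤ) : ℝ) * L
    push_cast
    linarith

theorem vert_hopfEnd (z : ℂ × ℂ) : vert (hopfEnd k R₀ L) z =
    (((2 * Real.pi / (k * L) : ℝ) : ℂ) * Complex.I) • z := by
  have h1 : HasDerivAt (fun t : ℝ => ((2 * Real.pi * t / (k * L) : ℝ) : ℂ) * Complex.I)
      (((2 * Real.pi / (k * L) : ℝ) : ℂ) * Complex.I) 0 := by
    refine HasDerivAt.mul_const (HasDerivAt.ofReal_comp ?_) _
    simpa using ((hasDerivAt_id (0 : ℝ)).const_mul (2 * Real.pi)).div_const (k * L)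
  have h2 : HasDerivAt (fun t => (hopfEnd k R₀ L).flow t z)
      ((((2 * Real.pi / (k * L) : ℝ) : ℂ) * Complex.I) • z) 0 := by
    have h3 := (h1.cexp).smul_const z
    refine h3.congr_deriv ?_
    simp
  exact h2.deriv

theorem hopfForm_apply (z v : ℂ × ℂ) : hopfForm k L z v =
    k * L / (2 * Real.pi) / (Complex.normSq z.1 + Complex.normSq z.2) *
      ((star z.1 * v.1).im + (star z.2 * v.2).im) := rfl

/-- The form `Im ⟨z, v⟩`. -/
def contact : ℂ × ℂ →L[ℝ] (ℂ × ℂ) →L[ℝ] ℝ :=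
  LinearMap.toContinuousLinearMap
    { toFun := fun z => Complex.imCLM.comp ((star z.1) • ContinuousLinearMap.fst ℝ ℂ ℂ)
        + Complex.imCLM.comp ((star z.2) • ContinuousLinearMap.snd ℝ ℂ ℂ)
      map_add' := fun z w => by
        ext v <;> simp <;> ring
      map_smul' := fun c z => by
        ext v <;> simp <;> ring }

theorem contact_apply (z v : ℂ × ℂ) :
    contact z v = (star z.1 * v.1).im + (star z.2 * v.2).im := rfl

theorem hopfForm_eq (z : ℂ × ℂ) : hopfForm k L z =
    (k * L / (2 * Real.pi) / (Complex.normSq z.1 + Complex.normSq z.2)) • contact z := rfl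

theorem hasFDerivAt_normSq (z : ℂ × ℂ) : ∃ f : ℂ × ℂ →L[ℝ] ℝ,
    HasFDerivAt (fun z : ℂ × ℂ => Complex.normSq z.1 + Complex.normSq z.2) f z ∧
      ∀ v, f v = 2 * ((star z.1 * v.1).re + (star z.2 * v.2).re) := by
  have h1 := (Complex.reCLM.comp (ContinuousLinearMap.fst ℝ ℂ ℂ)).hasFDerivAt (x := z)
  have h2 := (Complex.imCLM.comp (ContinuousLinearMap.fst ℝ ℂ ℂ)).hasFDerivAt (x := z)
  have h3 := (Complex.reCLM.comp (ContinuousLinearMap.snd ℝ ℂ ℂ)).hasFDerivAt (x := z)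
  have h4 := (Complex.imCLM.comp (ContinuousLinearMap.snd ℝ ℂ ℂ)).hasFDerivAt (x := z)
  refine ⟨_, ((h1.mul h1).add (h2.mul h2)).add ((h3.mul h3).add (h4.mul h4)), fun v => ?_⟩
  simp
  ring

theorem contDiffAt_hopfForm {z : ℂ × ℂ} (hz : z ≠ 0) : ContDiffAt ℝ ∞ (hopfForm k L) z := by
  obtain ⟨h1, h2, h3, h4⟩ := contDiff_re_im
  have h0 : Complex.normSq z.1 + Complex.normSq z.2 ≠ 0 := by
    rw [← norm_hopf, norm_hopf]
    intro h
    have := Complex.normSq_nonneg z.1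
    have := Complex.normSq_nonneg z.2
    exact hz (Prod.ext (Complex.normSq_eq_zero.1 (by linarith))
      (Complex.normSq_eq_zero.1 (by linarith)))
  have h5 : ContDiff ℝ ∞ fun z : ℂ × ℂ => Complex.normSq z.1 + Complex.normSq z.2 := by
    simp only [Complex.normSq_apply]
    fun_prop
  exact (contDiffAt_const.div h5.contDiffAt h0).smul contact.contDiff.contDiffAt

theorem isConnection_hopfForm (hk : 1 ≤ k) (hR : 0 ≤ R₀) (hL : 0 < L) :
    IsConnection (hopfEnd k R₀ L) (hopfForm k L) where
  smooth := fun z hz => (contDiffAt_hopfForm (ne_zero_of_mem_hopfEnd hR hz)).contDiffWithinAt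
  eta_vert := by
    intro z hz
    have hz0 : 0 < Complex.normSq z.1 + Complex.normSq z.2 := hR.trans_lt hz
    have hk' : (k : ℝ) ≠ 0 := by positivity
    have hp := Real.pi_pos
    rw [vert_hopfEnd, hopfForm_apply]
    have h1 : ∀ (a : ℝ) (w : ℂ), (star w * ((a : ℂ) * Complex.I * w)).im =
        a * Complex.normSq w := by
      intro a w
      simp [Complex.normSq_apply]
      ring
    show _ * ((star z.1 * (_ * z.1)).im + (star z.2 * (_ * z.2)).im) = 1
    rw [h1, h1]
    field_simp
  invariant := by
    intro t z _ v
    rw [fderiv_hopfEnd_flow, hopfEnd_flow]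
    generalize hc : Complex.exp ((2 * Real.pi * t / (k * L) : ℝ) * Complex.I) = c
    have hc1 : ‖c‖ = 1 := hc ▸ Complex.norm_exp_ofReal_mul_I _
    have hc2 : star c * c = 1 := by
      have := Complex.conj_mul' c
      rw [hc1] at this
      simpa using this
    rw [hopfForm_apply, hopfForm_apply, ← norm_hopf, ← norm_hopf, hopf_unit_smul hc1]
    have h1 : ∀ a b : ℂ, star (c * a) * (c * b) = star a * b := by
      intro a b
      rw [star_mul]
      linear_combination star a * b * hc2
    show _ * ((star (c * z.1) * (c * v.1)).im + (star (c * z.2) * (c * v.2)).im) = _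
    rw [h1, h1]

/-- The cross product of `ℝ³` as a continuous bilinear map. -/
def crossForm : Euc 3 →L[ℝ] Euc 3 →L[ℝ] Euc 3 :=
  LinearMap.toContinuousLinearMap
    { toFun := fun v => LinearMap.toContinuousLinearMap
        { toFun := fun w => WithLp.toLp 2 (crossProduct v.ofLp w.ofLp)
          map_add' := fun w w' => by simp
          map_smul' := fun c w => by simp }
      map_add' := fun w w' => by ext v : 1; simp
      map_smul' := fun c w => by ext v : 1; simp }

theorem crossForm_apply (v w : Euc 3) :
    crossForm v w = WithLp.toLp 2 (crossProduct v.ofLp w.ofLp) := rfl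

theorem crossForm_eq (v w : Euc 3) : crossForm v w =
    !₂[v 1 * w 2 - v 2 * w 1, v 2 * w 0 - v 0 * w 2, v 0 * w 1 - v 1 * w 0] := by
  rw [crossForm_apply, cross_apply]

/-- The volume form of `ℝ³`. -/
def tripleForm : Euc 3 →L[ℝ] Euc 3 →L[ℝ] Euc 3 →L[ℝ] ℝ :=
  ((ContinuousLinearMap.compL ℝ (Euc 3) (Euc 3 →L[ℝ] Euc 3) (Euc 3 →L[ℝ] ℝ)).flip crossForm).comp
    ((ContinuousLinearMap.compL ℝ (Euc 3) (Euc 3) ℝ).comp (innerForm 3))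

theorem tripleForm_apply (x v w : Euc 3) : tripleForm x v w = inner ℝ x (crossForm v w) := rfl

theorem tripleForm_eq (x v w : Euc 3) : tripleForm x v w =
    x 0 * (v 1 * w 2 - v 2 * w 1) + x 1 * (v 2 * w 0 - v 0 * w 2)
      + x 2 * (v 0 * w 1 - v 1 * w 0) := by
  rw [tripleForm_apply, crossForm_eq, PiLp.inner_apply, Fin.sum_univ_three]
  simp
  ring

/-- The curvature form of the Hopf connection. -/
def hopfCurv (k : ℕ) (L : ℝ) (x : Euc 3) : Euc 3 →L[ℝ] Euc 3 →L[ℝ] ℝ :=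
  (-(k * L / (2 * Real.pi) / 2) * (‖x‖ ^ 3)⁻¹) • tripleForm x

theorem contDiffAt_hopfCurv {x : Euc 3} (hx : x ≠ 0) : ContDiffAt ℝ ∞ (hopfCurv k L) x :=
  (contDiffAt_const.mul (((contDiffAt_norm ℝ hx).pow 3).inv (by simpa using hx))).smul
    tripleForm.contDiff.contDiffAt

theorem symbolClass_hopfCurv (n : ℕ) : SymbolClass n (-2) (hopfCurv k L) := by
  refine SymbolClass.of_homogeneous n (fun x hx => contDiffAt_hopfCurv hx) fun c x hc _ => ?_
  rw [hopfCurv, hopfCurv, norm_smul, Real.norm_of_nonneg hc.le, map_smul, smul_smul, smul_smul]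
  congr 1
  rw [show (-2 : ℤ) = -(2 : ℕ) by norm_num, zpow_neg, zpow_natCast]
  field_simp

/-- Differentiating `|z|^{-2}` times the contact form gives a two-form that descends to minus a
multiple of the solid angle form `|x|^{-3} vol(x, ·, ·)`, with factor `kL/(4π)`. -/
theorem isCurvature_hopfForm (hR : 0 ≤ R₀) :
    IsCurvature (hopfEnd k R₀ L) (hopfForm k L) (hopfCurv k L) := by
  intro z hz v w
  have hz0 : 0 < Complex.normSq z.1 + Complex.normSq z.2 := hR.trans_lt hz
  obtain ⟨f, hf, hfv⟩ := hasFDerivAt_normSq z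
  have h1 := ((hasFDerivAt_const (k * L / (2 * Real.pi)) z).mul
    ((hasDerivAt_inv hz0.ne').comp_hasFDerivAt z hf)).smul contact.hasFDerivAt
  have h2 : ∀ v w, fderiv ℝ (hopfForm k L) z v w = k * L / (2 * Real.pi) *
      ((Complex.normSq z.1 + Complex.normSq z.2)⁻¹ * contact v w -
        ((Complex.normSq z.1 + Complex.normSq z.2) ^ 2)⁻¹ * f v * contact z w) := by
    intro v w
    have h3 : HasFDerivAt (hopfForm k L) _ z := h1
    rw [h3.fderiv]
    simp
    ring
  rw [extd, h2, h2]
  show _ = hopfCurv k L (hopf z) (fderiv ℝ hopf z v) (fderiv ℝ hopf z w)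
  simp only [hopfCurv, smul_apply, smul_eq_mul]
  rw [norm_hopf]
  set ρ := Complex.normSq z.1 + Complex.normSq z.2 with hρ
  -- After clearing the powers of `|z|²` this is a polynomial identity in the real coordinates.
  have h4 : -(1 / 2) * tripleForm (hopf z) (fderiv ℝ hopf z v) (fderiv ℝ hopf z w) =
      ρ ^ 2 * (contact v w - contact w v) - ρ * (f v * contact z w - f w * contact z v) := by
    rw [tripleForm_eq, fderiv_hopf, fderiv_hopf, hfv, hfv]
    simp only [contact_apply, hρ, hopf, Complex.normSq_apply]
    simp
    ring
  field_simp
  linear_combination (-2 * k * L) * h4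

end HopfEnd

open Bornology Asymptotics

/-! ### Gibbons–Hawking potentials -/

theorem symbolClass_norm (n m : ℕ) : SymbolClass n 1 fun x : Euc m => ‖x‖ := by
  refine SymbolClass.of_homogeneous n (fun x hx => contDiffAt_norm ℝ hx) fun c x hc _ => ?_
  rw [norm_smul, Real.norm_of_nonneg hc.le, zpow_one, smul_eq_mul]

theorem symbolClass_inv_norm_sub (n : ℕ) {m : ℕ} (a : Euc m) :
    SymbolClass n (-1) fun x : Euc m => ‖x - a‖⁻¹ := by
  have h := (symbolClass_inv_norm_pow n 1 m).comp_sub_const a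
  simpa using h

theorem symbolClass_inv_norm_add_norm_sub (n : ℕ) {m : ℕ} (a : Euc m) :
    SymbolClass n (-1) fun x : Euc m => (‖x‖ + ‖x - a‖)⁻¹ := by
  refine ((symbolClass_norm n m).add ((symbolClass_norm n m).comp_sub_const a)).inv zero_lt_one
    (Eventually.of_forall fun x => ?_)
  rw [zpow_one, one_mul]
  exact le_add_of_nonneg_right (norm_nonneg _)

/-- Rationalizing, the difference is `(2⟨a, x⟩ - ‖a‖²)` divided by `‖x‖ ‖x - a‖ (‖x‖ + ‖x - a‖)`, of
degree `1 - 3`. -/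
theorem symbolClass_inv_norm_sub_sub (n : ℕ) {m : ℕ} (a : Euc m) :
    SymbolClass n (-2) fun x : Euc m => ‖x - a‖⁻¹ - ‖x‖⁻¹ := by
  have h1 := ((SymbolClass.clm n (innerSL ℝ a)).const_smul 2).sub
    ((SymbolClass.const n (‖a‖ ^ 2 : ℝ) (V := Euc m)).mono zero_le_one)
  have h2 := (h1.mul (symbolClass_inv_norm_sub n a)).mul (symbolClass_inv_norm_sub n (0 : Euc m))
  have h3 := h2.mul (symbolClass_inv_norm_add_norm_sub n a)
  refine h3.congr ?_
  filter_upwards [eventually_norm_gt ‖a‖] with x hx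
  have h4 : 0 < ‖x‖ := (norm_nonneg a).trans_lt hx
  have h5 : 0 < ‖x - a‖ := lt_of_lt_of_le (sub_pos.2 hx) (norm_sub_norm_le x a)
  have h6 := norm_sub_sq_real x a
  simp only [innerSL_apply_apply, smul_eq_mul, sub_zero]
  rw [real_inner_comm]
  field_simp
  linear_combination h6

theorem tendsto_normal_of_symbolClass {m k : ℕ} {p : ℤ} {f : Euc m → ℝ} (hf : SymbolClass 1 p f)
    (hp : p + k < 1) :
    Tendsto (fun x => ‖x‖ ^ k * fderiv ℝ f x (‖x‖⁻¹ • x)) (cobounded (Euc m)) (𝓝 0) := by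
  obtain ⟨C, R, hC, h⟩ := hf.fderiv_mem.bound
  have h1 : Tendsto (fun x : Euc m => C * ‖x‖ ^ (p - 1 + k)) (cobounded (Euc m)) (𝓝 0) := by
    simpa using (((tendsto_zpow_atTop_zero (show p - 1 + k < 0 by omega) (𝕜 := ℝ)).comp
      (tendsto_norm_cobounded_atTop (E := Euc m))).const_mul C)
  refine squeeze_zero_norm' ?_ h1
  filter_upwards [eventually_norm_gt R, eventually_norm_gt 0] with x hx hx0
  have h2 : ‖‖x‖⁻¹ • x‖ = 1 := by
    rw [norm_smul, norm_inv, norm_norm, inv_mul_cancel₀ hx0.ne']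
  rw [norm_mul, norm_pow, norm_norm, zpow_add₀ hx0.ne', zpow_natCast, ← mul_assoc, mul_comm]
  refine mul_le_mul_of_nonneg_right ?_ (by positivity)
  refine ((fderiv ℝ f x).le_opNorm _).trans ?_
  rw [h2, mul_one]
  exact h x hx

section Potential

variable {j : ℕ} {m R₀ : ℝ} {a : Fin j → Euc 3}

theorem ne_of_norm_le {F : Type*} [NormedAddCommGroup F] {x a : F} {R : ℝ} (ha : ‖a‖ ≤ R)
    (hx : R < ‖x‖) : x ≠ a := by
  rintro rfl
  linarith

theorem contDiffAt_mtnV (ha : ∀ i, ‖a i‖ ≤ R₀) {x : Euc 3} (hx : R₀ < ‖x‖) :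
    ContDiffAt ℝ ∞ (mtnV m a) x := by
  refine contDiffAt_const.add (ContDiffAt.sum fun i _ => contDiffAt_const.div ?_ ?_)
  · exact (contDiffAt_norm ℝ (sub_ne_zero.2 (ne_of_norm_le (ha i) hx))).comp x
      (contDiffAt_id.sub contDiffAt_const)
  · exact norm_ne_zero_iff.2 (sub_ne_zero.2 (ne_of_norm_le (ha i) hx))

theorem one_le_mtnV (hm : 0 < m) (x : Euc 3) : 1 ≤ mtnV m a x :=
  le_add_of_nonneg_right (Finset.sum_nonneg fun i _ => by positivity)

theorem symbolClass_mtnV (n : ℕ) : SymbolClass n (-1) fun x => mtnV m a x - 1 := by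
  refine (SymbolClass.sum Finset.univ fun i _ =>
    ((symbolClass_inv_norm_sub n (a i)).const_smul (2 * m))).congr (Eventually.of_forall fun x => ?_)
  simp [mtnV, div_eq_mul_inv]

theorem symbolClass_inv_mtnV (n : ℕ) : SymbolClass n (-1) fun x => (mtnV m a x)⁻¹ - 1 := by
  have h := (symbolClass_mtnV (m := m) (a := a) n).comp_smooth_of_zero (by norm_num)
    (P := fun y => (1 + y)⁻¹ - 1) ?_ (by simp)
  · refine h.congr (Eventually.of_forall fun x => ?_)
    simp
  · have h1 : ∀ᶠ y : ℝ in 𝓝 0, (1 + y) ≠ 0 :=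
      (continuousAt_const.add continuousAt_id).eventually_ne (by norm_num)
    filter_upwards [h1] with y hy
    exact ((contDiffAt_const.add contDiffAt_id).inv hy).sub contDiffAt_const

/-- All the charges may be moved to the origin: this changes the potential by a symbol of degree -2,
whose derivative is not seen at order `r^{-2}`. -/
theorem tendsto_fderiv_mtnV : Tendsto (fun x => ‖x‖ ^ (3 - 1) * fderiv ℝ (mtnV m a) x (‖x‖⁻¹ • x))
    (cobounded (Euc 3)) (𝓝 (-(2 * m * j))) := by
  have h1 := tendsto_fderiv_radial (m := 3) (k := 1) le_rfl (p := fun y => 1 + 2 * m * j * y)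
    (Eventually.of_forall fun y => by fun_prop)
  have hd : deriv (fun y : ℝ => 1 + 2 * m * j * y) 0 = 2 * m * j := by simp
  have hD : SymbolClass 1 (-2) fun x : Euc 3 => ∑ i, (2 * m) • (‖x - a i‖⁻¹ - ‖x‖⁻¹) :=
    SymbolClass.sum Finset.univ fun i _ => ((symbolClass_inv_norm_sub_sub 1 (a i)).const_smul (2 * m))
  have h2 := tendsto_normal_of_symbolClass (k := 2) hD (by norm_num)
  have h3 := h1.add h2
  rw [hd, add_zero, show (-((1 : ℕ) : ℝ) * (2 * m * j)) = -(2 * m * j) by push_cast; ring] at h3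
  refine h3.congr' ?_
  have h4 : ∀ᶠ x : Euc 3 in cobounded (Euc 3), ContDiffAt ℝ ∞
      (fun x : Euc 3 => ∑ i, (2 * m) • (‖x - a i‖⁻¹ - ‖x‖⁻¹)) x := hD.smooth
  filter_upwards [h4, eventually_norm_gt 0] with x hx hx0
  rw [← mul_add]
  congr 1
  have h5 : DifferentiableAt ℝ (fun x : Euc 3 => 1 + 2 * m * j * (‖x‖ ^ 1)⁻¹) x := by
    refine (DifferentiableAt.const_mul ?_ _).const_add 1
    refine DifferentiableAt.inv ?_ (by simpa using hx0.ne')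
    exact ((contDiffAt_norm ℝ (norm_pos_iff.1 hx0)).differentiableAt (n := ∞) (by simp)).pow 1
  have h6 : mtnV m a = (fun x : Euc 3 => 1 + 2 * m * j * (‖x‖ ^ 1)⁻¹) +
      fun x : Euc 3 => ∑ i, (2 * m) • (‖x - a i‖⁻¹ - ‖x‖⁻¹) := by
    funext y
    simp only [mtnV, Pi.add_apply, smul_eq_mul, mul_sub, Finset.sum_sub_distrib, pow_one,
      Finset.sum_const, Finset.card_univ, Fintype.card_fin, nsmul_eq_mul, div_eq_mul_inv]
    ring
  rw [h6, fderiv_add h5 (hx.differentiableAt (by simp))]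
  rfl

theorem tendsto_fderiv_inv_mtnV (hm : 0 < m) (ha : ∀ i, ‖a i‖ ≤ R₀) :
    Tendsto (fun x => ‖x‖ ^ (3 - 1) * fderiv ℝ (fun x => (mtnV m a x)⁻¹) x (‖x‖⁻¹ • x))
    (cobounded (Euc 3)) (𝓝 (2 * m * j)) := by
  have h1 : Tendsto (fun x => (mtnV m a x)⁻¹) (cobounded (Euc 3)) (𝓝 1) := by
    simpa using ((symbolClass_inv_mtnV (m := m) (a := a) 0).tendsto_zero (by norm_num)).add_const 1
  have h2 := (h1.pow 2).neg.mul (tendsto_fderiv_mtnV (m := m) (a := a))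
  rw [show -(1 : ℝ) ^ 2 * -(2 * m * j) = 2 * m * j by ring] at h2
  refine h2.congr' ?_
  filter_upwards [eventually_norm_gt R₀] with x hx
  have h3 := ((contDiffAt_mtnV (m := m) ha hx).differentiableAt (by simp)).hasFDerivAt
  have h4 : mtnV m a x ≠ 0 := (zero_lt_one.trans_le (one_le_mtnV hm x)).ne'
  have h5 : HasFDerivAt (fun x => (mtnV m a x)⁻¹) _ x :=
    (hasDerivAt_inv h4).comp_hasFDerivAt x h3
  rw [h5.fderiv]
  simp
  ring

end Potential

/-! ### Asymptotics and mass of Gibbons–Hawking metrics. -/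

section GibbonsHawking

variable {k j : ℕ} {m R₀ L : ℝ} {a : Fin j → Euc 3} {β : Euc 3 → Euc 3 →L[ℝ] ℝ}
  {θ : ℂ × ℂ → (ℂ × ℂ) →L[ℝ] ℝ}

theorem ghMetric_eq_bundleCoeff {V : Euc 3 → ℝ} {z : ℂ × ℂ}
    (hθ : ∀ v, θ z v = hopfForm k L z v + β (hopf z) (fderiv ℝ hopf z v)) (v w : ℂ × ℂ) :
    ghMetric (hopfEnd k R₀ L) V θ z v w =
      bundleCoeff V (fun x => (V x)⁻¹) β ((hopfEnd k R₀ L).proj z)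
        (coframe (hopfEnd k R₀ L) (hopfForm k L) z v)
        (coframe (hopfEnd k R₀ L) (hopfForm k L) z w) := by
  rw [bundleCoeff_apply, ghMetric, hθ, hθ]
  rfl

theorem isALF_ghMetric (hk : 1 ≤ k) (hR : 0 ≤ R₀) (hL : 0 < L) (hm : 0 < m)
    (ha : ∀ i, ‖a i‖ ≤ R₀) (hβs : ContDiffOn ℝ ∞ β {x | R₀ < ‖x‖}) (hβ : SymbolClass 2 (-1) β)
    (hθ : ∀ z ∈ (hopfEnd k R₀ L).carrier, ∀ v,
      θ z v = hopfForm k L z v + β (hopf z) (fderiv ℝ hopf z v)) :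
    IsALF (hopfEnd k R₀ L) (hopfForm k L) (ghMetric (hopfEnd k R₀ L) (mtnV m a) θ) := by
  have hVs : ∀ x : Euc 3, R₀ < ‖x‖ → ContDiffAt ℝ ∞ (mtnV m a) x :=
    fun x hx => contDiffAt_mtnV ha hx
  have hV0 : ∀ x, 0 < mtnV m a x := fun x => zero_lt_one.trans_le (one_le_mtnV hm x)
  refine isALF_bundle le_rfl (isCircleEnd_hopfEnd hk hR hL) (isConnection_hopfForm hk hR hL)
    (isCurvature_hopfForm hR) ?_ ?_ (fun z hz v w => ghMetric_eq_bundleCoeff (hθ z hz) v w)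
    (fun x hx => (hVs x hx).contDiffWithinAt)
    (fun x hx => ((hVs x hx).inv (hV0 x).ne').contDiffWithinAt) hβs
    (fun x _ => hV0 x) (fun x _ => inv_pos.2 (hV0 x)) ?_ ?_ hβ
  · exact fun x hx => (contDiffAt_hopfCurv (norm_pos_iff.1 (hR.trans_lt hx))).contDiffWithinAt
  · exact symbolClass_hopfCurv 1
  · exact symbolClass_mtnV 2
  · exact symbolClass_inv_mtnV 2

/-- With `P = V` and `N = 1/V` the two limits are `-2mj` and `2mj`, so the mass is `4mj - mj`. The
degree `k` of the fibration and the number `j` of charges are independent at this stage. -/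
theorem massGB_ghMetric (hk : 1 ≤ k) (hR : 0 ≤ R₀) (hL : 0 < L) (hm : 0 < m)
    (ha : ∀ i, ‖a i‖ ≤ R₀) (hβs : ContDiffOn ℝ ∞ β {x | R₀ < ‖x‖}) (hβ : SymbolClass 1 (-1) β)
    (hθ : ∀ z ∈ (hopfEnd k R₀ L).carrier, ∀ v,
      θ z v = hopfForm k L z v + β (hopf z) (fderiv ℝ hopf z v)) :
    massGB (hopfEnd k R₀ L) (hopfForm k L) (ghMetric (hopfEnd k R₀ L) (mtnV m a) θ) =
      ((3 * j * m : ℝ) : EReal) := by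
  have hVs : ∀ x : Euc 3, R₀ < ‖x‖ → ContDiffAt ℝ ∞ (mtnV m a) x :=
    fun x hx => contDiffAt_mtnV ha hx
  have hV0 : ∀ x, 0 < mtnV m a x := fun x => zero_lt_one.trans_le (one_le_mtnV hm x)
  have h := (mass_bundle le_rfl hR (isCircleEnd_hopfEnd hk hR hL) (isConnection_hopfForm hk hR hL)
    (isCurvature_hopfForm hR)
    (fun x hx => (contDiffAt_hopfCurv (norm_pos_iff.1 (hR.trans_lt hx))).contDiffWithinAt)
    (symbolClass_hopfCurv 1) (fun z hz v w => ghMetric_eq_bundleCoeff (V := mtnV m a) (hθ z hz) v w)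
    (fun x hx => (hVs x hx).contDiffWithinAt)
    (fun x hx => ((hVs x hx).inv (hV0 x).ne').contDiffWithinAt) hβs
    (symbolClass_inv_mtnV 1) hβ tendsto_fderiv_mtnV (tendsto_fderiv_inv_mtnV hm ha)).2
  rw [h]
  congr 1
  push_cast
  ring

/-- The Taub-NUT metrics are asymptotic to the Hopf model, with mass `3m`. -/
theorem taubNUT (m L : ℝ) (hm : 0 < m) (hL : 0 < L) :
    IsALF (hopfEnd 1 0 L) (hopfForm 1 L)
        (ghMetric (hopfEnd 1 0 L) (tnV m) (hopfForm 1 L)) ∧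
      massGB (hopfEnd 1 0 L) (hopfForm 1 L)
        (ghMetric (hopfEnd 1 0 L) (tnV m) (hopfForm 1 L)) = ((3 * m : ℝ) : EReal) := by
  have hV : tnV m = mtnV m (fun _ : Fin 1 => (0 : Euc 3)) := by
    funext x
    simp [tnV, mtnV]
  have ha : ∀ _ : Fin 1, ‖(0 : Euc 3)‖ ≤ 0 := by simp
  rw [hV]
  refine ⟨isALF_ghMetric (β := 0) le_rfl le_rfl hL hm ha contDiff_const.contDiffOn
    (SymbolClass.zero 2 _) (by simp), ?_⟩
  have h := massGB_ghMetric (k := 1) (β := 0) (θ := hopfForm 1 L) le_rfl le_rfl hL hm ha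
    contDiff_const.contDiffOn (SymbolClass.zero 1 _) (by simp)
  rw [h]
  simp

end GibbonsHawking

open Bornology Asymptotics

/-! ### Connections that differ by a form from the base -/

section Pullback

variable {m : ℕ} {E : Type*} [NormedAddCommGroup E] [NormedSpace ℝ E] {X : CircleEnd m E}
  {η : E → E →L[ℝ] ℝ} {β : Euc m → Euc m →L[ℝ] ℝ}

/-- The form `η + π^* β`. -/
def tilt (X : CircleEnd m E) (η : E → E →L[ℝ] ℝ) (β : Euc m → Euc m →L[ℝ] ℝ) (z : E) :
    E →L[ℝ] ℝ :=
  η z + (β (X.proj z)).comp (fderiv ℝ X.proj z)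

theorem tilt_apply (z v : E) :
    tilt X η β z v = η z v + β (X.proj z) (fderiv ℝ X.proj z v) := rfl

theorem isConnection_tilt (hX : IsCircleEnd X) (hη : IsConnection X η)
    (hβ : ContDiffOn ℝ ∞ β {x | X.R₀ < ‖x‖}) : IsConnection X (tilt X η β) where
  smooth := hη.smooth.add ((hβ.comp hX.proj_smooth fun _ hz => hX.proj_mem hz).clm_comp
    (hX.proj_smooth.fderiv_of_isOpen hX.isOpen (by simp)))
  eta_vert := fun z hz => by
    rw [tilt_apply, hX.fderiv_proj_vert hz, hη.eta_vert z hz, map_zero, add_zero]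
  invariant := fun t z hz v => by
    rw [tilt_apply, tilt_apply, hη.invariant t z hz, hX.proj_flow hz]
    have h := congrArg Prod.fst (coframe_flow hX hη hz t v)
    simp only [coframe_apply] at h
    rw [h]

/-- Exterior differentiation commutes with the pull-back of `β`, because the second derivative of
the projection is symmetric. -/
theorem extd_tilt (hX : IsCircleEnd X) (hη : IsConnection X η) {z : E} (hz : z ∈ X.carrier)
    (hβ : DifferentiableAt ℝ β (X.proj z)) (v w : E) :
    extd (tilt X η β) z v w =
      extd η z v w + extd β (X.proj z) (fderiv ℝ X.proj z v) (fderiv ℝ X.proj z w) := by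
  have h1 := ((hη.smooth.contDiffAt (hX.isOpen.mem_nhds hz)).differentiableAt
    (by simp)).hasFDerivAt
  have h2 : HasFDerivAt (fun z => β (X.proj z)) _ z := hβ.hasFDerivAt.comp z (hX.hasFDerivAt_proj hz)
  have h3 := (((hX.contDiffAt_proj hz).fderiv_right (m := ∞) (by simp)).differentiableAt
    (by simp)).hasFDerivAt
  have h4 : HasFDerivAt (tilt X η β) _ z := h1.add (h2.clm_comp h3)
  have hsymm : fderiv ℝ (fderiv ℝ X.proj) z v w = fderiv ℝ (fderiv ℝ X.proj) z w v :=
    ((hX.contDiffAt_proj hz).isSymmSndFDerivAt (by simp; exact WithTop.coe_le_coe.2 le_top)).eq v w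
  rw [extd, h4.fderiv, extd, extd]
  simp [hsymm]
  ring

end Pullback

/-! ### The magnetic potential of a displaced monopole -/

section Magnetic

variable {a : Euc 3}

/-- The scalar factor of the magnetic potential. -/
def magScalar (a x : Euc 3) : ℝ :=
  2 * (‖x‖ + ‖x - a‖) * (‖x‖ * ‖x - a‖ * ((‖x‖ + ‖x - a‖) ^ 2 - ‖a‖ ^ 2))⁻¹

/-- A one-form whose curl is the difference of the fields of unit charges at `a` and `0`. -/
def magForm (a x : Euc 3) : Euc 3 →L[ℝ] ℝ :=
  magScalar a x • (innerForm 3).comp (crossForm a) x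

theorem magScalar_pos {x : Euc 3} (hx : ‖a‖ < ‖x‖) : 0 < ‖x‖ ∧ 0 < ‖x - a‖ ∧
    0 < (‖x‖ + ‖x - a‖) ^ 2 - ‖a‖ ^ 2 := by
  have h0 := norm_nonneg a
  have h1 : 0 < ‖x - a‖ := lt_of_lt_of_le (sub_pos.2 hx) (norm_sub_norm_le x a)
  exact ⟨h0.trans_lt hx, h1, by nlinarith⟩

/-- The last factor of the denominator, `(‖x‖ + ‖x - a‖)² - ‖a‖²`, vanishes only on the segment from
0 to `a`. The opposite charges cancel, so no Dirac string reaches the exterior of the ball. -/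
theorem contDiffAt_magForm {x : Euc 3} (hx : ‖a‖ < ‖x‖) : ContDiffAt ℝ ∞ (magForm a) x := by
  obtain ⟨h0, h1, h2⟩ := magScalar_pos hx
  have hf0 : ContDiffAt ℝ ∞ (fun x : Euc 3 => ‖x‖) x := contDiffAt_norm ℝ (norm_pos_iff.1 h0)
  have hf1 : ContDiffAt ℝ ∞ (fun x : Euc 3 => ‖x - a‖) x :=
    (contDiffAt_norm ℝ (norm_pos_iff.1 h1)).comp x (contDiffAt_id.sub contDiffAt_const)
  have hq : ContDiffAt ℝ ∞ (magScalar a) x :=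
    (contDiffAt_const.mul (hf0.add hf1)).mul
      (((hf0.mul hf1).mul (((hf0.add hf1).pow 2).sub contDiffAt_const)).inv (by positivity))
  exact hq.smul ((innerForm 3).comp (crossForm a)).contDiff.contDiffAt

/-- The scalar factor has degree `1 - 1 - 1 - 2 = -3` and `a × x` has degree 1. The potential, that
of a dipole, is thus of degree -2, better than the degree -1 that is needed. -/
theorem symbolClass_magForm (n : ℕ) (a : Euc 3) : SymbolClass n (-1) (magForm a) := by
  have hf0 := symbolClass_norm n 3
  have hf1 := hf0.comp_sub_const a
  have hE : SymbolClass n (-2) fun x : Euc 3 => ((‖x‖ + ‖x - a‖) ^ 2 - ‖a‖ ^ 2)⁻¹ := by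
    have h1 := ((hf0.add hf1).mul (hf0.add hf1)).sub
      ((SymbolClass.const n (‖a‖ ^ 2 : ℝ) (V := Euc 3)).mono (show (0 : ℤ) ≤ 1 + 1 by norm_num))
    have h2 := h1.inv (c := 1 / 2) (by norm_num) ?_
    · refine h2.congr (Eventually.of_forall fun x => ?_)
      simp only [pow_two]
    · filter_upwards [eventually_norm_gt (2 * ‖a‖)] with x hx
      have h3 := norm_nonneg (x - a)
      have h4 := norm_nonneg a
      rw [show (1 + 1 : ℤ) = ((2 : ℕ) : ℤ) by norm_num, zpow_natCast]
      nlinarith [mul_nonneg (norm_nonneg x) h3]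
  have hq := ((hf0.add hf1).const_smul 2).mul
    (((symbolClass_inv_norm_sub n (0 : Euc 3)).mul (symbolClass_inv_norm_sub n a)).mul hE)
  have hA := SymbolClass.clm n ((innerForm 3).comp (crossForm a))
  refine ((hq.smul hA).mono (by norm_num)).congr (Eventually.of_forall fun x => ?_)
  simp only [magForm, magScalar, mul_inv, sub_zero, smul_eq_mul]

/-- The scalar depends on `x` through `‖x‖` and `‖x - a‖` only, so its gradient is a combination of
`x` and `x - a`. The last two relations are the two scalar equations to which the prescribed curl
reduces. -/
theorem fderiv_magScalar {x : Euc 3} (hx : ‖a‖ < ‖x‖) : ∃ c₀ c₁ : ℝ,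
    DifferentiableAt ℝ (magScalar a) x ∧
    (∀ v, fderiv ℝ (magScalar a) x v = c₀ * inner ℝ x v + c₁ * inner ℝ (x - a) v) ∧
    c₀ * inner ℝ x x + c₁ * inner ℝ (x - a) x + 2 * magScalar a x = -(‖x - a‖ ^ 3)⁻¹ ∧
    c₀ * inner ℝ x a + c₁ * inner ℝ (x - a) a = (‖x‖ ^ 3)⁻¹ - (‖x - a‖ ^ 3)⁻¹ := by
  obtain ⟨h0, h1, h2⟩ := magScalar_pos hx
  have hf0 := hasFDerivAt_norm (norm_pos_iff.1 h0)
  have hf1 : HasFDerivAt (fun x : Euc 3 => ‖x - a‖) (‖x - a‖⁻¹ • innerSL ℝ (x - a)) x := by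
    have h := HasFDerivAt.comp (f := fun y => y - a) x (hasFDerivAt_norm (norm_pos_iff.1 h1))
      ((hasFDerivAt_id x).sub_const a)
    rwa [ContinuousLinearMap.comp_id] at h
  have hne : ‖x‖ * ‖x - a‖ * ((‖x‖ + ‖x - a‖) ^ 2 - ‖a‖ ^ 2) ≠ 0 := by positivity
  have hd : HasFDerivAt (magScalar a) _ x := ((hf0.add hf1).const_mul 2).mul
    ((hasDerivAt_inv hne).comp_hasFDerivAt x
      ((hf0.mul hf1).mul (((hf0.add hf1).pow 2).sub_const (‖a‖ ^ 2))))
  have hs : inner ℝ x a = (‖x‖ ^ 2 + ‖a‖ ^ 2 - ‖x - a‖ ^ 2) / 2 := by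
    have := norm_sub_sq_real x a
    linarith
  have e1 : inner ℝ (x - a) x = (‖x‖ ^ 2 - ‖a‖ ^ 2 + ‖x - a‖ ^ 2) / 2 := by
    rw [inner_sub_left, real_inner_comm, real_inner_self_eq_norm_sq, real_inner_comm, hs]
    ring
  have e2 : inner ℝ (x - a) a = (‖x‖ ^ 2 - ‖a‖ ^ 2 - ‖x - a‖ ^ 2) / 2 := by
    rw [inner_sub_left, hs, real_inner_self_eq_norm_sq]
    ring
  set S := ‖x‖ + ‖x - a‖ with hS
  have hS0 : 0 < S := by positivity
  refine ⟨magScalar a x * (S⁻¹ - ‖x‖⁻¹ - 2 * S * (S ^ 2 - ‖a‖ ^ 2)⁻¹) * ‖x‖⁻¹,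
    magScalar a x * (S⁻¹ - ‖x - a‖⁻¹ - 2 * S * (S ^ 2 - ‖a‖ ^ 2)⁻¹) * ‖x - a‖⁻¹,
    hd.differentiableAt, fun v => ?_, ?_, ?_⟩
  · rw [hd.fderiv]
    simp [magScalar, inner_sub_left]
    simp only [← hS]
    clear hf0 hf1 hne hd hs e1 e2
    generalize inner ℝ x v = p
    generalize inner ℝ a v = q
    generalize ‖x - a‖ = b at *
    generalize ‖x‖ = r at *
    generalize ‖a‖ ^ 2 = c at *
    -- The factor `S² - c` becomes an atom, known to be positive, so that denominators can be
    -- cleared without expanding it.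
    obtain ⟨e, he⟩ : ∃ e, e = S ^ 2 - c := ⟨_, rfl⟩
    rw [← he] at h2 ⊢
    field_simp
    rw [hS]
    ring
  · rw [real_inner_self_eq_norm_sq, e1, magScalar, ← hS]
    clear hf0 hf1 hne hd hs e1 e2
    generalize ‖x - a‖ = b at *
    generalize ‖x‖ = r at *
    generalize ‖a‖ ^ 2 = c at *
    obtain ⟨e, he⟩ : ∃ e, e = S ^ 2 - c := ⟨_, rfl⟩
    rw [← he] at h2 ⊢
    obtain rfl : c = S ^ 2 - e := by linarith
    field_simp
    rw [hS]
    ring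
  · rw [hs, e2, magScalar, ← hS]
    clear hf0 hf1 hne hd hs e1 e2
    generalize ‖x - a‖ = b at *
    generalize ‖x‖ = r at *
    generalize ‖a‖ ^ 2 = c at *
    obtain ⟨e, he⟩ : ∃ e, e = S ^ 2 - c := ⟨_, rfl⟩
    rw [← he] at h2 ⊢
    obtain rfl : c = S ^ 2 - e := by linarith
    field_simp
    rw [hS]
    ring

/-- The value of `g ∧ (a × x)` on `(v, w)`: the vector identity `g × (a × x) = ⟨g, x⟩ a - ⟨g, a⟩ x`,
paired with `v × w`. -/
theorem curl_identity (g a x v w : Euc 3) :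
    inner ℝ g v * inner ℝ (crossForm a x) w - inner ℝ g w * inner ℝ (crossForm a x) v =
      inner ℝ g x * tripleForm a v w - inner ℝ g a * tripleForm x v w := by
  rw [tripleForm_eq, tripleForm_eq, crossForm_eq]
  simp only [PiLp.inner_apply, Fin.sum_univ_three]
  simp
  ring

/-- With `q` the scalar and `α = ⟨a × x, ·⟩`, one has `dα = 2 vol(a, ·, ·)` and `dq ∧ α = ⟨∇q, x⟩
vol(a, ·, ·) - ⟨∇q, a⟩ vol(x, ·, ·)`. The relations of `fderiv_magScalar` turn the sum into the
difference of the two fields. -/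
theorem extd_magForm {x : Euc 3} (hx : ‖a‖ < ‖x‖) (v w : Euc 3) : extd (magForm a) x v w =
    (‖x - a‖ ^ 3)⁻¹ * tripleForm (x - a) v w - (‖x‖ ^ 3)⁻¹ * tripleForm x v w := by
  obtain ⟨c₀, c₁, hd, h1, h2, h3⟩ := fderiv_magScalar hx
  have h4 : HasFDerivAt (magForm a) _ x :=
    hd.hasFDerivAt.smul ((innerForm 3).comp (crossForm a)).hasFDerivAt
  have h5 := curl_identity (c₀ • x + c₁ • (x - a)) a x v w
  simp only [inner_add_left, real_inner_smul_left] at h5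
  have h6 : inner ℝ (crossForm a v) w - inner ℝ (crossForm a w) v = 2 * tripleForm a v w := by
    rw [tripleForm_eq, crossForm_eq, crossForm_eq]
    simp only [PiLp.inner_apply, Fin.sum_univ_three]
    simp
    ring
  rw [extd, h4.fderiv]
  simp [h1]
  rw [eq_sub_of_add_eq h2, h3] at h5
  linear_combination h5 + magScalar a x * h6

end Magnetic

open Bornology Asymptotics

/-! ### Existence of monopole connections -/

section Existence

variable {k : ℕ} {m R₀ L : ℝ} {a : Fin k → Euc 3}

theorem fderiv_mtnV {j : ℕ} {a : Fin j → Euc 3} (ha : ∀ i, ‖a i‖ ≤ R₀) {x : Euc 3}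
    (hx : R₀ < ‖x‖) (u : Euc 3) :
    fderiv ℝ (mtnV m a) x u = ∑ i, -(2 * m) * ((‖x - a i‖ ^ 3)⁻¹ * inner ℝ (x - a i) u) := by
  have h1 : ∀ i, 0 < ‖x - a i‖ := fun i =>
    norm_pos_iff.2 (sub_ne_zero.2 (ne_of_norm_le (ha i) hx))
  have h2 : ∀ i ∈ Finset.univ, HasFDerivAt (fun y : Euc 3 => 2 * m / ‖y - a i‖)
      ((-(2 * m) * (‖x - a i‖ ^ 3)⁻¹) • innerSL ℝ (x - a i)) x := by
    intro i _
    have h3 : HasDerivAt (fun r : ℝ => 2 * m / r) (-(2 * m) / ‖x - a i‖ ^ 2) ‖x - a i‖ := by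
      have h := (hasDerivAt_const ‖x - a i‖ (2 * m)).div (hasDerivAt_id ‖x - a i‖) (h1 i).ne'
      refine h.congr_deriv ?_
      simp
    have h4 := HasFDerivAt.comp (f := fun y => y - a i) x
      (hasFDerivAt_radial (norm_pos_iff.1 (h1 i)) h3) ((hasFDerivAt_id x).sub_const (a i))
    rw [ContinuousLinearMap.comp_id, smul_smul] at h4
    refine h4.congr_fderiv ?_
    congr 1
    have := (h1 i).ne'
    field_simp
  have h3 : HasFDerivAt (mtnV m a) _ x := (HasFDerivAt.fun_sum h2).const_add 1
  rw [h3.fderiv]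
  simp [mul_assoc, inner_sub_left]

/-- The difference between the monopole connection with charges `a` and the Hopf connection. -/
def monopoleForm (m : ℝ) (a : Fin k → Euc 3) (x : Euc 3) : Euc 3 →L[ℝ] ℝ :=
  ∑ i, (-(2 * m)) • magForm (a i) x

theorem contDiffAt_monopoleForm (ha : ∀ i, ‖a i‖ ≤ R₀) {x : Euc 3} (hx : R₀ < ‖x‖) :
    ContDiffAt ℝ ∞ (monopoleForm m a) x :=
  ContDiffAt.sum fun i _ => (contDiffAt_const (c := -(2 * m))).smul (contDiffAt_magForm ((ha i).trans_lt hx))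

/-- Each `magForm (a i)` trades the field of a charge at `a i` for that of a charge at the origin;
the sum leaves `k` charges at the origin. -/
theorem extd_monopoleForm (ha : ∀ i, ‖a i‖ ≤ R₀) {x : Euc 3} (hx : R₀ < ‖x‖) (v w : Euc 3) :
    extd (monopoleForm m a) x v w =
      starD (mtnV m a) x v w + 2 * m * k * ((‖x‖ ^ 3)⁻¹ * tripleForm x v w) := by
  have h1 : HasFDerivAt (monopoleForm m a) _ x := HasFDerivAt.fun_sum (u := Finset.univ) fun i _ =>
    (((contDiffAt_magForm ((ha i).trans_lt hx)).differentiableAt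
      (by simp)).hasFDerivAt.const_smul (-(2 * m)))
  have h2 : ∀ i, fderiv ℝ (magForm (a i)) x v w - fderiv ℝ (magForm (a i)) x w v = _ :=
    fun i => extd_magForm ((ha i).trans_lt hx) v w
  rw [extd, h1.fderiv]
  simp only [sum_apply, smul_apply, smul_eq_mul]
  rw [← Finset.sum_sub_distrib, starD, ← crossForm_apply, fderiv_mtnV ha hx]
  simp only [← tripleForm_apply, ← mul_sub, h2]
  rw [Finset.sum_congr rfl fun i _ => mul_sub _ _ _, Finset.sum_sub_distrib]
  simp
  ring

/-- With `L = 8πm`, the factor `kL/(4π)` of the Hopf curvature equals `2mk`, so the Hopf connection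
accounts exactly for the charge left at the origin. -/
theorem isMonopole_tilt (hk : 1 ≤ k) (hR : 0 ≤ R₀) (hm : 0 < m) (ha : ∀ i, ‖a i‖ ≤ R₀)
    (hL : L = 8 * Real.pi * m) : IsMonopole (hopfEnd k R₀ L) (mtnV m a)
      (tilt (hopfEnd k R₀ L) (hopfForm k L) (monopoleForm m a)) := by
  have hp := Real.pi_pos
  have hL0 : 0 < L := by rw [hL]; positivity
  have hX := isCircleEnd_hopfEnd hk hR hL0
  have hη := isConnection_hopfForm hk hR hL0
  refine ⟨isConnection_tilt hX hη fun x hx => (contDiffAt_monopoleForm ha hx).contDiffWithinAt,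
    fun z hz v w => ?_⟩
  have hx := hX.proj_mem hz
  rw [extd_tilt hX hη hz ((contDiffAt_monopoleForm ha hx).differentiableAt (by simp)),
    isCurvature_hopfForm hR z hz, extd_monopoleForm ha hx]
  simp only [hopfCurv, smul_apply, smul_eq_mul]
  generalize tripleForm _ _ _ = T
  rw [hL]
  field_simp
  ring

theorem isALF_tilt_monopoleForm (hk : 1 ≤ k) (hR : 0 ≤ R₀) (hm : 0 < m) (ha : ∀ i, ‖a i‖ ≤ R₀)
    (hL : 0 < L) : IsALF (hopfEnd k R₀ L) (hopfForm k L) (ghMetric (hopfEnd k R₀ L) (mtnV m a)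
      (tilt (hopfEnd k R₀ L) (hopfForm k L) (monopoleForm m a))) :=
  isALF_ghMetric hk hR hL hm ha
    (fun _ hx => (contDiffAt_monopoleForm ha hx).contDiffWithinAt)
    (SymbolClass.sum Finset.univ fun i _ => (symbolClass_magForm 2 (a i)).const_smul (-(2 * m)))
    fun z _ v => tilt_apply z v

end Existence

/-! ### Decay of the coefficients of an asymptotic metric -/

section Converse

variable {F : Type*} [NormedAddCommGroup F] [NormedSpace ℝ F]

/-- Vectors of supremum norm at most 1/2 in `ℝ^m × ℝ` have Euclidean norm at most 1; they are
therefore admissible in the bounds that define asymptotic metrics. -/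
theorem norm_bilinear_le {B : F →L[ℝ] F →L[ℝ] ℝ} {K : ℝ} (hK : 0 ≤ K)
    (h : ∀ c d, ‖c‖ ≤ 1 / 2 → ‖d‖ ≤ 1 / 2 → |B c d| ≤ K) : ‖B‖ ≤ 4 * K := by
  have hhalf : ∀ c : F, ‖c‖ = 1 → ‖(1 / 2 : ℝ) • c‖ ≤ 1 / 2 := by
    intro c hc
    rw [norm_smul, hc]
    norm_num
  refine ContinuousLinearMap.opNorm_le_of_unit_norm (by positivity) fun c hc => ?_
  refine ContinuousLinearMap.opNorm_le_of_unit_norm (by positivity) fun d hd => ?_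
  have h1 := h _ _ (hhalf c hc) (hhalf d hd)
  simp only [map_smul, smul_apply, smul_eq_mul, abs_mul] at h1
  rw [Real.norm_eq_abs]
  norm_num at h1
  linarith

theorem norm_trilinear_le {T : F →L[ℝ] F →L[ℝ] F →L[ℝ] ℝ} {K : ℝ} (hK : 0 ≤ K)
    (h : ∀ b c d, ‖b‖ ≤ 1 / 2 → ‖c‖ ≤ 1 / 2 → ‖d‖ ≤ 1 / 2 → |T b c d| ≤ K) : ‖T‖ ≤ 8 * K := by
  refine ContinuousLinearMap.opNorm_le_of_unit_norm (by positivity) fun b hb => ?_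
  have h1 : ‖T ((1 / 2 : ℝ) • b)‖ ≤ 4 * K := norm_bilinear_le hK fun c d hc hd =>
    h _ c d (by rw [norm_smul, hb]; norm_num) hc hd
  rw [map_smul, norm_smul] at h1
  norm_num at h1
  linarith

variable {m : ℕ} {E : Type*} [NormedAddCommGroup E] [NormedSpace ℝ E] {X : CircleEnd m E}
  {η : E → E →L[ℝ] ℝ}

/-- Recovers the ordinary derivative of the coefficients from the covariant one: the connection
terms are added back and the result is restricted to horizontal directions. -/
theorem covCoeff_add_bilinAct_comp_inl (Ω : Euc m → Euc m →L[ℝ] Euc m →L[ℝ] ℝ)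
    (M : Euc m → Cyl m →L[ℝ] Cyl m →L[ℝ] ℝ) (x : Euc m) :
    (covCoeff Ω M x + bilinAct (M x) (connCoeff (Ω x))).comp (ContinuousLinearMap.inl ℝ (Euc m) ℝ)
      = fderiv ℝ M x := by
  have h : covCoeff Ω M x + bilinAct (M x) (connCoeff (Ω x)) =
      (fderiv ℝ M x).comp (ContinuousLinearMap.fst ℝ (Euc m) ℝ) := sub_add_cancel _ _
  rw [h]
  rfl

theorem model_frame_le (hX : IsCircleEnd X) (hη : IsConnection X η) {z : E} (hz : z ∈ X.carrier)
    {c : Cyl m} (hc : ‖c‖ ≤ 1 / 2) : model X η z (frame X η z c) (frame X η z c) ≤ 1 := by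
  rw [model_eq, coframe_frame hX hη hz, euclForm_apply, real_inner_self_eq_norm_sq]
  rw [Prod.norm_def, sup_le_iff, Real.norm_eq_abs, abs_le] at hc
  nlinarith [norm_nonneg c.1]

/-- The coefficients in the frame of an asymptotic metric are symbols. -/
theorem IsALF.symbolClass_coeff (hm : 3 ≤ m) (hX : IsCircleEnd X) (hη : IsConnection X η)
    {Ω : Euc m → Euc m →L[ℝ] Euc m →L[ℝ] ℝ} (hΩ : IsCurvature X η Ω)
    (hΩd : SymbolClass 1 (1 - (m : ℤ)) Ω)
    {M : Euc m → Cyl m →L[ℝ] Cyl m →L[ℝ] ℝ} {g : E → E → E → ℝ}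
    (hg : ∀ z ∈ X.carrier, ∀ v w,
      g z v w = M (X.proj z) (coframe X η z v) (coframe X η z w))
    (hM : ContDiffOn ℝ ∞ M {x | X.R₀ < ‖x‖}) (h : IsALF X η g) :
    SymbolClass 1 (2 - (m : ℤ)) fun x => M x - euclForm m := by
  have hopen : IsOpen {x : Euc m | X.R₀ < ‖x‖} := isOpen_lt continuous_const continuous_norm
  have hsurj : ∀ x : Euc m, X.R₀ < ‖x‖ → ∃ z ∈ X.carrier, X.proj z = x := by
    intro x hx
    have : x ∈ X.proj '' X.carrier := by rw [hX.proj_image]; exact hx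
    exact this
  have hD : SymbolClass 0 (2 - (m : ℤ)) fun x => M x - euclForm m := by
    obtain ⟨C, R, hC⟩ := h.decay₀
    refine SymbolClass.of_bound (C := 4 * max C 0) (R := max R X.R₀) ?_ ?_
    · filter_upwards [eventually_norm_gt X.R₀] with x hx
      exact (hM.contDiffAt (hopen.mem_nhds hx)).sub contDiffAt_const
    · intro x hx
      obtain ⟨z, hz, rfl⟩ := hsurj x ((le_max_right _ _).trans_lt hx)
      rw [mul_assoc]
      refine norm_bilinear_le (by positivity) fun c d hc hd => ?_
      have h1 := hC z hz ((le_max_left _ _).trans_lt hx) ![frame X η z c, frame X η z d] (by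
        intro i
        fin_cases i
        · exact model_frame_le hX hη hz hc
        · exact model_frame_le hX hη hz hd)
      have h2 : asTensor (fun z v w => g z v w - model X η z v w) z
          ![frame X η z c, frame X η z d] = (M (X.proj z) - euclForm m) c d := by
        show g z (frame X η z c) (frame X η z d) - model X η z (frame X η z c) (frame X η z d) = _
        rw [hg z hz, model_eq, coframe_frame hX hη hz, coframe_frame hX hη hz]
        rfl
      rw [h2] at h1
      refine h1.trans (mul_le_mul_of_nonneg_right (le_max_left _ _) (by positivity))
  have hcov : covCoeff Ω M =O[cobounded (Euc m)] fun x => ‖x‖ ^ (1 - (m : ℤ)) := by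
    obtain ⟨C, R, hC⟩ := h.decay₁
    refine IsBigO.of_bound (8 * max C 0) ?_
    filter_upwards [eventually_norm_gt (max R X.R₀)] with x hx
    obtain ⟨z, hz, rfl⟩ := hsurj x ((le_max_right _ _).trans_lt hx)
    rw [mul_assoc, norm_zpow, norm_norm]
    refine norm_trilinear_le (by positivity) fun b c d hb hc hd => ?_
    have h1 := hC z hz ((le_max_left _ _).trans_lt hx)
      ![frame X η z b, frame X η z c, frame X η z d] (by
        intro i
        fin_cases i
        · exact model_frame_le hX hη hz hb
        · exact model_frame_le hX hη hz hc
        · exact model_frame_le hX hη hz hd)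
    rw [covDeriv_eq_covCoeff hX hη hΩ hg hM hz] at h1
    simp only [Matrix.cons_val_zero, Matrix.cons_val_one, Matrix.cons_val,
      coframe_frame hX hη hz] at h1
    refine h1.trans (mul_le_mul_of_nonneg_right (le_max_left _ _) (by positivity))
  have hc : SymbolClass 0 (1 - (m : ℤ)) fun x => connCoeff (Ω x) :=
    hΩd.of_succ.clm_comp (connCoeffL m)
  have hact := ((SymbolClass.bilin bilinAct hD hc).mono
    (show (2 - (m : ℤ)) + (1 - m) ≤ 1 - m by omega)).isBigO
  refine ⟨hD, ?_, ?_⟩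
  · exact hD.smooth.mono fun x hx => hx.fderiv_right (m := ∞) (by simp)
  -- The derivative of `M` is `∇g` plus the connection acting on `M - h`, both of degree at most `1
  -- - m`.
  · have h1 := ((((ContinuousLinearMap.compL ℝ (Euc m) (Cyl m)
      (Cyl m →L[ℝ] Cyl m →L[ℝ] ℝ)).flip (ContinuousLinearMap.inl ℝ (Euc m) ℝ)).isBigO_comp
        (fun x => covCoeff Ω M x + bilinAct (M x - euclForm m) (connCoeff (Ω x)))
        (cobounded (Euc m))).trans (hcov.add hact))
    rw [show 2 - (m : ℤ) - 1 = 1 - m by ring]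
    refine h1.congr' ?_ EventuallyEq.rfl
    filter_upwards [eventually_norm_gt X.R₀] with x hx
    rw [← covCoeff_sub_euclForm (M := M) fun v w => hΩ.antisymm hX hx v w]
    show (covCoeff Ω (fun x => M x - euclForm m) x +
      bilinAct (M x - euclForm m) (connCoeff (Ω x))).comp (ContinuousLinearMap.inl ℝ (Euc m) ℝ) = _
    exact covCoeff_add_bilinAct_comp_inl Ω (fun x => M x - euclForm m) x

end Converse

open Bornology Asymptotics

/-! ### Descent of connections along the Hopf map -/

section Descent

/-- The Clifford action as a continuous bilinear map. -/
def pauliForm : Euc 3 →L[ℝ] (ℂ × ℂ) →L[ℝ] (ℂ × ℂ) :=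
  LinearMap.toContinuousLinearMap
    { toFun := fun v => LinearMap.toContinuousLinearMap
        { toFun := pauli v
          map_add' := fun z w => by ext1 <;> simp [pauli] <;> ring
          map_smul' := fun c z => by ext1 <;> simp [pauli] <;> ring }
      map_add' := fun v w => by
        refine ContinuousLinearMap.ext fun z => ?_
        show pauli (v + w) z = pauli v z + pauli w z
        ext1 <;> simp [pauli] <;> ring
      map_smul' := fun c v => by
        refine ContinuousLinearMap.ext fun z => ?_
        show pauli (c • v) z = c • pauli v z
        ext1 <;> simp [pauli] <;> ring }

/-- Complex linearity makes the horizontal lift equivariant under the flow. -/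
theorem pauli_smul (c : ℂ) (v : Euc 3) (z : ℂ × ℂ) : pauli v (c • z) = c • pauli v z := by
  ext1 <;> simp [pauli] <;> ring

/-- The vectors `pauli v z` are horizontal for the Hopf connection, since the Clifford action is
Hermitian. -/
theorem contact_pauli (v : Euc 3) (z : ℂ × ℂ) : contact z (pauli v z) = 0 := by
  rw [contact_apply]
  simp [pauli]
  ring

/-- The horizontal lift for the Hopf connection. -/
def hopfLift (z : ℂ × ℂ) : Euc 3 →L[ℝ] ℂ × ℂ := (2 * ‖hopf z‖)⁻¹ • pauliForm.flip z

theorem hopfLift_apply (z : ℂ × ℂ) (v : Euc 3) :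
    hopfLift z v = (2 * ‖hopf z‖)⁻¹ • pauli v z := rfl

theorem hopf_real_smul (c : ℝ) (z : ℂ × ℂ) : hopf (c • z) = c ^ 2 • hopf z := by
  ext i
  fin_cases i <;> simp [hopf, Complex.normSq_apply] <;> ring

/-- The operator `‖x‖ + pauli x` is, up to a factor, the projection onto the spinors lying over the
direction of `x`. Applied to a fixed `z` and normalized, it gives a local section. -/
theorem hopf_add_pauli (x : Euc 3) (z : ℂ × ℂ) : hopf (‖x‖ • z + pauli x z) =
    (2 * (‖x‖ * ‖hopf z‖ + inner ℝ x (hopf z))) • x := by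
  have hx : ‖x‖ ^ 2 = x 0 ^ 2 + x 1 ^ 2 + x 2 ^ 2 := by
    rw [EuclideanSpace.norm_sq_eq, Fin.sum_univ_three]; simp
  rw [norm_hopf, PiLp.inner_apply, Fin.sum_univ_three]
  generalize ‖x‖ = N at hx
  ext i
  fin_cases i
  · simp [hopf, pauli, Complex.normSq_apply]
    linear_combination 2 * (z.1.re * z.2.re + z.1.im * z.2.im) * hx
  · simp [hopf, pauli, Complex.normSq_apply]
    linear_combination 2 * (z.1.im * z.2.re - z.1.re * z.2.im) * hx
  · simp [hopf, pauli, Complex.normSq_apply]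
    linear_combination (z.1.re * z.1.re + z.1.im * z.1.im - z.2.re * z.2.re
      - z.2.im * z.2.im) * hx

/-- The Hopf map has smooth local sections. -/
theorem exists_hopf_section {x₀ : Euc 3} (hx₀ : x₀ ≠ 0) : ∃ σ : Euc 3 → ℂ × ℂ,
    ContDiffAt ℝ ∞ σ x₀ ∧ ∀ᶠ x in 𝓝 x₀, hopf (σ x) = x := by
  obtain ⟨z, rfl⟩ := exists_hopf_eq x₀
  have hc : ContinuousAt (fun x => 2 * (‖x‖ * ‖hopf z‖ + inner ℝ x (hopf z))) (hopf z) := by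
    fun_prop
  have h0 : 0 < 2 * (‖hopf z‖ * ‖hopf z‖ + inner ℝ (hopf z) (hopf z)) := by
    rw [real_inner_self_eq_norm_sq]
    have := norm_pos_iff.2 hx₀
    positivity
  have hs : ContDiffAt ℝ ∞ (fun x => 2 * (‖x‖ * ‖hopf z‖ + inner ℝ x (hopf z))) (hopf z) :=
    contDiffAt_const.mul (((contDiffAt_norm ℝ hx₀).mul contDiffAt_const).add
      (contDiffAt_id.inner ℝ contDiffAt_const))
  refine ⟨fun x => (Real.sqrt (2 * (‖x‖ * ‖hopf z‖ + inner ℝ x (hopf z))))⁻¹ •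
    (‖x‖ • z + pauli x z), ?_, ?_⟩
  · refine ((hs.sqrt h0.ne').inv (Real.sqrt_pos.2 h0).ne').smul ?_
    exact ((contDiffAt_norm ℝ hx₀).smul contDiffAt_const).add
      (pauliForm.flip z).contDiff.contDiffAt
  · filter_upwards [hc.eventually (eventually_gt_nhds h0)] with x hx
    rw [hopf_real_smul, hopf_add_pauli, smul_smul, inv_pow, Real.sq_sqrt hx.le,
      inv_mul_cancel₀ hx.ne', one_smul]

variable {k : ℕ} {R₀ L : ℝ} {θ : ℂ × ℂ → (ℂ × ℂ) →L[ℝ] ℝ}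

/-- Every connection on the Hopf fibration differs from the Hopf connection by a form from the
base. -/
theorem IsConnection.exists_eq_add (hk : 1 ≤ k) (hR : 0 ≤ R₀) (hL : 0 < L)
    (hθ : IsConnection (hopfEnd k R₀ L) θ) : ∃ β : Euc 3 → Euc 3 →L[ℝ] ℝ,
      ContDiffOn ℝ ∞ β {x | R₀ < ‖x‖} ∧ ∀ z ∈ (hopfEnd k R₀ L).carrier, ∀ v,
        θ z v = hopfForm k L z v + β (hopf z) (fderiv ℝ hopf z v) := by
  have hX := isCircleEnd_hopfEnd hk hR hL
  have hη := isConnection_hopfForm hk hR hL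
  choose s hs using exists_hopf_eq
  have hmem : ∀ {z}, z ∈ (hopfEnd k R₀ L).carrier ↔ R₀ < ‖hopf z‖ := by
    intro z; rw [hopfEnd_carrier]; rfl
  -- The form `θ` evaluated on horizontal lifts is invariant under the flow, hence depends only on
  -- the point of the base.
  have hinv : ∀ z ∈ (hopfEnd k R₀ L).carrier, ∀ w ∈ (hopfEnd k R₀ L).carrier, hopf z = hopf w →
      (θ z).comp (hopfLift z) = (θ w).comp (hopfLift w) := by
    intro z hz w hw h
    obtain ⟨t, rfl⟩ := (hX.fibre z hz w hw).1 h
    refine ContinuousLinearMap.ext fun v => ?_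
    have h1 := hθ.invariant t z hz (hopfLift z v)
    rw [fderiv_hopfEnd_flow] at h1
    show θ z (hopfLift z v) = θ _ (hopfLift _ v)
    rw [← h1, hopfLift_apply, hopfLift_apply, ← h, hopfEnd_flow, pauli_smul, smul_comm]
  have hβ : ∀ z ∈ (hopfEnd k R₀ L).carrier, (θ (s (hopf z))).comp (hopfLift (s (hopf z))) =
      (θ z).comp (hopfLift z) := fun z hz =>
    hinv _ (hmem.2 (by rw [hs]; exact hmem.1 hz)) _ hz (hs _)
  refine ⟨fun x => (θ (s x)).comp (hopfLift (s x)), fun x hx => ?_, fun z hz v => ?_⟩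
  · have hx0 : x ≠ 0 := norm_pos_iff.1 (hR.trans_lt hx)
    -- The section `s` is chosen pointwise and need not be continuous; near `x` it may be replaced
    -- by a smooth section, by invariance.
    obtain ⟨σ, hσ, hσx⟩ := exists_hopf_section hx0
    have hσ0 : hopf (σ x) = x := hσx.self_of_nhds
    have h1 : ContDiffAt ℝ ∞ (fun y => θ (σ y)) x :=
      (hθ.smooth.contDiffAt (hX.isOpen.mem_nhds (hmem.2 (by rw [hσ0]; exact hx)))).comp x hσ
    have h2 : ContDiffAt ℝ ∞ (fun y => hopfLift (σ y)) x := by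
      refine ContDiffAt.smul (𝕜' := ℝ) (ContDiffAt.inv (contDiffAt_const.mul ?_) ?_)
        (pauliForm.flip.contDiff.contDiffAt.comp x hσ)
      · exact (contDiffAt_norm ℝ (by rwa [hσ0])).comp x (contDiff_hopf.contDiffAt.comp x hσ)
      · rw [hσ0]
        simpa using hx0
    refine ((h1.clm_comp h2).congr_of_eventuallyEq ?_).contDiffWithinAt
    filter_upwards [hσx, (isOpen_lt continuous_const continuous_norm).mem_nhds hx] with y hy hy1
    have h3 := hβ (σ y) (hmem.2 (by rw [hy]; exact hy1))
    rwa [hy] at h3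
  · have hn : 0 < ‖hopf z‖ := hR.trans_lt (hmem.1 hz)
    have hlift : ∀ u, fderiv ℝ hopf z (hopfLift z u) = u := by
      intro u
      rw [hopfLift_apply, map_smul, fderiv_hopf_pauli, inv_smul_smul₀ (by positivity)]
    have hhor : ∀ u, hopfForm k L z (hopfLift z u) = 0 := by
      intro u
      rw [hopfForm_eq, hopfLift_apply, map_smul, smul_apply, contact_pauli, smul_zero, smul_zero]
    -- Splitting `v` into horizontal and vertical parts: on the vertical part both connections have
    -- the same value, and on the horizontal part the Hopf connection vanishes.
    have h1 : v = hopfLift z (fderiv ℝ hopf z v) + hopfForm k L z v • vert (hopfEnd k R₀ L) z := by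
      refine coframe_injective hX hη hz ?_
      rw [map_add, map_smul, coframe_vert hX hη hz, coframe_apply, coframe_apply]
      refine Prod.ext ?_ ?_
      · show fderiv ℝ hopf z v = fderiv ℝ hopf z (hopfLift z _) + hopfForm k L z v • 0
        rw [hlift, smul_zero, add_zero]
      · show hopfForm k L z v = hopfForm k L z (hopfLift z _) + hopfForm k L z v • 1
        rw [hhor, smul_eq_mul, mul_one, zero_add]
    have h2 := congrArg (θ z) h1
    rw [map_add, map_smul, hθ.eta_vert z hz, smul_eq_mul, mul_one] at h2
    show θ z v = hopfForm k L z v + (θ (s (hopf z))).comp (hopfLift (s (hopf z))) _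
    rw [hβ z hz, h2, add_comm]
    rfl

end Descent

/-! ### The mass of multi-Taub-NUT metrics for an arbitrary connection. -/

section MultiTaubNUT

variable {k : ℕ} {m R₀ L : ℝ} {a : Fin k → Euc 3} {θ : ℂ × ℂ → (ℂ × ℂ) →L[ℝ] ℝ}

/-- The form `β` by which `θ` differs from the Hopf connection has no a priori decay. It is `V`
times the mixed component of `g` in the frame, so it inherits the decay of the coefficients of the
asymptotic metric. -/
theorem massGB_of_isALF (hk : 1 ≤ k) (hR : 0 ≤ R₀) (hL : 0 < L) (hm : 0 < m)
    (ha : ∀ i, ‖a i‖ ≤ R₀) (hθ : IsConnection (hopfEnd k R₀ L) θ)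
    (h : IsALF (hopfEnd k R₀ L) (hopfForm k L) (ghMetric (hopfEnd k R₀ L) (mtnV m a) θ)) :
    massGB (hopfEnd k R₀ L) (hopfForm k L) (ghMetric (hopfEnd k R₀ L) (mtnV m a) θ)
      = ((3 * k * m : ℝ) : EReal) := by
  obtain ⟨β, hβs, hβ⟩ := hθ.exists_eq_add hk hR hL
  refine massGB_ghMetric hk hR hL hm ha hβs ?_ hβ
  have hVs : ∀ x : Euc 3, R₀ < ‖x‖ → ContDiffAt ℝ ∞ (mtnV m a) x :=
    fun x hx => contDiffAt_mtnV ha hx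
  have hV0 : ∀ x, 0 < mtnV m a x := fun x => zero_lt_one.trans_le (one_le_mtnV hm x)
  have h1 := h.symbolClass_coeff le_rfl (isCircleEnd_hopfEnd hk hR hL)
    (isConnection_hopfForm hk hR hL) (isCurvature_hopfForm hR) (symbolClass_hopfCurv 1)
    (fun z hz v w => ghMetric_eq_bundleCoeff (V := mtnV m a) (hβ z hz) v w)
    (contDiffOn_bundleCoeff (fun x hx => (hVs x hx).contDiffWithinAt)
      (fun x hx => ((hVs x hx).inv (hV0 x).ne').contDiffWithinAt) hβs)
  -- Extracts the component `ξ ↦ (g - h)(ξ, ∂_t)`, which equals `V⁻¹ β`; the model metric has no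
  -- mixed component.
  have h2 := h1.clm_comp
    (((ContinuousLinearMap.compL ℝ (Euc 3) (Cyl 3) ℝ).flip (ContinuousLinearMap.inl ℝ (Euc 3) ℝ)).comp
      ((ContinuousLinearMap.apply ℝ (Cyl 3 →L[ℝ] ℝ) ((0, 1) : Cyl 3)).comp
        (ContinuousLinearMap.flipₗᵢ ℝ (Cyl 3) (Cyl 3) ℝ).toContinuousLinearEquiv.toContinuousLinearMap))
  have h3 : SymbolClass 1 0 (mtnV m a) :=
    (((symbolClass_mtnV (m := m) (a := a) 1).mono (by norm_num)).add (SymbolClass.const 1 (1 : ℝ))).congr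
      (Eventually.of_forall fun x => by simp)
  refine (h3.smul h2).congr (Eventually.of_forall fun x => ?_)
  refine ContinuousLinearMap.ext fun ξ => ?_
  show mtnV m a x * ((bundleCoeff (mtnV m a) (fun x => (mtnV m a x)⁻¹) β x - euclForm 3)
    (ξ, 0) (0, 1)) = β x ξ
  rw [sub_apply, sub_apply, bundleCoeff_apply, euclForm_apply]
  have := (hV0 x).ne'
  simp
  field_simp

/-- The multi-Taub-NUT metrics are asymptotic to the Hopf models, with mass `3km`. -/
theorem multiTaubNUT (k : ℕ) (m R₀ : ℝ) (a : Fin k → Euc 3) (hk : 1 ≤ k) (hm : 0 < m)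
    (ha : ∀ i, ‖a i‖ ≤ R₀) (L : ℝ) (X : CircleEnd 3 (ℂ × ℂ)) (hL : L = 8 * Real.pi * m)
    (hX : X = hopfEnd k R₀ L) :
    (∃ θ, IsMonopole X (mtnV m a) θ ∧
      IsALF X (hopfForm k L) (ghMetric X (mtnV m a) θ)) ∧
    ∀ θ, IsMonopole X (mtnV m a) θ →
      IsALF X (hopfForm k L) (ghMetric X (mtnV m a) θ) →
      massGB X (hopfForm k L) (ghMetric X (mtnV m a) θ) = ((3 * k * m : ℝ) : EReal) := by
  subst hX
  have hR : 0 ≤ R₀ := (norm_nonneg _).trans (ha ⟨0, hk⟩)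
  have hL0 : 0 < L := by
    have := Real.pi_pos
    rw [hL]; positivity
  exact ⟨⟨_, isMonopole_tilt hk hR hm ha hL, isALF_tilt_monopoleForm hk hR hm ha hL0⟩,
    fun θ hθ h => massGB_of_isALF hk hR hL0 hm ha hθ.1 h⟩

end MultiTaubNUT

end ALF

end

theorem mainTheorem9 :
    -- Schwarzschild metrics
    (∀ (n : ℕ) (γ : ℝ), 4 ≤ n → 0 < γ →
      (∃ G, IsProfile (schwV n γ) γ G) ∧
      ∀ G, IsProfile (schwV n γ) γ G →
      ∀ (Ψ : Cyl (n - 1) → Amb (n - 1)) (L : ℝ) (X : CircleEnd (n - 1) (Cyl (n - 1)))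
        (g : Cyl (n - 1) → Cyl (n - 1) → Cyl (n - 1) → ℝ),
        Ψ = endChart G (schwR n γ) (schwC n γ) →
        L = 2 * Real.pi * schwC n γ →
        X = trivialEnd (n - 1) (schwU n γ) L →
        g = pullback Ψ (warped (fibreProfile (schwV n γ) (schwC n γ) G) G) →
        IsEndChart Ψ (schwU n γ) L ∧
        IsALF X (dtForm (n - 1)) g ∧
        massD X (dtForm (n - 1)) g = ((γ ^ (n - 3) : ℝ) : EReal) ∧
        massGB X (dtForm (n - 1)) g = ((((n : ℝ) - 1) / 2 * γ ^ (n - 3) : ℝ) : EReal) ∧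
        ∀ S : SpinStructure (n - 1), ¬ SpinTrivialAtInfinity S Ψ L) ∧
    -- Reissner–Nordström metrics
    (∀ m q : ℝ, (0 < m ∨ q ≠ 0) →
      (∃ G, IsProfile (rnV m q) (rnG₀ m q) G) ∧
      ∀ G, IsProfile (rnV m q) (rnG₀ m q) G →
      ∀ (Ψ : Cyl 3 → Amb 3) (L : ℝ) (X : CircleEnd 3 (Cyl 3))
        (gM : Amb 3 → Amb 3 → Amb 3 → ℝ) (g : Cyl 3 → Cyl 3 → Cyl 3 → ℝ),
        Ψ = endChart G (rnR m q) (rnC m q) →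
        L = 2 * Real.pi * rnC m q →
        X = trivialEnd 3 (rnU m q) L →
        gM = warped (fibreProfile (rnV m q) (rnC m q) G) G →
        g = pullback Ψ gM →
        IsCompleteMetric gM ∧
        IsEndChart Ψ (rnU m q) L ∧
        (∀ z ∈ X.carrier, scal g z = 0) ∧
        IsALF X (dtForm 3) g ∧
        massD X (dtForm 3) g = ((2 * m : ℝ) : EReal) ∧
        (m < 0 → massD X (dtForm 3) g < 0) ∧
        ∀ S : SpinStructure 3, ¬ SpinTrivialAtInfinity S Ψ L) ∧
    -- Taub-NUT metrics
    (∀ m L : ℝ, 0 < m → 0 < L →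
      IsALF (hopfEnd 1 0 L) (hopfForm 1 L)
        (ghMetric (hopfEnd 1 0 L) (tnV m) (hopfForm 1 L)) ∧
      massGB (hopfEnd 1 0 L) (hopfForm 1 L)
        (ghMetric (hopfEnd 1 0 L) (tnV m) (hopfForm 1 L)) = ((3 * m : ℝ) : EReal)) ∧
    -- multi-Taub-NUT metrics
    (∀ (k : ℕ) (m R₀ : ℝ) (a : Fin k → Euc 3), 1 ≤ k → 0 < m → (∀ i, ‖a i‖ ≤ R₀) →
      ∀ (L : ℝ) (X : CircleEnd 3 (ℂ × ℂ)), L = 8 * Real.pi * m → X = hopfEnd k R₀ L →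
        (∃ θ, IsMonopole X (mtnV m a) θ ∧
          IsALF X (hopfForm k L) (ghMetric X (mtnV m a) θ)) ∧
        ∀ θ, IsMonopole X (mtnV m a) θ →
          IsALF X (hopfForm k L) (ghMetric X (mtnV m a) θ) →
          massGB X (hopfForm k L) (ghMetric X (mtnV m a) θ)
            = ((3 * k * m : ℝ) : EReal)) := by
  exact ⟨fun n γ hn hγ => schwarzschild n γ hn hγ, fun m q h => reissnerNordstrom m q h,
    fun m L hm hL => taubNUT m L hm hL,
    fun k m R₀ a hk hm ha L X hL hX => multiTaubNUT k m R₀ a hk hm ha L X hL hX⟩
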